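/- **Setting.** Let $\gamma\in\mathbb R$ with $\sin\gamma\cos\gamma\neq0$ (for instance a slope angle $0<\gamma<\pi/2$), $k_0,m_0\in\mathbb R\setminus\{0\}$, $\chi\in C_c^\infty(\mathbb R)$, and $\nu_0,\kappa_0,\beta>0$. For small $\varepsilon>0$ consider in the half plane $\mathbb R^2_+=\{y>0\}$ the linear Boussinesq system $$\partial_tu-b\sin\gamma+\partial_xp=\nu\Delta u,\quad \partial_tw-b\cos\gamma+\partial_yp=\nu\Delta w,\quad \partial_tb+u\sin\gamma+w\cos\gamma=\kappa\Delta b,\quad \partial_xu+\partial_yw=0,$$ with boundary conditions $u=w=\partial_yb=0$ at $y=0$, in the five regimes - Case 1: $\nu=\nu_0\varepsilon^6$, $\kappa=\kappa_0\varepsilon^\beta$, $0<\beta<6$; - Case 2: $\nu=\nu_0\varepsilon^6$, $\kappa=\kappa_0\varepsilon^\beta$, $\beta>6$; - Case 3: $\nu=\nu_0\varepsilon^\beta$, $\kappa=\kappa_0\varepsilon^6$, $0<\beta<6$; - Case 4: $\nu=\nu_0\varepsilon^\beta$, $\kappa=\kappa_0\varepsilon^6$, $\beta>6$; - Case 5: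 $\nu=\nu_0\varepsilon^\beta$, $\kappa=\kappa_0\varepsilon^\beta$, $\beta>6$. Let $\omega=\omega_{k,m}$ be the one of $\pm\frac{k\cos\gamma-m\sin\gamma}{\sqrt{k^2+m^2}}$ with $\partial_m\omega<0$, $\zeta=\omega^2-\sin^2\gamma$, $\widehat A(k,m)=\varepsilon^{-2}\sum_\pm\chi(\varepsilon^{-2}(k\pm k_0))\chi(\varepsilon^{-2}(m\pm m_0))$, $X_{k,m}=\bigl(1,-\tfrac km,\tfrac{i(k\cos\gamma-m\sin\gamma)}{m\omega}\bigr)$, and $$\mathcal W_{\rm inc}=\int_{\mathbb R^2}\widehat A\,X_{k,m}\,e^{-i\omega t+ikx+imy}\,dk\,dm .$$ Assume near-criticality: for all small $\varepsilon$, $|\zeta|\le C\varepsilon^2$ where $\widehat A\ne0$ and, in Case 5, also $|\zeta|\ge c\,\varepsilon^2$ there, with $c,C>0$ independent of $\varepsilon$. **Boundary layers.** Inserting $(U,W,B,P)e^{-i\omega t+ikx-\lambda y}$ in the system gives a $4\times4$ linear system; let $\lambda_2,\lambda_3,\lambda_5$, $|\lambda_2|\le|\lambda_3|<|\lambda_5|$,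 be all the roots with ${\rm Re}\,\lambda>0$ of its determinant, and $$X_\lambda=\Bigl(1,\frac{ik}\lambda,\frac{\sin\gamma+ik\lambda^{-1}\cos\gamma}{i\omega-\kappa(k^2-\lambda^2)}\Bigr),\qquad \mathcal W_j=\int_{\mathbb R^2}\widehat A\,a_j\,X_{\lambda_j}\,e^{-i\omega t+ikx-\lambda_jy}\,dk\,dm\quad(j=2,3,5),$$ where the amplitudes $a_2,a_3,a_5$ are determined by requiring that, for each $(k,m)$ with $\widehat A\neq0$, the three modes cancel at $y=0$ the components $u$, $w$ and $\partial_yb$ of the incident plane wave. (The roots and amplitudes are taken measurable in $(k,m)$.) Put $\mathcal W^{\rm app}=\mathcal W_{\rm inc}+\mathcal W_2+\mathcal W_3+\mathcal W_5$ in Cases 1–4 and $\mathcal W^{\rm app}=\mathcal W_{\rm inc}+\mathcal W_3+\mathcal W_5$ in Case 5, where the slowly decaying, degenerate packet $\mathcal W_2$ is discarded. **Proposition.** In each case, for all small $\varepsilon$, there are exactly three such roots wherever $\widehat A\neq 0$, they are distinct, measurable roots and amplitudes as above exist, and the integrals defining the packets converge absolutely for $y\ge0$. For any such choice the following hold in $\mathbb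 R^2_+$, for all $t$, with constants in $O(\cdot)$ independent of $\varepsilon$, $t$ and the choice. 1. $\|\mathcal W^{\rm app}\|_{L^2}=O(1)$ in all five cases; $\|\mathcal W^{\rm app}\|_{L^\infty}=O(\varepsilon^{2-\beta/3})$ in Cases 1 and 3, and $O(1)$ in Cases 2, 4 and 5. (In Case 5 the $L^\infty$ bound also holds if $\mathcal W_2$ is kept.) 2. Packets $j=2,3$: in Cases 1 and 3, $\|\mathcal W_j\|_{L^\infty}=O(\varepsilon^{2-\beta/3})$ and $\|\mathcal W_j\|_{L^2}=O(\varepsilon^{1-\beta/6})$; in Cases 2 and 4, $\|\mathcal W_j\|_{L^\infty}=O(1)$ and $\|\mathcal W_j\|_{L^2}=O(1)$. 3. Packet $j=5$: - Case 1, $\beta\le\frac92$: $\|\mathcal W_5\|_{L^\infty}=O(\varepsilon^{2-\beta/3})$, $\|\mathcal W_5\|_{L^2}=O(\varepsilon^{5/2-\beta/3})$; Case 1, $\beta\ge\frac92$: $O(\varepsilon^{\beta/3-1})$, $O(\varepsilon^{\beta/3-1/2})$. - Case 2: $\|\mathcal W_5\|_{L^\infty}=O(\varepsilon^{\beta/2-2})$,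 $\|\mathcal W_5\|_{L^2}=O(\varepsilon^{3\beta/4-3})$. - Case 3: the velocity components $(u,w)$ of $\mathcal W_5$ have $L^\infty$ norm $O(\varepsilon^{11-5\beta/3})$ and $L^2$ norm $O(\varepsilon^{23/2-5\beta/3})$; the full packet has $\|\mathcal W_5\|_{L^\infty}=O(\varepsilon^{5-2\beta/3})$, $\|\mathcal W_5\|_{L^2}=O(\varepsilon^{11/2-2\beta/3})$. - Case 4, $\beta\le8$: $\|\mathcal W_5\|_{L^\infty}=O(\varepsilon^{4-\beta/2})$, $\|\mathcal W_5\|_{L^2}=O(\varepsilon^{3-\beta/4})$; Case 4, $\beta\ge8$: $O(1)$, $O(\varepsilon^{\beta/4-1})$. 4. Case 5: $\|\mathcal W_3\|_{L^\infty}=O(1)$, $\|\mathcal W_3\|_{L^2}=O(\varepsilon^{(\beta-6)/4})$, $\|\mathcal W_5\|_{L^\infty}=O(\varepsilon)$, $\|\mathcal W_5\|_{L^2}=O(\varepsilon^{\beta/4})$. Moreover, where $\widehat A\ne0$, both $|\lambda_j|$ and ${\rm Re}\,\lambda_j$ are bounded above and below by positive constants times $\varepsilon^{-\beta_j}$, where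 $\beta_2=\beta_3=\beta/3$, $\beta_5=3$ in Cases 1 and 3; $\beta_2=\beta_3=2$, $\beta_5=\beta/2$ in Cases 2 and 4; $\beta_3=\beta/2-1$, $\beta_5=\beta/2$ in Case 5. -/

import Mathlib

open MeasureTheory Filter Topology
open scoped ContDiff ENNReal

noncomputable section

namespace NearCritical

/-- Fixed data: slope angle, central wavenumber `(k₀, m₀)`, and the cut-off profile. -/
structure Setup where
  γ : ℝ
  k₀ : ℝ
  m₀ : ℝ
  χ : ℝ → ℂ

/-- Values `(u, w, b)`. -/
abbrev State := EuclideanSpace ℂ (Fin 3)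

variable (S : Setup)

/-- The branch `ω⁺ = (k cos γ - m sin γ) / √(k² + m²)` of the dispersion relation. -/
def Setup.omegaPlus (k m : ℝ) : ℝ :=
  (k * Real.cos S.γ - m * Real.sin S.γ) / Real.sqrt (k ^ 2 + m ^ 2)

open Classical in
/-- Time frequency `ω_{k,m}`: the branch `±ω⁺` whose vertical group velocity `∂_m ω` is negative,
so that the wave travels towards the boundary `y = 0`. -/
def Setup.omega (k m : ℝ) : ℝ :=
  if deriv (fun m' => S.omegaPlus k m') m < 0 then S.omegaPlus k m else -S.omegaPlus k m

/-- Criticality parameter `ζ = ω² - sin² γ`. -/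
def Setup.zeta (k m : ℝ) : ℝ := S.omega k m ^ 2 - Real.sin S.γ ^ 2

/-- Spectral amplitude
`Â(k,m) = ε⁻² ∑_± χ((k ± k₀)/ε²) χ((m ± m₀)/ε²)`; `p = (k, m)`. -/
def Setup.spec (ε : ℝ) (p : ℝ × ℝ) : ℂ :=
  ((1 / ε ^ 2 : ℝ) : ℂ) *
    (S.χ ((p.1 + S.k₀) / ε ^ 2) * S.χ ((p.2 + S.m₀) / ε ^ 2) +
      S.χ ((p.1 - S.k₀) / ε ^ 2) * S.χ ((p.2 - S.m₀) / ε ^ 2))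

/-- Polarization `X_{k,m}` of the incident plane wave. -/
def Setup.incVec (p : ℝ × ℝ) : State :=
  !₂[(1 : ℂ), -((p.1 / p.2 : ℝ) : ℂ),
    Complex.I * ((p.1 * Real.cos S.γ - p.2 * Real.sin S.γ : ℝ) : ℂ) /
      ((p.2 * S.omega p.1 p.2 : ℝ) : ℂ)]

/-- `Â(k,m) e^{-iωt + ikx + imy} X_{k,m}`. -/
def Setup.incIntegrand (ε t : ℝ) (z : ℝ × ℝ) (p : ℝ × ℝ) : State :=
  (S.spec ε p *
    Complex.exp (-Complex.I * S.omega p.1 p.2 * t + Complex.I * p.1 * z.1 +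
      Complex.I * p.2 * z.2)) • S.incVec p

/-- Incident wave packet at time `t` and point `z = (x, y)`. -/
def Setup.incident (ε t : ℝ) (z : ℝ × ℝ) : State := ∫ p, S.incIntegrand ε t z p

/-- The matrix `A_ε` obtained by inserting `(U, W, B, P) e^{-iωt + ikx - l y}` in
`∂_t u - b sin γ + ∂_x p = ν Δu`, `∂_t w - b cos γ + ∂_y p = ν Δw`,
`∂_t b + u sin γ + w cos γ = κ Δb`, `∂_x u + ∂_y w = 0`. -/
def Setup.layerMatrix (ν κ : ℝ) (p : ℝ × ℝ) (l : ℂ) : Matrix (Fin 4) (Fin 4) ℂ :=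
  let s : ℂ := Real.sin S.γ
  let c : ℂ := Real.cos S.γ
  let ik : ℂ := Complex.I * p.1
  let iω : ℂ := Complex.I * S.omega p.1 p.2
  let lap : ℂ := l ^ 2 - (p.1 : ℂ) ^ 2
  !![-iω - ν * lap, 0, -s, ik;
     0, -iω - ν * lap, -c, -l;
     s, c, -iω - κ * lap, 0;
     ik, -l, 0, 0]

/-- `l` is the decay rate of a boundary layer mode. -/
def Setup.IsLayerRoot (ν κ : ℝ) (p : ℝ × ℝ) (l : ℂ) : Prop :=
  0 < l.re ∧ (S.layerMatrix ν κ p l).det = 0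

/-- The eigenvector `X_{k,l} = (U_l, W_l, B_l)`, normalised by `U_l = 1`. -/
def Setup.layerVec (κ : ℝ) (p : ℝ × ℝ) (l : ℂ) : State :=
  !₂[(1 : ℂ), Complex.I * p.1 / l,
    (Real.sin S.γ + Complex.I * p.1 * l⁻¹ * Real.cos S.γ) /
      (Complex.I * S.omega p.1 p.2 - κ * ((p.1 : ℂ) ^ 2 - l ^ 2))]

/-- `l` lists the decay rates and `a` the amplitudes of the boundary layer modes, as measurable
functions of the wavenumber. The indices `0, 1, 2` are the layers numbered `2, 3, 5`.
On the support of the wave packet: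
* `l p 0, l p 1, l p 2` are distinct and are all the layer roots, in order of modulus, the last
  one being strictly the largest;
* at `y = 0` the three modes together cancel `u`, `w` and `∂_y b` of the incident plane wave. -/
structure Setup.IsLayerSystem (ν κ ε : ℝ) (l a : ℝ × ℝ → Fin 3 → ℂ) : Prop where
  measurable_rate : Measurable l
  measurable_amp : Measurable a
  injective : ∀ p, S.spec ε p ≠ 0 → Function.Injective (l p)
  roots : ∀ p, S.spec ε p ≠ 0 → ∀ μ : ℂ, S.IsLayerRoot ν κ p μ ↔ ∃ j, l p j = μ
  order : ∀ p, S.spec ε p ≠ 0 → ‖l p 0‖ ≤ ‖l p 1‖ ∧ ‖l p 1‖ < ‖l p 2‖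
  lift_u : ∀ p, S.spec ε p ≠ 0 → ∑ j, a p j * S.layerVec κ p (l p j) 0 = -S.incVec p 0
  lift_w : ∀ p, S.spec ε p ≠ 0 → ∑ j, a p j * S.layerVec κ p (l p j) 1 = -S.incVec p 1
  lift_b : ∀ p, S.spec ε p ≠ 0 →
    ∑ j, a p j * (-l p j * S.layerVec κ p (l p j) 2) = -(Complex.I * p.2 * S.incVec p 2)

/-- `Â(k,m) a_j e^{-iωt + ikx - l_j y} X_{k,l_j}`. -/
def Setup.layerIntegrand (κ ε : ℝ) (l a : ℝ × ℝ → Fin 3 → ℂ) (j : Fin 3) (t : ℝ) (z : ℝ × ℝ)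
    (p : ℝ × ℝ) : State :=
  (S.spec ε p * a p j *
    Complex.exp (-Complex.I * S.omega p.1 p.2 * t + Complex.I * p.1 * z.1 - l p j * z.2)) •
      S.layerVec κ p (l p j)

/-- The `j`-th boundary layer wave packet at time `t` and point `z = (x, y)`. -/
def Setup.layer (κ ε : ℝ) (l a : ℝ × ℝ → Fin 3 → ℂ) (j : Fin 3) (t : ℝ) (z : ℝ × ℝ) : State :=
  ∫ p, S.layerIntegrand κ ε l a j t z p

/-- Incident wave packet plus the boundary layer wave packets with index in `J`. -/
def Setup.approx (κ ε : ℝ) (l a : ℝ × ℝ → Fin 3 → ℂ) (J : Finset (Fin 3)) (t : ℝ) (z : ℝ × ℝ) :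
    State :=
  S.incident ε t z + ∑ j ∈ J, S.layer κ ε l a j t z

/-- The velocity components `(u, w)` of a field. -/
def velocity (F : ℝ → ℝ × ℝ → State) (t : ℝ) (z : ℝ × ℝ) : EuclideanSpace ℂ (Fin 2) :=
  !₂[F t z 0, F t z 1]

/-- Lebesgue measure on the half plane `y > 0`. -/
def halfPlane : Measure (ℝ × ℝ) := volume.restrict {z | 0 < z.2}

/-- `F(t)` lies in `L^q` of the half plane with norm at most `R`, at all times. -/
def SizeLE {E : Type*} [NormedAddCommGroup E] (F : ℝ → ℝ × ℝ → E) (q : ℝ≥0∞) (R : ℝ) : Prop :=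
  ∀ t, MemLp (F t) q halfPlane ∧ eLpNorm (F t) q halfPlane ≤ ENNReal.ofReal R

/-- `l_j` is of size `ε^{-b}`, and so is its real part, on the support of the wave packet. -/
def Setup.DecayScale (ε : ℝ) (l : ℝ × ℝ → Fin 3 → ℂ) (j : Fin 3) (b K : ℝ) : Prop :=
  ∀ p, S.spec ε p ≠ 0 → K⁻¹ * ε ^ (-b) ≤ (l p j).re ∧ ‖l p j‖ ≤ K * ε ^ (-b)

/-- A layer system exists, and for each of them all the wave packet integrals converge. -/
def Setup.LayersDefined (ν κ ε : ℝ) : Prop :=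
  (∃ l a, S.IsLayerSystem ν κ ε l a) ∧
    (∀ t z, Integrable (S.incIntegrand ε t z)) ∧
    ∀ l a, S.IsLayerSystem ν κ ε l a → ∀ j t z, 0 ≤ z.2 →
      Integrable (S.layerIntegrand κ ε l a j t z)

/-- For all small `ε` the layers are defined and every layer system satisfies `Q K ε`, with one
constant `K`. -/
def Setup.Uniformly (ν κ : ℝ → ℝ) (Q : ℝ → ℝ → (ℝ × ℝ → Fin 3 → ℂ) → (ℝ × ℝ → Fin 3 → ℂ) → Prop) :
    Prop :=
  ∃ K > 0, ∀ᶠ ε in 𝓝[>] (0 : ℝ), S.LayersDefined (ν ε) (κ ε) ε ∧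
    ∀ l a, S.IsLayerSystem (ν ε) (κ ε) ε l a → Q K ε l a

end NearCritical

end

open MeasureTheory Filter Topology
open scoped ContDiff ENNReal

/-! Everything is read off from the roots of one sextic. Up to sign, the determinant of the layer
system is `νκ (l² - k²)³ + iω(ν + κ)(l² - k²)² + (l + im)(iq - ζl)` with `q = 2k sin γ cos γ + mζ`
(`det_eq_layerDisp`): the inviscid part is quadratic in `l` and has the incident wave `l = -im`
among its zeros.

Roots. A polynomial of degree at most `n` has a zero within `n |P(z)| / |P'(z)|` of any point
(`exists_root_near`), so a simple zero of a rescaled limit equation yields a true root nearby, and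
six distinct roots are all of them. One root stays close to `-im`; viscosity pushes it into the left
half plane, because its real part has the sign of `-ωq` and the choice `∂_m ω < 0` makes `ωq`
positive at a critical wavenumber (`omega_mul_slope_pos`). Two fast roots are close to the square
roots of `-iω(ν + κ)/(νκ)`. The other three depend on the size of `ζ` relative to `η = (ν +
κ)^(1/3)`. If `ζ = O(η)`, they are `z/η` to leading order, where `z³ + iaz + B = 0`, `a = ζ/(ωη)` is
bounded and `B = q/ω > 0`; this cubic has one zero in the left half plane and one in each quadrant
of the right half plane, with bounds that are uniform by compactness. If `ν + κ ≪ |ζ|³`, two of them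
are close to the square roots of `-iζ/(ω(ν + κ))` and the third is close to `iq/ζ`, with a small
positive real part. Either way, exactly three roots decay.

Amplitudes. Suitably normalised, the three lifting conditions have bounded right-hand sides and rows
`1`, `1/l_j`, `h_j`, where `h₂ ≈ l₂` and `h₃ ≈ l₃`. The determinant, multiplied by `l₂l₃`, is close
to `-(l₃ - l₂)(l₂ + l₃ - h₅)`, whence `a₂, a₃ = O(|l₂|)` and `a₅ = O(|l₂||l₃| / (|l₃| + |h₅|))`
(`Separated.norm_amp_le`). What depends on the relative size of viscosity and diffusion is `h₅`: it
is close to `-(ν/κ) l₅` when `ν` does not dominate, and of size `ν|l₅|³` when it does. In the latter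
case buoyancy dominates velocity in the fast mode, which is why its velocity has better bounds.

Norms. The spectrum has height `ε⁻²` on a set of sides `ε²`. A packet whose modes have size `A` and
decay rates at least `r` is therefore `O(ε²A)` in `L^∞` and, by Plancherel in `x`, `O(εA r^(-1/2))`
in `L²`. The incident packet is `O(1)` in `L²` by Plancherel in both variables.

Uniformity in the wavenumber costs nothing, because all asymptotics are taken along a filter on
pairs `(ε, p)` (`Setup.germ`). Measurable roots exist because disjoint closed regions each contain
exactly one of them. The exponents come from inserting power laws for `ν` and `κ`. -/

namespace NearCritical

/-! ### Roots of sextics: existence near a point, counting, rescaling. -/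

section PolynomialRoots

open Polynomial

/-- A polynomial has a root at distance at most `n ‖P(z)‖ / ‖P'(z)‖` from any point `z`. -/
theorem exists_root_near {P : ℂ[X]} {n : ℕ} (hn : P.natDegree ≤ n) (z : ℂ)
    (hz : P.derivative.eval z ≠ 0) :
    ∃ r, P.eval r = 0 ∧ ‖r - z‖ * ‖P.derivative.eval z‖ ≤ n * ‖P.eval z‖ := by
  by_cases h0 : P.eval z = 0
  · exact ⟨z, h0, by simp [h0]⟩
  have hP : P ≠ 0 := by rintro rfl; simp at h0
  -- The logarithmic derivative `P'/P` at `z` is the sum of `1/(z - r)` over the roots. If every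
  -- root were farther away than claimed, this sum of at most `n` terms would be too small.
  have key := (IsAlgClosed.splits P).eval_derivative_div_eval_of_ne_zero h0
  by_contra! hcon
  have hr : ∀ r ∈ P.roots, n * ‖P.eval z‖ < ‖r - z‖ * ‖P.derivative.eval z‖ := fun r hr =>
    hcon r (by simpa using (mem_roots hP).1 hr)
  have hn0 : (0 : ℝ) < n := by
    rcases Nat.eq_zero_or_pos n with h | h
    · have : P.natDegree = 0 := by omega
      rw [eq_C_of_natDegree_eq_zero this] at hz
      simp at hz
    · exact_mod_cast h
  have hPz : 0 < ‖P.eval z‖ := norm_pos_iff.2 h0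
  have hdz : 0 < ‖P.derivative.eval z‖ := norm_pos_iff.2 hz
  set q := ‖P.derivative.eval z‖ / (n * ‖P.eval z‖) with hq
  have hqpos : 0 < q := by positivity
  have hbound : ∀ r ∈ P.roots, ‖1 / (z - r)‖ < q := by
    intro r hr'
    have h1 := hr r hr'
    have h2 : 0 < ‖r - z‖ := by
      by_contra! h
      have : ‖r - z‖ = 0 := le_antisymm h (norm_nonneg _)
      rw [this, zero_mul] at h1
      exact absurd h1 (not_lt.2 (by positivity))
    rw [norm_div, norm_one, norm_sub_rev, hq, div_lt_div_iff₀ h2 (by positivity)]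
    linarith
  have hsum : ‖(P.roots.map fun r => 1 / (z - r)).sum‖ ≤
      (P.roots.map fun r => ‖1 / (z - r)‖).sum := by
    simpa [Multiset.map_map, Function.comp_def] using
      norm_multiset_sum_le (P.roots.map fun r => 1 / (z - r))
  have hval : ‖(P.roots.map fun r => 1 / (z - r)).sum‖ = q * n := by
    rw [← key, norm_div, hq]; field_simp
  have hcard : Multiset.card P.roots ≤ n := (card_roots' P).trans hn
  have hne : P.roots ≠ 0 := by
    intro h
    rw [h] at hval
    simp at hval
    rcases hval with h | h
    · exact hqpos.ne' h
    · simp [h] at hn0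
  have : (P.roots.map fun r => ‖1 / (z - r)‖).sum < (P.roots.map fun _ => q).sum :=
    Multiset.sum_lt_sum_of_nonempty hne hbound
  rw [Multiset.map_const', Multiset.sum_replicate, nsmul_eq_mul] at this
  have h3 : (Multiset.card P.roots : ℝ) ≤ n := by exact_mod_cast hcard
  nlinarith

/-- The sextic `A₃ (l² - κ)³ + A₂ (l² - κ)² + (l + α) (β - γ l)`. -/
noncomputable def disp (A₃ A₂ κ α β γ l : ℂ) : ℂ :=
  A₃ * (l ^ 2 - κ) ^ 3 + A₂ * (l ^ 2 - κ) ^ 2 + (l + α) * (β - γ * l)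

/-- The derivative of `disp` in `l`. -/
noncomputable def dispDeriv (A₃ A₂ κ α β γ l : ℂ) : ℂ :=
  A₃ * (6 * l * (l ^ 2 - κ) ^ 2) + A₂ * (4 * l * (l ^ 2 - κ)) + ((β - γ * l) - γ * (l + α))

noncomputable def dispPoly (A₃ A₂ κ α β γ : ℂ) : ℂ[X] :=
  C A₃ * (X ^ 2 - C κ) ^ 3 + C A₂ * (X ^ 2 - C κ) ^ 2 + (X + C α) * (C β - C γ * X)

theorem eval_dispPoly (A₃ A₂ κ α β γ l : ℂ) :
    (dispPoly A₃ A₂ κ α β γ).eval l = disp A₃ A₂ κ α β γ l := by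
  simp [dispPoly, disp]

theorem eval_derivative_dispPoly (A₃ A₂ κ α β γ l : ℂ) :
    (dispPoly A₃ A₂ κ α β γ).derivative.eval l = dispDeriv A₃ A₂ κ α β γ l := by
  simp [dispPoly, dispDeriv, derivative_pow]
  ring

theorem natDegree_dispPoly_le (A₃ A₂ κ α β γ : ℂ) :
    (dispPoly A₃ A₂ κ α β γ).natDegree ≤ 6 := by
  unfold dispPoly
  compute_degree

theorem exists_disp_root_near (A₃ A₂ κ α β γ z : ℂ) (hz : dispDeriv A₃ A₂ κ α β γ z ≠ 0) :
    ∃ r, disp A₃ A₂ κ α β γ r = 0 ∧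
      ‖r - z‖ * ‖dispDeriv A₃ A₂ κ α β γ z‖ ≤ 6 * ‖disp A₃ A₂ κ α β γ z‖ := by
  have := exists_root_near (natDegree_dispPoly_le A₃ A₂ κ α β γ) z
    (by rwa [eval_derivative_dispPoly])
  simpa only [eval_derivative_dispPoly, eval_dispPoly, Nat.cast_ofNat] using this

/-- Six distinct roots are all the roots. -/
theorem disp_eq_zero_iff_mem {A₃ A₂ κ α β γ : ℂ} (h₃ : A₃ ≠ 0) {s : Finset ℂ} (hs : s.card = 6)
    (hroot : ∀ r ∈ s, disp A₃ A₂ κ α β γ r = 0) (l : ℂ) :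
    disp A₃ A₂ κ α β γ l = 0 ↔ l ∈ s := by
  refine ⟨fun hl => ?_, hroot l⟩
  have hP : dispPoly A₃ A₂ κ α β γ ≠ 0 := by
    intro h
    have hc : (dispPoly A₃ A₂ κ α β γ).coeff 6 = A₃ := by
      have : dispPoly A₃ A₂ κ α β γ = C A₃ * X ^ 6 + (C (A₂ - 3 * A₃ * κ) * X ^ 4 +
          C (3 * A₃ * κ ^ 2 - 2 * A₂ * κ - γ) * X ^ 2 + C (β - α * γ) * X +
          C (A₂ * κ ^ 2 - A₃ * κ ^ 3 + α * β)) := by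
        unfold dispPoly
        simp only [map_sub, map_add, map_mul, map_pow, map_ofNat]
        ring
      rw [this]
      simp only [coeff_add, coeff_C_mul, coeff_X_pow, coeff_X, coeff_C]
      norm_num
    rw [h] at hc
    exact h₃ (by simpa using hc.symm)
  by_contra hls
  have hsub : insert l s ⊆ (dispPoly A₃ A₂ κ α β γ).roots.toFinset := by
    intro r hr
    rw [Multiset.mem_toFinset, mem_roots hP, IsRoot, eval_dispPoly]
    rcases Finset.mem_insert.1 hr with rfl | h
    · exact hl
    · exact hroot r h
  have h1 := Finset.card_le_card hsub
  rw [Finset.card_insert_of_notMem hls, hs] at h1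
  have h2 := (Multiset.toFinset_card_le _).trans ((card_roots' _).trans
    (natDegree_dispPoly_le A₃ A₂ κ α β γ))
  omega

/-- This family of sextics is stable under `l = Y w` followed by division by `N`. Every asymptotic
regime is thus a choice of `Y` and `N`, and one perturbation argument serves for all. -/
theorem disp_scale (A₃ A₂ κ α β γ w : ℂ) {Y N : ℂ} (hY : Y ≠ 0) (hN : N ≠ 0) :
    disp A₃ A₂ κ α β γ (Y * w) = N * disp (A₃ * Y ^ 6 / N) (A₂ * Y ^ 4 / N) (κ / Y ^ 2) (α / Y)
      (β * Y / N) (γ * Y ^ 2 / N) w := by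
  unfold disp
  field_simp

end PolynomialRoots

/-! ### Perturbation of simple roots along a filter. -/

section FilterRoots

variable {ι : Type*} {𝓕 : Filter ι}

/-- Approximate simple roots are close to true roots, for a family of sextics. -/
theorem exists_disp_root_tendsto {A₃ A₂ κ α β γ w : ι → ℂ}
    (h0 : Tendsto (fun i => disp (A₃ i) (A₂ i) (κ i) (α i) (β i) (γ i) (w i)) 𝓕 (𝓝 0))
    {c : ℝ} (hc : 0 < c)
    (h1 : ∀ᶠ i in 𝓕, c ≤ ‖dispDeriv (A₃ i) (A₂ i) (κ i) (α i) (β i) (γ i) (w i)‖) :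
    ∃ r : ι → ℂ, (∀ᶠ i in 𝓕, disp (A₃ i) (A₂ i) (κ i) (α i) (β i) (γ i) (r i) = 0) ∧
      Tendsto (fun i => r i - w i) 𝓕 (𝓝 0) := by
  -- The root is chosen index by index, with the value 0 where the derivative bound fails. No
  -- regularity in the index is needed.
  have : ∀ i, ∃ r, c ≤ ‖dispDeriv (A₃ i) (A₂ i) (κ i) (α i) (β i) (γ i) (w i)‖ →
      disp (A₃ i) (A₂ i) (κ i) (α i) (β i) (γ i) r = 0 ∧
      ‖r - w i‖ ≤ 6 / c * ‖disp (A₃ i) (A₂ i) (κ i) (α i) (β i) (γ i) (w i)‖ := by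
    intro i
    by_cases h : c ≤ ‖dispDeriv (A₃ i) (A₂ i) (κ i) (α i) (β i) (γ i) (w i)‖
    · obtain ⟨r, hr, hr'⟩ := exists_disp_root_near (A₃ i) (A₂ i) (κ i) (α i) (β i) (γ i) (w i)
        (norm_pos_iff.1 (hc.trans_le h))
      refine ⟨r, fun _ => ⟨hr, ?_⟩⟩
      rw [div_mul_eq_mul_div, le_div_iff₀ hc]
      exact (mul_le_mul_of_nonneg_left h (norm_nonneg _)).trans hr'
    · exact ⟨0, fun h' => absurd h' h⟩
  choose r hr using this
  refine ⟨r, h1.mono fun i hi => (hr i hi).1, ?_⟩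
  refine squeeze_zero_norm' (h1.mono fun i hi => (hr i hi).2) ?_
  simpa using h0.norm.const_mul (6 / c)

end FilterRoots

end NearCritical

namespace NearCritical

section ScaledRoots

variable {ι : Type*} {𝓕 : Filter ι}

/-- Roots of a family of sextics which, after rescaling, converge to a sextic with a simple
root `w₀`. -/
theorem exists_disp_root_scaled {A₃ A₂ κ α β γ Y N : ι → ℂ} {a₃ a₂ κ₀ α₀ β₀ γ₀ w₀ : ℂ}
    (hY : ∀ᶠ i in 𝓕, Y i ≠ 0) (hN : ∀ᶠ i in 𝓕, N i ≠ 0)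
    (h₃ : Tendsto (fun i => A₃ i * Y i ^ 6 / N i) 𝓕 (𝓝 a₃))
    (h₂ : Tendsto (fun i => A₂ i * Y i ^ 4 / N i) 𝓕 (𝓝 a₂))
    (hκ : Tendsto (fun i => κ i / Y i ^ 2) 𝓕 (𝓝 κ₀))
    (hα : Tendsto (fun i => α i / Y i) 𝓕 (𝓝 α₀))
    (hβ : Tendsto (fun i => β i * Y i / N i) 𝓕 (𝓝 β₀))
    (hγ : Tendsto (fun i => γ i * Y i ^ 2 / N i) 𝓕 (𝓝 γ₀))
    (h0 : disp a₃ a₂ κ₀ α₀ β₀ γ₀ w₀ = 0) (h1 : dispDeriv a₃ a₂ κ₀ α₀ β₀ γ₀ w₀ ≠ 0) :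
    ∃ r : ι → ℂ, (∀ᶠ i in 𝓕, disp (A₃ i) (A₂ i) (κ i) (α i) (β i) (γ i) (Y i * r i) = 0) ∧
      Tendsto r 𝓕 (𝓝 w₀) := by
  have hprod := h₃.prodMk_nhds (h₂.prodMk_nhds (hκ.prodMk_nhds
    (hα.prodMk_nhds (hβ.prodMk_nhds hγ))))
  have c0 : Continuous fun x : ℂ × ℂ × ℂ × ℂ × ℂ × ℂ =>
      disp x.1 x.2.1 x.2.2.1 x.2.2.2.1 x.2.2.2.2.1 x.2.2.2.2.2 w₀ := by unfold disp; fun_prop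
  have c1 : Continuous fun x : ℂ × ℂ × ℂ × ℂ × ℂ × ℂ =>
      dispDeriv x.1 x.2.1 x.2.2.1 x.2.2.2.1 x.2.2.2.2.1 x.2.2.2.2.2 w₀ := by
    unfold dispDeriv; fun_prop
  have t0 := (c0.tendsto _).comp hprod
  have t1 := ((c1.tendsto _).comp hprod).norm
  simp only [Function.comp_def, h0] at t0 t1
  have hpos : 0 < ‖dispDeriv a₃ a₂ κ₀ α₀ β₀ γ₀ w₀‖ := norm_pos_iff.2 h1
  obtain ⟨r, hr, hr'⟩ := exists_disp_root_tendsto t0 (half_pos hpos)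
    ((t1.eventually_const_lt (half_lt_self hpos)).mono fun i hi => hi.le)
  refine ⟨r, ?_, by simpa using hr'.add_const w₀⟩
  filter_upwards [hY, hN, hr] with i hYi hNi hri
  rw [disp_scale _ _ _ _ _ _ _ hYi hNi, hri, mul_zero]

end ScaledRoots

/-! ### Square roots of imaginary numbers. -/

section ImaginarySqrt

/-- The square root of `i x` in the right half plane. -/
noncomputable def isqrt (x : ℝ) : ℂ := (√(|x| / 2) : ℝ) * (1 + Complex.I * (SignType.sign x : ℝ))

theorem isqrt_sq (x : ℝ) : isqrt x ^ 2 = Complex.I * x := by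
  have h1 : ((√(|x| / 2) : ℝ) : ℂ) ^ 2 = ((|x| / 2 : ℝ) : ℂ) := by
    rw [← Complex.ofReal_pow, Real.sq_sqrt (by positivity)]
  rw [isqrt, mul_pow, h1]
  rcases lt_trichotomy x 0 with h | rfl | h
  · rw [abs_of_neg h, sign_neg h]
    push_cast
    ring_nf
    simp [Complex.I_sq]
  · simp
  · rw [abs_of_pos h, sign_pos h]
    push_cast
    ring_nf
    simp [Complex.I_sq]

theorem norm_isqrt_sq (x : ℝ) : ‖isqrt x‖ ^ 2 = |x| := by
  rw [← norm_pow, isqrt_sq]; simp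

theorem isqrt_re (x : ℝ) : (isqrt x).re = √(|x| / 2) := by
  simp [isqrt]

theorem norm_isqrt (x : ℝ) : ‖isqrt x‖ = √|x| := by
  rw [← norm_isqrt_sq, Real.sqrt_sq (norm_nonneg _)]

/-- The argument of `isqrt x` is `±π/4`, so `√2` would do in place of 2. The slack is what keeps
points at a small relative distance inside the right half plane. -/
theorem norm_isqrt_le_re (x : ℝ) : ‖isqrt x‖ ≤ 2 * (isqrt x).re := by
  rw [norm_isqrt, isqrt_re]
  have : (2 : ℝ) * √(|x| / 2) = √(2 ^ 2 * (|x| / 2)) := by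
    rw [Real.sqrt_mul (by norm_num), Real.sqrt_sq (by norm_num)]
  rw [this]
  apply Real.sqrt_le_sqrt
  nlinarith [abs_nonneg x]

theorem isqrt_ne_zero {x : ℝ} (h : x ≠ 0) : isqrt x ≠ 0 := by
  intro h0
  have := norm_isqrt_sq x
  rw [h0] at this
  simp at this
  exact h (abs_eq_zero.1 this.symm)

end ImaginarySqrt

/-! ### The dispersion relation and its root close to the incident wave. -/

/-- The dispersion sextic of the boundary layers. -/
noncomputable def layerDisp (ν κ k m Ω q ζ : ℝ) (l : ℂ) : ℂ :=
  disp (ν * κ : ℝ) (Complex.I * (Ω * (ν + κ) : ℝ)) (k ^ 2 : ℝ) (Complex.I * m) (Complex.I * q) ζ l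

/-- Coefficients of a family of dispersion relations close to critical in the inviscid limit. -/
structure NearCriticalFamily {ι : Type*} (𝓕 : Filter ι) (ν κ k m Ω q ζ : ι → ℝ)
    (k₀ m₀ Ω₀ q₀ : ℝ) : Prop where
  k_lim : Tendsto k 𝓕 (𝓝 k₀)
  m_lim : Tendsto m 𝓕 (𝓝 m₀)
  Ω_lim : Tendsto Ω 𝓕 (𝓝 Ω₀)
  q_lim : Tendsto q 𝓕 (𝓝 q₀)
  ζ_lim : Tendsto ζ 𝓕 (𝓝 0)
  ν_lim : Tendsto ν 𝓕 (𝓝 0)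
  κ_lim : Tendsto κ 𝓕 (𝓝 0)
  ν_pos : ∀ᶠ i in 𝓕, 0 < ν i
  κ_pos : ∀ᶠ i in 𝓕, 0 < κ i
  k_ne : k₀ ≠ 0
  m_ne : m₀ ≠ 0
  pos : 0 < Ω₀ * q₀

namespace NearCriticalFamily

variable {ι : Type*} {𝓕 : Filter ι} {ν κ k m Ω q ζ : ι → ℝ} {k₀ m₀ Ω₀ q₀ : ℝ}

theorem Ω₀_ne (h : NearCriticalFamily 𝓕 ν κ k m Ω q ζ k₀ m₀ Ω₀ q₀) : Ω₀ ≠ 0 := by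
  have := h.pos; rintro rfl; simp at this

theorem q₀_ne (h : NearCriticalFamily 𝓕 ν κ k m Ω q ζ k₀ m₀ Ω₀ q₀) : q₀ ≠ 0 := by
  have := h.pos; rintro rfl; simp at this

/-- The root close to that of the incident wave lies in the left half plane. -/
theorem exists_small_root (h : NearCriticalFamily 𝓕 ν κ k m Ω q ζ k₀ m₀ Ω₀ q₀) :
    ∃ r : ι → ℂ, (∀ᶠ i in 𝓕, layerDisp (ν i) (κ i) (k i) (m i) (Ω i) (q i) (ζ i) (r i) = 0) ∧
      Tendsto r 𝓕 (𝓝 (-(Complex.I * m₀))) ∧ ∀ᶠ i in 𝓕, (r i).re < 0 := by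
  have ofR : ∀ {f : ι → ℝ} {a : ℝ}, Tendsto f 𝓕 (𝓝 a) →
      Tendsto (fun i => (f i : ℂ)) 𝓕 (𝓝 (a : ℂ)) := fun hf =>
    (Complex.continuous_ofReal.tendsto _).comp hf
  have hΩ := h.Ω₀_ne
  have hq := h.q₀_ne
  -- Without rescaling, only `(l + i m₀) i q₀` survives as `ν`, `κ` and `ζ` tend to 0; its root `-i
  -- m₀` is simple.
  obtain ⟨r, hr, hr'⟩ := exists_disp_root_scaled (𝓕 := 𝓕) (Y := fun _ => 1) (N := fun _ => 1)
    (A₃ := fun i => (ν i * κ i : ℝ)) (A₂ := fun i => Complex.I * (Ω i * (ν i + κ i) : ℝ))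
    (κ := fun i => (k i ^ 2 : ℝ)) (α := fun i => Complex.I * m i) (β := fun i => Complex.I * q i)
    (γ := fun i => ζ i) (a₃ := ((0 * 0 : ℝ) : ℂ)) (a₂ := Complex.I * ((Ω₀ * (0 + 0) : ℝ) : ℂ))
    (κ₀ := ((k₀ ^ 2 : ℝ) : ℂ)) (α₀ := Complex.I * m₀) (β₀ := Complex.I * q₀) (γ₀ := ((0 : ℝ) : ℂ))
    (w₀ := -(Complex.I * m₀)) (by simp) (by simp)
    (by simpa only [one_pow, mul_one, div_one] using ofR (h.ν_lim.mul h.κ_lim))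
    (by simpa only [one_pow, mul_one, div_one] using
      (ofR (h.Ω_lim.mul (h.ν_lim.add h.κ_lim))).const_mul Complex.I)
    (by simpa only [one_pow, mul_one, div_one] using ofR (h.k_lim.pow 2))
    (by simpa only [one_pow, mul_one, div_one] using (ofR h.m_lim).const_mul Complex.I)
    (by simpa only [one_pow, mul_one, div_one] using (ofR h.q_lim).const_mul Complex.I)
    (by simpa only [one_pow, mul_one, div_one] using ofR h.ζ_lim)
    (by simp [disp]) (by simp [dispDeriv, hq])
  simp only [one_mul] at hr
  refine ⟨r, hr, hr', ?_⟩
  -- the real part is governed by the viscous terms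
  set L : ι → ℂ := fun i => r i ^ 2 - (k i ^ 2 : ℝ) with hL
  have hLlim : Tendsto L 𝓕 (𝓝 ((-(Complex.I * m₀)) ^ 2 - ((k₀ ^ 2 : ℝ) : ℂ))) :=
    (hr'.pow 2).sub (ofR (h.k_lim.pow 2))
  have hfrac : Tendsto (fun i => ν i * κ i / (ν i + κ i)) 𝓕 (𝓝 0) := by
    refine squeeze_zero' ?_ ?_ h.ν_lim
    · filter_upwards [h.ν_pos, h.κ_pos] with i h1 h2
      positivity
    · filter_upwards [h.ν_pos, h.κ_pos] with i h1 h2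
      rw [div_le_iff₀ (by positivity)]
      nlinarith
  have hden : Tendsto (fun i => Complex.I * q i - ζ i * r i) 𝓕
      (𝓝 (Complex.I * q₀ - ((0 : ℝ) : ℂ) * (-(Complex.I * m₀)))) :=
    ((ofR h.q_lim).const_mul _).sub ((ofR h.ζ_lim).mul hr')
  have hden0 : Complex.I * q₀ - ((0 : ℝ) : ℂ) * (-(Complex.I * m₀)) ≠ 0 := by simp [hq]
  -- By the equation, `(r + i m)/(ν + κ)` is this quotient. Its limit is the real number `-Ω₀ (m₀² +
  -- k₀²)²/q₀`, negative because `Ω₀ q₀ > 0`; the term `i m` does not contribute to the real part.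
  have hlim := ((((ofR hfrac).mul (hLlim.pow 3)).add
    (((ofR h.Ω_lim).const_mul Complex.I).mul (hLlim.pow 2))).div hden hden0).neg
  have hval : -((((0 : ℝ) : ℂ) * ((-(Complex.I * m₀)) ^ 2 - ((k₀ ^ 2 : ℝ) : ℂ)) ^ 3 +
      Complex.I * Ω₀ * ((-(Complex.I * m₀)) ^ 2 - ((k₀ ^ 2 : ℝ) : ℂ)) ^ 2) /
      (Complex.I * q₀ - ((0 : ℝ) : ℂ) * (-(Complex.I * m₀)))) =
      ((-(Ω₀ * q₀ * (m₀ ^ 2 + k₀ ^ 2) ^ 2 / q₀ ^ 2) : ℝ) : ℂ) := by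
    have hq' : (q₀ : ℂ) ≠ 0 := by exact_mod_cast hq
    have hsq : (-(Complex.I * m₀)) ^ 2 = -(m₀ : ℂ) ^ 2 := by
      rw [neg_sq, mul_pow, Complex.I_sq]; ring
    rw [hsq]
    simp only [Complex.ofReal_zero, zero_mul, sub_zero, zero_add]
    rw [← neg_div, div_eq_iff (mul_ne_zero Complex.I_ne_zero hq')]
    push_cast
    field_simp
    ring
  rw [hval] at hlim
  have hneg : -(Ω₀ * q₀ * (m₀ ^ 2 + k₀ ^ 2) ^ 2 / q₀ ^ 2) < 0 := by
    have := h.pos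
    have h2 : 0 < k₀ ^ 2 := by have := h.k_ne; positivity
    have : 0 < q₀ ^ 2 := by positivity
    rw [neg_lt_zero]
    positivity
  have hre := ((Complex.continuous_re.tendsto _).comp hlim).eventually_lt_const
    (by rwa [Complex.ofReal_re] : _ < (0 : ℝ))
  filter_upwards [hre, hr, hden.eventually_ne hden0, h.ν_pos, h.κ_pos] with i h1 h2 h3 h4 h5
  have hμ : 0 < ν i + κ i := by positivity
  have hμ' : ((ν i : ℂ) + κ i) ≠ 0 := by exact_mod_cast hμ.ne'
  have heq : r i + Complex.I * m i = ((ν i + κ i : ℝ) : ℂ) *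
      -((((ν i * κ i / (ν i + κ i) : ℝ) : ℂ) * L i ^ 3 + Complex.I * Ω i * L i ^ 2) /
      (Complex.I * q i - ζ i * r i)) := by
    rw [disp] at h2
    push_cast at h2 ⊢
    rw [← neg_div, mul_div_assoc', eq_div_iff h3]
    have e : ((ν i : ℂ) + κ i) * -((ν i : ℂ) * κ i / (ν i + κ i) * L i ^ 3 +
      Complex.I * Ω i * L i ^ 2) = -((ν i : ℂ) * κ i * L i ^ 3 +
      Complex.I * (Ω i * (ν i + κ i)) * L i ^ 2) := by
      field_simp
    rw [e, hL]
    push_cast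
    linear_combination h2
  have h6 := congrArg Complex.re heq
  rw [Complex.re_ofReal_mul] at h6
  simp only [Complex.add_re, Complex.mul_re, Complex.I_re, Complex.I_im, Complex.ofReal_re,
    Complex.ofReal_im, mul_zero, zero_mul, sub_zero, add_zero] at h6
  rw [h6]
  exact mul_neg_of_pos_of_neg hμ h1

end NearCriticalFamily

end NearCritical

namespace NearCritical

section Tendsto

variable {ι : Type*} {𝓕 : Filter ι}

theorem tendsto_ofReal {f : ι → ℝ} {a : ℝ} (hf : Tendsto f 𝓕 (𝓝 a)) :
    Tendsto (fun i => (f i : ℂ)) 𝓕 (𝓝 (a : ℂ)) :=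
  (Complex.continuous_ofReal.tendsto _).comp hf

theorem tendsto_zero_of_sq_norm {f : ι → ℂ} (h : Tendsto (fun i => ‖f i‖ ^ 2) 𝓕 (𝓝 0)) :
    Tendsto f 𝓕 (𝓝 0) := by
  rw [tendsto_zero_iff_norm_tendsto_zero]
  have := (Real.continuous_sqrt.tendsto 0).comp h
  simpa [Function.comp_def, Real.sqrt_sq] using this

theorem tendsto_zero_mul_of_norm_le {f g : ι → ℂ} (hf : Tendsto f 𝓕 (𝓝 0)) {C : ℝ}
    (hg : ∀ᶠ i in 𝓕, ‖g i‖ ≤ C) : Tendsto (fun i => f i * g i) 𝓕 (𝓝 0) := by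
  refine squeeze_zero_norm' (a := fun i => ‖f i‖ * C) ?_ (by simpa using hf.norm.mul_const C)
  filter_upwards [hg] with i hi
  rw [norm_mul]
  exact mul_le_mul_of_nonneg_left hi (norm_nonneg _)

end Tendsto

/-! ### The two fast roots. -/

namespace NearCriticalFamily

variable {ι : Type*} {𝓕 : Filter ι} {ν κ k m Ω q ζ : ι → ℝ} {k₀ m₀ Ω₀ q₀ : ℝ}

/-- In each rescaled equation, terms to be discarded appear as a null family times this ratio. Hence
the asymptotics of the roots need no assumption on the relative size of `ν` and `κ`. -/
theorem ratio_le (h : NearCriticalFamily 𝓕 ν κ k m Ω q ζ k₀ m₀ Ω₀ q₀) :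
    ∀ᶠ i in 𝓕, ‖((ν i * κ i / (ν i + κ i) ^ 2 : ℝ) : ℂ)‖ ≤ 1 := by
  filter_upwards [h.ν_pos, h.κ_pos] with i h1 h2
  rw [Complex.norm_real, Real.norm_of_nonneg (by positivity), div_le_one (by positivity)]
  nlinarith

theorem Ω_ne (h : NearCriticalFamily 𝓕 ν κ k m Ω q ζ k₀ m₀ Ω₀ q₀) : ∀ᶠ i in 𝓕, Ω i ≠ 0 :=
  h.Ω_lim.eventually_ne h.Ω₀_ne

theorem q_ne (h : NearCriticalFamily 𝓕 ν κ k m Ω q ζ k₀ m₀ Ω₀ q₀) : ∀ᶠ i in 𝓕, q i ≠ 0 :=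
  h.q_lim.eventually_ne h.q₀_ne

theorem μ_lim (h : NearCriticalFamily 𝓕 ν κ k m Ω q ζ k₀ m₀ Ω₀ q₀) :
    Tendsto (fun i => ν i + κ i) 𝓕 (𝓝 0) := by
  simpa using h.ν_lim.add h.κ_lim

/-- The two fastest decay rates, with a negligible stratification. -/
theorem exists_large_root (h : NearCriticalFamily 𝓕 ν κ k m Ω q ζ k₀ m₀ Ω₀ q₀) {s : ℂ}
    (hs : s ^ 2 = 1) :
    ∃ r : ι → ℂ, (∀ᶠ i in 𝓕, layerDisp (ν i) (κ i) (k i) (m i) (Ω i) (q i) (ζ i)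
      (isqrt (-(Ω i * (ν i + κ i) / (ν i * κ i))) * r i) = 0) ∧ Tendsto r 𝓕 (𝓝 s) := by
  have hs0 : s ≠ 0 := by rintro rfl; simp at hs
  set Z : ι → ℂ := fun i => isqrt (-(Ω i * (ν i + κ i) / (ν i * κ i))) with hZ
  have hpos := h.ν_pos.and (h.κ_pos.and h.Ω_ne)
  have hZ0 : ∀ᶠ i in 𝓕, Z i ≠ 0 := by
    filter_upwards [hpos] with i ⟨h1, h2, h3⟩
    exact isqrt_ne_zero (neg_ne_zero.2 (by positivity))
  have hinv : Tendsto (fun i => (Z i)⁻¹) 𝓕 (𝓝 0) := by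
    apply tendsto_zero_of_sq_norm
    have hb : Tendsto (fun i => (ν i + κ i) / |Ω i|) 𝓕 (𝓝 0) := by
      have := h.μ_lim.div h.Ω_lim.abs (abs_ne_zero.2 h.Ω₀_ne)
      rw [zero_div] at this
      exact this
    refine squeeze_zero' (Eventually.of_forall fun i => by positivity) ?_ hb
    filter_upwards [hpos] with i ⟨h1, h2, h3⟩
    have h4 : 0 < |Ω i| := abs_pos.2 h3
    rw [norm_inv, inv_pow, norm_isqrt_sq, abs_neg, abs_div, abs_mul, abs_of_pos (mul_pos h1 h2),
      abs_of_pos (add_pos h1 h2), inv_div, div_le_div_iff₀ (by positivity) h4]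
    nlinarith [mul_pos h1 h2, mul_pos h4 (mul_pos h1 h2), mul_pos h4 (sq_pos_of_pos h1),
      mul_pos h4 (sq_pos_of_pos h2)]
  have hsq : ∀ i, Z i ^ 2 = Complex.I * ((-(Ω i * (ν i + κ i) / (ν i * κ i)) : ℝ) : ℂ) :=
    fun i => isqrt_sq _
  have hq2 : Tendsto (fun i => Complex.I * ((q i / Ω i ^ 2 : ℝ) : ℂ)) 𝓕
      (𝓝 (Complex.I * ((q₀ / Ω₀ ^ 2 : ℝ) : ℂ))) :=
    (tendsto_ofReal (h.q_lim.div (h.Ω_lim.pow 2) (pow_ne_zero 2 h.Ω₀_ne))).const_mul _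
  have hζ2 : Tendsto (fun i => ((ζ i / Ω i ^ 2 : ℝ) : ℂ)) 𝓕 (𝓝 ((0 / Ω₀ ^ 2 : ℝ) : ℂ)) :=
    tendsto_ofReal (h.ζ_lim.div (h.Ω_lim.pow 2) (pow_ne_zero 2 h.Ω₀_ne))
  have hβ := tendsto_zero_mul_of_norm_le (by simpa using hinv.mul hq2) h.ratio_le
  have hγ := tendsto_zero_mul_of_norm_le (by simpa using hζ2) h.ratio_le
  have hcast : ∀ᶠ i in 𝓕, (ν i : ℂ) ≠ 0 ∧ (κ i : ℂ) ≠ 0 ∧ (Ω i : ℂ) ≠ 0 ∧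
      ((ν i : ℂ) + κ i) ≠ 0 := by
    filter_upwards [hpos] with i ⟨h1, h2, h3⟩
    exact ⟨by exact_mod_cast h1.ne', by exact_mod_cast h2.ne', by exact_mod_cast h3,
      by exact_mod_cast (add_pos h1 h2).ne'⟩
  have hsqc : ∀ᶠ i in 𝓕, Complex.I * (Ω i * (ν i + κ i)) = -(ν i * κ i * Z i ^ 2) := by
    filter_upwards [hcast] with i ⟨h1, h2, h3, h4⟩
    rw [hsq]; push_cast; field_simp
  -- Since `Z²` is exactly `-iΩ(ν + κ)/(νκ)`, division by `N = iΩ(ν + κ)Z⁴` leaves the limit `w⁴ -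
  -- w⁶`, whose zeros `±1` are simple.
  refine exists_disp_root_scaled (Y := Z) (N := fun i => Complex.I * (Ω i * (ν i + κ i) : ℝ) *
    Z i ^ 4) (a₃ := -1) (a₂ := 1) (κ₀ := 0) (α₀ := 0) (β₀ := 0) (γ₀ := 0) hZ0 ?_ ?_ ?_ ?_ ?_ ?_ ?_
    ?_ ?_
  · filter_upwards [hcast, hZ0] with i ⟨h1, h2, h3, h4⟩ h5
    push_cast
    exact mul_ne_zero (mul_ne_zero Complex.I_ne_zero (mul_ne_zero h3 h4)) (pow_ne_zero _ h5)
  · refine tendsto_const_nhds.congr' ?_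
    filter_upwards [hcast, hZ0, hsqc] with i ⟨h1, h2, h3, h4⟩ h5 h6
    push_cast
    rw [h6]
    field_simp
  · refine tendsto_const_nhds.congr' ?_
    filter_upwards [hcast, hZ0] with i ⟨h1, h2, h3, h4⟩ h5
    push_cast
    have := Complex.I_ne_zero
    field_simp
  · have := (tendsto_ofReal (h.k_lim.pow 2)).mul (hinv.pow 2)
    simpa [div_eq_mul_inv] using this
  · have := ((tendsto_ofReal h.m_lim).const_mul Complex.I).mul hinv
    simpa [div_eq_mul_inv] using this
  · refine hβ.congr' ?_
    filter_upwards [hcast, hZ0, hsqc] with i ⟨h1, h2, h3, h4⟩ h5 h6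
    have hI := Complex.I_ne_zero
    push_cast
    have h7 : (Z i) ^ 4 = Z i * Z i * Z i ^ 2 := by ring
    rw [h7, hsq]
    push_cast
    field_simp
    simp only [Complex.I_sq]
    ring
  · refine hγ.congr' ?_
    filter_upwards [hcast, hZ0, hsqc] with i ⟨h1, h2, h3, h4⟩ h5 h6
    have hI := Complex.I_ne_zero
    push_cast
    have h7 : (Z i) ^ 4 = Z i ^ 2 * Z i ^ 2 := by ring
    have h8 : (Z i) ^ 2 ≠ 0 := pow_ne_zero _ h5
    rw [h7, mul_comm _ (Z i ^ 2 * Z i ^ 2), mul_assoc (Z i ^ 2), mul_comm ((ζ i : ℂ)),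
      mul_div_mul_left _ _ h8, hsq]
    push_cast
    field_simp
    simp only [Complex.I_sq]
    ring
  · simp only [disp]
    linear_combination (-(s ^ 2) ^ 2) * hs
  · simp only [dispDeriv]
    have : -1 * (6 * s * (s ^ 2 - 0) ^ 2) + 1 * (4 * s * (s ^ 2 - 0)) + (0 - 0 * s - 0 * (s + 0))
        = -2 * s := by rw [hs]; ring
    rw [this]
    exact mul_ne_zero (by norm_num) hs0

end NearCriticalFamily

end NearCritical

/-! ### The moderate and degenerate roots away from criticality. -/

namespace NearCritical

namespace NearCriticalFamily

variable {ι : Type*} {𝓕 : Filter ι} {ν κ k m Ω q ζ : ι → ℝ} {k₀ m₀ Ω₀ q₀ : ℝ}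

theorem cast_ne (h : NearCriticalFamily 𝓕 ν κ k m Ω q ζ k₀ m₀ Ω₀ q₀) :
    ∀ᶠ i in 𝓕, (ν i : ℂ) ≠ 0 ∧ (κ i : ℂ) ≠ 0 ∧ (Ω i : ℂ) ≠ 0 ∧ ((ν i : ℂ) + κ i) ≠ 0 := by
  filter_upwards [h.ν_pos, h.κ_pos, h.Ω_ne] with i h1 h2 h3
  exact ⟨by exact_mod_cast h1.ne', by exact_mod_cast h2.ne', by exact_mod_cast h3,
    by exact_mod_cast (add_pos h1 h2).ne'⟩

/-- Moderately fast decay rates far from criticality. -/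
theorem exists_moderate_root (h : NearCriticalFamily 𝓕 ν κ k m Ω q ζ k₀ m₀ Ω₀ q₀)
    (hζ : ∀ᶠ i in 𝓕, ζ i ≠ 0)
    (hμ : Tendsto (fun i => (ν i + κ i) / |ζ i| ^ 3) 𝓕 (𝓝 0)) {s : ℂ} (hs : s ^ 2 = 1) :
    ∃ r : ι → ℂ, (∀ᶠ i in 𝓕, layerDisp (ν i) (κ i) (k i) (m i) (Ω i) (q i) (ζ i)
      (isqrt (-(ζ i / (Ω i * (ν i + κ i)))) * r i) = 0) ∧ Tendsto r 𝓕 (𝓝 s) := by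
  have hs0 : s ≠ 0 := by rintro rfl; simp at hs
  set Y : ι → ℂ := fun i => isqrt (-(ζ i / (Ω i * (ν i + κ i)))) with hY
  have hpos := h.ν_pos.and (h.κ_pos.and h.Ω_ne)
  have hY0 : ∀ᶠ i in 𝓕, Y i ≠ 0 := by
    filter_upwards [hpos, hζ] with i ⟨h1, h2, h3⟩ h4
    exact isqrt_ne_zero (neg_ne_zero.2 (by positivity))
  have hΩa : Tendsto (fun i => |Ω i|) 𝓕 (𝓝 |Ω₀|) := h.Ω_lim.abs
  have hinv : Tendsto (fun i => (Y i)⁻¹) 𝓕 (𝓝 0) := by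
    apply tendsto_zero_of_sq_norm
    have hb := (hΩa.mul hμ).mul (h.ζ_lim.abs.pow 2)
    rw [mul_zero, zero_mul] at hb
    refine hb.congr' ?_
    filter_upwards [hpos, hζ] with i ⟨h1, h2, h3⟩ h4
    have h5 : 0 < |ζ i| := abs_pos.2 h4
    rw [norm_inv, inv_pow, norm_isqrt_sq, abs_neg, abs_div, abs_mul,
      abs_of_pos (add_pos h1 h2), inv_div]
    field_simp
  -- Here `ν + κ ≪ |ζ|³` enters: `|ζ Y|⁻² = |Ω|(ν + κ)/|ζ|³`, so the term linear in `l` is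
  -- negligible at the scale `Y`.
  have hinv2 : Tendsto (fun i => ((ζ i : ℂ) * Y i)⁻¹) 𝓕 (𝓝 0) := by
    apply tendsto_zero_of_sq_norm
    have hb := hΩa.mul hμ
    rw [mul_zero] at hb
    refine hb.congr' ?_
    filter_upwards [hpos, hζ] with i ⟨h1, h2, h3⟩ h4
    have h5 : 0 < |ζ i| := abs_pos.2 h4
    rw [norm_inv, inv_pow, norm_mul, mul_pow, norm_isqrt_sq, abs_neg, abs_div, abs_mul,
      abs_of_pos (add_pos h1 h2), Complex.norm_real, Real.norm_eq_abs]
    have h6 : 0 < |Ω i| := abs_pos.2 h3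
    field_simp
  have hsq : ∀ i, Y i ^ 2 = Complex.I * ((-(ζ i / (Ω i * (ν i + κ i))) : ℝ) : ℂ) :=
    fun i => isqrt_sq _
  have hζ2 : Tendsto (fun i => ((-(ζ i / Ω i ^ 2) : ℝ) : ℂ)) 𝓕 (𝓝 ((-(0 / Ω₀ ^ 2) : ℝ) : ℂ)) :=
    tendsto_ofReal (h.ζ_lim.div (h.Ω_lim.pow 2) (pow_ne_zero 2 h.Ω₀_ne)).neg
  have h₃ := tendsto_zero_mul_of_norm_le (by simpa using hζ2) h.ratio_le
  have hcast := h.cast_ne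
  have hζc : ∀ᶠ i in 𝓕, (ζ i : ℂ) ≠ 0 := hζ.mono fun i hi => by exact_mod_cast hi
  have hI := Complex.I_ne_zero
  have hsqc : ∀ᶠ i in 𝓕, Complex.I * (Ω i * (ν i + κ i)) * Y i ^ 2 = ζ i := by
    filter_upwards [hcast] with i ⟨h1, h2, h3, h4⟩
    rw [hsq]; push_cast; field_simp; simp [Complex.I_sq]
  -- The two terms kept, `iΩ(ν + κ) l⁴` and `-ζ l²`, balance at the scale `Y`; the limit `w⁴ - w²`
  -- has the simple zeros `±1`.
  refine exists_disp_root_scaled (Y := Y) (N := fun i => (ζ i : ℂ) * Y i ^ 2)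
    (a₃ := 0) (a₂ := 1) (κ₀ := 0) (α₀ := 0) (β₀ := 0) (γ₀ := 1) hY0 ?_ ?_ ?_ ?_ ?_ ?_ ?_
    ?_ ?_
  · filter_upwards [hζc, hY0] with i h4 h5
    exact mul_ne_zero h4 (pow_ne_zero _ h5)
  · refine h₃.congr' ?_
    filter_upwards [hcast, hY0, hζc] with i ⟨h1, h2, h3, h4⟩ h5 h6
    have h7 : (Y i) ^ 6 = Y i ^ 2 * Y i ^ 2 * Y i ^ 2 := by ring
    have h8 : (Y i) ^ 2 ≠ 0 := pow_ne_zero _ h5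
    rw [h7, ← mul_assoc, mul_div_mul_right _ _ h8, hsq]
    push_cast
    field_simp
    simp [Complex.I_sq]
  · refine tendsto_const_nhds.congr' ?_
    filter_upwards [hcast, hY0, hζc, hsqc] with i ⟨h1, h2, h3, h4⟩ h5 h6 h7
    have h8 : (Y i) ^ 2 ≠ 0 := pow_ne_zero _ h5
    have h9 : (Y i) ^ 4 = Y i ^ 2 * Y i ^ 2 := by ring
    push_cast
    rw [h9, ← mul_assoc, h7, div_self (mul_ne_zero h6 h8)]
  · have := (tendsto_ofReal (h.k_lim.pow 2)).mul (hinv.pow 2)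
    simpa [div_eq_mul_inv] using this
  · have := ((tendsto_ofReal h.m_lim).const_mul Complex.I).mul hinv
    simpa [div_eq_mul_inv] using this
  · have := ((tendsto_ofReal h.q_lim).const_mul Complex.I).mul hinv2
    rw [mul_zero] at this
    refine this.congr' ?_
    filter_upwards [hY0, hζc] with i h5 h6
    field_simp
  · refine tendsto_const_nhds.congr' ?_
    filter_upwards [hY0, hζc] with i h5 h6
    rw [div_self (mul_ne_zero h6 (pow_ne_zero _ h5))]
  · simp only [disp]
    linear_combination s ^ 2 * hs
  · simp only [dispDeriv]
    have : 0 * (6 * s * (s ^ 2 - 0) ^ 2) + 1 * (4 * s * (s ^ 2 - 0)) + (0 - 1 * s - 1 * (s + 0))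
        = 2 * s := by rw [hs]; ring
    rw [this]
    exact mul_ne_zero (by norm_num) hs0

/-- The slow decay rate far from criticality: it is almost imaginary, and lies in the right half
plane. -/
theorem exists_degenerate_root (h : NearCriticalFamily 𝓕 ν κ k m Ω q ζ k₀ m₀ Ω₀ q₀)
    (hζ : ∀ᶠ i in 𝓕, ζ i ≠ 0)
    (hμ : Tendsto (fun i => (ν i + κ i) / |ζ i| ^ 3) 𝓕 (𝓝 0)) :
    ∃ r : ι → ℂ, (∀ᶠ i in 𝓕, layerDisp (ν i) (κ i) (k i) (m i) (Ω i) (q i) (ζ i)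
      (Complex.I * (q i / ζ i : ℝ) * r i) = 0) ∧ Tendsto r 𝓕 (𝓝 1) ∧
      ∀ᶠ i in 𝓕, 0 < (Complex.I * (q i / ζ i : ℝ) * r i).re := by
  set Y : ι → ℂ := fun i => Complex.I * (q i / ζ i : ℝ) with hY
  have hI := Complex.I_ne_zero
  have hcast := h.cast_ne
  have hζc : ∀ᶠ i in 𝓕, (ζ i : ℂ) ≠ 0 := hζ.mono fun i hi => by exact_mod_cast hi
  have hqc : ∀ᶠ i in 𝓕, (q i : ℂ) ≠ 0 := h.q_ne.mono fun i hi => by exact_mod_cast hi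
  have hY0 : ∀ᶠ i in 𝓕, Y i ≠ 0 := by
    filter_upwards [hζc, hqc] with i h1 h2
    simp only [hY]
    push_cast
    exact mul_ne_zero hI (div_ne_zero h2 h1)
  have hN : ∀ᶠ i in 𝓕, (ζ i : ℂ) * Y i ^ 2 ≠ 0 := by
    filter_upwards [hζc, hY0] with i h4 h5
    exact mul_ne_zero h4 (pow_ne_zero _ h5)
  have hs : Tendsto (fun i => (ν i + κ i) / ζ i ^ 3) 𝓕 (𝓝 0) := by
    refine squeeze_zero_norm' ?_ hμ
    filter_upwards [h.ν_pos, h.κ_pos] with i h1 h2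
    rw [norm_div, norm_pow, Real.norm_eq_abs, Real.norm_eq_abs, abs_of_pos (add_pos h1 h2)]
  have hinv : Tendsto (fun i => (Y i)⁻¹) 𝓕 (𝓝 0) := by
    have h1 := (tendsto_ofReal (h.ζ_lim.div h.q_lim h.q₀_ne)).const_mul (-Complex.I)
    simp only [zero_div, Complex.ofReal_zero, mul_zero] at h1
    refine h1.congr fun i => ?_
    simp [hY, mul_comm]
  -- Both viscous coefficients are measured in units of `σ = (ν + κ)/ζ³`: the one of `l⁶` is `o(σ)`,
  -- the one of `l⁴` is asymptotic to `-iΩ₀q₀² σ`. This gives the first-order correction, needed for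
  -- the real part, and not only the limit.
  have hA₃ : Tendsto (fun i => ((ν i * κ i : ℝ) : ℂ) * Y i ^ 6 / ((ζ i : ℂ) * Y i ^ 2) /
      (((ν i + κ i) / ζ i ^ 3 : ℝ) : ℂ)) 𝓕 (𝓝 0) := by
    have h1 := tendsto_ofReal ((hs.mul h.ζ_lim).mul (h.q_lim.pow 4))
    rw [zero_mul, zero_mul, Complex.ofReal_zero] at h1
    refine (tendsto_zero_mul_of_norm_le h1 h.ratio_le).congr' ?_
    filter_upwards [hcast, hζc, hqc] with i ⟨h1, h2, h3, h4⟩ h5 h6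
    simp only [hY]
    push_cast
    field_simp
    simp [show Complex.I ^ 4 = 1 from Complex.I_pow_four]
  have hA₂ : Tendsto (fun i => Complex.I * ((Ω i * (ν i + κ i) : ℝ) : ℂ) * Y i ^ 4 /
      ((ζ i : ℂ) * Y i ^ 2) / (((ν i + κ i) / ζ i ^ 3 : ℝ) : ℂ)) 𝓕
      (𝓝 (-Complex.I * ((Ω₀ * q₀ ^ 2 : ℝ) : ℂ))) := by
    refine ((tendsto_ofReal (h.Ω_lim.mul (h.q_lim.pow 2))).const_mul (-Complex.I)).congr' ?_
    filter_upwards [hcast, hζc, hqc] with i ⟨h1, h2, h3, h4⟩ h5 h6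
    simp only [hY]
    push_cast
    field_simp
    rw [Complex.I_sq]
  have hsne : ∀ᶠ i in 𝓕, (((ν i + κ i) / ζ i ^ 3 : ℝ) : ℂ) ≠ 0 := by
    filter_upwards [hcast, hζc] with i ⟨h1, h2, h3, h4⟩ h5
    push_cast
    exact div_ne_zero h4 (pow_ne_zero _ h5)
  have hmul : ∀ {f : ι → ℂ} {a : ℂ}, Tendsto (fun i => f i / (((ν i + κ i) / ζ i ^ 3 : ℝ) : ℂ)) 𝓕
      (𝓝 a) → Tendsto f 𝓕 (𝓝 0) := by
    intro f a hf
    have := hf.mul (tendsto_ofReal hs)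
    rw [Complex.ofReal_zero, mul_zero] at this
    refine this.congr' ?_
    filter_upwards [hsne] with i hi
    exact div_mul_cancel₀ _ hi
  have hκ : Tendsto (fun i => ((k i ^ 2 : ℝ) : ℂ) / Y i ^ 2) 𝓕 (𝓝 0) := by
    have := (tendsto_ofReal (h.k_lim.pow 2)).mul (hinv.pow 2)
    simpa [div_eq_mul_inv] using this
  have hα : Tendsto (fun i => Complex.I * m i / Y i) 𝓕 (𝓝 0) := by
    have := ((tendsto_ofReal h.m_lim).const_mul Complex.I).mul hinv
    simpa [div_eq_mul_inv] using this
  have hβ : ∀ᶠ i in 𝓕, Complex.I * q i * Y i / ((ζ i : ℂ) * Y i ^ 2) = 1 := by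
    filter_upwards [hζc, hqc] with i h5 h6
    simp only [hY]
    push_cast
    field_simp
  have hγ : ∀ᶠ i in 𝓕, (ζ i : ℂ) * Y i ^ 2 / ((ζ i : ℂ) * Y i ^ 2) = 1 :=
    hN.mono fun i hi => div_self hi
  -- The limit equation is `w(1 - w) = 0`: the inviscid factor `iq - ζl` alone fixes this root.
  obtain ⟨r, hr, hr'⟩ := exists_disp_root_scaled (w₀ := 1) hY0 hN (hmul hA₃) (hmul hA₂) hκ hα
    (tendsto_const_nhds.congr' (hβ.mono fun i hi => hi.symm))
    (tendsto_const_nhds.congr' (hγ.mono fun i hi => hi.symm)) (by simp [disp]) (by simp [dispDeriv])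
  refine ⟨r, hr, hr', ?_⟩
  have hL : Tendsto (fun i => r i ^ 2 - ((k i ^ 2 : ℝ) : ℂ) / Y i ^ 2) 𝓕 (𝓝 1) := by
    simpa using (hr'.pow 2).sub hκ
  have hden : Tendsto (fun i => r i + Complex.I * m i / Y i) 𝓕 (𝓝 1) := by
    simpa using hr'.add hα
  have hlim := ((((hA₃.mul (hL.pow 3)).add (hA₂.mul (hL.pow 2))).div hden one_ne_zero).const_mul
    Complex.I).mul (tendsto_ofReal h.q_lim)
  have hval : Complex.I * ((0 * 1 ^ 3 + -Complex.I * ((Ω₀ * q₀ ^ 2 : ℝ) : ℂ) * 1 ^ 2) / 1) * q₀ =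
      ((Ω₀ * q₀ * q₀ ^ 2 : ℝ) : ℂ) := by
    push_cast
    linear_combination (-(Ω₀ : ℂ) * q₀ ^ 3) * Complex.I_sq
  rw [hval] at hlim
  have hq2 : 0 < q₀ ^ 2 := by have := h.q₀_ne; positivity
  have hre := ((Complex.continuous_re.tendsto _).comp hlim).eventually_const_lt
    (by rw [Complex.ofReal_re]; exact mul_pos h.pos hq2 : (0 : ℝ) < _)
  filter_upwards [hre, hr, hY0, hN, hβ, hγ, h.ν_pos, h.κ_pos, hden.eventually_ne one_ne_zero, hζ,
    hsne] with i h1 h2 h3 h4 h5 h6 h7 h8 h9 h10 h11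
  rw [disp_scale _ _ _ _ _ _ _ h3 h4, mul_eq_zero, or_iff_right h4, h5, h6, disp] at h2
  set a : ℂ := ((ν i * κ i : ℝ) : ℂ) * Y i ^ 6 / ((ζ i : ℂ) * Y i ^ 2)
  set b : ℂ := Complex.I * ((Ω i * (ν i + κ i) : ℝ) : ℂ) * Y i ^ 4 / ((ζ i : ℂ) * Y i ^ 2)
  set L : ℂ := r i ^ 2 - ((k i ^ 2 : ℝ) : ℂ) / Y i ^ 2
  set σ : ℝ := (ν i + κ i) / ζ i ^ 3 with hσ
  have heq : r i - 1 = (σ : ℂ) * ((a / σ * L ^ 3 + b / σ * L ^ 2) /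
      (r i + Complex.I * m i / Y i)) := by
    rw [mul_div_assoc', eq_div_iff h9]
    have : (σ : ℂ) * (a / σ * L ^ 3 + b / σ * L ^ 2) = a * L ^ 3 + b * L ^ 2 := by
      field_simp
    rw [this]
    linear_combination -h2
  have hYr : Y i * r i = Y i + ((σ / ζ i : ℝ) : ℂ) * (Complex.I * ((a / σ * L ^ 3 + b / σ * L ^ 2) /
      (r i + Complex.I * m i / Y i)) * q i) := by
    have : Y i * r i = Y i + Y i * (r i - 1) := by ring
    rw [this, heq]
    simp only [hY]
    push_cast
    ring
  rw [hYr, Complex.add_re, Complex.re_ofReal_mul]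
  -- The leading order is purely imaginary, so the real part is the correction `(σ/ζ)` times a
  -- factor whose real part tends to `Ω₀q₀³ > 0`. As `σ/ζ = (ν + κ)/ζ⁴`, the sign of `ζ` plays no
  -- role.
  have hYre : (Y i).re = 0 := by simp [hY]
  rw [hYre, zero_add]
  refine mul_pos ?_ h1
  rw [hσ, div_div]
  have : 0 < ζ i ^ 4 := by positivity
  have h12 : ζ i ^ 3 * ζ i = ζ i ^ 4 := by ring
  rw [h12]
  positivity

end NearCriticalFamily

end NearCritical

namespace NearCritical

/-! ### The cubic that governs the slow roots at criticality. -/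

section Cubic

/-- Division by `z - z₁` leaves `z² + z₁ z + (z₁² + p)`, solved by completing the square. Nothing is
claimed about distinctness. -/
theorem exists_cubic_roots (p : ℂ) {q z₁ : ℂ} (h : z₁ ^ 3 + p * z₁ + q = 0) :
    ∃ z₂ z₃ : ℂ, z₁ + z₂ + z₃ = 0 ∧ z₂ ^ 3 + p * z₂ + q = 0 ∧ z₃ ^ 3 + p * z₃ + q = 0 := by
  obtain ⟨w, hw⟩ := IsAlgClosed.exists_pow_nat_eq (z₁ ^ 2 - 4 * (z₁ ^ 2 + p)) (n := 2) (by norm_num)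
  refine ⟨(-z₁ + w) / 2, (-z₁ - w) / 2, by ring, ?_, ?_⟩
  · linear_combination h + ((-z₁ + w) / 8 - z₁ / 4) * hw
  · linear_combination h + ((-z₁ - w) / 8 - z₁ / 4) * hw

variable {a B : ℝ} {z : ℂ}

/-- Multiply the cubic by the conjugate of `z` and take real parts: `i a |z|²` drops out, so `a`
disappears. For `B > 0` the sign of `re² - im²` is then opposite to that of `re`. A root on the
right makes an angle greater than `π/4` with the real axis, and a root on the left an angle smaller
than that. -/
theorem cubic_re_im (h : z ^ 3 + Complex.I * a * z + B = 0) :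
    (z.re ^ 2 + z.im ^ 2) * (z.re ^ 2 - z.im ^ 2) = -(B * z.re) := by
  have h1 := congrArg Complex.re h
  have h2 := congrArg Complex.im h
  simp [pow_succ] at h1 h2
  linear_combination z.re * h1 + z.im * h2

theorem cubic_re_ne_zero (hB : 0 < B) (h : z ^ 3 + Complex.I * a * z + B = 0) : z.re ≠ 0 := by
  intro h0
  have h1 := cubic_re_im h
  rw [h0] at h1
  have h2 : z.im = 0 := by
    have : z.im ^ 4 = 0 := by linear_combination -h1
    exact pow_eq_zero_iff (by norm_num) |>.1 this
  have : z = 0 := Complex.ext h0 h2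
  rw [this] at h
  simp at h
  exact hB.ne' h

theorem cubic_abs_re_lt (hB : 0 < B) (h : z ^ 3 + Complex.I * a * z + B = 0) (hz : 0 < z.re) :
    z.re < |z.im| := by
  have h1 := cubic_re_im h
  have h2 : 0 < z.re ^ 2 + z.im ^ 2 := by positivity
  have h3 : z.re ^ 2 - z.im ^ 2 < 0 := by
    by_contra! h4
    have := mul_nonneg h2.le h4
    have := mul_pos hB hz
    linarith
  exact lt_of_le_of_lt (le_abs_self _) (sq_lt_sq.1 (by linarith))

theorem cubic_abs_im_lt (hB : 0 < B) (h : z ^ 3 + Complex.I * a * z + B = 0) (hz : z.re < 0) :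
    |z.im| < -z.re := by
  have h1 := cubic_re_im h
  have h2 : 0 < z.re ^ 2 + z.im ^ 2 := by have := hz.ne; positivity
  have h3 : 0 < z.re ^ 2 - z.im ^ 2 := by
    by_contra! h4
    have := mul_nonpos_of_nonneg_of_nonpos h2.le h4
    have := mul_neg_of_pos_of_neg hB hz
    linarith
  rw [← abs_of_neg hz]
  exact sq_lt_sq.1 (by linarith)

/-- The rescaled sextic tends to `z` times the cubic, whose derivative at a zero of the cubic is
this product. If it vanished, then `2 a i z = -3B` would be a nonzero real number, which forces `a =
0` or `re z = 0`; both are impossible. -/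
theorem cubic_deriv_ne_zero (hB : 0 < B) (h : z ^ 3 + Complex.I * a * z + B = 0) :
    z * (3 * z ^ 2 + Complex.I * a) ≠ 0 := by
  intro h0
  have h1 : (2 * a : ℝ) * (Complex.I * z) = ((-(3 * B) : ℝ) : ℂ) := by
    push_cast
    linear_combination 3 * h - h0
  have h2 := congrArg Complex.im h1
  rw [Complex.im_ofReal_mul, Complex.ofReal_im] at h2
  have h3 := congrArg Complex.re h1
  rw [Complex.re_ofReal_mul, Complex.ofReal_re] at h3
  simp at h2 h3
  rcases h2 with h2 | h2
  · rw [h2] at h3; simp at h3; exact hB.ne' h3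
  · exact cubic_re_ne_zero hB h h2

/-- One root of the cubic lies in the left half plane, and one in each of the two quadrants of the
right half plane. -/
theorem exists_cubic_roots_quadrants (a : ℝ) (hB : 0 < B) :
    ∃ z : Fin 3 → ℂ, (∀ j, z j ^ 3 + Complex.I * a * z j + B = 0) ∧ 0 < (z 0).re ∧ 0 < (z 0).im ∧
      0 < (z 1).re ∧ (z 1).im < 0 ∧ (z 2).re < 0 := by
  obtain ⟨z₁, h₁, hn⟩ : ∃ z₁ : ℂ, z₁ ^ 3 + Complex.I * a * z₁ + B = 0 ∧ z₁.re < 0 := by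
    obtain ⟨u, hu⟩ : ∃ u : ℂ, u ^ 3 + Complex.I * a * u + B = 0 := by
      have hd : (Polynomial.X ^ 3 + Polynomial.C (Complex.I * a) * Polynomial.X +
          Polynomial.C (B : ℂ)).degree = 3 := by compute_degree!
      obtain ⟨u, hu⟩ := IsAlgClosed.exists_root _ (by rw [hd]; norm_num)
      exact ⟨u, by simpa [Polynomial.IsRoot] using hu⟩
    -- The roots sum to 0 and none is purely imaginary, so they cannot all lie in the right half
    -- plane.
    obtain ⟨v, w, hs, hv, hw⟩ := exists_cubic_roots _ hu
    have hs' := congrArg Complex.re hs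
    simp at hs'
    by_contra! hcon
    have e1 := lt_of_le_of_ne (hcon u hu) (cubic_re_ne_zero hB hu).symm
    have e2 := lt_of_le_of_ne (hcon v hv) (cubic_re_ne_zero hB hv).symm
    have e3 := lt_of_le_of_ne (hcon w hw) (cubic_re_ne_zero hB hw).symm
    linarith
  obtain ⟨z₂, z₃, hs, h₂, h₃⟩ := exists_cubic_roots _ h₁
  have hsr := congrArg Complex.re hs
  have hsi := congrArg Complex.im hs
  simp at hsr hsi
  -- With two roots on the left, the third would satisfy `|im v| > re v = -(re z₁ + re u) > |im z₁|
  -- + |im u|`, whereas the imaginary parts sum to 0.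
  have key : ∀ {u v : ℂ}, u ^ 3 + Complex.I * a * u + B = 0 → v ^ 3 + Complex.I * a * v + B = 0 →
      z₁.re + u.re + v.re = 0 → z₁.im + u.im + v.im = 0 → 0 < u.re := by
    intro u v hu hv hr hi
    by_contra! hcon
    have hun := lt_of_le_of_ne hcon (cubic_re_ne_zero hB hu)
    have e1 := cubic_abs_im_lt hB h₁ hn
    have e2 := cubic_abs_im_lt hB hu hun
    have e3 := cubic_abs_re_lt hB hv (by linarith)
    have e4 : |v.im| ≤ |z₁.im| + |u.im| := by
      have : v.im = -(z₁.im + u.im) := by linarith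
      rw [this, abs_neg]
      exact abs_add_le _ _
    linarith
  have p₂ := key h₂ h₃ hsr hsi
  have p₃ := key h₃ h₂ (by linarith) (by linarith)
  have q₁ := cubic_abs_im_lt hB h₁ hn
  have q₂ := cubic_abs_re_lt hB h₂ p₂
  have q₃ := cubic_abs_re_lt hB h₃ p₃
  -- Imaginary parts of the same sign would add up to more than `re z₂ + re z₃ = -re z₁ > |im z₁|`
  -- in absolute value, contradicting the zero sum.
  rcases lt_abs.1 q₂ with i₂ | i₂ <;> rcases lt_abs.1 q₃ with i₃ | i₃
  · have := neg_abs_le z₁.im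
    linarith
  · refine ⟨![z₂, z₃, z₁], ?_, p₂, by simp; linarith, p₃, by simp; linarith, hn⟩
    intro j; fin_cases j <;> simpa
  · refine ⟨![z₃, z₂, z₁], ?_, p₃, by simp; linarith, p₂, by simp; linarith, hn⟩
    intro j; fin_cases j <;> simpa
  · have := le_abs_self z₁.im
    linarith

theorem cubic_norm_le {C : ℝ} (hC : 1 ≤ C) (ha : |a| ≤ C) (hB : |B| ≤ C)
    (h : z ^ 3 + Complex.I * a * z + B = 0) : ‖z‖ ≤ 2 * C := by
  by_contra! hcon
  have h1 : ‖z‖ ^ 3 ≤ C * ‖z‖ + C := by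
    have : z ^ 3 = -(Complex.I * a * z + B) := by linear_combination h
    rw [← norm_pow, this, norm_neg]
    refine (norm_add_le _ _).trans (add_le_add ?_ (by simpa using hB))
    rw [norm_mul, norm_mul, Complex.norm_I, one_mul, Complex.norm_real]
    exact mul_le_mul_of_nonneg_right ha (norm_nonneg _)
  nlinarith [norm_nonneg z, mul_nonneg (norm_nonneg z) (sq_nonneg ‖z‖),
    mul_pos (by linarith : (0 : ℝ) < ‖z‖) (by linarith : (0 : ℝ) < ‖z‖ - 2 * C)]

/-- Uniform bounds for the roots of the cubic. -/
theorem exists_cubic_bounds (C b : ℝ) (hb : 0 < b) :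
    ∃ c > 0, ∃ R, ∀ a B : ℝ, |a| ≤ C → b ≤ B → B ≤ C → ∀ z : ℂ,
      z ^ 3 + Complex.I * a * z + B = 0 →
      ‖z‖ ≤ R ∧ c ≤ |z.re| ∧ c ≤ ‖z * (3 * z ^ 2 + Complex.I * a)‖ := by
  -- The admissible triples `(a, B, z)` form a compact set, on which `|re z|` and the derivative are
  -- continuous and never 0. Their minima are the uniform constants.
  set S : Set (ℝ × ℝ × ℂ) := (Set.Icc (-C) C ×ˢ Set.Icc b C ×ˢ
    Metric.closedBall 0 (2 * max C 1)) ∩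
    {x | x.2.2 ^ 3 + Complex.I * x.1 * x.2.2 + x.2.1 = 0} with hS
  have hSc : IsCompact S := by
    refine (isCompact_Icc.prod (isCompact_Icc.prod (isCompact_closedBall _ _))).inter_right ?_
    exact isClosed_eq (by fun_prop) continuous_const
  have hmem : ∀ a B : ℝ, |a| ≤ C → b ≤ B → B ≤ C → ∀ z : ℂ,
      z ^ 3 + Complex.I * a * z + B = 0 → (a, B, z) ∈ S := by
    intro a B ha h1 h2 z hz
    refine ⟨⟨abs_le.1 ha, ⟨h1, h2⟩, ?_⟩, hz⟩
    rw [mem_closedBall_zero_iff]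
    exact cubic_norm_le (le_max_right _ _) (ha.trans (le_max_left _ _))
      ((abs_of_pos (hb.trans_le h1)).trans_le (h2.trans (le_max_left _ _))) hz
  have bound : ∀ f : ℝ × ℝ × ℂ → ℝ, Continuous f → (∀ x ∈ S, 0 < f x) →
      ∃ c > 0, ∀ x ∈ S, c ≤ f x := by
    intro f hf hpos
    rcases S.eq_empty_or_nonempty with he | hne
    · exact ⟨1, one_pos, by simp [he]⟩
    · obtain ⟨x, hx, hmin⟩ := hSc.exists_isMinOn hne hf.continuousOn
      exact ⟨f x, hpos x hx, fun y hy => hmin hy⟩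
  have hcont : Continuous fun x : ℝ × ℝ × ℂ => |x.2.2.re| := by
    have : Continuous fun x : ℝ × ℝ × ℂ => x.2.2.re := Complex.continuous_re.comp (by fun_prop)
    exact this.abs
  obtain ⟨c₁, hc₁, h₁⟩ := bound _ hcont fun x hx =>
    abs_pos.2 (cubic_re_ne_zero (hb.trans_le hx.1.2.1.1) hx.2)
  obtain ⟨c₂, hc₂, h₂⟩ := bound
    (fun x => ‖x.2.2 * (3 * x.2.2 ^ 2 + Complex.I * x.1)‖) (by fun_prop)
    fun x hx => norm_pos_iff.2 (cubic_deriv_ne_zero (hb.trans_le hx.1.2.1.1) hx.2)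
  refine ⟨min c₁ c₂, lt_min hc₁ hc₂, 2 * max C 1, fun a B ha hB1 hB2 z hz => ?_⟩
  have hx := hmem a B ha hB1 hB2 z hz
  exact ⟨mem_closedBall_zero_iff.1 hx.1.2.2, (min_le_left _ _).trans (h₁ _ hx),
    (min_le_right _ _).trans (h₂ _ hx)⟩

end Cubic

end NearCritical

/-! ### The complete set of roots at criticality. -/

namespace NearCritical

theorem injective_vec3 {α : Type*} {a b c : α} (hab : a ≠ b) (hac : a ≠ c) (hbc : b ≠ c) :
    Function.Injective ![a, b, c] := by
  intro i j hij
  fin_cases i <;> fin_cases j <;> simp_all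

/-- Three roots in each half plane are all the roots. -/
theorem layerDisp_eq_zero_iff {ν κ k m Ω q ζ : ℝ} (hν : ν ≠ 0) (hκ : κ ≠ 0) {p n : Fin 3 → ℂ}
    (hp : Function.Injective p) (hn : Function.Injective n) (hp0 : ∀ j, 0 < (p j).re)
    (hn0 : ∀ j, (n j).re < 0) (hpr : ∀ j, layerDisp ν κ k m Ω q ζ (p j) = 0)
    (hnr : ∀ j, layerDisp ν κ k m Ω q ζ (n j) = 0) (μ : ℂ) (hμ : 0 ≤ μ.re) :
    layerDisp ν κ k m Ω q ζ μ = 0 ↔ ∃ j, p j = μ := by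
  have hinj : Function.Injective (Sum.elim p n) := by
    refine hp.sumElim hn fun i j hij => ?_
    have := hp0 i
    rw [hij] at this
    exact lt_asymm this (hn0 j)
  have hcard : (Finset.univ.image (Sum.elim p n)).card = 6 := by
    rw [Finset.card_image_of_injective _ hinj]; rfl
  have h3 : ((ν * κ : ℝ) : ℂ) ≠ 0 := by exact_mod_cast mul_ne_zero hν hκ
  have := disp_eq_zero_iff_mem (A₂ := Complex.I * (Ω * (ν + κ) : ℝ)) (κ := (k ^ 2 : ℝ))
    (α := Complex.I * m) (β := Complex.I * q) (γ := ζ) h3 hcard (by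
      intro r hr
      obtain ⟨j, -, rfl⟩ := Finset.mem_image.1 hr
      rcases j with j | j
      · exact hpr j
      · exact hnr j) μ
  rw [layerDisp, this, Finset.mem_image]
  constructor
  · rintro ⟨j | j, -, hj⟩
    · exact ⟨j, hj⟩
    · simp only [Sum.elim_inr] at hj
      rw [← hj] at hμ
      exact absurd (hn0 j) (not_lt.2 hμ)
  · rintro ⟨j, hj⟩
    exact ⟨Sum.inl j, Finset.mem_univ _, hj⟩

namespace NearCriticalFamily

variable {ι : Type*} {𝓕 : Filter ι} {ν κ k m Ω q ζ η : ι → ℝ} {k₀ m₀ Ω₀ q₀ : ℝ}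

/-- At criticality the moderate decay rates are asymptotic to the roots of the cubic. -/
theorem exists_critical_root (h : NearCriticalFamily 𝓕 ν κ k m Ω q ζ k₀ m₀ Ω₀ q₀)
    (hη : ∀ᶠ i in 𝓕, 0 < η i) (hημ : ∀ᶠ i in 𝓕, η i ^ 3 = ν i + κ i) (hη0 : Tendsto η 𝓕 (𝓝 0))
    {C R c : ℝ} (hc : 0 < c) (ha : ∀ᶠ i in 𝓕, |ζ i / (Ω i * η i)| ≤ C) {z : ι → ℂ}
    (hz : ∀ᶠ i in 𝓕, z i ^ 3 + Complex.I * (ζ i / (Ω i * η i) : ℝ) * z i + (q i / Ω i : ℝ) = 0)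
    (hzR : ∀ᶠ i in 𝓕, ‖z i‖ ≤ R)
    (hzc : ∀ᶠ i in 𝓕, c ≤ ‖z i * (3 * z i ^ 2 + Complex.I * (ζ i / (Ω i * η i) : ℝ))‖) :
    ∃ r : ι → ℂ, (∀ᶠ i in 𝓕, layerDisp (ν i) (κ i) (k i) (m i) (Ω i) (q i) (ζ i)
      ((η i : ℂ)⁻¹ * r i) = 0) ∧ Tendsto (fun i => r i - z i) 𝓕 (𝓝 0) := by
  have hcast := h.cast_ne
  have hηc : ∀ᶠ i in 𝓕, (η i : ℂ) ≠ 0 := hη.mono fun i hi => by exact_mod_cast hi.ne'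
  have hI := Complex.I_ne_zero
  set a : ι → ℂ := fun i => ((ζ i / (Ω i * η i) : ℝ) : ℂ) with haDef
  set b : ι → ℂ := fun i => ((q i / Ω i : ℝ) : ℂ) with hbDef
  set d : ι → ℂ := fun i => ((ν i * κ i : ℝ) : ℂ) * ((η i : ℂ)⁻¹) ^ 6 /
    (Complex.I * Ω i / η i) with hd
  have hd0 : Tendsto d 𝓕 (𝓝 0) := by
    have h1 := (tendsto_ofReal (hη0.div h.Ω_lim h.Ω₀_ne)).const_mul (-Complex.I)
    rw [zero_div, Complex.ofReal_zero, mul_zero] at h1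
    refine (tendsto_zero_mul_of_norm_le h1 h.ratio_le).congr' ?_
    filter_upwards [hcast, hημ, hηc] with i ⟨h1, h2, h3, h4⟩ h5 h6
    simp only [hd, Pi.div_apply]
    rw [← h5]
    push_cast
    field_simp
    simp [Complex.I_sq]
  have hzbd : ∀ n : ℕ, ∀ᶠ i in 𝓕, ‖z i ^ n‖ ≤ R ^ n := fun n => by
    filter_upwards [hzR] with i hi
    rw [norm_pow]
    exact pow_le_pow_left₀ (norm_nonneg _) hi n
  have hb : Tendsto b 𝓕 (𝓝 ((q₀ / Ω₀ : ℝ) : ℂ)) :=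
    tendsto_ofReal (h.q_lim.div h.Ω_lim h.Ω₀_ne)
  have hbb : ∀ᶠ i in 𝓕, ‖b i‖ ≤ ‖((q₀ / Ω₀ : ℝ) : ℂ)‖ + 1 :=
    (hb.norm.eventually_lt_const (lt_add_one _)).mono fun i hi => hi.le
  have hab : ∀ᶠ i in 𝓕, ‖a i‖ ≤ C := by
    filter_upwards [ha] with i hi
    rwa [Complex.norm_real]
  set e : ι → ℂ := fun i => ((k i ^ 2 : ℝ) : ℂ) * (η i : ℂ) ^ 2 with he
  have he0 : Tendsto e 𝓕 (𝓝 0) := by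
    simpa [he] using (tendsto_ofReal (h.k_lim.pow 2)).mul ((tendsto_ofReal hη0).pow 2)
  set f : ι → ℂ := fun i => Complex.I * m i * η i with hf
  have hf0 : Tendsto f 𝓕 (𝓝 0) := by
    simpa [hf] using ((tendsto_ofReal h.m_lim).const_mul Complex.I).mul (tendsto_ofReal hη0)
  have hze : ∀ᶠ i in 𝓕, ‖z i ^ 2 - e i‖ ≤ R ^ 2 + 1 := by
    filter_upwards [hzbd 2, he0.norm.eventually_lt_const (by simp : ‖(0 : ℂ)‖ < 1)] with i h1 h2
    exact (norm_sub_le _ _).trans (add_le_add h1 h2.le)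
  have hlin : ∀ᶠ i in 𝓕, ‖b i + Complex.I * a i * z i‖ ≤ ‖((q₀ / Ω₀ : ℝ) : ℂ)‖ + 1 + C * R := by
    filter_upwards [hab, hbb, hzR] with i h1 h2 h3
    refine (norm_add_le _ _).trans (add_le_add h2 ?_)
    rw [norm_mul, norm_mul, Complex.norm_I, one_mul]
    exact mul_le_mul h1 h3 (norm_nonneg _) ((norm_nonneg _).trans h1)
  -- The ratio `ζ/(Ωη)` is only bounded and need not converge, so there is no limit equation. The
  -- moving zero `z i` of the cubic serves as approximate root, with `l = w/η` and `N = iΩ/η`.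
  obtain ⟨r, hr, hr'⟩ := exists_disp_root_tendsto (𝓕 := 𝓕) (w := z) (A₃ := d) (A₂ := fun _ => 1)
    (κ := e) (α := f) (β := b) (γ := fun i => -(Complex.I * a i)) (c := c / 2) (by
      have t1 := tendsto_zero_mul_of_norm_le hd0 (g := fun i => (z i ^ 2 - e i) ^ 3)
        (C := (R ^ 2 + 1) ^ 3) (by
          filter_upwards [hze] with i hi
          rw [norm_pow]
          exact pow_le_pow_left₀ (norm_nonneg _) hi 3)
      have t2 := tendsto_zero_mul_of_norm_le he0 (g := fun i => -2 * z i ^ 2)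
        (C := 2 * R ^ 2) (by
          filter_upwards [hzbd 2] with i hi
          rw [norm_mul]
          simpa using hi)
      have t3 := tendsto_zero_mul_of_norm_le hf0 hlin
      have := ((t1.add t2).add (he0.pow 2)).add t3
      simp only [add_zero, zero_pow two_ne_zero] at this
      refine this.congr' ?_
      filter_upwards [hz] with i hi
      simp only [disp]
      linear_combination (-(z i)) * hi) (half_pos hc) (by
      have t1 := tendsto_zero_mul_of_norm_le hd0 (g := fun i => 6 * z i * (z i ^ 2 - e i) ^ 2)
        (C := 6 * R * (R ^ 2 + 1) ^ 2) (by
          filter_upwards [hze, hzR] with i hi hi'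
          rw [norm_mul, norm_mul, norm_pow]
          have : ‖(6 : ℂ)‖ = 6 := by simp
          rw [this]
          have hR : 0 ≤ R := (norm_nonneg _).trans hi'
          gcongr)
      have t2 := tendsto_zero_mul_of_norm_le he0 (g := fun i => -4 * z i)
        (C := 4 * R) (by
          filter_upwards [hzR] with i hi
          rw [norm_mul]
          simpa using hi)
      have t3 := tendsto_zero_mul_of_norm_le hf0 (g := fun i => Complex.I * a i) (C := C) (by
          filter_upwards [hab] with i hi
          simpa using hi)
      have := ((t1.add t2).add t3).norm
      simp only [add_zero, norm_zero] at this
      filter_upwards [hz, hzc, this.eventually_lt_const (half_pos hc)] with i h1 h2 h3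
      have e1 : dispDeriv (d i) 1 (e i) (f i) (b i) (-(Complex.I * a i)) (z i) =
          z i * (3 * z i ^ 2 + Complex.I * a i) + (d i * (6 * z i * (z i ^ 2 - e i) ^ 2) +
          e i * (-4 * z i) + f i * (Complex.I * a i)) := by
        simp only [dispDeriv]
        linear_combination h1
      rw [e1]
      have := norm_sub_le_norm_add (z i * (3 * z i ^ 2 + Complex.I * a i))
        (d i * (6 * z i * (z i ^ 2 - e i) ^ 2) + e i * (-4 * z i) + f i * (Complex.I * a i))
      linarith)
  refine ⟨r, ?_, hr'⟩
  filter_upwards [hr, hcast, hημ, hηc] with i h1 ⟨h2, h3, h4, h5⟩ h6 h7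
  have h6' : (η i : ℂ) ^ 3 = ν i + κ i := by exact_mod_cast h6
  have hN : Complex.I * Ω i / η i ≠ 0 := div_ne_zero (mul_ne_zero hI h4) h7
  rw [layerDisp, disp_scale _ _ _ _ _ _ _ (inv_ne_zero h7) hN]
  have e2 : Complex.I * ((Ω i * (ν i + κ i) : ℝ) : ℂ) * ((η i : ℂ)⁻¹) ^ 4 /
      (Complex.I * Ω i / η i) = 1 := by
    push_cast
    rw [← h6']
    field_simp
  have e3 : ((k i ^ 2 : ℝ) : ℂ) / ((η i : ℂ)⁻¹) ^ 2 = e i := by simp [he, div_eq_mul_inv]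
  have e4 : Complex.I * m i / (η i : ℂ)⁻¹ = f i := by simp [hf, div_eq_mul_inv]
  have e5 : Complex.I * q i * (η i : ℂ)⁻¹ / (Complex.I * Ω i / η i) = b i := by
    simp only [hbDef]; push_cast; field_simp
  have e6 : (ζ i : ℂ) * ((η i : ℂ)⁻¹) ^ 2 / (Complex.I * Ω i / η i) = -(Complex.I * a i) := by
    simp only [haDef]; push_cast; field_simp; simp [Complex.I_sq]
  rw [e2, e3, e4, e5, e6, h1, mul_zero]

end NearCriticalFamily

end NearCritical

namespace NearCritical

theorem forall_vec3 {α : Type*} {P : α → Prop} {a b c : α} (ha : P a) (hb : P b) (hc : P c)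
    (j : Fin 3) : P (![a, b, c] j) := by
  fin_cases j
  exacts [ha, hb, hc]

theorem forall_ne_two_iff {P : Fin 3 → Prop} : (∀ j, j ≠ 2 → P j) ↔ P 0 ∧ P 1 := by
  refine ⟨fun h => ⟨h 0 (by decide), h 1 (by decide)⟩, fun h j hj => ?_⟩
  fin_cases j
  exacts [h.1, h.2, absurd rfl hj]

/-- The leading order of the fastest decay rate. -/
noncomputable def fastRate (ν κ Ω : ℝ) : ℂ := isqrt (-(Ω * (ν + κ) / (ν * κ)))

theorem norm_fastRate_sq {ν κ : ℝ} (Ω : ℝ) (hν : 0 < ν) (hκ : 0 < κ) :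
    ‖fastRate ν κ Ω‖ ^ 2 = |Ω| * (ν + κ) / (ν * κ) := by
  rw [fastRate, norm_isqrt_sq, abs_neg, abs_div, abs_mul, abs_of_pos (add_pos hν hκ),
    abs_of_pos (mul_pos hν hκ)]

/-- A rescaled point close to `Z`. -/
theorem norm_mul_sub_le {Z r s : ℂ} {ρ : ℝ} (h : ‖r - s‖ ≤ ρ) : ‖Z * r - Z * s‖ ≤ ρ * ‖Z‖ := by
  rw [← mul_sub, norm_mul, mul_comm]
  exact mul_le_mul_of_nonneg_right h (norm_nonneg _)

theorem re_pos_of_near {Z l : ℂ} {ρ : ℝ} (hZ : ‖Z‖ ≤ 2 * Z.re) (hZ0 : Z ≠ 0) (hρ : ρ < 1 / 2)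
    (h : ‖l - Z‖ ≤ ρ * ‖Z‖) : 0 < l.re := by
  have h1 := (Complex.abs_re_le_norm (l - Z)).trans h
  rw [Complex.sub_re, abs_le] at h1
  have h2 : 0 < ‖Z‖ := norm_pos_iff.2 hZ0
  nlinarith [h1.1]

theorem re_neg_of_near {Z l : ℂ} {ρ : ℝ} (hZ : ‖Z‖ ≤ 2 * Z.re) (hZ0 : Z ≠ 0) (hρ : ρ < 1 / 2)
    (h : ‖l - -Z‖ ≤ ρ * ‖Z‖) : l.re < 0 := by
  have : 0 < (-l).re := re_pos_of_near hZ hZ0 hρ (by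
    have e : -l - Z = -(l - -Z) := by ring
    rwa [e, norm_neg])
  simpa using this

theorem norm_bounds_of_near {Z l : ℂ} {ρ : ℝ} (h : ‖l - Z‖ ≤ ρ * ‖Z‖) :
    (1 - ρ) * ‖Z‖ ≤ ‖l‖ ∧ ‖l‖ ≤ (1 + ρ) * ‖Z‖ := by
  have h1 := norm_sub_norm_le Z l
  have h2 := norm_sub_norm_le l Z
  rw [norm_sub_rev] at h1
  constructor <;> linarith

namespace NearCriticalFamily

variable {ι : Type*} {𝓕 : Filter ι} {ν κ k m Ω q ζ η : ι → ℝ} {k₀ m₀ Ω₀ q₀ : ℝ}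

theorem fastRate_ne_zero (h : NearCriticalFamily 𝓕 ν κ k m Ω q ζ k₀ m₀ Ω₀ q₀) :
    ∀ᶠ i in 𝓕, fastRate (ν i) (κ i) (Ω i) ≠ 0 := by
  filter_upwards [h.ν_pos, h.κ_pos, h.Ω_ne] with i h1 h2 h3
  exact isqrt_ne_zero (neg_ne_zero.2 (by positivity))

theorem exists_fast_roots (h : NearCriticalFamily 𝓕 ν κ k m Ω q ζ k₀ m₀ Ω₀ q₀) :
    ∃ r r' : ι → ℂ, ∀ ρ > 0, ∀ᶠ i in 𝓕,
      layerDisp (ν i) (κ i) (k i) (m i) (Ω i) (q i) (ζ i) (r i) = 0 ∧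
      layerDisp (ν i) (κ i) (k i) (m i) (Ω i) (q i) (ζ i) (r' i) = 0 ∧
      ‖r i - fastRate (ν i) (κ i) (Ω i)‖ ≤ ρ * ‖fastRate (ν i) (κ i) (Ω i)‖ ∧
      ‖r' i - -fastRate (ν i) (κ i) (Ω i)‖ ≤ ρ * ‖fastRate (ν i) (κ i) (Ω i)‖ := by
  obtain ⟨r, hr, hr'⟩ := h.exists_large_root (s := 1) (by norm_num)
  obtain ⟨t, ht, ht'⟩ := h.exists_large_root (s := -1) (by norm_num)
  refine ⟨fun i => fastRate (ν i) (κ i) (Ω i) * r i, fun i => fastRate (ν i) (κ i) (Ω i) * t i,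
    fun ρ hρ => ?_⟩
  · filter_upwards [hr, ht, (tendsto_iff_norm_sub_tendsto_zero.1 hr').eventually_le_const hρ,
      (tendsto_iff_norm_sub_tendsto_zero.1 ht').eventually_le_const hρ] with i h1 h2 h3 h4
    refine ⟨h1, h2, ?_, ?_⟩
    · simpa [fastRate] using
        norm_mul_sub_le (Z := isqrt (-(Ω i * (ν i + κ i) / (ν i * κ i)))) h3
    · simpa [fastRate] using
        norm_mul_sub_le (Z := isqrt (-(Ω i * (ν i + κ i) / (ν i * κ i)))) h4

/-- Since `νκ ≤ (ν + κ)²`, the square of the fast rate is at least `|Ω|/(ν + κ) = |Ω| η⁻³`, which is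
much larger than `η⁻²`. -/
theorem le_mul_fastRate (h : NearCriticalFamily 𝓕 ν κ k m Ω q ζ k₀ m₀ Ω₀ q₀)
    (hη : ∀ᶠ i in 𝓕, 0 < η i) (hημ : ∀ᶠ i in 𝓕, η i ^ 3 = ν i + κ i) (hη0 : Tendsto η 𝓕 (𝓝 0))
    {ρ : ℝ} (hρ : 0 < ρ) :
    ∀ᶠ i in 𝓕, 1 / η i ≤ ρ * ‖fastRate (ν i) (κ i) (Ω i)‖ := by
  have hΩ := abs_pos.2 h.Ω₀_ne
  filter_upwards [h.ν_pos, h.κ_pos, hη, hημ, h.Ω_lim.abs.eventually_const_lt (half_lt_self hΩ),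
    hη0.eventually_lt_const (by positivity : 0 < ρ ^ 2 * (|Ω₀| / 2))] with i h1 h2 h3 h4 h5 h6
  refine le_of_sq_le_sq ?_ (by positivity)
  rw [mul_pow, norm_fastRate_sq _ h1 h2, div_pow, one_pow, mul_div_assoc', div_le_div_iff₀
    (by positivity) (by positivity), ← h4]
  have h7 : ν i * κ i ≤ η i ^ 6 := by
    have : η i ^ 6 = (ν i + κ i) ^ 2 := by rw [← h4]; ring
    rw [this]; nlinarith
  have h8 : η i ≤ ρ ^ 2 * |Ω i| := by nlinarith [sq_pos_of_pos hρ]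
  have h9 : η i * η i ^ 5 ≤ ρ ^ 2 * |Ω i| * η i ^ 5 := by gcongr
  nlinarith

set_option maxHeartbeats 1000000 in
/-- The decay rates at criticality. -/
theorem exists_critical_roots (h : NearCriticalFamily 𝓕 ν κ k m Ω q ζ k₀ m₀ Ω₀ q₀)
    (hη : ∀ᶠ i in 𝓕, 0 < η i) (hημ : ∀ᶠ i in 𝓕, η i ^ 3 = ν i + κ i) (hη0 : Tendsto η 𝓕 (𝓝 0))
    {C : ℝ} (ha : ∀ᶠ i in 𝓕, |ζ i| ≤ C * η i) :
    ∃ c > 0, ∃ R > 0, ∀ ρ > 0, ∀ᶠ i in 𝓕, ∃ l : Fin 3 → ℂ,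
      (∀ μ : ℂ, 0 ≤ μ.re →
        (layerDisp (ν i) (κ i) (k i) (m i) (Ω i) (q i) (ζ i) μ = 0 ↔ ∃ j, l j = μ)) ∧
      (∀ j, j ≠ 2 → c / η i ≤ (l j).re ∧ ‖l j‖ ≤ R / η i) ∧
      c / η i ≤ (l 0).im ∧ (l 1).im ≤ -(c / η i) ∧
      ‖l 2 - fastRate (ν i) (κ i) (Ω i)‖ ≤ ρ * ‖fastRate (ν i) (κ i) (Ω i)‖ ∧
      R / η i ≤ ρ * ‖fastRate (ν i) (κ i) (Ω i)‖ := by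
  have hB₀ : 0 < q₀ / Ω₀ := by
    have : q₀ / Ω₀ = Ω₀ * q₀ / Ω₀ ^ 2 := by have := h.Ω₀_ne; field_simp
    rw [this]
    have := h.pos; have := h.Ω₀_ne; positivity
  have hΩ₀ := abs_pos.2 h.Ω₀_ne
  have hBlim : Tendsto (fun i => q i / Ω i) 𝓕 (𝓝 (q₀ / Ω₀)) := h.q_lim.div h.Ω_lim h.Ω₀_ne
  have hB₁ : ∀ᶠ i in 𝓕, q₀ / Ω₀ / 2 ≤ q i / Ω i :=
    (hBlim.eventually_const_lt (half_lt_self hB₀)).mono fun i hi => hi.le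
  have hB₂ : ∀ᶠ i in 𝓕, q i / Ω i ≤ q₀ / Ω₀ + 1 :=
    (hBlim.eventually_lt_const (lt_add_one _)).mono fun i hi => hi.le
  have ha' : ∀ᶠ i in 𝓕, |ζ i / (Ω i * η i)| ≤ C * 2 / |Ω₀| := by
    filter_upwards [ha, hη, h.Ω_lim.abs.eventually_const_lt (half_lt_self hΩ₀)] with i h1 h2 h3
    have h4 : 0 < |Ω i| := (half_pos hΩ₀).trans h3
    rw [abs_div, abs_mul, abs_of_pos h2, div_le_div_iff₀ (by positivity) hΩ₀]
    have h5 : 0 ≤ C := by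
      by_contra! hc
      have := mul_neg_of_neg_of_pos hc h2
      linarith [abs_nonneg (ζ i)]
    calc |ζ i| * |Ω₀| ≤ C * η i * (2 * |Ω i|) := by gcongr; linarith
      _ = C * 2 * (|Ω i| * η i) := by ring
  obtain ⟨c, hc, R, hR⟩ := exists_cubic_bounds (max (C * 2 / |Ω₀|) (q₀ / Ω₀ + 1)) (q₀ / Ω₀ / 2)
    (by positivity)
  have hz : ∀ i, ∃ z : Fin 3 → ℂ, 0 < q i / Ω i →
      (∀ j, z j ^ 3 + Complex.I * (ζ i / (Ω i * η i) : ℝ) * z j + (q i / Ω i : ℝ) = 0) ∧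
      0 < (z 0).re ∧ 0 < (z 0).im ∧ 0 < (z 1).re ∧ (z 1).im < 0 ∧ (z 2).re < 0 := by
    intro i
    by_cases hi : 0 < q i / Ω i
    · obtain ⟨z, hz⟩ := exists_cubic_roots_quadrants (ζ i / (Ω i * η i)) hi
      exact ⟨z, fun _ => hz⟩
    · exact ⟨0, fun hi' => absurd hi' hi⟩
  choose z hz using hz
  have hBpos : ∀ᶠ i in 𝓕, 0 < q i / Ω i := hB₁.mono fun i hi => (half_pos hB₀).trans_le hi
  have hzb : ∀ j, ∀ᶠ i in 𝓕, ‖z i j‖ ≤ R ∧ c ≤ |(z i j).re| ∧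
      c ≤ ‖z i j * (3 * z i j ^ 2 + Complex.I * (ζ i / (Ω i * η i) : ℝ))‖ := by
    intro j
    filter_upwards [ha', hB₁, hB₂, hBpos] with i h1 h2 h3 h4
    exact hR _ _ (h1.trans (le_max_left _ _)) h2 (h3.trans (le_max_right _ _)) _ ((hz i h4).1 j)
  have hex : ∀ j : Fin 3, ∃ r : ι → ℂ,
      (∀ᶠ i in 𝓕, layerDisp (ν i) (κ i) (k i) (m i) (Ω i) (q i) (ζ i)
      ((η i : ℂ)⁻¹ * r i) = 0) ∧ Tendsto (fun i => r i - z i j) 𝓕 (𝓝 0) := fun j =>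
    h.exists_critical_root hη hημ hη0 hc ha' (z := fun i => z i j)
      (hBpos.mono fun i hi => (hz i hi).1 j) ((hzb j).mono fun i hi => hi.1)
      ((hzb j).mono fun i hi => hi.2.2)
  choose r hr hr' using hex
  obtain ⟨u, u', hu⟩ := h.exists_fast_roots
  obtain ⟨w, hw, hw', hw''⟩ := h.exists_small_root
  have hclose : ∀ j, ∀ᶠ i in 𝓕, ‖r j i - z i j‖ ≤ c / 2 := fun j =>
    ((tendsto_zero_iff_norm_tendsto_zero.1 (hr' j)).eventually_le_const (half_pos hc))
  have hwn := hw'.norm.eventually_lt_const (lt_add_one _)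
  -- True roots differ from the zeros of the cubic by at most `c/2` in units of `1/η`: half of the
  -- lower bound is given up, and `c` is added to the upper one.
  refine ⟨c / 2, half_pos hc, |R| + c, by positivity, fun ρ hρ => ?_⟩
  have hρ' : 0 < min ρ (1 / 4) := lt_min hρ (by norm_num)
  have hηsmall : ∀ᶠ i in 𝓕, ‖-(Complex.I * (m₀ : ℂ))‖ + 1 < c / 2 / η i := by
    filter_upwards [hη, hη0.eventually_lt_const
      (by positivity : 0 < c / 2 / (‖-(Complex.I * (m₀ : ℂ))‖ + 1))] with i h1 h2
    rw [lt_div_iff₀ h1]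
    rw [lt_div_iff₀ (by positivity)] at h2
    linarith
  have hR' : 0 < min ρ (1 / 4) / (|R| + c) := by positivity
  filter_upwards [hBpos, hzb 0, hzb 1, hzb 2, hr 0, hr 1, hr 2, hu _ hρ', hw, hw'', hwn, hηsmall,
    hclose 0, hclose 1, hclose 2, hη, h.le_mul_fastRate hη hημ hη0 hR', h.ν_pos, h.κ_pos,
    h.fastRate_ne_zero] with i hBi b0 b1 b2 r0 r1 r2 hui hwi hwi' hwi'' hηs d0 d1 d2 hηi hZi hνi hκi
      hZ0
  obtain ⟨hcub, x0, y0, x1, y1, x2⟩ := hz i hBi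
  set Z := fastRate (ν i) (κ i) (Ω i) with hZdef
  have hZre : ‖Z‖ ≤ 2 * Z.re := norm_isqrt_le_re _
  have hZpos : 0 < ‖Z‖ := norm_pos_iff.2 hZ0
  have hZi' : (|R| + c) / η i ≤ min ρ (1 / 4) * ‖Z‖ := by
    rw [div_mul_eq_mul_div, le_div_iff₀ (by positivity)] at hZi
    rw [div_eq_mul_one_div, mul_comm]
    exact hZi
  have hscale : ∀ x : ℂ, (η i : ℂ)⁻¹ * x = ((η i)⁻¹ : ℝ) * x := fun x => by push_cast; rfl
  have hre : ∀ x : ℂ, ((η i : ℂ)⁻¹ * x).re = x.re / η i := fun x => by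
    rw [hscale, Complex.re_ofReal_mul, div_eq_inv_mul]
  have him : ∀ x : ℂ, ((η i : ℂ)⁻¹ * x).im = x.im / η i := fun x => by
    rw [hscale, Complex.im_ofReal_mul, div_eq_inv_mul]
  have hnorm : ∀ x : ℂ, ‖(η i : ℂ)⁻¹ * x‖ = ‖x‖ / η i := fun x => by
    rw [norm_mul, norm_inv, Complex.norm_real, Real.norm_of_nonneg hηi.le, div_eq_inv_mul]
  have hnb : ∀ x y : ℂ, ‖x - y‖ ≤ c / 2 → ‖y‖ ≤ R → ‖(η i : ℂ)⁻¹ * x‖ ≤ (|R| + c) / η i := by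
    intro x y h1 h2
    rw [hnorm]
    have h3 := norm_sub_norm_le x y
    have h4 := le_abs_self R
    gcongr
    linarith
  have hreb : ∀ x y : ℂ, ‖x - y‖ ≤ c / 2 → |x.re - y.re| ≤ c / 2 ∧ |x.im - y.im| ≤ c / 2 := by
    intro x y h1
    exact ⟨(Complex.abs_re_le_norm (x - y)).trans h1, (Complex.abs_im_le_norm (x - y)).trans h1⟩
  have e0 : c / 2 ≤ (r 0 i).re := by
    have h1 := (abs_le.1 (hreb _ _ d0).1).1
    have h2 := b0.2.1
    rw [abs_of_pos x0] at h2
    linarith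
  -- On the right half plane the imaginary part of a zero of the cubic exceeds its real part in
  -- absolute value, so the bound for real parts also keeps the two slow roots apart vertically.
  have f0 : c / 2 ≤ (r 0 i).im := by
    have h1 := (abs_le.1 (hreb _ _ d0).2).1
    have h2 := b0.2.1
    have h3 := cubic_abs_re_lt hBi (hcub 0) x0
    rw [abs_of_pos x0] at h2
    rw [abs_of_pos y0] at h3
    linarith
  have e1 : c / 2 ≤ (r 1 i).re := by
    have h1 := (abs_le.1 (hreb _ _ d1).1).1
    have h2 := b1.2.1
    rw [abs_of_pos x1] at h2
    linarith
  have f1 : (r 1 i).im ≤ -(c / 2) := by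
    have h1 := (abs_le.1 (hreb _ _ d1).2).2
    have h2 := b1.2.1
    have h3 := cubic_abs_re_lt hBi (hcub 1) x1
    rw [abs_of_pos x1] at h2
    rw [abs_of_neg y1] at h3
    linarith
  have e2 : (r 2 i).re ≤ -(c / 2) := by
    have h1 := (abs_le.1 (hreb _ _ d2).1).2
    have h2 := b2.2.1
    rw [abs_of_neg x2] at h2
    linarith
  have hcη : 0 < c / 2 / η i := by positivity
  have hmin4 : min ρ (1 / 4) ≤ 1 / 4 := min_le_right _ _
  have hlarge : ∀ x : ℂ, ‖x‖ ≤ (|R| + c) / η i → ‖x‖ ≤ 1 / 4 * ‖Z‖ := fun x hx =>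
    hx.trans (hZi'.trans (by gcongr))
  have hu1 := (norm_bounds_of_near hui.2.2.1).1
  have hu2 := (norm_bounds_of_near (by rw [norm_neg]; exact hui.2.2.2)).1
  rw [norm_neg] at hu2
  have hu1' : 3 / 4 * ‖Z‖ ≤ ‖u i‖ := le_trans (by nlinarith) hu1
  have hu2' : 3 / 4 * ‖Z‖ ≤ ‖u' i‖ := le_trans (by nlinarith) hu2
  refine ⟨![(η i : ℂ)⁻¹ * r 0 i, (η i : ℂ)⁻¹ * r 1 i, u i], ?_, ?_, ?_, ?_, ?_, ?_⟩
  -- The left half plane holds the root near `-i m₀`, the left zero of the cubic divided by `η`, and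
  -- the fast root near `-Z`. On each side the roots are told apart by modulus, and the two slow
  -- ones on the right by the sign of the imaginary part.
  · refine layerDisp_eq_zero_iff hνi.ne' hκi.ne' (n := ![w i, (η i : ℂ)⁻¹ * r 2 i, u' i])
      (injective_vec3 ?_ ?_ ?_) (injective_vec3 ?_ ?_ ?_) ?_ ?_ ?_ ?_
    · intro he
      have := congrArg Complex.im he
      rw [him, him, div_left_inj' hηi.ne'] at this
      linarith
    · intro he
      have := hlarge _ (hnb _ _ d0 b0.1)
      rw [he] at this
      linarith
    · intro he
      have := hlarge _ (hnb _ _ d1 b1.1)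
      rw [he] at this
      linarith
    · intro he
      have h1 : ‖w i‖ < c / 2 / η i := hwi''.trans hηs
      rw [he, hnorm, div_lt_div_iff_of_pos_right hηi] at h1
      have := Complex.abs_re_le_norm (r 2 i)
      have := neg_le_abs (r 2 i).re
      linarith
    · intro he
      have h1 : ‖w i‖ < c / 2 / η i := hwi''.trans hηs
      have h2 : c / 2 / η i ≤ (|R| + c) / η i := by
        gcongr
        linarith [abs_nonneg R]
      have := hlarge _ (h1.le.trans h2)
      rw [he] at this
      linarith
    · intro he
      have := hlarge _ (hnb _ _ d2 b2.1)
      rw [he] at this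
      linarith
    · refine forall_vec3 (P := fun x : ℂ => 0 < x.re) ?_ ?_ ?_
      · rw [hre]; exact div_pos (by linarith) hηi
      · rw [hre]; exact div_pos (by linarith) hηi
      · exact re_pos_of_near hZre hZ0 (by linarith) hui.2.2.1
    · refine forall_vec3 (P := fun x : ℂ => x.re < 0) hwi' ?_ ?_
      · rw [hre]
        exact div_neg_of_neg_of_pos (by linarith) hηi
      · exact re_neg_of_near hZre hZ0 (by linarith) hui.2.2.2
    · exact forall_vec3 (P := fun x => layerDisp (ν i) (κ i) (k i) (m i) (Ω i) (q i) (ζ i) x = 0)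
        r0 r1 hui.1
    · exact forall_vec3 (P := fun x => layerDisp (ν i) (κ i) (k i) (m i) (Ω i) (q i) (ζ i) x = 0)
        hwi r2 hui.2.1
  · rw [forall_ne_two_iff]
    refine ⟨⟨?_, hnb _ _ d0 b0.1⟩, ?_, hnb _ _ d1 b1.1⟩
    · simp only [Matrix.cons_val_zero, hre]
      gcongr
    · simp only [Matrix.cons_val_one, Matrix.cons_val_zero, hre]
      gcongr
  · simp only [Matrix.cons_val_zero, him]
    gcongr
  · simp only [Matrix.cons_val_one, Matrix.cons_val_zero, him, ← neg_div]
    gcongr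
    linarith
  · refine hui.2.2.1.trans ?_
    gcongr
    exact min_le_left _ _
  · refine hZi'.trans ?_
    gcongr
    exact min_le_left _ _

end NearCriticalFamily

end NearCritical

/-! ### The complete set of roots away from criticality. -/

namespace NearCritical

/-- The leading order of the moderate decay rate far from criticality. -/
noncomputable def midRate (ν κ Ω ζ : ℝ) : ℂ := isqrt (-(ζ / (Ω * (ν + κ))))

theorem norm_midRate_sq {ν κ : ℝ} (Ω ζ : ℝ) (hν : 0 < ν) (hκ : 0 < κ) :
    ‖midRate ν κ Ω ζ‖ ^ 2 = |ζ| / (|Ω| * (ν + κ)) := by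
  rw [midRate, norm_isqrt_sq, abs_neg, abs_div, abs_mul, abs_of_pos (add_pos hν hκ)]

namespace NearCriticalFamily

variable {ι : Type*} {𝓕 : Filter ι} {ν κ k m Ω q ζ : ι → ℝ} {k₀ m₀ Ω₀ q₀ : ℝ}

theorem midRate_ne_zero (h : NearCriticalFamily 𝓕 ν κ k m Ω q ζ k₀ m₀ Ω₀ q₀)
    (hζ : ∀ᶠ i in 𝓕, ζ i ≠ 0) : ∀ᶠ i in 𝓕, midRate (ν i) (κ i) (Ω i) (ζ i) ≠ 0 := by
  filter_upwards [h.ν_pos, h.κ_pos, h.Ω_ne, hζ] with i h1 h2 h3 h4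
  exact isqrt_ne_zero (neg_ne_zero.2 (by positivity))

theorem exists_mid_roots (h : NearCriticalFamily 𝓕 ν κ k m Ω q ζ k₀ m₀ Ω₀ q₀)
    (hζ : ∀ᶠ i in 𝓕, ζ i ≠ 0)
    (hμ : Tendsto (fun i => (ν i + κ i) / |ζ i| ^ 3) 𝓕 (𝓝 0)) :
    ∃ r r' : ι → ℂ, ∀ ρ > 0, ∀ᶠ i in 𝓕,
      layerDisp (ν i) (κ i) (k i) (m i) (Ω i) (q i) (ζ i) (r i) = 0 ∧
      layerDisp (ν i) (κ i) (k i) (m i) (Ω i) (q i) (ζ i) (r' i) = 0 ∧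
      ‖r i - midRate (ν i) (κ i) (Ω i) (ζ i)‖ ≤ ρ * ‖midRate (ν i) (κ i) (Ω i) (ζ i)‖ ∧
      ‖r' i - -midRate (ν i) (κ i) (Ω i) (ζ i)‖ ≤ ρ * ‖midRate (ν i) (κ i) (Ω i) (ζ i)‖ := by
  obtain ⟨r, hr, hr'⟩ := h.exists_moderate_root hζ hμ (s := 1) (by norm_num)
  obtain ⟨t, ht, ht'⟩ := h.exists_moderate_root hζ hμ (s := -1) (by norm_num)
  refine ⟨fun i => midRate (ν i) (κ i) (Ω i) (ζ i) * r i,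
    fun i => midRate (ν i) (κ i) (Ω i) (ζ i) * t i, fun ρ hρ => ?_⟩
  filter_upwards [hr, ht, (tendsto_iff_norm_sub_tendsto_zero.1 hr').eventually_le_const hρ,
    (tendsto_iff_norm_sub_tendsto_zero.1 ht').eventually_le_const hρ] with i h1 h2 h3 h4
  refine ⟨h1, h2, ?_, ?_⟩
  · simpa using norm_mul_sub_le (Z := midRate (ν i) (κ i) (Ω i) (ζ i)) h3
  · simpa using norm_mul_sub_le (Z := midRate (ν i) (κ i) (Ω i) (ζ i)) h4

/-- The squared ratio of the two rates is `q²|Ω|(ν + κ)/|ζ|³`, which tends to 0 by hypothesis. -/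
theorem slow_le_mul_midRate (h : NearCriticalFamily 𝓕 ν κ k m Ω q ζ k₀ m₀ Ω₀ q₀)
    (hζ : ∀ᶠ i in 𝓕, ζ i ≠ 0)
    (hμ : Tendsto (fun i => (ν i + κ i) / |ζ i| ^ 3) 𝓕 (𝓝 0)) {ρ : ℝ} (hρ : 0 < ρ) :
    ∀ᶠ i in 𝓕, |q i / ζ i| ≤ ρ * ‖midRate (ν i) (κ i) (Ω i) (ζ i)‖ := by
  have h0 := ((h.q_lim.pow 2).mul h.Ω_lim.abs).mul hμ
  rw [mul_zero] at h0
  filter_upwards [h.ν_pos, h.κ_pos, h.Ω_ne, hζ,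
    h0.eventually_le_const (sq_pos_of_pos hρ)] with i h1 h2 h3 h4 h5
  have h6 : 0 < |ζ i| := abs_pos.2 h4
  have h7 : 0 < |Ω i| := abs_pos.2 h3
  refine le_of_sq_le_sq ?_ (by positivity)
  rw [mul_pow, norm_midRate_sq _ _ h1 h2, abs_div, div_pow, sq_abs, mul_div_assoc',
    div_le_div_iff₀ (by positivity) (by positivity)]
  rw [mul_div_assoc', div_le_iff₀ (by positivity)] at h5
  calc q i ^ 2 * (|Ω i| * (ν i + κ i)) = q i ^ 2 * |Ω i| * (ν i + κ i) := by ring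
    _ ≤ _ := h5
    _ = _ := by ring

/-- The squared ratio is `|ζ| νκ / (Ω²(ν + κ)²)`, at most `|ζ|/Ω²`. -/
theorem midRate_le_mul_fastRate (h : NearCriticalFamily 𝓕 ν κ k m Ω q ζ k₀ m₀ Ω₀ q₀)
    {ρ : ℝ} (hρ : 0 < ρ) :
    ∀ᶠ i in 𝓕, ‖midRate (ν i) (κ i) (Ω i) (ζ i)‖ ≤ ρ * ‖fastRate (ν i) (κ i) (Ω i)‖ := by
  have h0 := h.ζ_lim.abs.div (h.Ω_lim.abs.pow 2) (pow_ne_zero 2 (abs_ne_zero.2 h.Ω₀_ne))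
  rw [abs_zero, zero_div] at h0
  filter_upwards [h.ν_pos, h.κ_pos, h.Ω_ne,
    h0.eventually_le_const (sq_pos_of_pos hρ)] with i h1 h2 h3 h5
  have h7 : 0 < |Ω i| := abs_pos.2 h3
  refine le_of_sq_le_sq ?_ (by positivity)
  simp only [Pi.div_apply] at h5
  rw [div_le_iff₀ (by positivity)] at h5
  rw [mul_pow, norm_midRate_sq _ _ h1 h2, norm_fastRate_sq _ h1 h2, mul_div_assoc',
    div_le_div_iff₀ (by positivity) (by positivity)]
  have h8 : ν i * κ i ≤ (ν i + κ i) ^ 2 := by nlinarith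
  calc |ζ i| * (ν i * κ i) ≤ ρ ^ 2 * |Ω i| ^ 2 * (ν i + κ i) ^ 2 := by gcongr
    _ = _ := by ring

set_option maxHeartbeats 1000000 in
/-- The decay rates away from criticality. -/
theorem exists_noncritical_roots (h : NearCriticalFamily 𝓕 ν κ k m Ω q ζ k₀ m₀ Ω₀ q₀)
    (hζ : ∀ᶠ i in 𝓕, ζ i ≠ 0)
    (hμ : Tendsto (fun i => (ν i + κ i) / |ζ i| ^ 3) 𝓕 (𝓝 0)) {ρ : ℝ} (hρ : 0 < ρ) :
    ∀ᶠ i in 𝓕, ∃ l : Fin 3 → ℂ,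
      (∀ μ : ℂ, 0 ≤ μ.re →
        (layerDisp (ν i) (κ i) (k i) (m i) (Ω i) (q i) (ζ i) μ = 0 ↔ ∃ j, l j = μ)) ∧
      0 < (l 0).re ∧ ‖l 0 - Complex.I * (q i / ζ i : ℝ)‖ ≤ ρ * |q i / ζ i| ∧
      ‖l 1 - midRate (ν i) (κ i) (Ω i) (ζ i)‖ ≤ ρ * ‖midRate (ν i) (κ i) (Ω i) (ζ i)‖ ∧
      ‖l 2 - fastRate (ν i) (κ i) (Ω i)‖ ≤ ρ * ‖fastRate (ν i) (κ i) (Ω i)‖ ∧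
      |q i / ζ i| ≤ ρ * ‖midRate (ν i) (κ i) (Ω i) (ζ i)‖ ∧
      ‖midRate (ν i) (κ i) (Ω i) (ζ i)‖ ≤ ρ * ‖fastRate (ν i) (κ i) (Ω i)‖ := by
  obtain ⟨u, u', hu⟩ := h.exists_fast_roots
  obtain ⟨v, v', hv⟩ := h.exists_mid_roots hζ hμ
  obtain ⟨d, hd, hd', hd''⟩ := h.exists_degenerate_root hζ hμ
  obtain ⟨w, hw, hw', hw''⟩ := h.exists_small_root
  have hρ' : 0 < min ρ (1 / 4) := lt_min hρ (by norm_num)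
  have hwn := hw'.norm.eventually_lt_const (lt_add_one _)
  have hslow : ∀ᶠ i in 𝓕, ‖-(Complex.I * (m₀ : ℂ))‖ + 1 ≤ |q i / ζ i| := by
    have hq := abs_pos.2 h.q₀_ne
    have h0 := h.ζ_lim.abs
    rw [abs_zero] at h0
    filter_upwards [hζ, h.q_lim.abs.eventually_const_lt (half_lt_self hq),
      h0.eventually_lt_const
      (by positivity : 0 < |q₀| / 2 / (‖-(Complex.I * (m₀ : ℂ))‖ + 1))] with i h1 h2 h3
    have h4 : 0 < |ζ i| := abs_pos.2 h1
    rw [abs_div, le_div_iff₀ h4]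
    rw [lt_div_iff₀ (by positivity)] at h3
    linarith
  filter_upwards [hu _ hρ', hv _ hρ', hd, (tendsto_iff_norm_sub_tendsto_zero.1
    hd').eventually_le_const hρ', hd'', hw, hw'', hwn, hslow, h.slow_le_mul_midRate hζ hμ hρ',
    h.midRate_le_mul_fastRate hρ', h.fastRate_ne_zero, h.midRate_ne_zero hζ, h.ν_pos, h.κ_pos,
    hζ, h.q_ne]
    with i hui hvi hdi hdi' hdi'' hwi hwi' hwi'' hsl hsm hmf hZ0 hY0 hνi hκi hζi hqi
  set Z := fastRate (ν i) (κ i) (Ω i) with hZdef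
  set Y := midRate (ν i) (κ i) (Ω i) (ζ i) with hYdef
  set X : ℂ := Complex.I * (q i / ζ i : ℝ) with hXdef
  have hXn : ‖X‖ = |q i / ζ i| := by
    rw [hXdef, norm_mul, Complex.norm_I, one_mul, Complex.norm_real, Real.norm_eq_abs]
  have hZre : ‖Z‖ ≤ 2 * Z.re := norm_isqrt_le_re _
  have hYre : ‖Y‖ ≤ 2 * Y.re := norm_isqrt_le_re _
  have hZpos : 0 < ‖Z‖ := norm_pos_iff.2 hZ0
  have hYpos : 0 < ‖Y‖ := norm_pos_iff.2 hY0
  have hm4 : min ρ (1 / 4) ≤ 1 / 4 := min_le_right _ _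
  have hmρ : min ρ (1 / 4) ≤ ρ := min_le_left _ _
  have hXr : ‖X * d i - X‖ ≤ min ρ (1 / 4) * ‖X‖ := by
    simpa using norm_mul_sub_le (Z := X) hdi'
  have bX := norm_bounds_of_near hXr
  have bY := norm_bounds_of_near hvi.2.2.1
  have bY' := norm_bounds_of_near (Z := -Y) (by rw [norm_neg]; exact hvi.2.2.2)
  have bZ := norm_bounds_of_near hui.2.2.1
  have bZ' := norm_bounds_of_near (Z := -Z) (by rw [norm_neg]; exact hui.2.2.2)
  rw [norm_neg] at bY' bZ'
  have hXle : ‖X‖ ≤ 1 / 4 * ‖Y‖ := by rw [hXn]; exact hsm.trans (by gcongr)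
  have hYle : ‖Y‖ ≤ 1 / 4 * ‖Z‖ := hmf.trans (by gcongr)
  have lowY : ∀ x, (1 - min ρ (1 / 4)) * ‖Y‖ ≤ x → 3 / 4 * ‖Y‖ ≤ x := fun x hx =>
    le_trans (by gcongr; linarith) hx
  have lowZ : ∀ x, (1 - min ρ (1 / 4)) * ‖Z‖ ≤ x → 3 / 4 * ‖Z‖ ≤ x := fun x hx =>
    le_trans (by gcongr; linarith) hx
  have upX : ‖X * d i‖ ≤ 5 / 4 * ‖X‖ := bX.2.trans (by gcongr; linarith)
  have upY : ∀ x, x ≤ (1 + min ρ (1 / 4)) * ‖Y‖ → x ≤ 5 / 4 * ‖Y‖ := fun x hx =>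
    hx.trans (by gcongr; linarith)
  have hwX : ‖w i‖ < ‖X‖ := by rw [hXn]; exact hwi''.trans_le hsl
  have c1 := lowY _ bY.1
  have c2 := lowY _ bY'.1
  have c3 := lowZ _ bZ.1
  have c4 := lowZ _ bZ'.1
  have c5 := upY _ bY.2
  have c6 := upY _ bY'.2
  refine ⟨![X * d i, v i, u i], ?_, hdi'', ?_, ?_, ?_, ?_, ?_⟩
  -- The moduli on each side have three different orders of magnitude: on the left those of `m₀`,
  -- `Y` and `Z`, on the right those of `q/ζ`, `Y` and `Z`.
  · refine layerDisp_eq_zero_iff hνi.ne' hκi.ne' (n := ![w i, v' i, u' i])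
      (injective_vec3 ?_ ?_ ?_) (injective_vec3 ?_ ?_ ?_) ?_ ?_ ?_ ?_
    · intro he; rw [he] at upX; linarith
    · intro he; rw [he] at upX; linarith
    · intro he; rw [he] at c5; linarith
    · intro he; rw [he] at hwX; linarith
    · intro he; rw [he] at hwX; linarith
    · intro he; rw [he] at c6; linarith
    · exact forall_vec3 (P := fun x : ℂ => 0 < x.re) hdi''
        (re_pos_of_near hYre hY0 (by linarith) hvi.2.2.1)
        (re_pos_of_near hZre hZ0 (by linarith) hui.2.2.1)
    · exact forall_vec3 (P := fun x : ℂ => x.re < 0) hwi'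
        (re_neg_of_near hYre hY0 (by linarith) hvi.2.2.2)
        (re_neg_of_near hZre hZ0 (by linarith) hui.2.2.2)
    · exact forall_vec3 (P := fun x => layerDisp (ν i) (κ i) (k i) (m i) (Ω i) (q i) (ζ i) x = 0)
        hdi hvi.1 hui.1
    · exact forall_vec3 (P := fun x => layerDisp (ν i) (κ i) (k i) (m i) (Ω i) (q i) (ζ i) x = 0)
        hwi hvi.2.1 hui.2.1
  · rw [← hXn]
    exact hXr.trans (by gcongr)
  · exact hvi.2.2.1.trans (by gcongr)
  · exact hui.2.2.1.trans (by gcongr)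
  · exact hsm.trans (by gcongr)
  · exact hmf.trans (by gcongr)

end NearCriticalFamily

end NearCritical

namespace NearCritical

/-! ### The linear system for the amplitudes. -/

section Amplitude

variable {l₂ l₃ l₅ h₂ h₃ h₅ : ℂ} {c δ : ℝ}

/-- Scale separation for the linear system that determines the amplitudes. -/
structure Separated (c δ : ℝ) (l₂ l₃ l₅ h₂ h₃ h₅ : ℂ) : Prop where
  one_le : 1 ≤ ‖l₂‖
  le : ‖l₂‖ ≤ ‖l₃‖
  le_mul : ‖l₃‖ ≤ δ * ‖l₅‖
  sep : c * ‖l₃‖ ≤ ‖l₃ - l₂‖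
  near₂ : ‖h₂ - l₂‖ ≤ δ * ‖l₂‖
  near₃ : ‖h₃ - l₃‖ ≤ δ * ‖l₃‖
  main : c * (‖l₃‖ + ‖h₅‖) ≤ ‖l₂ + l₃ - h₅‖

/-- The determinant of the amplitude system, multiplied by `l₂ l₃`. -/
noncomputable def ampDet (l₂ l₃ l₅ h₂ h₃ h₅ : ℂ) : ℂ :=
  h₅ * (l₃ - l₂) - h₂ * (l₂ * l₃ / l₅ - l₂) + h₃ * (l₂ * l₃ / l₅ - l₃)

namespace Separated

theorem l₃_pos (h : Separated c δ l₂ l₃ l₅ h₂ h₃ h₅) : 0 < ‖l₃‖ := by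
  linarith [h.one_le, h.le]

theorem norm_div_le (h : Separated c δ l₂ l₃ l₅ h₂ h₃ h₅) :
    ‖l₂ * l₃ / l₅‖ ≤ δ * ‖l₂‖ := by
  have h5 : 0 < ‖l₅‖ := by
    rcases (norm_nonneg l₅).eq_or_lt with h0 | h0
    · have := h.le_mul; rw [← h0, mul_zero] at this; linarith [h.l₃_pos]
    · exact h0
  rw [norm_div, norm_mul, div_le_iff₀ h5]
  nlinarith [mul_le_mul_of_nonneg_left h.le_mul (norm_nonneg l₂)]

theorem δ_nonneg (h : Separated c δ l₂ l₃ l₅ h₂ h₃ h₅) : 0 ≤ δ := by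
  by_contra! h0
  have := mul_nonpos_of_nonpos_of_nonneg h0.le (norm_nonneg l₅)
  linarith [h.le_mul, h.l₃_pos]

/-- With `h₂`, `h₃` replaced by `l₂`, `l₃` and `l₂l₃/l₅` by 0, the determinant becomes `-(l₃ -
l₂)(l₂ + l₃ - h₅)`. The three errors are at most `2δ|l₃|²` each, and `12δ ≤ c²` makes their sum at
most half of the lower bound for this product. -/
theorem le_norm_ampDet (h : Separated c δ l₂ l₃ l₅ h₂ h₃ h₅) (hc : 0 < c) (hδ : δ ≤ 1)
    (hcδ : 12 * δ ≤ c ^ 2) :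
    c ^ 2 / 2 * (‖l₃‖ * (‖l₃‖ + ‖h₅‖)) ≤ ‖ampDet l₂ l₃ l₅ h₂ h₃ h₅‖ := by
  have hx := h.norm_div_le
  have hδ0 := h.δ_nonneg
  have h2 := norm_nonneg l₂
  have h3 := h.l₃_pos
  set x := l₂ * l₃ / l₅ with hxdef
  have e : ampDet l₂ l₃ l₅ h₂ h₃ h₅ = -((l₃ - l₂) * (l₂ + l₃ - h₅)) + ((l₃ - l₂) * x +
      (-((h₂ - l₂) * (x - l₂)) + (h₃ - l₃) * (x - l₃))) := by
    rw [ampDet]; ring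
  have b1 : ‖(l₃ - l₂) * x‖ ≤ 2 * δ * ‖l₃‖ ^ 2 := by
    rw [norm_mul]
    have := norm_sub_le l₃ l₂
    calc ‖l₃ - l₂‖ * ‖x‖ ≤ (2 * ‖l₃‖) * (δ * ‖l₃‖) := by
          gcongr
          · linarith [h.le]
          · exact hx.trans (mul_le_mul_of_nonneg_left h.le hδ0)
      _ = _ := by ring
  have hx2 : ‖x‖ ≤ ‖l₂‖ := hx.trans (by nlinarith)
  have b2 : ‖-((h₂ - l₂) * (x - l₂))‖ ≤ 2 * δ * ‖l₃‖ ^ 2 := by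
    rw [norm_neg, norm_mul]
    have := norm_sub_le x l₂
    calc ‖h₂ - l₂‖ * ‖x - l₂‖ ≤ (δ * ‖l₃‖) * (2 * ‖l₃‖) := by
          gcongr
          · exact h.near₂.trans (mul_le_mul_of_nonneg_left h.le hδ0)
          · linarith [h.le]
      _ = _ := by ring
  have b3 : ‖(h₃ - l₃) * (x - l₃)‖ ≤ 2 * δ * ‖l₃‖ ^ 2 := by
    rw [norm_mul]
    have := norm_sub_le x l₃
    calc ‖h₃ - l₃‖ * ‖x - l₃‖ ≤ (δ * ‖l₃‖) * (2 * ‖l₃‖) := by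
          gcongr
          · exact h.near₃
          · linarith [h.le]
      _ = _ := by ring
  have b0 : c ^ 2 * (‖l₃‖ * (‖l₃‖ + ‖h₅‖)) ≤ ‖-((l₃ - l₂) * (l₂ + l₃ - h₅))‖ := by
    rw [norm_neg, norm_mul]
    calc c ^ 2 * (‖l₃‖ * (‖l₃‖ + ‖h₅‖)) = (c * ‖l₃‖) * (c * (‖l₃‖ + ‖h₅‖)) := by ring
      _ ≤ _ := by
        gcongr
        · exact h.sep
        · exact h.main
  rw [e]
  have t1 := norm_sub_le_norm_add (-((l₃ - l₂) * (l₂ + l₃ - h₅))) ((l₃ - l₂) * x +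
      (-((h₂ - l₂) * (x - l₂)) + (h₃ - l₃) * (x - l₃)))
  have t2 := norm_add_le ((l₃ - l₂) * x) (-((h₂ - l₂) * (x - l₂)) + (h₃ - l₃) * (x - l₃))
  have t3 := norm_add_le (-((h₂ - l₂) * (x - l₂))) ((h₃ - l₃) * (x - l₃))
  have t4 : 6 * δ * ‖l₃‖ ^ 2 ≤ c ^ 2 / 2 * (‖l₃‖ * (‖l₃‖ + ‖h₅‖)) := by
    have : 6 * δ * ‖l₃‖ ^ 2 ≤ c ^ 2 / 2 * ‖l₃‖ ^ 2 := by gcongr; linarith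
    have h6 : 0 ≤ c ^ 2 / 2 * (‖l₃‖ * ‖h₅‖) := by positivity
    nlinarith
  linarith

theorem norms_le (h : Separated c δ l₂ l₃ l₅ h₂ h₃ h₅) (hδ : δ ≤ 1) :
    ‖h₂‖ ≤ 2 * ‖l₂‖ ∧ ‖h₃‖ ≤ 2 * ‖l₃‖ := by
  have h1 := norm_sub_norm_le h₂ l₂
  have h2 := norm_sub_norm_le h₃ l₃
  have h3 := h.near₂
  have h4 := h.near₃
  have h5 : δ * ‖l₂‖ ≤ ‖l₂‖ := by nlinarith [norm_nonneg l₂]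
  have h6 : δ * ‖l₃‖ ≤ ‖l₃‖ := by nlinarith [norm_nonneg l₃]
  constructor <;> linarith

variable {a₂ a₃ a₅ r₁ r₂ r₃ : ℂ} {C : ℝ}

/-- Bounds for the solution of the amplitude system. -/
theorem norm_amp_le (h : Separated c δ l₂ l₃ l₅ h₂ h₃ h₅) (hc : 0 < c) (hc1 : c ≤ 1) (hδ : δ ≤ 1)
    (hcδ : 12 * δ ≤ c ^ 2) (hr₁ : ‖r₁‖ ≤ C) (hr₂ : ‖r₂‖ ≤ C) (hr₃ : ‖r₃‖ ≤ C)
    (e₁ : a₂ + a₃ + a₅ = r₁) (e₂ : a₂ / l₂ + a₃ / l₃ + a₅ / l₅ = r₂)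
    (e₃ : a₂ * h₂ + a₃ * h₃ + a₅ * h₅ = r₃) :
    ‖a₂‖ ≤ 42 * C / c ^ 3 * ‖l₂‖ ∧ ‖a₃‖ ≤ 42 * C / c ^ 3 * ‖l₂‖ ∧
      ‖a₅‖ ≤ 20 * C / c ^ 2 * (‖l₂‖ * ‖l₃‖ / (‖l₃‖ + ‖h₅‖)) := by
  have hC : 0 ≤ C := (norm_nonneg _).trans hr₁
  have p2 : 0 < ‖l₂‖ := by linarith [h.one_le]
  have p3 := h.l₃_pos
  have n2 : l₂ ≠ 0 := norm_pos_iff.1 p2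
  have n3 : l₃ ≠ 0 := norm_pos_iff.1 p3
  have hx := h.norm_div_le
  have e₂' : a₂ * l₃ + a₃ * l₂ + a₅ * (l₂ * l₃ / l₅) = r₂ * (l₂ * l₃) := by
    rw [← e₂]; field_simp
  -- Elimination by hand: the first two equations express `a₂` and `a₃` through `a₅`, and the third,
  -- multiplied by `l₃ - l₂`, becomes an equation for `a₅` times the determinant.
  have f2 : a₂ * (l₃ - l₂) = r₂ * (l₂ * l₃) - r₁ * l₂ - a₅ * (l₂ * l₃ / l₅ - l₂) := by
    linear_combination e₂' - l₂ * e₁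
  have f3 : a₃ * (l₂ - l₃) = r₂ * (l₂ * l₃) - r₁ * l₃ - a₅ * (l₂ * l₃ / l₅ - l₃) := by
    linear_combination e₂' - l₃ * e₁
  have f5 : a₅ * ampDet l₂ l₃ l₅ h₂ h₃ h₅ = r₃ * (l₃ - l₂) - h₂ * (r₂ * (l₂ * l₃) - r₁ * l₂) +
      h₃ * (r₂ * (l₂ * l₃) - r₁ * l₃) := by
    rw [ampDet]
    linear_combination (l₃ - l₂) * e₃ - h₂ * f2 + h₃ * f3
  obtain ⟨m2, m3⟩ := h.norms_le hδ
  have hδ0 := h.δ_nonneg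
  have hx2 : ‖l₂ * l₃ / l₅‖ ≤ ‖l₂‖ := hx.trans (by nlinarith)
  have g0 : ‖r₂ * (l₂ * l₃)‖ ≤ C * (‖l₂‖ * ‖l₃‖) := by
    rw [norm_mul, norm_mul]; gcongr
  have g1 : ‖r₁ * l₂‖ ≤ C * (‖l₂‖ * ‖l₃‖) := by
    rw [norm_mul]
    have := h.one_le.trans h.le
    gcongr
    nlinarith
  have g2 : ‖r₁ * l₃‖ ≤ C * (‖l₂‖ * ‖l₃‖) := by
    rw [norm_mul]
    have := h.one_le
    gcongr
    nlinarith
  have b5 : ‖a₅‖ ≤ 20 * C / c ^ 2 * (‖l₂‖ * ‖l₃‖ / (‖l₃‖ + ‖h₅‖)) := by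
    have hd := h.le_norm_ampDet hc hδ hcδ
    have g3 : ‖a₅‖ * ‖ampDet l₂ l₃ l₅ h₂ h₃ h₅‖ ≤ 10 * C * (‖l₂‖ * ‖l₃‖ ^ 2) := by
      rw [← norm_mul, f5]
      have k1 : ‖r₃ * (l₃ - l₂)‖ ≤ 2 * C * (‖l₂‖ * ‖l₃‖ ^ 2) := by
        rw [norm_mul]
        calc ‖r₃‖ * ‖l₃ - l₂‖ ≤ C * (2 * ‖l₃‖) := by
              gcongr
              linarith [norm_sub_le l₃ l₂, h.le]
          _ ≤ C * (2 * (‖l₂‖ * ‖l₃‖ ^ 2)) := by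
              gcongr
              have := h.one_le
              have h1 : 1 * 1 ≤ ‖l₂‖ * ‖l₃‖ := mul_le_mul this (this.trans h.le) zero_le_one p2.le
              nlinarith
          _ = _ := by ring
      have k2 : ‖h₂ * (r₂ * (l₂ * l₃) - r₁ * l₂)‖ ≤ 4 * C * (‖l₂‖ * ‖l₃‖ ^ 2) := by
        rw [norm_mul]
        calc ‖h₂‖ * ‖r₂ * (l₂ * l₃) - r₁ * l₂‖ ≤ (2 * ‖l₃‖) * (2 * (C * (‖l₂‖ * ‖l₃‖))) := by
              gcongr
              · linarith [h.le]
              · linarith [norm_sub_le (r₂ * (l₂ * l₃)) (r₁ * l₂)]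
          _ = _ := by ring
      have k3 : ‖h₃ * (r₂ * (l₂ * l₃) - r₁ * l₃)‖ ≤ 4 * C * (‖l₂‖ * ‖l₃‖ ^ 2) := by
        rw [norm_mul]
        calc ‖h₃‖ * ‖r₂ * (l₂ * l₃) - r₁ * l₃‖ ≤ (2 * ‖l₃‖) * (2 * (C * (‖l₂‖ * ‖l₃‖))) := by
              gcongr
              linarith [norm_sub_le (r₂ * (l₂ * l₃)) (r₁ * l₃)]
          _ = _ := by ring
      linarith [norm_add_le (r₃ * (l₃ - l₂) - h₂ * (r₂ * (l₂ * l₃) - r₁ * l₂))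
        (h₃ * (r₂ * (l₂ * l₃) - r₁ * l₃)),
        norm_sub_le (r₃ * (l₃ - l₂)) (h₂ * (r₂ * (l₂ * l₃) - r₁ * l₂))]
    have g4 := (mul_le_mul_of_nonneg_left hd (norm_nonneg a₅)).trans g3
    have p5 : 0 < ‖l₃‖ + ‖h₅‖ := by positivity
    rw [div_mul_div_comm, le_div_iff₀ (by positivity)]
    have g5 : ‖l₃‖ * (‖a₅‖ * (c ^ 2 * (‖l₃‖ + ‖h₅‖))) ≤ ‖l₃‖ * (20 * C * (‖l₂‖ * ‖l₃‖)) := by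
      linarith
    exact le_of_mul_le_mul_left g5 p3
  have b5' : ‖a₅‖ ≤ 20 * C / c ^ 2 * ‖l₂‖ := by
    refine b5.trans ?_
    gcongr
    rw [div_le_iff₀ (by positivity)]
    gcongr
    linarith [norm_nonneg h₅]
  -- The constant is `42 = 2 + 2·20`, the 20 coming from the bound on `a₅`. The third power of `1/c`
  -- comes from dividing by `|x| ≥ c|l₃|`, and `c ≤ 1` lets `2C` be absorbed into `2C/c²`.
  have final : ∀ a x : ℂ, ‖a * x‖ ≤ 2 * (C * (‖l₂‖ * ‖l₃‖)) + ‖a₅‖ * (2 * ‖l₃‖) →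
      c * ‖l₃‖ ≤ ‖x‖ → ‖a‖ ≤ 42 * C / c ^ 3 * ‖l₂‖ := by
    intro a x ha hx
    rw [norm_mul] at ha
    have s1 := (mul_le_mul_of_nonneg_left hx (norm_nonneg a)).trans ha
    have s2 : 2 * C ≤ 2 * C / c ^ 2 := by
      rw [le_div_iff₀ (by positivity)]
      nlinarith [pow_le_one₀ hc.le hc1 (n := 2)]
    have s3 : ‖a‖ * (c * ‖l₃‖) ≤ (42 * C / c ^ 2 * ‖l₂‖) * ‖l₃‖ := by
      refine s1.trans ?_
      have : ‖a₅‖ * (2 * ‖l₃‖) ≤ 20 * C / c ^ 2 * ‖l₂‖ * (2 * ‖l₃‖) := by gcongr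
      have s4 : 2 * C * (‖l₂‖ * ‖l₃‖) ≤ 2 * C / c ^ 2 * (‖l₂‖ * ‖l₃‖) := by gcongr
      have s5 : 42 * C / c ^ 2 * ‖l₂‖ * ‖l₃‖ = 2 * C / c ^ 2 * (‖l₂‖ * ‖l₃‖) +
        20 * C / c ^ 2 * ‖l₂‖ * (2 * ‖l₃‖) := by ring
      linarith
    have s6 : ‖l₃‖ * (‖a‖ * c) ≤ ‖l₃‖ * (42 * C / c ^ 2 * ‖l₂‖) := by linarith
    have s7 := le_of_mul_le_mul_left s6 p3
    rw [← le_div_iff₀ hc] at s7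
    refine s7.trans (le_of_eq ?_)
    field_simp
  refine ⟨final a₂ (l₃ - l₂) ?_ h.sep, final a₃ (l₂ - l₃) ?_ ?_, b5⟩
  · rw [f2]
    have k1 : ‖a₅ * (l₂ * l₃ / l₅ - l₂)‖ ≤ ‖a₅‖ * (2 * ‖l₃‖) := by
      rw [norm_mul]
      gcongr
      linarith [norm_sub_le (l₂ * l₃ / l₅) l₂, h.le]
    linarith [norm_sub_le (r₂ * (l₂ * l₃) - r₁ * l₂) (a₅ * (l₂ * l₃ / l₅ - l₂)),
      norm_sub_le (r₂ * (l₂ * l₃)) (r₁ * l₂)]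
  · rw [f3]
    have k1 : ‖a₅ * (l₂ * l₃ / l₅ - l₃)‖ ≤ ‖a₅‖ * (2 * ‖l₃‖) := by
      rw [norm_mul]
      gcongr
      linarith [norm_sub_le (l₂ * l₃ / l₅) l₃, h.le]
    linarith [norm_sub_le (r₂ * (l₂ * l₃) - r₁ * l₃) (a₅ * (l₂ * l₃ / l₅ - l₃)),
      norm_sub_le (r₂ * (l₂ * l₃)) (r₁ * l₃)]
  · rw [norm_sub_rev]; exact h.sep

end Separated

/-- The solution of the amplitude system. -/
noncomputable def ampSol (l₂ l₃ l₅ h₂ h₃ h₅ r₁ r₂ r₃ : ℂ) : Fin 3 → ℂ :=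
  let a₅ := (r₃ * (l₃ - l₂) - h₂ * (r₂ * (l₂ * l₃) - r₁ * l₂) +
      h₃ * (r₂ * (l₂ * l₃) - r₁ * l₃)) / ampDet l₂ l₃ l₅ h₂ h₃ h₅
  ![(r₂ * (l₂ * l₃) - r₁ * l₂ - a₅ * (l₂ * l₃ / l₅ - l₂)) / (l₃ - l₂),
    (r₂ * (l₂ * l₃) - r₁ * l₃ - a₅ * (l₂ * l₃ / l₅ - l₃)) / (l₂ - l₃), a₅]

theorem ampSol_spec {r₁ r₂ r₃ : ℂ} (h₂0 : l₂ ≠ 0) (h₃0 : l₃ ≠ 0) (hne : l₃ ≠ l₂)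
    (hD : ampDet l₂ l₃ l₅ h₂ h₃ h₅ ≠ 0) :
    let a := ampSol l₂ l₃ l₅ h₂ h₃ h₅ r₁ r₂ r₃
    a 0 + a 1 + a 2 = r₁ ∧ a 0 / l₂ + a 1 / l₃ + a 2 / l₅ = r₂ ∧
      a 0 * h₂ + a 1 * h₃ + a 2 * h₅ = r₃ := by
  have n1 : l₃ - l₂ ≠ 0 := sub_ne_zero.2 hne
  have n2 : l₂ - l₃ ≠ 0 := sub_ne_zero.2 hne.symm
  simp only [ampSol, Matrix.cons_val_zero, Matrix.cons_val_one, Matrix.cons_val]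
  set a₅ := (r₃ * (l₃ - l₂) - h₂ * (r₂ * (l₂ * l₃) - r₁ * l₂) +
      h₃ * (r₂ * (l₂ * l₃) - r₁ * l₃)) / ampDet l₂ l₃ l₅ h₂ h₃ h₅ with ha₅
  have f5 : a₅ * ampDet l₂ l₃ l₅ h₂ h₃ h₅ = r₃ * (l₃ - l₂) - h₂ * (r₂ * (l₂ * l₃) - r₁ * l₂) +
      h₃ * (r₂ * (l₂ * l₃) - r₁ * l₃) := div_mul_cancel₀ _ hD
  set a₂ := (r₂ * (l₂ * l₃) - r₁ * l₂ - a₅ * (l₂ * l₃ / l₅ - l₂)) / (l₃ - l₂) with ha₂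
  set a₃ := (r₂ * (l₂ * l₃) - r₁ * l₃ - a₅ * (l₂ * l₃ / l₅ - l₃)) / (l₂ - l₃) with ha₃
  have f2 : a₂ * (l₃ - l₂) = r₂ * (l₂ * l₃) - r₁ * l₂ - a₅ * (l₂ * l₃ / l₅ - l₂) :=
    div_mul_cancel₀ _ n1
  have f3 : a₃ * (l₂ - l₃) = r₂ * (l₂ * l₃) - r₁ * l₃ - a₅ * (l₂ * l₃ / l₅ - l₃) :=
    div_mul_cancel₀ _ n2
  clear_value a₂ a₃ a₅
  rw [ampDet] at f5
  have e1 : a₂ + a₃ + a₅ = r₁ := by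
    apply mul_left_cancel₀ n1
    linear_combination f2 - f3
  have e2 : a₂ * l₃ + a₃ * l₂ + a₅ * (l₂ * l₃ / l₅) = r₂ * (l₂ * l₃) := by
    linear_combination f2 + l₂ * e1
  refine ⟨e1, ?_, ?_⟩
  · apply mul_right_cancel₀ (mul_ne_zero h₂0 h₃0)
    rw [← e2]
    field_simp
  · apply mul_left_cancel₀ n1
    linear_combination f5 + h₂ * f2 - h₃ * f3

end Amplitude

end NearCritical

/-! ### The determinant and the lifting conditions in normal form. -/

namespace NearCritical

variable {S : Setup} {ν κ : ℝ} {p : ℝ × ℝ} {l : ℂ}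

theorem Setup.det_layerMatrix (S : Setup) (ν κ : ℝ) (p : ℝ × ℝ) (l : ℂ) :
    (S.layerMatrix ν κ p l).det =
      -((Complex.I * S.omega p.1 p.2 + ν * (l ^ 2 - (p.1 : ℂ) ^ 2)) *
      (Complex.I * S.omega p.1 p.2 + κ * (l ^ 2 - (p.1 : ℂ) ^ 2)) * (l ^ 2 - (p.1 : ℂ) ^ 2) +
      (Real.sin S.γ * l + Complex.I * p.1 * Real.cos S.γ) ^ 2) := by
  simp only [Setup.layerMatrix, Matrix.det_succ_row_zero, Fin.sum_univ_succ, Matrix.submatrix_apply]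
  simp [Fin.succAbove]
  ring_nf
  have h3 : Complex.I ^ 3 = -Complex.I := Complex.I_pow_three
  have h4 : Complex.I ^ 4 = 1 := Complex.I_pow_four
  simp only [Complex.I_sq, h3, h4]
  ring

theorem Setup.omega_sq (S : Setup) {k m : ℝ} (hk : k ≠ 0) :
    S.omega k m ^ 2 * (k ^ 2 + m ^ 2) = (k * Real.cos S.γ - m * Real.sin S.γ) ^ 2 := by
  have h1 : S.omega k m ^ 2 = S.omegaPlus k m ^ 2 := by
    rw [Setup.omega]; split_ifs <;> ring
  have h2 : 0 < k ^ 2 + m ^ 2 := by positivity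
  rw [h1, Setup.omegaPlus, div_pow, Real.sq_sqrt h2.le, div_mul_cancel₀ _ h2.ne']

/-- The coefficient `2 k sin γ cos γ + m ζ`. -/
noncomputable def Setup.slope (S : Setup) (p : ℝ × ℝ) : ℝ :=
  2 * p.1 * Real.sin S.γ * Real.cos S.γ + p.2 * S.zeta p.1 p.2

/-- The inviscid part `-ω²(l² - k²) + (l sin γ + ik cos γ)²` vanishes at `l = -im` by the dispersion
relation of the incident wave, hence factors as `(l + im)(iq - ζl)`. This exhibits `ζ` as the
coefficient whose smallness is criticality. -/
theorem Setup.det_eq_layerDisp (S : Setup) (ν κ : ℝ) {p : ℝ × ℝ} (hk : p.1 ≠ 0) (l : ℂ) :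
    (S.layerMatrix ν κ p l).det =
      -layerDisp ν κ p.1 p.2 (S.omega p.1 p.2) (S.slope p) (S.zeta p.1 p.2) l := by
  have h1 : ((S.omega p.1 p.2 : ℝ) : ℂ) ^ 2 * ((p.1 : ℂ) ^ 2 + (p.2 : ℂ) ^ 2) =
      ((p.1 : ℂ) * (Real.cos S.γ : ℝ) - p.2 * (Real.sin S.γ : ℝ)) ^ 2 := by
    exact_mod_cast S.omega_sq hk
  rw [S.det_layerMatrix, layerDisp, disp, Setup.slope, Setup.zeta]
  push_cast
  push_cast at h1
  linear_combination (-1 : ℂ) * h1 - (((S.omega p.1 p.2 : ℝ) : ℂ) ^ 2 * (l ^ 2 - (p.1 : ℂ) ^ 2) +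
    (p.1 : ℂ) ^ 2 * Complex.cos S.γ ^ 2 - (2 * p.1 * Complex.sin S.γ * Complex.cos S.γ * p.2 +
      (p.2 : ℂ) ^ 2 * (((S.omega p.1 p.2 : ℝ) : ℂ) ^ 2 - Complex.sin S.γ ^ 2))) * Complex.I_sq

/-- `l` lists the layer roots, in order of modulus. -/
structure Setup.IsRootList (S : Setup) (ν κ : ℝ) (p : ℝ × ℝ) (l : Fin 3 → ℂ) : Prop where
  injective : Function.Injective l
  roots : ∀ μ : ℂ, S.IsLayerRoot ν κ p μ ↔ ∃ j, l j = μ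
  order : ‖l 0‖ ≤ ‖l 1‖ ∧ ‖l 1‖ < ‖l 2‖

/-- The modes with amplitudes `a` and decay rates `l` cancel the trace of the incident wave. -/
structure Setup.IsLift (S : Setup) (κ : ℝ) (p : ℝ × ℝ) (l a : Fin 3 → ℂ) : Prop where
  lift_u : ∑ j, a j * S.layerVec κ p (l j) 0 = -S.incVec p 0
  lift_w : ∑ j, a j * S.layerVec κ p (l j) 1 = -S.incVec p 1
  lift_b : ∑ j, a j * (-l j * S.layerVec κ p (l j) 2) = -(Complex.I * p.2 * S.incVec p 2)

theorem Setup.IsRootList.re_pos {l : Fin 3 → ℂ} (h : S.IsRootList ν κ p l) (j : Fin 3) :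
    0 < (l j).re := ((h.roots _).2 ⟨j, rfl⟩).1

/-- Two lists of the roots agree up to the order of the first two. -/
theorem Setup.IsRootList.eq_or {l l' : Fin 3 → ℂ} (h : S.IsRootList ν κ p l)
    (hr : ∀ μ : ℂ, S.IsLayerRoot ν κ p μ ↔ ∃ j, l' j = μ) (h0 : ‖l' 0‖ < ‖l' 2‖)
    (h1 : ‖l' 1‖ < ‖l' 2‖) :
    l 2 = l' 2 ∧ ((l 0 = l' 0 ∧ l 1 = l' 1) ∨ (l 0 = l' 1 ∧ l 1 = l' 0)) := by
  have hex : ∀ j, ∃ i, l' i = l j := fun j => (hr _).1 ((h.roots _).2 ⟨j, rfl⟩)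
  have hex' : ∀ j, ∃ i, l i = l' j := fun j => (h.roots _).1 ((hr _).2 ⟨j, rfl⟩)
  have hlt : ∀ i, ‖l i‖ ≤ ‖l 2‖ := by
    intro i; fin_cases i
    · exact h.order.1.trans h.order.2.le
    · exact h.order.2.le
    · exact le_rfl
  have h2 : l 2 = l' 2 := by
    obtain ⟨i, hi⟩ := hex 2
    obtain ⟨j, hj⟩ := hex' 2
    have hle := hlt j
    rw [hj] at hle
    fin_cases i
    · simp only [Fin.zero_eta] at hi; rw [← hi] at hle; exact absurd hle (not_le.2 h0)
    · simp only [Fin.mk_one] at hi; rw [← hi] at hle; exact absurd hle (not_le.2 h1)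
    · exact hi.symm
  refine ⟨h2, ?_⟩
  have n01 : l 0 ≠ l 1 := fun e => absurd (h.injective e) (by decide)
  have n02 : l 0 ≠ l 2 := fun e => absurd (h.injective e) (by decide)
  have n12 : l 1 ≠ l 2 := fun e => absurd (h.injective e) (by decide)
  obtain ⟨i, hi⟩ := hex 0
  obtain ⟨j, hj⟩ := hex 1
  fin_cases i <;> fin_cases j <;> simp_all

/-- The coefficient of a layer mode in the normalised third lifting equation. -/
noncomputable def Setup.buoy (S : Setup) (κ : ℝ) (p : ℝ × ℝ) (l : ℂ) : ℂ :=
  Complex.I * S.omega p.1 p.2 / Real.sin S.γ * (l * S.layerVec κ p l 2)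

/-- When `|l|` is large and `κ|l|²` small, both corrections are negligible and the coefficient is
close to `l`; the factor `iω/sin γ` in its definition is chosen for this. -/
theorem Setup.buoy_eq (S : Setup) (hs : Real.sin S.γ ≠ 0) (κ : ℝ) (p : ℝ × ℝ) {l : ℂ}
    (hl : l ≠ 0) :
    S.buoy κ p l = Complex.I * S.omega p.1 p.2 *
      (l + Complex.I * (p.1 * Real.cos S.γ / Real.sin S.γ : ℝ)) /
      (Complex.I * S.omega p.1 p.2 + κ * (l ^ 2 - (p.1 : ℂ) ^ 2)) := by
  have hs' : (Real.sin S.γ : ℂ) ≠ 0 := by exact_mod_cast hs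
  have e : Complex.I * S.omega p.1 p.2 - κ * ((p.1 : ℂ) ^ 2 - l ^ 2) =
    Complex.I * S.omega p.1 p.2 + κ * (l ^ 2 - (p.1 : ℂ) ^ 2) := by ring
  simp only [Setup.buoy, Setup.layerVec, Matrix.cons_val, e]
  push_cast at hs' ⊢
  field_simp

/-- The `w` condition is divided by `ik` and the `∂_y b` condition multiplied by `-iω/sin γ`. The
right-hand sides then stay bounded, and the rows have coefficients `1`, `1/l_j` and `h_j`. -/
theorem Setup.isLift_iff (S : Setup) (hs : Real.sin S.γ ≠ 0) (κ : ℝ) {p : ℝ × ℝ} (hk : p.1 ≠ 0)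
    (hm : p.2 ≠ 0) (hΩ : S.omega p.1 p.2 ≠ 0) {l : Fin 3 → ℂ} (a : Fin 3 → ℂ) :
    S.IsLift κ p l a ↔ a 0 + a 1 + a 2 = -1 ∧
      a 0 / l 0 + a 1 / l 1 + a 2 / l 2 = -Complex.I / p.2 ∧
      a 0 * S.buoy κ p (l 0) + a 1 * S.buoy κ p (l 1) + a 2 * S.buoy κ p (l 2) =
        -Complex.I * (p.1 * Real.cos S.γ - p.2 * Real.sin S.γ : ℝ) / Real.sin S.γ := by
  have hI := Complex.I_ne_zero
  have hs' : (Real.sin S.γ : ℂ) ≠ 0 := by exact_mod_cast hs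
  have hk' : (p.1 : ℂ) ≠ 0 := by exact_mod_cast hk
  have hm' : (p.2 : ℂ) ≠ 0 := by exact_mod_cast hm
  have hΩ' : (S.omega p.1 p.2 : ℂ) ≠ 0 := by exact_mod_cast hΩ
  have h1 : (∑ j, a j * S.layerVec κ p (l j) 0 = -S.incVec p 0) ↔ a 0 + a 1 + a 2 = -1 := by
    simp [Setup.layerVec, Setup.incVec, Fin.sum_univ_three]
  have h2 : (∑ j, a j * S.layerVec κ p (l j) 1 = -S.incVec p 1) ↔
      a 0 / l 0 + a 1 / l 1 + a 2 / l 2 = -Complex.I / p.2 := by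
    have e1 : Complex.I * p.1 * (a 0 / l 0 + a 1 / l 1 + a 2 / l 2) =
      ∑ j, a j * S.layerVec κ p (l j) 1 := by
      simp [Setup.layerVec, Fin.sum_univ_three]
      ring
    have e2 : Complex.I * p.1 * (-Complex.I / p.2) = -S.incVec p 1 := by
      simp [Setup.incVec]
      linear_combination (-(p.1 : ℂ) / p.2) * Complex.I_sq
    rw [← e1, ← e2, mul_right_inj' (mul_ne_zero hI hk')]
  have h3 : (∑ j, a j * (-l j * S.layerVec κ p (l j) 2) = -(Complex.I * p.2 * S.incVec p 2)) ↔
      a 0 * S.buoy κ p (l 0) + a 1 * S.buoy κ p (l 1) + a 2 * S.buoy κ p (l 2) =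
        -Complex.I * (p.1 * Real.cos S.γ - p.2 * Real.sin S.γ : ℝ) / Real.sin S.γ := by
    have hc : -(Complex.I * S.omega p.1 p.2 / (Real.sin S.γ : ℂ)) ≠ 0 :=
      neg_ne_zero.2 (div_ne_zero (mul_ne_zero hI hΩ') hs')
    rw [← mul_right_inj' hc]
    have e1 : -(Complex.I * S.omega p.1 p.2 / (Real.sin S.γ : ℂ)) *
        ∑ j, a j * (-l j * S.layerVec κ p (l j) 2) =
        a 0 * S.buoy κ p (l 0) + a 1 * S.buoy κ p (l 1) + a 2 * S.buoy κ p (l 2) := by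
      simp only [Setup.buoy, Fin.sum_univ_three]
      ring
    have e2 : -(Complex.I * S.omega p.1 p.2 / (Real.sin S.γ : ℂ)) *
        -(Complex.I * p.2 * S.incVec p 2) =
        -Complex.I * (p.1 * Real.cos S.γ - p.2 * Real.sin S.γ : ℝ) / Real.sin S.γ := by
      simp only [Setup.incVec, Matrix.cons_val]
      push_cast at hs' ⊢
      field_simp
      linear_combination (((p.1 : ℂ) * Complex.cos S.γ - p.2 * Complex.sin S.γ)) * Complex.I_sq
    rw [e1, e2]
  constructor
  · rintro ⟨g1, g2, g3⟩
    exact ⟨h1.1 g1, h2.1 g2, h3.1 g3⟩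
  · rintro ⟨g1, g2, g3⟩
    exact ⟨h1.2 g1, h2.2 g2, h3.2 g3⟩

theorem Setup.isLayerSystem_iff (S : Setup) (ν κ ε : ℝ) (l a : ℝ × ℝ → Fin 3 → ℂ) :
    S.IsLayerSystem ν κ ε l a ↔ Measurable l ∧ Measurable a ∧
      ∀ p, S.spec ε p ≠ 0 → S.IsRootList ν κ p (l p) ∧ S.IsLift κ p (l p) (a p) :=
  ⟨fun h => ⟨h.1, h.2, fun p hp => ⟨⟨h.injective p hp, h.roots p hp, h.order p hp⟩,
    h.lift_u p hp, h.lift_w p hp, h.lift_b p hp⟩⟩,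
  fun ⟨h1, h2, h⟩ => ⟨h1, h2, fun p hp => (h p hp).1.1, fun p hp => (h p hp).1.2,
    fun p hp => (h p hp).1.3, fun p hp => (h p hp).2.1, fun p hp => (h p hp).2.2,
    fun p hp => (h p hp).2.3⟩⟩

end NearCritical

namespace NearCritical

/-! ### Size of the buoyancy coefficient of slow and fast modes. -/

section Buoyancy

variable {Ω κ ν k g δ ρ : ℝ} {l Z : ℂ}

theorem norm_I_mul_ofReal (x : ℝ) : ‖Complex.I * (x : ℂ)‖ = |x| := by simp

theorem norm_sq_sub_le (l : ℂ) (k : ℝ) : ‖l ^ 2 - (k : ℂ) ^ 2‖ ≤ ‖l‖ ^ 2 + k ^ 2 := by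
  refine (norm_sub_le _ _).trans (le_of_eq ?_)
  simp

theorem le_norm_sq_sub (l : ℂ) (k : ℝ) : ‖l‖ ^ 2 - k ^ 2 ≤ ‖l ^ 2 - (k : ℂ) ^ 2‖ := by
  have := norm_sub_norm_le (l ^ 2) ((k : ℂ) ^ 2)
  simpa using this

/-- The buoyancy coefficient of a mode with slow diffusion. -/
theorem norm_buoy_sub_le (hΩ : Ω ≠ 0) (hκ : 0 ≤ κ) (hδ : δ ≤ 1) (hg : 4 * |g| ≤ δ * ‖l‖)
    (hk : k ^ 2 ≤ ‖l‖ ^ 2) (hl : 8 * κ * ‖l‖ ^ 2 ≤ δ * |Ω|) :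
    ‖Complex.I * Ω * (l + Complex.I * g) / (Complex.I * Ω + κ * (l ^ 2 - (k : ℂ) ^ 2)) - l‖ ≤
      δ * ‖l‖ := by
  have hΩ' := abs_pos.2 hΩ
  have h1 : ‖(κ : ℂ) * (l ^ 2 - (k : ℂ) ^ 2)‖ ≤ δ * |Ω| / 4 := by
    rw [norm_mul, Complex.norm_real, Real.norm_of_nonneg hκ]
    have := mul_le_mul_of_nonneg_left ((norm_sq_sub_le l k).trans (add_le_add_right hk _)) hκ
    linarith
  have hδ' : δ * |Ω| ≤ |Ω| := by nlinarith
  have h2 : |Ω| / 2 ≤ ‖Complex.I * Ω + κ * (l ^ 2 - (k : ℂ) ^ 2)‖ := by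
    have := norm_sub_le_norm_add (Complex.I * (Ω : ℂ)) (κ * (l ^ 2 - (k : ℂ) ^ 2))
    rw [norm_I_mul_ofReal] at this
    linarith
  have h3 : Complex.I * Ω + κ * (l ^ 2 - (k : ℂ) ^ 2) ≠ 0 :=
    norm_pos_iff.1 ((half_pos hΩ').trans_le h2)
  have e : Complex.I * Ω * (l + Complex.I * g) / (Complex.I * Ω + κ * (l ^ 2 - (k : ℂ) ^ 2)) - l =
      (Complex.I * Ω * (Complex.I * g) - l * (κ * (l ^ 2 - (k : ℂ) ^ 2))) /
      (Complex.I * Ω + κ * (l ^ 2 - (k : ℂ) ^ 2)) := by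
    field_simp
    ring
  rw [e, norm_div, div_le_iff₀ (norm_pos_iff.2 h3)]
  have h4 : ‖Complex.I * (Ω : ℂ) * (Complex.I * g)‖ = |Ω| * |g| := by simp
  have h5 := norm_sub_le (Complex.I * (Ω : ℂ) * (Complex.I * g)) (l * (κ * (l ^ 2 - (k : ℂ) ^ 2)))
  rw [h4, norm_mul] at h5
  have h6 := mul_le_mul_of_nonneg_left h1 (norm_nonneg l)
  have h7 : 0 ≤ δ * ‖l‖ := le_trans (by positivity) hg
  have h8 := mul_le_mul_of_nonneg_left h2 h7
  have h9 := mul_le_mul_of_nonneg_left hg hΩ'.le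
  nlinarith

/-- The buoyancy coefficient of the fastest mode, when diffusion is not much weaker than
viscosity. -/
theorem norm_buoy_add_le {C : ℝ} (hΩ : Ω ≠ 0) (hν : 0 < ν) (hκ : 0 < κ) (hC : 0 ≤ C)
    (hνκ : ν ≤ C * κ) (hZ : Z ^ 2 = Complex.I * (-(Ω * (ν + κ) / (ν * κ)) : ℝ))
    (hρ : 8 * ρ * (1 + C) ≤ 1) (hlZ : ‖l - Z‖ ≤ ρ * ‖Z‖) (hk : k ^ 2 ≤ ρ * ‖Z‖ ^ 2)
    (hg : 2 * |g| ≤ ρ * ‖l‖) :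
    ‖Complex.I * Ω * (l + Complex.I * g) / (Complex.I * Ω + κ * (l ^ 2 - (k : ℂ) ^ 2)) +
      (ν / κ : ℝ) * l‖ ≤ 9 * (1 + C) * ρ * (ν / κ * ‖l‖) := by
  have hΩ' := abs_pos.2 hΩ
  have hZn : ‖Z‖ ^ 2 = |Ω| * (ν + κ) / (ν * κ) := by
    rw [← norm_pow, hZ, norm_I_mul_ofReal, abs_neg, abs_div, abs_mul, abs_of_pos (add_pos hν hκ),
      abs_of_pos (mul_pos hν hκ)]
  have hZ0 : 0 < ‖Z‖ ^ 2 := by rw [hZn]; positivity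
  have hρ0 : 0 ≤ ρ := by
    by_contra! h
    have := mul_neg_of_neg_of_pos h hZ0
    nlinarith [sq_nonneg k]
  have hρ1 : ρ ≤ 1 := by nlinarith
  set E : ℂ := l ^ 2 - Z ^ 2 - (k : ℂ) ^ 2 with hE
  have hEn : ‖E‖ ≤ 4 * ρ * ‖Z‖ ^ 2 := by
    have e1 : l ^ 2 - Z ^ 2 = (l - Z) * ((l - Z) + 2 * Z) := by ring
    have h1 : ‖l ^ 2 - Z ^ 2‖ ≤ ρ * ‖Z‖ * (3 * ‖Z‖) := by
      rw [e1, norm_mul]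
      have : ‖l - Z + 2 * Z‖ ≤ 3 * ‖Z‖ := by
        refine (norm_add_le _ _).trans ?_
        rw [norm_mul]
        have : ‖(2 : ℂ)‖ = 2 := by simp
        rw [this]
        nlinarith [norm_nonneg Z]
      gcongr
    have h2 : ‖(k : ℂ) ^ 2‖ = k ^ 2 := by simp
    have := norm_sub_le (l ^ 2 - Z ^ 2) ((k : ℂ) ^ 2)
    nlinarith
  have hν' : (ν : ℂ) ≠ 0 := by exact_mod_cast hν.ne'
  have hκ' : (κ : ℂ) ≠ 0 := by exact_mod_cast hκ.ne'
  have hμ : ν + κ ≤ (1 + C) * κ := by linarith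
  have hκE : ‖(κ : ℂ) * E‖ ≤ |Ω| * κ / (2 * ν) := by
    rw [norm_mul, Complex.norm_real, Real.norm_of_nonneg hκ.le]
    calc κ * ‖E‖ ≤ κ * (4 * ρ * ‖Z‖ ^ 2) := by gcongr
      _ = 4 * ρ * (ν + κ) * |Ω| / ν := by rw [hZn]; field_simp
      _ ≤ 4 * ρ * ((1 + C) * κ) * |Ω| / ν := by gcongr
      _ = 8 * ρ * (1 + C) * (|Ω| * κ / (2 * ν)) := by field_simp; ring
      _ ≤ 1 * (|Ω| * κ / (2 * ν)) := by gcongr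
      _ = _ := one_mul _
  -- As `κZ² = -iΩ(ν + κ)/ν`, the term `iΩ` cancels and `-iΩκ/ν` remains. It dominates `κE` because
  -- `ν ≤ Cκ`.
  have eden : Complex.I * Ω + κ * (l ^ 2 - (k : ℂ) ^ 2) =
      Complex.I * ((-(Ω * κ / ν) : ℝ) : ℂ) + κ * E := by
    have : l ^ 2 - (k : ℂ) ^ 2 = E + Z ^ 2 := by rw [hE]; ring
    rw [this, hZ]
    push_cast
    field_simp
    ring
  have hden : |Ω| * κ / (2 * ν) ≤ ‖Complex.I * Ω + κ * (l ^ 2 - (k : ℂ) ^ 2)‖ := by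
    rw [eden]
    have := norm_sub_le_norm_add (Complex.I * ((-(Ω * κ / ν) : ℝ) : ℂ)) (κ * E)
    rw [norm_I_mul_ofReal, abs_neg, abs_div, abs_mul, abs_of_pos hν, abs_of_pos hκ] at this
    have h2 : |Ω| * κ / ν = 2 * (|Ω| * κ / (2 * ν)) := by field_simp
    linarith
  have hden0 : Complex.I * Ω + κ * (l ^ 2 - (k : ℂ) ^ 2) ≠ 0 :=
    norm_pos_iff.1 (lt_of_lt_of_le (by positivity) hden)
  have e : Complex.I * Ω * (l + Complex.I * g) / (Complex.I * Ω + κ * (l ^ 2 - (k : ℂ) ^ 2)) +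
      (ν / κ : ℝ) * l = (l * (ν * E) - Ω * g) /
      (Complex.I * Ω + κ * (l ^ 2 - (k : ℂ) ^ 2)) := by
    rw [eq_div_iff hden0, add_mul, div_mul_cancel₀ _ hden0, hE, hZ]
    push_cast
    field_simp
    linear_combination (Ω * g * κ) * Complex.I_sq
  rw [e, norm_div, div_le_iff₀ (norm_pos_iff.2 hden0)]
  have n1 : ‖l * (ν * E)‖ ≤ ‖l‖ * (4 * ρ * (1 + C) * |Ω|) := by
    rw [norm_mul, norm_mul, Complex.norm_real, Real.norm_of_nonneg hν.le]
    refine mul_le_mul_of_nonneg_left ?_ (norm_nonneg _)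
    calc ν * ‖E‖ ≤ ν * (4 * ρ * ‖Z‖ ^ 2) := by gcongr
      _ = 4 * ρ * (ν + κ) * |Ω| / κ := by rw [hZn]; field_simp
      _ ≤ 4 * ρ * ((1 + C) * κ) * |Ω| / κ := by gcongr
      _ = 4 * ρ * (1 + C) * |Ω| := by field_simp
  have n2 : ‖(Ω : ℂ) * g‖ ≤ |Ω| * (ρ * ‖l‖ / 2) := by
    rw [norm_mul, Complex.norm_real, Complex.norm_real, Real.norm_eq_abs, Real.norm_eq_abs]
    gcongr
    linarith
  have n3 := norm_sub_le (l * (ν * E)) ((Ω : ℂ) * g)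
  have n4 : 9 * (1 + C) * ρ * (ν / κ * ‖l‖) * (|Ω| * κ / (2 * ν)) ≤
      9 * (1 + C) * ρ * (ν / κ * ‖l‖) * ‖Complex.I * Ω + κ * (l ^ 2 - (k : ℂ) ^ 2)‖ := by
    gcongr
  have n5 : 9 * (1 + C) * ρ * (ν / κ * ‖l‖) * (|Ω| * κ / (2 * ν)) =
      9 / 2 * (1 + C) * ρ * ‖l‖ * |Ω| := by field_simp
  have n6 : 0 ≤ C * (ρ * ‖l‖ * |Ω|) := by positivity
  linarith

/-- The buoyancy coefficient of the fastest mode, when diffusion is much weaker than viscosity. -/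
theorem norm_buoy_bounds {s c : ℝ} (hs : s ≠ 0) (hΩ : Ω ≠ 0) (hν : 0 < ν)
    (hroot : (Complex.I * Ω + ν * (l ^ 2 - (k : ℂ) ^ 2)) * (Complex.I * Ω +
      κ * (l ^ 2 - (k : ℂ) ^ 2)) * (l ^ 2 - (k : ℂ) ^ 2) + (s * l + Complex.I * k * c) ^ 2 = 0)
    (hk : 2 * k ^ 2 ≤ ‖l‖ ^ 2) (hkc : 2 * |k * c| ≤ |s| * ‖l‖) (hl : 0 < ‖l‖)
    (hΩl : 4 * |Ω| ≤ ν * ‖l‖ ^ 2) :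
    |Ω| / (16 * s ^ 2) * (ν * ‖l‖ ^ 3) ≤ ‖Complex.I * Ω * (l + Complex.I * (k * c / s : ℝ)) /
      (Complex.I * Ω + κ * (l ^ 2 - (k : ℂ) ^ 2))‖ ∧
    ‖Complex.I * Ω * (l + Complex.I * (k * c / s : ℝ)) /
      (Complex.I * Ω + κ * (l ^ 2 - (k : ℂ) ^ 2))‖ ≤ 12 * |Ω| / s ^ 2 * (ν * ‖l‖ ^ 3) := by
  have hs0 := abs_pos.2 hs
  have hΩ' := abs_pos.2 hΩ
  have hsc : (s : ℂ) ≠ 0 := by exact_mod_cast hs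
  set L := l ^ 2 - (k : ℂ) ^ 2 with hL
  set w := (s : ℂ) * l + Complex.I * k * c with hw
  have hwn : |s| * ‖l‖ / 2 ≤ ‖w‖ ∧ ‖w‖ ≤ 2 * (|s| * ‖l‖) := by
    have e1 : ‖Complex.I * (k : ℂ) * c‖ = |k * c| := by simp
    have e2 : ‖(s : ℂ) * l‖ = |s| * ‖l‖ := by simp
    have h1 := norm_sub_le_norm_add ((s : ℂ) * l) (Complex.I * k * c)
    have h2 := norm_add_le ((s : ℂ) * l) (Complex.I * k * c)
    rw [e1, e2] at h1 h2
    have : 0 < |s| * ‖l‖ := by positivity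
    constructor <;> linarith
  have hw0 : w ≠ 0 := norm_pos_iff.1 (lt_of_lt_of_le (by positivity) hwn.1)
  have hd0 : Complex.I * Ω + κ * L ≠ 0 := by
    intro h
    rw [h, mul_zero, zero_mul, zero_add] at hroot
    exact hw0 (by simpa using hroot)
  -- For dominant viscosity the denominator `iΩ + κL` nearly cancels and cannot be estimated
  -- directly. The root equation gives its inverse as `-(iΩ + νL)L/w²`, where no cancellation
  -- occurs.
  have e : Complex.I * Ω * (l + Complex.I * (k * c / s : ℝ)) / (Complex.I * Ω + κ * L) =
      -(Complex.I * Ω * ((Complex.I * Ω + ν * L) * L)) / (s * w) := by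
    rw [div_eq_div_iff hd0 (mul_ne_zero hsc hw0)]
    have : (s : ℂ) * (l + Complex.I * (k * c / s : ℝ)) = w := by
      rw [hw]; push_cast; field_simp
    linear_combination (Complex.I * Ω) * hroot + (Complex.I * Ω * w) * this
  have hL1 : ‖l‖ ^ 2 / 2 ≤ ‖L‖ := by linarith [le_norm_sq_sub l k]
  have hL2 : ‖L‖ ≤ 2 * ‖l‖ ^ 2 := by linarith [norm_sq_sub_le l k, sq_nonneg k]
  have hνL : ‖(ν : ℂ) * L‖ = ν * ‖L‖ := by
    rw [norm_mul, Complex.norm_real, Real.norm_of_nonneg hν.le]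
  have a1 := norm_sub_le_norm_add ((ν : ℂ) * L) (Complex.I * Ω)
  have a2 := norm_add_le (Complex.I * (Ω : ℂ)) (ν * L)
  rw [add_comm, norm_I_mul_ofReal, hνL] at a1
  rw [norm_I_mul_ofReal, hνL] at a2
  have a3 : ν * ‖l‖ ^ 2 / 4 ≤ ‖Complex.I * Ω + ν * L‖ := by
    have := mul_le_mul_of_nonneg_left hL1 hν.le
    linarith
  have a4 : ‖Complex.I * Ω + ν * L‖ ≤ 3 * (ν * ‖l‖ ^ 2) := by
    have := mul_le_mul_of_nonneg_left hL2 hν.le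
    have : 0 ≤ ν * ‖l‖ ^ 2 := by positivity
    linarith
  have en : ‖-(Complex.I * Ω * ((Complex.I * Ω + ν * L) * L)) / (s * w)‖ =
      |Ω| * (‖Complex.I * Ω + ν * L‖ * ‖L‖) / (|s| * ‖w‖) := by
    rw [norm_div, norm_neg, norm_mul, norm_I_mul_ofReal, norm_mul, norm_mul, Complex.norm_real,
      Real.norm_eq_abs]
  have hs2 : s ^ 2 = |s| ^ 2 := (sq_abs s).symm
  have hwpos : 0 < ‖w‖ := norm_pos_iff.2 hw0
  rw [e, en, hs2]
  constructor
  · calc |Ω| / (16 * |s| ^ 2) * (ν * ‖l‖ ^ 3) =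
        |Ω| * ((ν * ‖l‖ ^ 2 / 4) * (‖l‖ ^ 2 / 2)) / (|s| * (2 * (|s| * ‖l‖))) := by
          field_simp; ring
      _ ≤ _ := by
          gcongr
          exact hwn.2
  · calc |Ω| * (‖Complex.I * Ω + ν * L‖ * ‖L‖) / (|s| * ‖w‖) ≤
        |Ω| * ((3 * (ν * ‖l‖ ^ 2)) * (2 * ‖l‖ ^ 2)) / (|s| * (|s| * ‖l‖ / 2)) := by
          gcongr
          exact hwn.1
      _ = _ := by field_simp; ring

end Buoyancy

end NearCritical

namespace NearCritical

/-! ### Plancherel's identity for the Fourier integral. -/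

section Plancherel

open FourierTransform SchwartzMap

variable {E : Type*} [NormedAddCommGroup E] [InnerProductSpace ℂ E] [CompleteSpace E]

/-- On `L¹ ∩ L²` the Fourier integral represents the `L²` Fourier transform. -/
theorem fourier_ae_eq_fourier_toLp {f : ℝ → E} (h1 : Integrable f) (h2 : MemLp f 2) :
    𝓕 f =ᵐ[volume] (𝓕 (h2.toLp f) : Lp E 2) := by
  have hcont : Continuous (𝓕 f) :=
    VectorFourier.fourierIntegral_continuous Real.continuous_fourierChar
      (by exact continuous_inner) h1
  -- Both functions are tested against smooth compactly supported functions: for the Fourier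
  -- integral the transform passes to the test function by Fubini, for the `L²` transform by its
  -- definition on tempered distributions.
  refine ae_eq_of_integral_contDiff_smul_eq (hcont.locallyIntegrable)
    ((Lp.memLp _).locallyIntegrable (by norm_num)) fun φ hφ hφc => ?_
  have hψc : HasCompactSupport fun x => (φ x : ℂ) := hφc.comp_left (g := fun x : ℝ => (x : ℂ)) rfl
  have hψ : ContDiff ℝ ∞ fun x => (φ x : ℂ) := Complex.ofRealCLM.contDiff.comp hφ
  set ψ : 𝓢(ℝ, ℂ) := hψc.toSchwartzMap hψ with hψdef
  have e1 : ∫ x, ψ x • (𝓕 f) x = ∫ x, (𝓕 ψ) x • f x := by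
    have := VectorFourier.integral_fourierIntegral_smul_eq_flip (L := innerₗ ℝ)
      Real.continuous_fourierChar (by exact continuous_inner) (ψ.integrable (μ := volume)) h1
    rw [flip_innerₗ] at this
    exact this.symm
  have e2 := congrArg (fun T : 𝓢'(ℝ, E) => T ψ)
    (Lp.fourier_toTemperedDistribution_eq (h2.toLp f))
  simp only [TemperedDistribution.fourier_apply, Lp.toTemperedDistribution_apply] at e2
  have e3 : ∫ x, (𝓕 ψ) x • (h2.toLp f) x = ∫ x, (𝓕 ψ) x • f x := by
    refine integral_congr_ae ?_
    filter_upwards [h2.coeFn_toLp] with x hx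
    rw [hx]
  have e4 : ∀ (g : ℝ → E), (∫ x, φ x • g x) = ∫ x, ψ x • g x := fun g => by
    refine integral_congr_ae (Eventually.of_forall fun x => ?_)
    exact (Complex.coe_smul (φ x) (g x)).symm
  rw [e4, e4, e1, ← e3, e2]

theorem lintegral_enorm_fourier_sq {f : ℝ → E} (h1 : Integrable f) (h2 : MemLp f 2) :
    ∫⁻ x, ‖𝓕 f x‖ₑ ^ 2 = ∫⁻ x, ‖f x‖ₑ ^ 2 := by
  have key : ∀ g : Lp E 2 (volume : Measure ℝ), ∫⁻ x, ‖g x‖ₑ ^ 2 = ENNReal.ofReal (‖g‖ ^ 2) := by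
    intro g
    have e := Lp.enorm_def g
    rw [eLpNorm_eq_lintegral_rpow_enorm_toReal (by norm_num) (by norm_num)] at e
    have : ‖g‖ₑ ^ 2 = ENNReal.ofReal (‖g‖ ^ 2) := by
      rw [← ofReal_norm, ENNReal.ofReal_pow (norm_nonneg _)]
    rw [← this, e, ← ENNReal.rpow_natCast, ← ENNReal.rpow_mul]
    simp
  calc ∫⁻ x, ‖𝓕 f x‖ₑ ^ 2 = ∫⁻ x, ‖(𝓕 (h2.toLp f) : Lp E 2 (volume : Measure ℝ)) x‖ₑ ^ 2 :=
        lintegral_congr_ae ((fourier_ae_eq_fourier_toLp h1 h2).mono fun x hx => by simp only [hx])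
    _ = ∫⁻ x, ‖(h2.toLp f) x‖ₑ ^ 2 := by
        rw [key, key, Lp.norm_fourier_eq (h2.toLp f)]
    _ = _ := lintegral_congr_ae (h2.coeFn_toLp.mono fun x hx => by simp only [hx])

/-- Plancherel's identity for the Fourier integral with kernel `e^{ikx}`. -/
theorem lintegral_enorm_exp_integral_sq {f : ℝ → E} (h1 : Integrable f) (h2 : MemLp f 2) :
    ∫⁻ x : ℝ, ‖∫ k : ℝ, Complex.exp (Complex.I * k * x) • f k‖ₑ ^ 2 =
      ENNReal.ofReal (2 * Real.pi) * ∫⁻ x, ‖f x‖ₑ ^ 2 := by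
  -- The transform `𝓕` has kernel `e^(-2πi k ξ)`, so `e^(ikx)` means `ξ = -x/(2π)`; the Jacobian of
  -- this change of variable is the factor `2π`.
  set a : ℝ := -(2 * Real.pi)⁻¹ with ha
  have ha0 : a ≠ 0 := by rw [ha]; simp [Real.pi_ne_zero]
  have e : ∀ x : ℝ, ∫ k : ℝ, Complex.exp (Complex.I * k * x) • f k = 𝓕 f (a * x) := by
    intro x
    rw [Real.fourier_real_eq_integral_exp_smul]
    congr 1
    ext k
    congr 2
    rw [ha]
    push_cast
    have : (Real.pi : ℂ) ≠ 0 := by exact_mod_cast Real.pi_ne_zero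
    field_simp
  simp_rw [e]
  have hmap := Real.map_volume_mul_left ha0
  have hme : MeasurableEmbedding fun x : ℝ => a * x := measurableEmbedding_mulLeft₀ ha0
  have := hme.lintegral_map (μ := volume) fun y => ‖𝓕 f y‖ₑ ^ 2
  rw [← this, hmap, lintegral_smul_measure, lintegral_enorm_fourier_sq h1 h2]
  have habs : |a⁻¹| = 2 * Real.pi := by
    rw [ha, inv_neg, inv_inv, abs_neg, abs_of_pos (by positivity)]
  rw [habs, smul_eq_mul]

end Plancherel

/-- The derivative of `ω⁺` in `m` is `-k(k sin γ + m cos γ)/(k² + m²)^(3/2)`. The choice of branch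
thus becomes the sign of a polynomial, from which measurability and continuity follow. -/
theorem Setup.omega_eq_ite (S : Setup) {p : ℝ × ℝ} (hp : p.1 ≠ 0) : S.omega p.1 p.2 =
    if 0 < p.1 * (Real.sin S.γ * p.1 + Real.cos S.γ * p.2) then S.omegaPlus p.1 p.2
    else -S.omegaPlus p.1 p.2 := by
  have hpos : 0 < p.1 ^ 2 + p.2 ^ 2 := by positivity
  have hd : HasDerivAt (fun m' => S.omegaPlus p.1 m')
      (-(p.1 * (Real.sin S.γ * p.1 + Real.cos S.γ * p.2)) /
        (√(p.1 ^ 2 + p.2 ^ 2) ^ 3)) p.2 := by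
    have h1 : HasDerivAt (fun m' : ℝ => p.1 * Real.cos S.γ - m' * Real.sin S.γ)
        (-Real.sin S.γ) p.2 := by
      simpa using ((hasDerivAt_id p.2).mul_const (Real.sin S.γ)).const_sub (p.1 * Real.cos S.γ)
    have h2 : HasDerivAt (fun m' : ℝ => p.1 ^ 2 + m' ^ 2) (2 * p.2) p.2 := by
      simpa using (hasDerivAt_pow 2 p.2).const_add (p.1 ^ 2)
    have h3 := h1.div (h2.sqrt hpos.ne') (Real.sqrt_pos.2 hpos).ne'
    refine h3.congr_deriv ?_
    have h4 : 0 < √(p.1 ^ 2 + p.2 ^ 2) := Real.sqrt_pos.2 hpos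
    have h5 : √(p.1 ^ 2 + p.2 ^ 2) ^ 2 = p.1 ^ 2 + p.2 ^ 2 := Real.sq_sqrt hpos.le
    field_simp
    rw [h5]
    ring
  have h4 : 0 < √(p.1 ^ 2 + p.2 ^ 2) ^ 3 := pow_pos (Real.sqrt_pos.2 hpos) 3
  simp only [Setup.omega, hd.deriv, neg_div, neg_lt_zero, div_pos_iff_of_pos_right h4]

theorem Setup.measurable_omega (S : Setup) : Measurable fun p : ℝ × ℝ => S.omega p.1 p.2 := by
  have hplus : Measurable fun p : ℝ × ℝ => S.omegaPlus p.1 p.2 := by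
    unfold Setup.omegaPlus; fun_prop
  -- The explicit criterion for the branch needs `k ≠ 0`. On the line `k = 0` measurability comes
  -- from that of the derivative of a function of `m` alone.
  have hzero : Measurable fun p : ℝ × ℝ => S.omega 0 p.2 := by
    have : Measurable fun m : ℝ => S.omega 0 m := by
      have h0 : Measurable fun m : ℝ => S.omegaPlus 0 m := hplus.comp (measurable_const.prodMk
        measurable_id)
      exact Measurable.ite (measurableSet_lt (measurable_deriv _) measurable_const) h0 h0.neg
    exact this.comp measurable_snd
  have : (fun p : ℝ × ℝ => S.omega p.1 p.2) = fun p => if p.1 = 0 then S.omega 0 p.2 else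
      if 0 < p.1 * (Real.sin S.γ * p.1 + Real.cos S.γ * p.2) then S.omegaPlus p.1 p.2
      else -S.omegaPlus p.1 p.2 := by
    ext p
    split_ifs with h1 h2
    · rw [h1]
    · rw [S.omega_eq_ite h1, if_pos h2]
    · rw [S.omega_eq_ite h1, if_neg h2]
  rw [this]
  refine Measurable.ite (measurable_fst (measurableSet_singleton 0)) hzero
    (Measurable.ite (measurableSet_lt measurable_const (by fun_prop)) hplus hplus.neg)

end NearCritical

namespace NearCritical

set_option linter.unusedSectionVars false

/-! ### Norms of superpositions of horizontal waves. -/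

section Packet

variable {E : Type*} [NormedAddCommGroup E] [InnerProductSpace ℂ E] [CompleteSpace E]

theorem integrable_of_bound_of_support {α : Type*} [MeasurableSpace α] {μ : Measure α} {f : α → E}
    {s : Set α} {C : ℝ} (hf : AEStronglyMeasurable f μ) (hs : μ s < ⊤) (hC : ∀ x, ‖f x‖ ≤ C)
    (h0 : ∀ x, x ∉ s → f x = 0) : Integrable f μ := by
  have : IntegrableOn f s μ :=
    Measure.integrableOn_of_bounded hs.ne hf (Eventually.of_forall hC)
  exact this.integrable_of_forall_notMem_eq_zero h0

theorem memLp_two_of_bound_of_support {f : ℝ → E} {s : Set ℝ} {C : ℝ}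
    (hf : AEStronglyMeasurable f volume) (hs : volume s < ⊤) (hC : ∀ x, ‖f x‖ ≤ C)
    (h0 : ∀ x, x ∉ s → f x = 0) : MemLp f 2 := by
  rw [memLp_two_iff_integrable_sq_norm hf]
  refine integrable_of_bound_of_support (E := ℂ) (f := fun x => ((‖f x‖ ^ 2 : ℝ) : ℂ)) (C := C ^ 2)
    (s := s) (by fun_prop) hs ?_ ?_ |>.re
  · intro x
    rw [Complex.norm_real, Real.norm_of_nonneg (by positivity)]
    exact pow_le_pow_left₀ (norm_nonneg _) (hC x) 2
  · intro x hx
    simp [h0 x hx]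

theorem lintegral_enorm_sq_le_of_support {α : Type*} [MeasurableSpace α] {μ : Measure α} {f : α → E}
    {s : Set α} {C d : ℝ} (hs : MeasurableSet s) (hsd : μ s ≤ ENNReal.ofReal d)
    (hC : ∀ x, ‖f x‖ ≤ C) (h0 : ∀ x, x ∉ s → f x = 0) :
    ∫⁻ x, ‖f x‖ₑ ^ 2 ∂μ ≤ ENNReal.ofReal (C ^ 2) * ENNReal.ofReal d := by
  calc ∫⁻ x, ‖f x‖ₑ ^ 2 ∂μ ≤ ∫⁻ x, s.indicator (fun _ => ENNReal.ofReal (C ^ 2)) x ∂μ := by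
        refine lintegral_mono fun x => ?_
        by_cases hx : x ∈ s
        · rw [Set.indicator_of_mem hx, ← ofReal_norm, ← ENNReal.ofReal_pow (norm_nonneg _)]
          exact ENNReal.ofReal_le_ofReal (pow_le_pow_left₀ (norm_nonneg _) (hC x) 2)
        · simp [h0 x hx]
    _ = ENNReal.ofReal (C ^ 2) * μ s := by rw [lintegral_indicator_const hs]
    _ ≤ _ := by gcongr

/-- A superposition of horizontal waves with vertical profiles `g`. -/
noncomputable def packet (g : ℝ → ℝ × ℝ → E) (z : ℝ × ℝ) : E :=
  ∫ p : ℝ × ℝ, Complex.exp (Complex.I * p.1 * z.1) • g z.2 p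

/-- The profiles `g` are measurable, supported in `I × J`, and bounded by `b`. -/
structure ProfileBound (I J : Set ℝ) (d : ℝ) (b : ℝ → ℝ) (g : ℝ → ℝ × ℝ → E) : Prop where
  meas : StronglyMeasurable fun q : ℝ × (ℝ × ℝ) => g q.1 q.2
  measI : MeasurableSet I
  measJ : MeasurableSet J
  volI : volume I ≤ ENNReal.ofReal d
  volJ : volume J ≤ ENNReal.ofReal d
  d_nonneg : 0 ≤ d
  support : ∀ y p, p ∉ I ×ˢ J → g y p = 0
  bound : ∀ y, 0 ≤ y → ∀ p, ‖g y p‖ ≤ b y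

namespace ProfileBound

variable {I J : Set ℝ} {d : ℝ} {b : ℝ → ℝ} {g : ℝ → ℝ × ℝ → E}

theorem norm_exp_I_mul (k x : ℝ) : ‖Complex.exp (Complex.I * k * x)‖ = 1 := by
  have : Complex.I * k * x = ((k * x : ℝ) : ℂ) * Complex.I := by push_cast; ring
  rw [this, Complex.norm_exp_ofReal_mul_I]

theorem vol_prod (h : ProfileBound I J d b g) :
    (volume : Measure (ℝ × ℝ)) (I ×ˢ J) ≤ ENNReal.ofReal (d ^ 2) := by
  rw [Measure.volume_eq_prod, Measure.prod_prod, sq, ENNReal.ofReal_mul h.d_nonneg]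
  exact mul_le_mul' h.volI h.volJ

theorem b_nonneg (h : ProfileBound I J d b g) {y : ℝ} (hy : 0 ≤ y) : 0 ≤ b y :=
  (norm_nonneg _).trans (h.bound y hy 0)

theorem stronglyMeasurable_integrand (h : ProfileBound I J d b g) :
    StronglyMeasurable fun q : (ℝ × ℝ) × (ℝ × ℝ) =>
      Complex.exp (Complex.I * q.2.1 * q.1.1) • g q.1.2 q.2 := by
  refine StronglyMeasurable.smul ?_ ?_
  · exact Continuous.stronglyMeasurable (by fun_prop)
  · exact h.meas.comp_measurable (measurable_snd.comp measurable_fst |>.prodMk measurable_snd)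

theorem integrable (h : ProfileBound I J d b g) (z : ℝ × ℝ) (hz : 0 ≤ z.2) :
    Integrable fun p : ℝ × ℝ => Complex.exp (Complex.I * p.1 * z.1) • g z.2 p := by
  refine integrable_of_bound_of_support (C := b z.2)
    ((h.stronglyMeasurable_integrand.comp_measurable measurable_prodMk_left).aestronglyMeasurable)
    (h.vol_prod.trans_lt ENNReal.ofReal_lt_top) ?_ ?_
  · intro p
    rw [norm_smul, norm_exp_I_mul, one_mul]
    exact h.bound _ hz _
  · intro p hp
    rw [h.support _ _ hp, smul_zero]

theorem stronglyMeasurable_packet (h : ProfileBound I J d b g) :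
    StronglyMeasurable (packet g) :=
  h.stronglyMeasurable_integrand.integral_prod_right'

theorem norm_packet_le (h : ProfileBound I J d b g) (z : ℝ × ℝ) (hz : 0 ≤ z.2) :
    ‖packet g z‖ ≤ b z.2 * d ^ 2 := by
  have hz' : ∀ p, p ∉ I ×ˢ J → Complex.exp (Complex.I * p.1 * z.1) • g z.2 p = 0 := fun p hp => by
    rw [h.support _ _ hp, smul_zero]
  rw [packet, ← setIntegral_eq_integral_of_forall_compl_eq_zero hz']
  refine (norm_setIntegral_le_of_norm_le_const (h.vol_prod.trans_lt ENNReal.ofReal_lt_top)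
    (C := b z.2) ?_).trans ?_
  · intro p _
    rw [norm_smul, norm_exp_I_mul, one_mul]
    exact h.bound _ hz _
  · refine mul_le_mul_of_nonneg_left ?_ (h.b_nonneg hz)
    exact ENNReal.toReal_le_of_le_ofReal (by positivity) h.vol_prod

/-- The vertical superposition of the profiles. -/
noncomputable def column (g : ℝ → ℝ × ℝ → E) (y k : ℝ) : E := ∫ m, g y (k, m)

theorem stronglyMeasurable_column (h : ProfileBound I J d b g) :
    StronglyMeasurable fun q : ℝ × ℝ => column g q.1 q.2 := by
  have : StronglyMeasurable fun q : (ℝ × ℝ) × ℝ => g q.1.1 (q.1.2, q.2) :=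
    h.meas.comp_measurable (measurable_fst.comp measurable_fst |>.prodMk
      ((measurable_snd.comp measurable_fst).prodMk measurable_snd))
  exact this.integral_prod_right'

theorem column_eq_zero (h : ProfileBound I J d b g) (y : ℝ) {k : ℝ} (hk : k ∉ I) :
    column g y k = 0 := by
  have : ∀ m, g y (k, m) = 0 := fun m => h.support _ _ fun hm => hk hm.1
  simp [column, this]

theorem norm_column_le (h : ProfileBound I J d b g) {y : ℝ} (hy : 0 ≤ y) (k : ℝ) :
    ‖column g y k‖ ≤ b y * d := by
  have hz' : ∀ m, m ∉ J → g y (k, m) = 0 := fun m hm => h.support _ _ fun hm' => hm hm'.2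
  rw [column, ← setIntegral_eq_integral_of_forall_compl_eq_zero hz']
  refine (norm_setIntegral_le_of_norm_le_const (h.volJ.trans_lt ENNReal.ofReal_lt_top)
    (C := b y) fun m _ => h.bound _ hy _).trans ?_
  refine mul_le_mul_of_nonneg_left ?_ (h.b_nonneg hy)
  exact ENNReal.toReal_le_of_le_ofReal h.d_nonneg h.volJ

theorem packet_eq (h : ProfileBound I J d b g) (x : ℝ) {y : ℝ} (hy : 0 ≤ y) :
    packet g (x, y) = ∫ k : ℝ, Complex.exp (Complex.I * k * x) • column g y k := by
  have := h.integrable (x, y) hy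
  rw [packet, Measure.volume_eq_prod, integral_prod _ this]
  congr 1
  ext k
  rw [column, ← integral_smul]

/-- Plancherel in `x` alone, at each height: once `m` is integrated out, the packet is a Fourier
integral in `k` of its column. -/
theorem lintegral_packet_sq (h : ProfileBound I J d b g) :
    ∫⁻ z, ‖packet g z‖ₑ ^ 2 ∂halfPlane = ENNReal.ofReal (2 * Real.pi) *
      ∫⁻ y in Set.Ioi 0, ∫⁻ k, ‖column g y k‖ₑ ^ 2 := by
  have hhp : halfPlane = (volume : Measure ℝ).prod (volume.restrict (Set.Ioi 0)) := by
    have : {z : ℝ × ℝ | 0 < z.2} = Set.univ ×ˢ Set.Ioi 0 := by ext z; simp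
    rw [halfPlane, this, Measure.volume_eq_prod, ← Measure.prod_restrict, Measure.restrict_univ]
  rw [hhp, lintegral_prod_symm _ (h.stronglyMeasurable_packet.enorm.pow_const 2).aemeasurable,
    ← lintegral_const_mul' _ _ ENNReal.ofReal_ne_top]
  refine setLIntegral_congr_fun measurableSet_Ioi fun y hy => ?_
  have hy : 0 < y := hy
  simp only [h.packet_eq _ hy.le]
  have hm : AEStronglyMeasurable (column g y) volume :=
    (h.stronglyMeasurable_column.comp_measurable measurable_prodMk_left).aestronglyMeasurable
  have hI : volume I < ⊤ := h.volI.trans_lt ENNReal.ofReal_lt_top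
  exact lintegral_enorm_exp_integral_sq
    (integrable_of_bound_of_support hm hI (h.norm_column_le hy.le)
      (fun k hk => h.column_eq_zero y hk))
    (memLp_two_of_bound_of_support hm hI (h.norm_column_le hy.le)
      (fun k hk => h.column_eq_zero y hk))

theorem memLp_and_eLpNorm_le_of_lintegral {f : ℝ × ℝ → E} (hf : AEStronglyMeasurable f halfPlane)
    {R : ℝ} (h : ∫⁻ z, ‖f z‖ₑ ^ 2 ∂halfPlane ≤ ENNReal.ofReal R) :
    MemLp f 2 halfPlane ∧ eLpNorm f 2 halfPlane ≤ ENNReal.ofReal (√R) := by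
  have e : eLpNorm f 2 halfPlane ≤ ENNReal.ofReal (√R) := by
    rw [eLpNorm_eq_lintegral_rpow_enorm_toReal (by norm_num) (by norm_num), Real.sqrt_eq_rpow]
    rcases le_or_gt 0 R with hR | hR
    · rw [← ENNReal.ofReal_rpow_of_nonneg hR (by norm_num)]
      refine ENNReal.rpow_le_rpow (le_trans (le_of_eq ?_) h) (by norm_num)
      congr 1
      ext z
      simp
    · rw [ENNReal.ofReal_of_nonpos hR.le] at h
      have : ∫⁻ z, ‖f z‖ₑ ^ ((2 : ℝ≥0∞).toReal) ∂halfPlane = 0 := by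
        rw [← nonpos_iff_eq_zero]
        refine le_trans (le_of_eq ?_) h
        congr 1
        ext z
        simp
      rw [this]
      simp
  exact ⟨⟨hf, e.trans_lt ENNReal.ofReal_lt_top⟩, e⟩

theorem memLp_top (h : ProfileBound I J d b g) {B : ℝ} (hB : ∀ y, 0 < y → b y ≤ B) :
    MemLp (packet g) ⊤ halfPlane ∧ eLpNorm (packet g) ⊤ halfPlane ≤ ENNReal.ofReal (B * d ^ 2) := by
  have hb : ∀ᵐ z ∂halfPlane, ‖packet g z‖ ≤ B * d ^ 2 := by
    have hms : MeasurableSet {z : ℝ × ℝ | 0 < z.2} := measurableSet_lt measurable_const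
      measurable_snd
    rw [halfPlane, ae_restrict_iff' hms]
    refine Eventually.of_forall fun z hz => (h.norm_packet_le z (le_of_lt hz)).trans ?_
    exact mul_le_mul_of_nonneg_right (hB _ hz) (by positivity)
  refine ⟨memLp_top_of_bound h.stronglyMeasurable_packet.aestronglyMeasurable _ hb, ?_⟩
  rw [eLpNorm_exponent_top]
  exact eLpNormEssSup_le_of_ae_bound hb

/-- Size of a packet whose profiles decay exponentially. -/
theorem memLp_two_of_decay {B r : ℝ} (hr : 0 < r)
    (h : ProfileBound I J d (fun y => B * Real.exp (-r * y)) g) :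
    MemLp (packet g) 2 halfPlane ∧
      eLpNorm (packet g) 2 halfPlane ≤ ENNReal.ofReal (√(4 * B ^ 2 * d ^ 3 / r)) := by
  refine memLp_and_eLpNorm_le_of_lintegral h.stronglyMeasurable_packet.aestronglyMeasurable ?_
  rw [h.lintegral_packet_sq]
  -- The integral over `m` contributes `d` to the column, hence `d²` to its square, and the support
  -- in `k` one more `d`. The integral over `y` then gives `1/(2r)`.
  have h1 : ∀ y ∈ Set.Ioi (0 : ℝ), ∫⁻ k, ‖column g y k‖ₑ ^ 2 ≤
      ENNReal.ofReal (B ^ 2 * d ^ 3 * Real.exp (-(2 * r) * y)) := by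
    intro y hy
    have hy : 0 < y := hy
    refine (lintegral_enorm_sq_le_of_support h.measI h.volI (h.norm_column_le hy.le)
      (fun k hk => h.column_eq_zero y hk)).trans (le_of_eq ?_)
    rw [← ENNReal.ofReal_mul (by positivity)]
    congr 1
    have : Real.exp (-(2 * r) * y) = Real.exp (-r * y) ^ 2 := by
      rw [← Real.exp_nat_mul]; congr 1; push_cast; ring
    rw [this]
    ring
  have hint : IntegrableOn (fun y => B ^ 2 * d ^ 3 * Real.exp (-(2 * r) * y)) (Set.Ioi 0) :=
    (integrableOn_exp_mul_Ioi (by linarith) 0).const_mul _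
  have hd := h.d_nonneg
  have h2 : ∫⁻ y in Set.Ioi (0 : ℝ), ENNReal.ofReal (B ^ 2 * d ^ 3 * Real.exp (-(2 * r) * y)) =
      ENNReal.ofReal (B ^ 2 * d ^ 3 / (2 * r)) := by
    rw [← ofReal_integral_eq_lintegral_ofReal hint (Eventually.of_forall fun y => by positivity),
      integral_const_mul, integral_exp_mul_Ioi (by linarith) 0]
    congr 1
    simp
    field_simp
  calc ENNReal.ofReal (2 * Real.pi) * ∫⁻ y in Set.Ioi 0, ∫⁻ k, ‖column g y k‖ₑ ^ 2 ≤
      ENNReal.ofReal (2 * Real.pi) * ENNReal.ofReal (B ^ 2 * d ^ 3 / (2 * r)) := by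
        rw [← h2]
        refine mul_le_mul' le_rfl ?_
        exact setLIntegral_mono' measurableSet_Ioi h1
    _ = ENNReal.ofReal (2 * Real.pi * (B ^ 2 * d ^ 3 / (2 * r))) := by
        rw [← ENNReal.ofReal_mul (by positivity)]
    _ ≤ _ := by
        refine ENNReal.ofReal_le_ofReal ?_
        have : 2 * Real.pi * (B ^ 2 * d ^ 3 / (2 * r)) = Real.pi * B ^ 2 * d ^ 3 / r := by
          field_simp
        rw [this]
        gcongr
        exact Real.pi_le_four

/-- Size of a packet of vertically propagating waves. -/
theorem memLp_two_of_wave {B : ℝ} {g₀ : ℝ × ℝ → E} (h : ProfileBound I J d (fun _ => B) g)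
    (hg : ∀ y p, g y p = Complex.exp (Complex.I * p.2 * y) • g₀ p)
    (hg₀ : StronglyMeasurable g₀) :
    MemLp (packet g) 2 halfPlane ∧
      eLpNorm (packet g) 2 halfPlane ≤ ENNReal.ofReal (√(64 * B ^ 2 * d ^ 2)) := by
  refine memLp_and_eLpNorm_le_of_lintegral h.stronglyMeasurable_packet.aestronglyMeasurable ?_
  rw [h.lintegral_packet_sq]
  have hb0 : ∀ p, ‖g₀ p‖ ≤ B := fun p => by
    have := h.bound 0 le_rfl p
    rwa [hg, norm_smul, norm_exp_I_mul, one_mul] at this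
  have hs0 : ∀ p, p ∉ I ×ˢ J → g₀ p = 0 := fun p hp => by
    have := h.support 0 p hp
    rw [hg, smul_eq_zero] at this
    exact this.resolve_left (Complex.exp_ne_zero _)
  -- There is no decay in `y` to use. For fixed `k` the column is a Fourier integral in `m`
  -- evaluated at `y`, so Plancherel applies once the half line is enlarged to the whole line.
  have h1 : ∀ k, ∫⁻ y in Set.Ioi (0 : ℝ), ‖column g y k‖ₑ ^ 2 ≤
      ENNReal.ofReal (2 * Real.pi) * ∫⁻ m, ‖g₀ (k, m)‖ₑ ^ 2 := by
    intro k
    have hm : AEStronglyMeasurable (fun m => g₀ (k, m)) volume :=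
      (hg₀.comp_measurable measurable_prodMk_left).aestronglyMeasurable
    have hJ : volume J < ⊤ := h.volJ.trans_lt ENNReal.ofReal_lt_top
    rw [← lintegral_enorm_exp_integral_sq
      (integrable_of_bound_of_support hm hJ (fun m => hb0 _) (fun m hm => hs0 _ fun h => hm h.2))
      (memLp_two_of_bound_of_support hm hJ (fun m => hb0 _) (fun m hm => hs0 _ fun h => hm h.2))]
    simp only [column, hg]
    exact setLIntegral_le_lintegral _ _
  have h2 : ∫⁻ k, ∫⁻ m, ‖g₀ (k, m)‖ₑ ^ 2 ≤ ENNReal.ofReal (B ^ 2) * ENNReal.ofReal (d ^ 2) := by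
    rw [← lintegral_prod (μ := volume) (ν := volume) (fun p : ℝ × ℝ => ‖g₀ p‖ₑ ^ 2)
      (hg₀.enorm.pow_const 2).aemeasurable]
    exact lintegral_enorm_sq_le_of_support (h.measI.prod h.measJ) h.vol_prod hb0 hs0
  have hswap : ∫⁻ y in Set.Ioi (0 : ℝ), ∫⁻ k, ‖column g y k‖ₑ ^ 2 =
      ∫⁻ k, ∫⁻ y in Set.Ioi (0 : ℝ), ‖column g y k‖ₑ ^ 2 :=
    lintegral_lintegral_swap (h.stronglyMeasurable_column.enorm.pow_const 2).aemeasurable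
  rw [hswap]
  calc ENNReal.ofReal (2 * Real.pi) * ∫⁻ k, ∫⁻ y in Set.Ioi (0 : ℝ), ‖column g y k‖ₑ ^ 2 ≤
      ENNReal.ofReal (2 * Real.pi) * (ENNReal.ofReal (2 * Real.pi) *
        (ENNReal.ofReal (B ^ 2) * ENNReal.ofReal (d ^ 2))) := by
        refine mul_le_mul' le_rfl ?_
        refine (lintegral_mono h1).trans ?_
        rw [lintegral_const_mul' _ _ ENNReal.ofReal_ne_top]
        gcongr
    _ = ENNReal.ofReal (2 * Real.pi * (2 * Real.pi * (B ^ 2 * d ^ 2))) := by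
        rw [← ENNReal.ofReal_mul (by positivity), ← ENNReal.ofReal_mul (by positivity),
          ← ENNReal.ofReal_mul (by positivity)]
    _ ≤ _ := by
        refine ENNReal.ofReal_le_ofReal ?_
        have h3 : 2 * Real.pi ≤ 8 := by linarith [Real.pi_le_four]
        have h4 : 0 ≤ B ^ 2 * d ^ 2 := by positivity
        have h5 : 0 ≤ Real.pi := Real.pi_pos.le
        calc 2 * Real.pi * (2 * Real.pi * (B ^ 2 * d ^ 2)) ≤ 8 * (8 * (B ^ 2 * d ^ 2)) := by gcongr
          _ = _ := by ring

end ProfileBound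

end Packet

end NearCritical

namespace NearCritical

/-! ### Measurable selection of roots and amplitudes. -/

section Selection

variable {α : Type*} [MeasurableSpace α]

/-- The parameters for which a function continuous in `z` has a zero in a compact set form a
measurable set. -/
theorem measurableSet_exists_zero {F : α → ℂ → ℂ} (hm : ∀ z, Measurable fun p => F p z)
    (hc : ∀ p, Continuous (F p)) {s : Set ℂ} (hs : IsCompact s) :
    MeasurableSet {p | ∃ z ∈ s, F p z = 0} := by
  obtain ⟨t, hts, htc, hst⟩ :=
    (TopologicalSpace.IsSeparable.of_separableSpace s).exists_countable_dense_subset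
  -- On a compact set a zero exists if and only if the infimum of `|F p|` is 0, and by continuity a
  -- countable dense subset detects this.
  have : {p | ∃ z ∈ s, F p z = 0} = ⋂ n : ℕ, ⋃ z ∈ t, {p | ‖F p z‖ < 1 / ((n : ℝ) + 1)} := by
    ext p
    simp only [Set.mem_ofPred_eq, Set.mem_iInter, Set.mem_iUnion, exists_prop]
    constructor
    · rintro ⟨z, hz, h0⟩ n
      have hopen : IsOpen {w | ‖F p w‖ < 1 / ((n : ℝ) + 1)} :=
        isOpen_lt (hc p).norm continuous_const
      have hzm : z ∈ {w | ‖F p w‖ < 1 / ((n : ℝ) + 1)} := by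
        simp only [Set.mem_ofPred_eq, h0, norm_zero]; positivity
      obtain ⟨w, hw, hwt⟩ := mem_closure_iff.1 (hst hz) _ hopen hzm
      exact ⟨w, hwt, hw⟩
    · intro h
      obtain ⟨w₀, hw₀, -⟩ := h 0
      obtain ⟨z, hz, hmin⟩ := hs.exists_isMinOn ⟨w₀, hts hw₀⟩ (hc p).norm.continuousOn
      refine ⟨z, hz, ?_⟩
      by_contra h0
      obtain ⟨n, hn⟩ := exists_nat_one_div_lt (norm_pos_iff.2 h0)
      obtain ⟨w, hw, hlt⟩ := h n
      exact absurd (hmin (hts hw)) (not_le.2 (hlt.trans hn))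
  rw [this]
  exact MeasurableSet.iInter fun n => MeasurableSet.biUnion htc fun z _ =>
    measurableSet_lt (hm z).norm measurable_const

/-- A zero which is unique in a closed set depends measurably on the parameters. -/
theorem measurable_of_unique_zero {F : α → ℂ → ℂ} (hm : ∀ z, Measurable fun p => F p z)
    (hc : ∀ p, Continuous (F p)) {D : Set ℂ} (hD : IsClosed D) {E : Set α} (hE : MeasurableSet E)
    {f : α → ℂ} (hf : ∀ p ∈ E, f p ∈ D ∧ F p (f p) = 0)
    (hu : ∀ p ∈ E, ∀ z ∈ D, F p z = 0 → z = f p) (h0 : ∀ p, p ∉ E → f p = 0) : Measurable f := by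
  refine measurable_of_isClosed fun C hC => ?_
  -- By uniqueness, on `E` the value `f p` lies in `C` if and only if `F p` has a zero in `C ∩ D`.
  -- Intersecting with balls makes this set a countable union of compact sets.
  have key : f ⁻¹' C = (E ∩ ⋃ n : ℕ, {p | ∃ z ∈ C ∩ D ∩ Metric.closedBall 0 n, F p z = 0}) ∪
      (Eᶜ ∩ {_p | (0 : ℂ) ∈ C}) := by
    ext p
    simp only [Set.mem_preimage, Set.mem_union, Set.mem_inter_iff, Set.mem_iUnion,
      Set.mem_ofPred_eq, Set.mem_compl_iff]
    by_cases hp : p ∈ E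
    · simp only [hp, true_and, not_true_eq_false, false_and, or_false]
      constructor
      · intro h
        obtain ⟨n, hn⟩ := exists_nat_ge ‖f p‖
        exact ⟨n, f p, ⟨⟨h, (hf p hp).1⟩, by simpa using hn⟩, (hf p hp).2⟩
      · rintro ⟨n, z, ⟨⟨hzC, hzD⟩, -⟩, hz⟩
        rwa [← hu p hp z hzD hz]
    · simp [hp, h0 p hp]
  rw [key]
  refine (hE.inter (MeasurableSet.iUnion fun n => measurableSet_exists_zero hm hc ?_)).union
    (hE.compl.inter (MeasurableSet.const _))
  exact (isCompact_closedBall _ _).inter_left (hC.inter hD)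

end Selection

theorem continuous_layerDisp (ν κ k m Ω q ζ : ℝ) : Continuous (layerDisp ν κ k m Ω q ζ) := by
  unfold layerDisp disp
  fun_prop

variable {S : Setup} {ν κ : ℝ}

/-- The dispersion relation of the layers at the wavenumber `p`. -/
noncomputable def Setup.dispAt (S : Setup) (ν κ : ℝ) (p : ℝ × ℝ) (l : ℂ) : ℂ :=
  layerDisp ν κ p.1 p.2 (S.omega p.1 p.2) (S.slope p) (S.zeta p.1 p.2) l

theorem Setup.isLayerRoot_iff {p : ℝ × ℝ} (hk : p.1 ≠ 0) (l : ℂ) :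
    S.IsLayerRoot ν κ p l ↔ 0 < l.re ∧ S.dispAt ν κ p l = 0 := by
  rw [Setup.IsLayerRoot, S.det_eq_layerDisp ν κ hk, neg_eq_zero, Setup.dispAt]

theorem Setup.measurable_zeta (S : Setup) : Measurable fun p : ℝ × ℝ => S.zeta p.1 p.2 := by
  unfold Setup.zeta
  exact (S.measurable_omega.pow_const 2).sub_const _

theorem Setup.measurable_slope (S : Setup) : Measurable S.slope := by
  unfold Setup.slope
  have := S.measurable_zeta
  fun_prop

theorem Setup.measurable_dispAt (S : Setup) (ν κ : ℝ) (l : ℂ) :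
    Measurable fun p => S.dispAt ν κ p l := by
  unfold Setup.dispAt layerDisp disp
  have h1 := S.measurable_zeta
  have h2 := S.measurable_slope
  have h3 := S.measurable_omega
  fun_prop

/-- The layer roots, in the order in which they lie in the regions `D j`. -/
structure Setup.RootsIn (S : Setup) (ν κ : ℝ) (p : ℝ × ℝ) (D : Fin 3 → Set ℂ) (l : Fin 3 → ℂ) :
    Prop where
  k_ne : p.1 ≠ 0
  roots : ∀ μ : ℂ, 0 ≤ μ.re → (S.dispAt ν κ p μ = 0 ↔ ∃ j, l j = μ)
  re_pos : ∀ j, 0 < (l j).re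
  mem : ∀ j, l j ∈ D j
  lt₀ : ‖l 0‖ < ‖l 2‖
  lt₁ : ‖l 1‖ < ‖l 2‖

theorem Setup.RootsIn.isLayerRoot_iff {p : ℝ × ℝ} {D : Fin 3 → Set ℂ} {l : Fin 3 → ℂ}
    (h : S.RootsIn ν κ p D l) (μ : ℂ) : S.IsLayerRoot ν κ p μ ↔ ∃ j, l j = μ := by
  rw [Setup.isLayerRoot_iff h.k_ne]
  constructor
  · rintro ⟨h1, h2⟩
    exact (h.roots μ h1.le).1 h2
  · rintro ⟨j, rfl⟩
    exact ⟨h.re_pos j, (h.roots _ (h.re_pos j).le).2 ⟨j, rfl⟩⟩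

/-- Regions label the roots, but need not order the first two by modulus: at criticality they have
the same magnitude. The first two entries may have to be exchanged. -/
theorem Setup.RootsIn.isRootList {p : ℝ × ℝ} {D : Fin 3 → Set ℂ} {l : Fin 3 → ℂ}
    (h : S.RootsIn ν κ p D l) (hD : Pairwise fun i j => Disjoint (D i) (D j)) :
    S.IsRootList ν κ p (if ‖l 0‖ ≤ ‖l 1‖ then l else ![l 1, l 0, l 2]) := by
  have hinj : Function.Injective l := fun i j hij => by
    by_contra hne
    exact Set.disjoint_left.1 (hD hne) (h.mem i) (hij ▸ h.mem j)
  split_ifs with h01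
  · exact ⟨hinj, h.isLayerRoot_iff, h01, h.lt₁⟩
  · have n01 : l 0 ≠ l 1 := fun e => absurd (hinj e) (by decide)
    have n02 : l 0 ≠ l 2 := fun e => absurd (hinj e) (by decide)
    have n12 : l 1 ≠ l 2 := fun e => absurd (hinj e) (by decide)
    refine ⟨?_, fun μ => (h.isLayerRoot_iff μ).trans ?_, (not_le.1 h01).le, h.lt₀⟩
    · intro i j
      fin_cases i <;> fin_cases j <;> simp [n01, n02, n12, n01.symm, n02.symm, n12.symm]
    · simp only [Fin.exists_fin_succ, Matrix.cons_val_zero,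
        Matrix.cons_val_succ, IsEmpty.exists_iff, or_false]
      simp only [Fin.succ_zero_eq_one, Fin.succ_one_eq_two]
      tauto

/-- Layer roots separated by fixed closed regions can be listed measurably. -/
theorem Setup.exists_measurable_rootList {E : Set (ℝ × ℝ)} (hE : MeasurableSet E)
    {D : Fin 3 → Set ℂ} (hDc : ∀ j, IsClosed (D j)) (hDr : ∀ j, ∀ z ∈ D j, 0 ≤ z.re)
    (hD : Pairwise fun i j => Disjoint (D i) (D j))
    (h : ∀ p ∈ E, ∃ l, S.RootsIn ν κ p D l) :
    ∃ l : ℝ × ℝ → Fin 3 → ℂ, Measurable l ∧ ∀ p ∈ E, S.IsRootList ν κ p (l p) := by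
  classical
  choose! l hl using h
  let f : Fin 3 → ℝ × ℝ → ℂ := fun j p => if p ∈ E then l p j else 0
  have hf : ∀ j, Measurable (f j) := by
    intro j
    have hfE : ∀ p ∈ E, f j p = l p j := fun p hp => if_pos hp
    refine measurable_of_unique_zero (S.measurable_dispAt ν κ) (fun p => continuous_layerDisp ..)
      (hDc j) hE (fun p hp => ?_) (fun p hp z hz h0 => ?_) (fun p hp => if_neg hp)
    · rw [hfE p hp]
      exact ⟨(hl p hp).mem j, ((hl p hp).roots _ ((hl p hp).re_pos j).le).2 ⟨j, rfl⟩⟩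
    · obtain ⟨i, rfl⟩ := ((hl p hp).roots z (hDr j z hz)).1 h0
      rw [hfE p hp]
      by_contra hne
      have hij : i ≠ j := fun e => hne (by rw [e])
      exact Set.disjoint_left.1 (hD hij) ((hl p hp).mem i) hz
  refine ⟨fun p => if ‖f 0 p‖ ≤ ‖f 1 p‖ then ![f 0 p, f 1 p, f 2 p] else ![f 1 p, f 0 p, f 2 p],
    ?_, ?_⟩
  · refine Measurable.ite (measurableSet_le (hf 0).norm (hf 1).norm) ?_ ?_ <;>
    · refine measurable_pi_iff.2 fun j => ?_
      fin_cases j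
      exacts [hf _, hf _, hf _]
  · intro p hp
    have e : ∀ j, f j p = l p j := fun j => if_pos hp
    have e' : ![l p 0, l p 1, l p 2] = l p := by
      ext j; fin_cases j <;> rfl
    simp only [e, e']
    exact (hl p hp).isRootList hD

/-- The amplitudes determined by the decay rates `l`. -/
noncomputable def Setup.ampAt (S : Setup) (κ : ℝ) (p : ℝ × ℝ) (l : Fin 3 → ℂ) : Fin 3 → ℂ :=
  ampSol (l 0) (l 1) (l 2) (S.buoy κ p (l 0)) (S.buoy κ p (l 1)) (S.buoy κ p (l 2)) (-1)
    (-Complex.I / p.2) (-Complex.I * (p.1 * Real.cos S.γ - p.2 * Real.sin S.γ : ℝ) / Real.sin S.γ)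

theorem Setup.measurable_layerVec (S : Setup) (κ : ℝ) {l : ℝ × ℝ → ℂ} (hl : Measurable l) :
    Measurable fun p => S.layerVec κ p (l p) := by
  have h := S.measurable_omega
  unfold Setup.layerVec
  refine (WithLp.measurable_toLp 2 _).comp (measurable_pi_iff.2 fun j => ?_)
  fin_cases j
  · exact measurable_const
  · simp only [Fin.mk_one, Matrix.cons_val_one, Matrix.cons_val_zero]; fun_prop
  · simp only [Fin.reduceFinMk, Matrix.cons_val]; fun_prop

theorem Setup.measurable_buoy (S : Setup) (κ : ℝ) {l : ℝ × ℝ → ℂ} (hl : Measurable l) :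
    Measurable fun p => S.buoy κ p (l p) := by
  have h := S.measurable_omega
  have h' : Measurable fun p => S.layerVec κ p (l p) 2 :=
    (EuclideanSpace.proj (𝕜 := ℂ) (2 : Fin 3)).continuous.measurable.comp
      (S.measurable_layerVec κ hl)
  unfold Setup.buoy
  fun_prop

theorem Setup.measurable_ampAt (S : Setup) (κ : ℝ) {l : ℝ × ℝ → Fin 3 → ℂ} (hl : Measurable l) :
    Measurable fun p => S.ampAt κ p (l p) := by
  have hl' := fun j => measurable_pi_iff.1 hl j
  have h0 := hl' 0
  have h1 := hl' 1
  have h2 := hl' 2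
  have b0 := S.measurable_buoy κ h0
  have b1 := S.measurable_buoy κ h1
  have b2 := S.measurable_buoy κ h2
  refine measurable_pi_iff.2 fun j => ?_
  unfold Setup.ampAt ampSol ampDet
  fin_cases j
  · simp only [Fin.zero_eta, Matrix.cons_val_zero]; fun_prop
  · simp only [Fin.mk_one, Matrix.cons_val_one, Matrix.cons_val_zero]; fun_prop
  · simp only [Fin.reduceFinMk, Matrix.cons_val]; fun_prop

theorem Setup.isLift_ampAt (S : Setup) (hs : Real.sin S.γ ≠ 0) {p : ℝ × ℝ} (hk : p.1 ≠ 0)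
    (hm : p.2 ≠ 0) (hΩ : S.omega p.1 p.2 ≠ 0) {l : Fin 3 → ℂ} (hl : S.IsRootList ν κ p l)
    (hD : ampDet (l 0) (l 1) (l 2) (S.buoy κ p (l 0)) (S.buoy κ p (l 1)) (S.buoy κ p (l 2)) ≠ 0) :
    S.IsLift κ p l (S.ampAt κ p l) := by
  rw [S.isLift_iff hs κ hk hm hΩ]
  have hne : ∀ j, l j ≠ 0 := fun j h0 => by
    have := hl.re_pos j
    rw [h0] at this
    exact lt_irrefl _ this
  exact ampSol_spec (hne 0) (hne 1) (fun e => absurd (hl.injective e) (by decide)) hD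

end NearCritical

namespace NearCritical

/-! ### From bounds on modes to norms of wave packets. -/

section Sizes

variable {S : Setup} {κ ε D : ℝ} {l a : ℝ × ℝ → Fin 3 → ℂ}

/-- The spectral amplitude is of size `ε⁻²` and supported in a set of size `ε²`. -/
structure Setup.SpecBound (S : Setup) (ε D : ℝ) (I J : Set ℝ) : Prop where
  ε_pos : 0 < ε
  D_pos : 0 < D
  meas : Measurable (S.spec ε)
  measI : MeasurableSet I
  measJ : MeasurableSet J
  volI : volume I ≤ ENNReal.ofReal (D * ε ^ 2)
  volJ : volume J ≤ ENNReal.ofReal (D * ε ^ 2)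
  support : ∀ p, p ∉ I ×ˢ J → S.spec ε p = 0
  bound : ∀ p, ‖S.spec ε p‖ ≤ D / ε ^ 2

theorem measurable_toLp_vec3 {α : Type*} [MeasurableSpace α] {f g h : α → ℂ} (hf : Measurable f)
    (hg : Measurable g) (hh : Measurable h) : Measurable fun x => (!₂[f x, g x, h x] : State) := by
  refine (WithLp.measurable_toLp 2 _).comp (measurable_pi_iff.2 fun j => ?_)
  fin_cases j
  exacts [hf, hg, hh]

theorem Setup.measurable_incVec (S : Setup) : Measurable S.incVec := by
  have h := S.measurable_omega
  unfold Setup.incVec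
  exact measurable_toLp_vec3 (by fun_prop) (by fun_prop) (by fun_prop)

/-- Vertical profiles of a layer packet. -/
noncomputable def Setup.layerProfile (S : Setup) (κ ε : ℝ) (l a : ℝ × ℝ → Fin 3 → ℂ) (j : Fin 3)
    (t y : ℝ) (p : ℝ × ℝ) : State :=
  (S.spec ε p * a p j * Complex.exp (-Complex.I * S.omega p.1 p.2 * t - l p j * y)) •
    S.layerVec κ p (l p j)

theorem Setup.layerIntegrand_eq (S : Setup) (κ ε : ℝ) (l a : ℝ × ℝ → Fin 3 → ℂ) (j : Fin 3)
    (t : ℝ) (z p : ℝ × ℝ) : S.layerIntegrand κ ε l a j t z p =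
      Complex.exp (Complex.I * p.1 * z.1) • S.layerProfile κ ε l a j t z.2 p := by
  rw [Setup.layerIntegrand, Setup.layerProfile, smul_smul]
  congr 1
  rw [mul_left_comm, ← Complex.exp_add]
  congr 2
  ring

theorem Setup.layer_eq_packet (S : Setup) (κ ε : ℝ) (l a : ℝ × ℝ → Fin 3 → ℂ) (j : Fin 3)
    (t : ℝ) : S.layer κ ε l a j t = packet (S.layerProfile κ ε l a j t) := by
  ext1 z
  simp only [Setup.layer, packet, Setup.layerIntegrand_eq]

/-- Vertical profiles of the incident packet. -/
noncomputable def Setup.incProfile (S : Setup) (ε t : ℝ) (p : ℝ × ℝ) : State :=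
  (S.spec ε p * Complex.exp (-Complex.I * S.omega p.1 p.2 * t)) • S.incVec p

theorem Setup.incIntegrand_eq (S : Setup) (ε t : ℝ) (z p : ℝ × ℝ) : S.incIntegrand ε t z p =
    Complex.exp (Complex.I * p.1 * z.1) • (Complex.exp (Complex.I * p.2 * z.2) •
      S.incProfile ε t p) := by
  rw [Setup.incIntegrand, Setup.incProfile, smul_smul, smul_smul]
  congr 1
  rw [mul_left_comm, ← Complex.exp_add, ← Complex.exp_add]
  congr 2
  ring

theorem Setup.incident_eq_packet (S : Setup) (ε t : ℝ) : S.incident ε t =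
    packet fun y p => Complex.exp (Complex.I * p.2 * y) • S.incProfile ε t p := by
  ext1 z
  simp only [Setup.incident, packet, Setup.incIntegrand_eq]

theorem norm_exp_neg_I_mul (w t : ℝ) (x : ℂ) :
    ‖Complex.exp (-Complex.I * w * t - x)‖ = Real.exp (-x.re) := by
  rw [Complex.norm_exp]
  simp

/-- The weight `v` stands for the norm of the whole eigenvector or of its velocity part, so one
estimate serves both kinds of packet. -/
theorem Setup.norm_layerProfile_le {I J : Set ℝ} (h : S.SpecBound ε D I J) {j : Fin 3} {A r : ℝ}
    {v : ℝ × ℝ → ℝ} (hv : ∀ p, 0 ≤ v p)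
    (hA : ∀ p, S.spec ε p ≠ 0 → ‖a p j‖ * v p ≤ A)
    (hA0 : 0 ≤ A) (hr : ∀ p, S.spec ε p ≠ 0 → r ≤ (l p j).re) (t : ℝ) {y : ℝ} (hy : 0 ≤ y)
    (p : ℝ × ℝ) :
    ‖S.spec ε p * a p j * Complex.exp (-Complex.I * S.omega p.1 p.2 * t - l p j * y)‖ * v p ≤
      D / ε ^ 2 * A * Real.exp (-r * y) := by
  have hD := h.D_pos
  have hε := h.ε_pos
  by_cases hp : S.spec ε p = 0
  · rw [hp, zero_mul, zero_mul, norm_zero, zero_mul]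
    positivity
  · rw [norm_mul, norm_mul, norm_exp_neg_I_mul]
    have e : (l p j * (y : ℂ)).re = (l p j).re * y := by simp
    have h1 : Real.exp (-(l p j * (y : ℂ)).re) ≤ Real.exp (-r * y) := by
      rw [e]
      refine Real.exp_le_exp.2 ?_
      nlinarith [mul_le_mul_of_nonneg_right (hr p hp) hy]
    calc ‖S.spec ε p‖ * ‖a p j‖ * Real.exp (-(l p j * (y : ℂ)).re) * v p
        = ‖S.spec ε p‖ * (‖a p j‖ * v p) * Real.exp (-(l p j * (y : ℂ)).re) := by ring
      _ ≤ D / ε ^ 2 * A * Real.exp (-r * y) := by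
        have := hv p
        have := h.bound p
        have := hA p hp
        gcongr

theorem Setup.stronglyMeasurable_layerProfile {I J : Set ℝ} (h : S.SpecBound ε D I J)
    (hl : Measurable l) (ha : Measurable a) (j : Fin 3) (t : ℝ) :
    StronglyMeasurable fun q : ℝ × (ℝ × ℝ) => S.layerProfile κ ε l a j t q.1 q.2 := by
  have h1 := h.meas
  have h2 := S.measurable_omega
  have h3 : Measurable fun p => l p j := measurable_pi_iff.1 hl j
  have h4 : Measurable fun p => a p j := measurable_pi_iff.1 ha j
  have h5 := S.measurable_layerVec κ h3
  unfold Setup.layerProfile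
  have h5' : Measurable fun q : ℝ × (ℝ × ℝ) => S.layerVec κ q.2 (l q.2 j) :=
    h5.comp measurable_snd
  have h3' : Measurable fun q : ℝ × (ℝ × ℝ) => l q.2 j := h3.comp measurable_snd
  have h4' : Measurable fun q : ℝ × (ℝ × ℝ) => a q.2 j := h4.comp measurable_snd
  have h2' : Measurable fun q : ℝ × (ℝ × ℝ) => S.omega q.2.1 q.2.2 := h2.comp measurable_snd
  exact Measurable.stronglyMeasurable (by fun_prop)

theorem Setup.profileBound_layer {I J : Set ℝ} (h : S.SpecBound ε D I J)
    (hl : Measurable l) (ha : Measurable a) {j : Fin 3} {A r : ℝ}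
    (hA : ∀ p, S.spec ε p ≠ 0 → ‖a p j‖ * ‖S.layerVec κ p (l p j)‖ ≤ A)
    (hA0 : 0 ≤ A) (hr : ∀ p, S.spec ε p ≠ 0 → r ≤ (l p j).re) (t : ℝ) :
    ProfileBound I J (D * ε ^ 2) (fun y => D / ε ^ 2 * A * Real.exp (-r * y))
      (S.layerProfile κ ε l a j t) where
  meas := S.stronglyMeasurable_layerProfile h hl ha j t
  measI := h.measI
  measJ := h.measJ
  volI := h.volI
  volJ := h.volJ
  d_nonneg := by have := h.D_pos; positivity
  support y p hp := by rw [Setup.layerProfile, h.support p hp, zero_mul, zero_mul, zero_smul]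
  bound y hy p := by
    rw [Setup.layerProfile, norm_smul]
    exact Setup.norm_layerProfile_le h (fun p => norm_nonneg _) hA hA0 hr t hy p

theorem Setup.integrable_layerIntegrand {I J : Set ℝ} (h : S.SpecBound ε D I J)
    (hl : Measurable l) (ha : Measurable a) {j : Fin 3} {A : ℝ}
    (hA : ∀ p, S.spec ε p ≠ 0 → ‖a p j‖ * ‖S.layerVec κ p (l p j)‖ ≤ A)
    (hA0 : 0 ≤ A) (hr : ∀ p, S.spec ε p ≠ 0 → 0 ≤ (l p j).re) (t : ℝ) (z : ℝ × ℝ) (hz : 0 ≤ z.2) :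
    Integrable (S.layerIntegrand κ ε l a j t z) := by
  have := (Setup.profileBound_layer h hl ha hA hA0 hr t).integrable z hz
  exact this.congr (Eventually.of_forall fun p => (S.layerIntegrand_eq κ ε l a j t z p).symm)

/-- A height `ε⁻²A` over a support of area `ε⁴`. -/
theorem decay_scale_sup {A : ℝ} (hε : 0 < ε) :
    D / ε ^ 2 * A * (D * ε ^ 2) ^ 2 = D ^ 3 * (ε ^ 2 * A) := by
  field_simp

/-- A height squared `ε⁻⁴A²`, a factor `ε⁶` from two integrations in `m` and one in `k`, and `1/r`
from the integration in `y`. -/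
theorem decay_scale_two {A r : ℝ} (hε : 0 < ε) (hD : 0 < D) (hA0 : 0 ≤ A) (hr : 0 < r) :
    √(4 * (D / ε ^ 2 * A) ^ 2 * (D * ε ^ 2) ^ 3 / r) = 2 * √(D ^ 5) * (ε * A * (√r)⁻¹) := by
  have : 4 * (D / ε ^ 2 * A) ^ 2 * (D * ε ^ 2) ^ 3 / r = (2 * (ε * A)) ^ 2 * (D ^ 5 / r) := by
    field_simp
    ring
  rw [this, Real.sqrt_mul (by positivity), Real.sqrt_sq (by positivity),
    Real.sqrt_div (by positivity)]
  ring

theorem Setup.sizeLE_layer_top {I J : Set ℝ} (h : S.SpecBound ε D I J)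
    (hl : Measurable l) (ha : Measurable a) {j : Fin 3} {A : ℝ}
    (hA : ∀ p, S.spec ε p ≠ 0 → ‖a p j‖ * ‖S.layerVec κ p (l p j)‖ ≤ A)
    (hA0 : 0 ≤ A) (hr : ∀ p, S.spec ε p ≠ 0 → 0 ≤ (l p j).re) :
    SizeLE (S.layer κ ε l a j) ⊤ (D ^ 3 * (ε ^ 2 * A)) := by
  intro t
  rw [S.layer_eq_packet, ← decay_scale_sup h.ε_pos]
  refine (Setup.profileBound_layer h hl ha hA hA0 hr t).memLp_top fun y hy => ?_
  simp

theorem Setup.sizeLE_layer_two {I J : Set ℝ} (h : S.SpecBound ε D I J)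
    (hl : Measurable l) (ha : Measurable a) {j : Fin 3} {A r : ℝ}
    (hA : ∀ p, S.spec ε p ≠ 0 → ‖a p j‖ * ‖S.layerVec κ p (l p j)‖ ≤ A)
    (hA0 : 0 ≤ A) (hr0 : 0 < r) (hr : ∀ p, S.spec ε p ≠ 0 → r ≤ (l p j).re) :
    SizeLE (S.layer κ ε l a j) 2 (2 * √(D ^ 5) * (ε * A * (√r)⁻¹)) := by
  intro t
  rw [S.layer_eq_packet, ← decay_scale_two h.ε_pos h.D_pos hA0 hr0]
  exact (Setup.profileBound_layer h hl ha hA hA0 hr t).memLp_two_of_decay hr0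

/-- The projection onto the velocity components. -/
noncomputable def velocityProj : State →L[ℂ] EuclideanSpace ℂ (Fin 2) :=
  ((PiLp.continuousLinearEquiv 2 ℂ fun _ : Fin 2 => ℂ).symm : _ →L[ℂ] _).comp
    (ContinuousLinearMap.pi ![EuclideanSpace.proj 0, EuclideanSpace.proj 1])

theorem velocityProj_apply (v : State) : velocityProj v = !₂[v 0, v 1] := by
  ext j
  fin_cases j <;> rfl

theorem velocity_eq_packet (κ ε : ℝ) (l a : ℝ × ℝ → Fin 3 → ℂ) (j : Fin 3) (t : ℝ) (z : ℝ × ℝ)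
    (hi : Integrable (S.layerIntegrand κ ε l a j t z)) :
    velocity (S.layer κ ε l a j) t z =
      packet (fun y p => velocityProj (S.layerProfile κ ε l a j t y p)) z := by
  have e : velocity (S.layer κ ε l a j) t z = velocityProj (S.layer κ ε l a j t z) := by
    rw [velocityProj_apply]; rfl
  rw [e, Setup.layer, ← velocityProj.integral_comp_comm hi, packet]
  simp only [Setup.layerIntegrand_eq, map_smul]

theorem Setup.profileBound_velocity {I J : Set ℝ} (h : S.SpecBound ε D I J)
    (hl : Measurable l) (ha : Measurable a) {j : Fin 3} {A r : ℝ}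
    (hA : ∀ p, S.spec ε p ≠ 0 → ‖a p j‖ * ‖velocityProj (S.layerVec κ p (l p j))‖ ≤ A)
    (hA0 : 0 ≤ A) (hr : ∀ p, S.spec ε p ≠ 0 → r ≤ (l p j).re) (t : ℝ) :
    ProfileBound I J (D * ε ^ 2) (fun y => D / ε ^ 2 * A * Real.exp (-r * y))
      (fun y p => velocityProj (S.layerProfile κ ε l a j t y p)) where
  meas := velocityProj.continuous.comp_stronglyMeasurable
    (S.stronglyMeasurable_layerProfile h hl ha j t)
  measI := h.measI
  measJ := h.measJ
  volI := h.volI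
  volJ := h.volJ
  d_nonneg := by have := h.D_pos; positivity
  support y p hp := by
    rw [Setup.layerProfile, h.support p hp, zero_mul, zero_mul, zero_smul, map_zero]
  bound y hy p := by
    rw [Setup.layerProfile, map_smul, norm_smul]
    exact Setup.norm_layerProfile_le h (fun p => norm_nonneg _) hA hA0 hr t hy p

theorem Setup.velocity_ae_eq {j : Fin 3}
    (hi : ∀ t z, 0 ≤ z.2 → Integrable (S.layerIntegrand κ ε l a j t z)) (t : ℝ) :
    velocity (S.layer κ ε l a j) t =ᵐ[halfPlane]
      packet (fun y p => velocityProj (S.layerProfile κ ε l a j t y p)) := by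
  have hms : MeasurableSet {z : ℝ × ℝ | 0 < z.2} := measurableSet_lt measurable_const
    measurable_snd
  rw [halfPlane, EventuallyEq, ae_restrict_iff' hms]
  exact Eventually.of_forall fun z hz => velocity_eq_packet κ ε l a j t z (hi t z (le_of_lt hz))

theorem Setup.sizeLE_velocity {I J : Set ℝ} (h : S.SpecBound ε D I J)
    (hl : Measurable l) (ha : Measurable a) {j : Fin 3} {A r : ℝ}
    (hi : ∀ t z, 0 ≤ z.2 → Integrable (S.layerIntegrand κ ε l a j t z))
    (hA : ∀ p, S.spec ε p ≠ 0 → ‖a p j‖ * ‖velocityProj (S.layerVec κ p (l p j))‖ ≤ A)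
    (hA0 : 0 ≤ A) (hr0 : 0 < r) (hr : ∀ p, S.spec ε p ≠ 0 → r ≤ (l p j).re) :
    SizeLE (velocity (S.layer κ ε l a j)) ⊤ (D ^ 3 * (ε ^ 2 * A)) ∧
    SizeLE (velocity (S.layer κ ε l a j)) 2 (2 * √(D ^ 5) * (ε * A * (√r)⁻¹)) := by
  have hD := h.D_pos
  have hε := h.ε_pos
  constructor <;> intro t <;> have hae := Setup.velocity_ae_eq hi t <;>
    rw [memLp_congr_ae hae, eLpNorm_congr_ae hae]
  · rw [← decay_scale_sup h.ε_pos]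
    refine (Setup.profileBound_velocity h hl ha hA hA0 hr t).memLp_top fun y hy => ?_
    have : Real.exp (-r * y) ≤ 1 := Real.exp_le_one_iff.2 (by nlinarith)
    exact mul_le_of_le_one_right (by positivity) this
  · rw [← decay_scale_two h.ε_pos h.D_pos hA0 hr0]
    exact (Setup.profileBound_velocity h hl ha hA hA0 hr t).memLp_two_of_decay hr0

theorem Setup.profileBound_incident {I J : Set ℝ} (h : S.SpecBound ε D I J) {A : ℝ} (hA0 : 0 ≤ A)
    (hA : ∀ p, S.spec ε p ≠ 0 → ‖S.incVec p‖ ≤ A) (t : ℝ) :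
    StronglyMeasurable (S.incProfile ε t) ∧
    ProfileBound I J (D * ε ^ 2) (fun _ => D / ε ^ 2 * A)
      (fun y p => Complex.exp (Complex.I * p.2 * y) • S.incProfile ε t p) := by
  have hD := h.D_pos
  have hε := h.ε_pos
  have h1 := h.meas
  have h2 := S.measurable_omega
  have hm : Measurable (S.incProfile ε t) := by
    unfold Setup.incProfile
    have := S.measurable_incVec
    fun_prop
  refine ⟨hm.stronglyMeasurable, ?_, h.measI, h.measJ, h.volI, h.volJ, by positivity, ?_, ?_⟩
  · exact Measurable.stronglyMeasurable (by fun_prop)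
  · intro y p hp
    rw [Setup.incProfile, h.support p hp, zero_mul, zero_smul, smul_zero]
  · intro y _ p
    rw [norm_smul, ProfileBound.norm_exp_I_mul, one_mul, Setup.incProfile]
    by_cases hp : S.spec ε p = 0
    · rw [hp, zero_mul, zero_smul, norm_zero]
      positivity
    · have e : ‖Complex.exp (-Complex.I * S.omega p.1 p.2 * t)‖ = 1 := by
        have := norm_exp_neg_I_mul (S.omega p.1 p.2) t 0
        simpa using this
      rw [norm_smul, norm_mul, e, mul_one]
      exact mul_le_mul (h.bound p) (hA p hp) (norm_nonneg _) (by positivity)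

theorem Setup.integrable_incIntegrand {I J : Set ℝ} (h : S.SpecBound ε D I J) {A : ℝ} (hA0 : 0 ≤ A)
    (hA : ∀ p, S.spec ε p ≠ 0 → ‖S.incVec p‖ ≤ A) (t : ℝ) (z : ℝ × ℝ) :
    Integrable (S.incIntegrand ε t z) := by
  -- Profile bounds give integrability for `y ≥ 0` only. Since `e^(imy)` is unimodular, the case `y
  -- = 0` implies all the others, including `y < 0`.
  have h1 := (Setup.profileBound_incident h hA0 hA t).2.integrable (z.1, 0) le_rfl
  have e : S.incIntegrand ε t z = fun p => Complex.exp (Complex.I * p.2 * z.2) •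
      S.incIntegrand ε t (z.1, 0) p := by
    ext1 p
    simp only [S.incIntegrand_eq, smul_smul]
    congr 1
    simp
    ring
  rw [e]
  have h2 : Integrable (S.incIntegrand ε t (z.1, 0)) := h1.congr (Eventually.of_forall fun p => by
    simp only [S.incIntegrand_eq])
  exact h2.bdd_smul 1 (Continuous.aestronglyMeasurable (by fun_prop))
    (Eventually.of_forall fun p => (ProfileBound.norm_exp_I_mul p.2 z.2).le)

theorem Setup.sizeLE_incident {I J : Set ℝ} (h : S.SpecBound ε D I J) {A : ℝ} (hA0 : 0 ≤ A)
    (hA : ∀ p, S.spec ε p ≠ 0 → ‖S.incVec p‖ ≤ A) :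
    SizeLE (S.incident ε) ⊤ (D ^ 3 * (ε ^ 2 * A)) ∧ SizeLE (S.incident ε) 2 (8 * D ^ 2 * A) := by
  have hD := h.D_pos
  have hε := h.ε_pos
  constructor <;> intro t <;> rw [S.incident_eq_packet] <;>
    obtain ⟨hm, hb⟩ := Setup.profileBound_incident h hA0 hA t
  · rw [← decay_scale_sup h.ε_pos]
    exact hb.memLp_top fun y _ => le_rfl
  · have := hb.memLp_two_of_wave (fun y p => rfl) hm
    have e : 64 * (D / ε ^ 2 * A) ^ 2 * (D * ε ^ 2) ^ 2 = (8 * D ^ 2 * A) ^ 2 := by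
      field_simp
      ring
    rwa [e, Real.sqrt_sq (by positivity)] at this

theorem SizeLE.mono {E : Type*} [NormedAddCommGroup E] {F : ℝ → ℝ × ℝ → E} {q : ℝ≥0∞} {R R' : ℝ}
    (h : SizeLE F q R) (hR : R ≤ R') : SizeLE F q R' :=
  fun t => ⟨(h t).1, (h t).2.trans (ENNReal.ofReal_le_ofReal hR)⟩

theorem SizeLE.add {E : Type*} [NormedAddCommGroup E] {F G : ℝ → ℝ × ℝ → E} {q : ℝ≥0∞} {R R' : ℝ}
    (hq : 1 ≤ q) (h : SizeLE F q R) (h' : SizeLE G q R') (hR : 0 ≤ R) (hR' : 0 ≤ R') :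
    SizeLE (fun t z => F t z + G t z) q (R + R') := fun t =>
  ⟨(h t).1.add (h' t).1, (eLpNorm_add_le (h t).1.1 (h' t).1.1 hq).trans
    ((add_le_add (h t).2 (h' t).2).trans_eq (ENNReal.ofReal_add hR hR').symm)⟩

theorem Setup.sizeLE_approx_univ {q : ℝ≥0∞} (hq : 1 ≤ q) {R₀ R₁ : ℝ} (hR₀ : 0 ≤ R₀) (hR₁ : 0 ≤ R₁)
    (h : SizeLE (S.incident ε) q R₀) (hj : ∀ j, SizeLE (S.layer κ ε l a j) q R₁) :
    SizeLE (S.approx κ ε l a Finset.univ) q (R₀ + 3 * R₁) := by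
  have h3 := (((hj 0).add hq (hj 1) hR₁ hR₁).add hq (hj 2) (by positivity) hR₁)
  have := h.add hq h3 hR₀ (by positivity)
  have e : S.approx κ ε l a Finset.univ = fun t z => S.incident ε t z +
      (S.layer κ ε l a 0 t z + S.layer κ ε l a 1 t z + S.layer κ ε l a 2 t z) := by
    ext1 t; ext1 z
    rw [Setup.approx, Fin.sum_univ_three]
  rw [e]
  exact this.mono (by linarith)

theorem Setup.sizeLE_approx_pair {q : ℝ≥0∞} (hq : 1 ≤ q) {R₀ R₁ : ℝ} (hR₀ : 0 ≤ R₀) (hR₁ : 0 ≤ R₁)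
    (h : SizeLE (S.incident ε) q R₀) (h1 : SizeLE (S.layer κ ε l a 1) q R₁)
    (h2 : SizeLE (S.layer κ ε l a 2) q R₁) :
    SizeLE (S.approx κ ε l a {1, 2}) q (R₀ + 2 * R₁) := by
  have := h.add hq (h1.add hq h2 hR₁ hR₁) hR₀ (by positivity)
  have e : S.approx κ ε l a {1, 2} = fun t z => S.incident ε t z +
      (S.layer κ ε l a 1 t z + S.layer κ ε l a 2 t z) := by
    ext1 t; ext1 z
    rw [Setup.approx, Finset.sum_pair (by decide)]
  rw [e]
  exact this.mono (by linarith)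

end Sizes

end NearCritical

/-! ### Support of the spectrum, and the filter of small `ε` with nearby wavenumbers. -/

namespace NearCritical

variable {S : Setup}

/-- The wavenumber `p` lies within distance `Mε²` of `P`. -/
def Near (M ε : ℝ) (P p : ℝ × ℝ) : Prop := |p.1 - P.1| ≤ M * ε ^ 2 ∧ |p.2 - P.2| ≤ M * ε ^ 2

theorem exists_bound_of_cutoff {χ : ℝ → ℂ} (hχ : Continuous χ) (hχc : HasCompactSupport χ) :
    ∃ M > 0, (∀ x, ‖χ x‖ ≤ M) ∧ ∀ x, χ x ≠ 0 → |x| ≤ M := by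
  obtain ⟨B, hB⟩ := hχc.exists_bound_of_continuous hχ
  obtain ⟨R, hR⟩ := hχc.isCompact.isBounded.subset_closedBall 0
  refine ⟨max 1 (max B R), by positivity, fun x => (hB x).trans (by simp), fun x hx => ?_⟩
  have := hR (subset_tsupport _ hx)
  rw [mem_closedBall_zero_iff, Real.norm_eq_abs] at this
  exact this.trans (by simp)

theorem Setup.near_of_spec_ne {M ε : ℝ} (hε : 0 < ε) (hM : ∀ x, S.χ x ≠ 0 → |x| ≤ M) {p : ℝ × ℝ}
    (hp : S.spec ε p ≠ 0) : Near M ε (S.k₀, S.m₀) p ∨ Near M ε (-S.k₀, -S.m₀) p := by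
  have hdiv : ∀ x : ℝ, S.χ (x / ε ^ 2) ≠ 0 → |x| ≤ M * ε ^ 2 := fun x hx => by
    have := hM _ hx
    rwa [abs_div, abs_of_pos (by positivity : 0 < ε ^ 2), div_le_iff₀ (by positivity)] at this
  by_contra! hcon
  refine hp ?_
  rw [Setup.spec]
  have z1 : S.χ ((p.1 + S.k₀) / ε ^ 2) * S.χ ((p.2 + S.m₀) / ε ^ 2) = 0 := by
    by_contra h
    refine hcon.2 ⟨?_, ?_⟩
    · simpa using hdiv _ (left_ne_zero_of_mul h)
    · simpa using hdiv _ (right_ne_zero_of_mul h)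
  have z2 : S.χ ((p.1 - S.k₀) / ε ^ 2) * S.χ ((p.2 - S.m₀) / ε ^ 2) = 0 := by
    by_contra h
    exact hcon.1 ⟨hdiv _ (left_ne_zero_of_mul h), hdiv _ (right_ne_zero_of_mul h)⟩
  rw [z1, z2, add_zero, mul_zero]

theorem volume_near_le {M ε : ℝ} (hM : 0 < M) (a b : ℝ) :
    volume (Set.Icc (a - M * ε ^ 2) (a + M * ε ^ 2) ∪ Set.Icc (b - M * ε ^ 2) (b + M * ε ^ 2)) ≤
      ENNReal.ofReal (4 * M * ε ^ 2) := by
  refine (measure_union_le _ _).trans ?_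
  rw [Real.volume_Icc, Real.volume_Icc, ← ENNReal.ofReal_add (by ring_nf; positivity)
    (by ring_nf; positivity)]
  exact ENNReal.ofReal_le_ofReal (by linarith)

theorem Setup.exists_specBound (hχ : Continuous S.χ) (hχc : HasCompactSupport S.χ) :
    ∃ D, ∀ ε > 0, ∃ I J, S.SpecBound ε D I J := by
  obtain ⟨M, hM0, hMb, hMs⟩ := exists_bound_of_cutoff hχ hχc
  refine ⟨4 * M + 2 * M ^ 2, fun ε hε => ⟨_, _, hε, by positivity, ?_, ?_, ?_,
    (volume_near_le (ε := ε) hM0 S.k₀ (-S.k₀)).trans (ENNReal.ofReal_le_ofReal ?_),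
    (volume_near_le (ε := ε) hM0 S.m₀ (-S.m₀)).trans (ENNReal.ofReal_le_ofReal ?_), ?_, ?_⟩⟩
  · unfold Setup.spec
    have := hχ.measurable
    fun_prop
  · exact measurableSet_Icc.union measurableSet_Icc
  · exact measurableSet_Icc.union measurableSet_Icc
  · gcongr; linarith [sq_nonneg M]
  · gcongr; linarith [sq_nonneg M]
  · intro p hp
    by_contra h
    refine hp ?_
    rcases Setup.near_of_spec_ne hε hMs h with ⟨h1, h2⟩ | ⟨h1, h2⟩ <;>
      rw [abs_le] at h1 h2 <;> dsimp only at h1 h2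
    · exact ⟨Or.inl ⟨by linarith, by linarith⟩, Or.inl ⟨by linarith, by linarith⟩⟩
    · exact ⟨Or.inr ⟨by linarith, by linarith⟩, Or.inr ⟨by linarith, by linarith⟩⟩
  · intro p
    have hb : ∀ x y, ‖S.χ x * S.χ y‖ ≤ M ^ 2 := fun x y => by
      rw [norm_mul, sq]
      exact mul_le_mul (hMb x) (hMb y) (norm_nonneg _) hM0.le
    rw [Setup.spec, norm_mul, Complex.norm_real, Real.norm_of_nonneg (by positivity),
      div_mul_eq_mul_div, one_mul]
    gcongr
    refine (norm_add_le _ _).trans ?_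
    linarith [hb ((p.1 + S.k₀) / ε ^ 2) ((p.2 + S.m₀) / ε ^ 2),
      hb ((p.1 - S.k₀) / ε ^ 2) ((p.2 - S.m₀) / ε ^ 2)]

/-- Small `ε`, together with wavenumbers near `P` in the support of the packet. -/
def Setup.germ (S : Setup) (M : ℝ) (P : ℝ × ℝ) : Filter (ℝ × (ℝ × ℝ)) :=
  comap Prod.fst (𝓝[>] (0 : ℝ)) ⊓ 𝓟 {i | S.spec i.1 i.2 ≠ 0 ∧ Near M i.1 P i.2}

/-- The reason for this filter: eventual statements along it are exactly those that hold for all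
small `ε` uniformly over the wavenumbers of the support near `P`. -/
theorem Setup.eventually_germ {M : ℝ} {P : ℝ × ℝ} {Q : ℝ × (ℝ × ℝ) → Prop} :
    (∀ᶠ i in S.germ M P, Q i) ↔
      ∀ᶠ ε in 𝓝[>] (0 : ℝ), ∀ p, S.spec ε p ≠ 0 → Near M ε P p → Q (ε, p) := by
  rw [Setup.germ, eventually_inf_principal, eventually_comap]
  refine eventually_congr (Eventually.of_forall fun ε => ?_)
  constructor
  · intro h p h1 h2
    exact h (ε, p) rfl ⟨h1, h2⟩
  · rintro h ⟨ε', p⟩ rfl ⟨h1, h2⟩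
    exact h p h1 h2

theorem Setup.tendsto_germ_fst (S : Setup) (M : ℝ) (P : ℝ × ℝ) :
    Tendsto Prod.fst (S.germ M P) (𝓝[>] (0 : ℝ)) :=
  tendsto_comap.mono_left inf_le_left

theorem Setup.tendsto_germ_snd (S : Setup) (M : ℝ) (P : ℝ × ℝ) :
    Tendsto Prod.snd (S.germ M P) (𝓝 P) := by
  have hsq : Tendsto (fun i : ℝ × (ℝ × ℝ) => M * i.1 ^ 2) (S.germ M P) (𝓝 0) := by
    have : Tendsto (fun ε : ℝ => M * ε ^ 2) (𝓝[>] 0) (𝓝 0) := by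
      have hc : Continuous fun ε : ℝ => M * ε ^ 2 := by fun_prop
      simpa using (hc.tendsto 0).mono_left nhdsWithin_le_nhds
    exact this.comp (S.tendsto_germ_fst M P)
  have hn : ∀ᶠ i in S.germ M P, Near M i.1 P i.2 :=
    Setup.eventually_germ.2 (Eventually.of_forall fun ε p _ h => h)
  have h1 : Tendsto (fun i : ℝ × (ℝ × ℝ) => i.2.1) (S.germ M P) (𝓝 P.1) := by
    rw [tendsto_iff_norm_sub_tendsto_zero]
    exact squeeze_zero' (Eventually.of_forall fun _ => norm_nonneg _) (hn.mono fun i hi => hi.1) hsq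
  have h2 : Tendsto (fun i : ℝ × (ℝ × ℝ) => i.2.2) (S.germ M P) (𝓝 P.2) := by
    rw [tendsto_iff_norm_sub_tendsto_zero]
    exact squeeze_zero' (Eventually.of_forall fun _ => norm_nonneg _) (hn.mono fun i hi => hi.2) hsq
  exact h1.prodMk_nhds h2

theorem Setup.zeta_eq (S : Setup) {p : ℝ × ℝ} (hk : p.1 ≠ 0) : S.zeta p.1 p.2 =
    (p.1 * Real.cos S.γ - p.2 * Real.sin S.γ) ^ 2 / (p.1 ^ 2 + p.2 ^ 2) - Real.sin S.γ ^ 2 := by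
  have h2 : 0 < p.1 ^ 2 + p.2 ^ 2 := by positivity
  rw [Setup.zeta, ← S.omega_sq hk, mul_div_cancel_right₀ _ h2.ne']

theorem Setup.continuousAt_zeta (S : Setup) {P : ℝ × ℝ} (hk : P.1 ≠ 0) :
    ContinuousAt (fun p : ℝ × ℝ => S.zeta p.1 p.2) P := by
  have h2 : 0 < P.1 ^ 2 + P.2 ^ 2 := by positivity
  have : ContinuousAt (fun p : ℝ × ℝ => (p.1 * Real.cos S.γ - p.2 * Real.sin S.γ) ^ 2 /
      (p.1 ^ 2 + p.2 ^ 2) - Real.sin S.γ ^ 2) P := by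
    refine ContinuousAt.sub (ContinuousAt.div (by fun_prop) (by fun_prop) h2.ne') (by fun_prop)
  refine this.congr ?_
  filter_upwards [continuous_fst.continuousAt.eventually_ne hk] with p hp
  exact (S.zeta_eq hp).symm

/-- Where the polynomial that decides the branch does not vanish, the branch is locally constant. -/
theorem Setup.continuousAt_omega (S : Setup) {P : ℝ × ℝ}
    (hP : P.1 * (Real.sin S.γ * P.1 + Real.cos S.γ * P.2) ≠ 0) :
    ContinuousAt (fun p : ℝ × ℝ => S.omega p.1 p.2) P := by
  have hk : P.1 ≠ 0 := left_ne_zero_of_mul hP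
  have h2 : 0 < P.1 ^ 2 + P.2 ^ 2 := by positivity
  have hplus : ContinuousAt (fun p : ℝ × ℝ => S.omegaPlus p.1 p.2) P := by
    unfold Setup.omegaPlus
    exact ContinuousAt.div (by fun_prop) (by fun_prop) (Real.sqrt_pos.2 h2).ne'
  have hc : ContinuousAt (fun p : ℝ × ℝ => p.1 * (Real.sin S.γ * p.1 + Real.cos S.γ * p.2)) P := by
    fun_prop
  have hne := continuous_fst.continuousAt.eventually_ne hk
  rcases lt_or_gt_of_ne hP with h | h
  · refine hplus.neg.congr ?_
    filter_upwards [hne, hc.eventually_lt_const h] with p h1 h3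
    rw [S.omega_eq_ite h1, if_neg h3.le.not_gt]
    rfl
  · refine hplus.congr ?_
    filter_upwards [hne, hc.eventually_const_lt h] with p h1 h3
    rw [S.omega_eq_ite h1, if_pos h3]

/-- At a critical wavenumber the frequency and the slope coefficient have the same sign. -/
theorem Setup.omega_mul_slope_pos (S : Setup) (hs : Real.sin S.γ ≠ 0)
    {P : ℝ × ℝ} (hk : P.1 ≠ 0) (hζ : S.zeta P.1 P.2 = 0) :
    P.1 * (Real.sin S.γ * P.1 + Real.cos S.γ * P.2) ≠ 0 ∧
      0 < S.omega P.1 P.2 * S.slope P := by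
  have h2 : 0 < P.1 ^ 2 + P.2 ^ 2 := by positivity
  have hsc := Real.sin_sq_add_cos_sq S.γ
  -- As `k ≠ 0`, the equation `ζ = 0` reduces to `k cos 2γ = m sin 2γ`. This fixes the direction of
  -- the wave vector and makes the two linear factors below explicit.
  have e1 : P.1 * (Real.cos S.γ ^ 2 - Real.sin S.γ ^ 2) =
      2 * P.2 * Real.cos S.γ * Real.sin S.γ := by
    have := hζ
    rw [S.zeta_eq hk, sub_eq_zero, div_eq_iff h2.ne'] at this
    have h3 : P.1 * (P.1 * (Real.cos S.γ ^ 2 - Real.sin S.γ ^ 2) -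
      2 * P.2 * Real.cos S.γ * Real.sin S.γ) = 0 := by linear_combination this
    exact sub_eq_zero.1 ((mul_eq_zero.1 h3).resolve_left hk)
  have e2 : 2 * Real.sin S.γ * (P.1 * (Real.sin S.γ * P.1 + Real.cos S.γ * P.2)) = P.1 ^ 2 := by
    linear_combination (-P.1) * e1 + P.1 ^ 2 * hsc
  have e3 : 2 * Real.cos S.γ * (P.1 * Real.cos S.γ - P.2 * Real.sin S.γ) = P.1 := by
    linear_combination e1 + P.1 * hsc
  have hk2 : 0 < P.1 ^ 2 := by positivity
  have hne : P.1 * (Real.sin S.γ * P.1 + Real.cos S.γ * P.2) ≠ 0 := fun h0 => by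
    rw [h0, mul_zero] at e2
    exact hk2.ne e2
  refine ⟨hne, ?_⟩
  have hq : S.slope P = 2 * P.1 * Real.sin S.γ * Real.cos S.γ := by
    rw [Setup.slope, hζ, mul_zero, add_zero]
  have hsq : 0 < √(P.1 ^ 2 + P.2 ^ 2) := Real.sqrt_pos.2 h2
  have e4 : S.omegaPlus P.1 P.2 * S.slope P =
      P.1 ^ 2 * Real.sin S.γ / √(P.1 ^ 2 + P.2 ^ 2) := by
    rw [hq, Setup.omegaPlus]
    field_simp
    linear_combination e3
  -- By `e2` the branch carries the sign of `sin γ`, and by `e4` so does `ω⁺ q`; the product `ω q`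
  -- is therefore positive.
  rw [S.omega_eq_ite hk]
  split_ifs with h
  · rw [e4]
    have : 0 < Real.sin S.γ := by
      by_contra! h'
      nlinarith [mul_nonneg h.le (neg_nonneg.2 h')]
    positivity
  · rw [neg_mul, e4]
    have : Real.sin S.γ < 0 := by
      rcases lt_or_gt_of_ne hs with h' | h'
      · exact h'
      · push Not at h
        nlinarith [mul_nonneg (neg_nonneg.2 h) h'.le]
    have := div_neg_of_neg_of_pos (mul_neg_of_pos_of_neg hk2 this) hsq
    linarith

theorem Setup.nearCriticalFamily (hs : Real.sin S.γ ≠ 0) {M C : ℝ} {P : ℝ × ℝ} (hk : P.1 ≠ 0) (hm : P.2 ≠ 0) [NeBot (S.germ M P)]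
    (hζ : ∀ᶠ ε in 𝓝[>] (0 : ℝ), ∀ p : ℝ × ℝ, S.spec ε p ≠ 0 → |S.zeta p.1 p.2| ≤ C * ε ^ 2)
    {ν κ : ℝ → ℝ} (hν : Tendsto ν (𝓝[>] 0) (𝓝 0)) (hκ : Tendsto κ (𝓝[>] 0) (𝓝 0))
    (hν0 : ∀ᶠ ε in 𝓝[>] (0 : ℝ), 0 < ν ε) (hκ0 : ∀ᶠ ε in 𝓝[>] (0 : ℝ), 0 < κ ε) :
    NearCriticalFamily (S.germ M P) (fun i => ν i.1) (fun i => κ i.1) (fun i => i.2.1)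
      (fun i => i.2.2) (fun i => S.omega i.2.1 i.2.2) (fun i => S.slope i.2)
      (fun i => S.zeta i.2.1 i.2.2) P.1 P.2 (S.omega P.1 P.2) (S.slope P) := by
  have t1 := S.tendsto_germ_fst M P
  have t2 := S.tendsto_germ_snd M P
  have z1 : Tendsto (fun i : ℝ × (ℝ × ℝ) => S.zeta i.2.1 i.2.2) (S.germ M P)
      (𝓝 (S.zeta P.1 P.2)) := (S.continuousAt_zeta hk).tendsto.comp t2
  have z2 : Tendsto (fun i : ℝ × (ℝ × ℝ) => S.zeta i.2.1 i.2.2) (S.germ M P) (𝓝 0) := by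
    refine squeeze_zero_norm' (a := fun i => C * i.1 ^ 2) ?_ ?_
    · exact Setup.eventually_germ.2 (hζ.mono fun ε h p hp _ => h p hp)
    · have : Tendsto (fun ε : ℝ => C * ε ^ 2) (𝓝[>] 0) (𝓝 0) := by
        have hc : Continuous fun ε : ℝ => C * ε ^ 2 := by fun_prop
        simpa using (hc.tendsto 0).mono_left nhdsWithin_le_nhds
      exact this.comp t1
  -- The centre itself is critical: along a nontrivial filter `ζ` tends both to its value at `P` and
  -- to 0.
  have hz := tendsto_nhds_unique z1 z2
  obtain ⟨hne, hpos⟩ := S.omega_mul_slope_pos hs hk hz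
  have k1 : Tendsto (fun i : ℝ × (ℝ × ℝ) => i.2.1) (S.germ M P) (𝓝 P.1) :=
    (continuous_fst.tendsto P).comp t2
  have m1 : Tendsto (fun i : ℝ × (ℝ × ℝ) => i.2.2) (S.germ M P) (𝓝 P.2) :=
    (continuous_snd.tendsto P).comp t2
  exact {
    k_lim := k1
    m_lim := m1
    Ω_lim := (S.continuousAt_omega hne).tendsto.comp t2
    q_lim := by
      unfold Setup.slope
      exact (((k1.const_mul 2).mul_const _).mul_const _).add (m1.mul z1)
    ζ_lim := z2
    ν_lim := hν.comp t1
    κ_lim := hκ.comp t1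
    ν_pos := t1.eventually hν0
    κ_pos := t1.eventually hκ0
    k_ne := hk
    m_ne := hm
    pos := hpos }

/-- Statements which hold near each of the two central wavenumbers hold on the whole support. -/
theorem Setup.eventually_of_germ {M : ℝ} (hM : ∀ x, S.χ x ≠ 0 → |x| ≤ M)
    {Q : ℝ → ℝ → ℝ × ℝ → Prop}
    (h : ∀ P ∈ ({(S.k₀, S.m₀), (-S.k₀, -S.m₀)} : Set (ℝ × ℝ)), NeBot (S.germ M P) →
      ∃ K₀, ∀ K ≥ K₀, ∀ᶠ i in S.germ M P, Q K i.1 i.2) :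
    ∃ K₀, ∀ K ≥ K₀, ∀ᶠ ε in 𝓝[>] (0 : ℝ), ∀ p, S.spec ε p ≠ 0 → Q K ε p := by
  have h' : ∀ P ∈ ({(S.k₀, S.m₀), (-S.k₀, -S.m₀)} : Set (ℝ × ℝ)),
      ∃ K₀, ∀ K ≥ K₀, ∀ᶠ i in S.germ M P, Q K i.1 i.2 := by
    intro P hP
    rcases eq_or_neBot (S.germ M P) with hb | hb
    · exact ⟨0, fun K _ => by rw [hb]; exact eventually_bot⟩
    · exact h P hP hb
  obtain ⟨K₁, h1⟩ := h' _ (Or.inl rfl)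
  obtain ⟨K₂, h2⟩ := h' _ (Or.inr rfl)
  refine ⟨max K₁ K₂, fun K hK => ?_⟩
  filter_upwards [Setup.eventually_germ.1 (h1 K ((le_max_left _ _).trans hK)),
    Setup.eventually_germ.1 (h2 K ((le_max_right _ _).trans hK)),
    self_mem_nhdsWithin] with ε g1 g2 hε p hp
  rcases Setup.near_of_spec_ne hε hM hp with h | h
  · exact g1 p hp h
  · exact g2 p hp h

end NearCritical

/-! ### Pointwise bounds for the layers, and their consequences. -/

namespace NearCritical

variable {S : Setup} {ν κ : ℝ} {p : ℝ × ℝ} {l a : Fin 3 → ℂ}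

/-- Position of the layer roots in `D`, and bounds for every list of layer roots and amplitudes:
real parts above `r`, moduli below `ρ`, modes below `A`, velocity of the last mode below `V`. -/
structure Setup.LayerBounds (S : Setup) (ν κ : ℝ) (p : ℝ × ℝ) (D : Fin 3 → Set ℂ)
    (r ρ A : Fin 3 → ℝ) (V K : ℝ) : Prop where
  m_ne : p.2 ≠ 0
  Ω_ne : S.omega p.1 p.2 ≠ 0
  rootsIn : ∃ l, S.RootsIn ν κ p D l
  det_ne : ∀ l, S.IsRootList ν κ p l → ampDet (l 0) (l 1) (l 2) (S.buoy κ p (l 0))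
    (S.buoy κ p (l 1)) (S.buoy κ p (l 2)) ≠ 0
  re_ge : ∀ l, S.IsRootList ν κ p l → ∀ j, K⁻¹ * r j ≤ (l j).re
  norm_le : ∀ l, S.IsRootList ν κ p l → ∀ j, ‖l j‖ ≤ K * ρ j
  amp_le : ∀ l a, S.IsRootList ν κ p l → S.IsLift κ p l a → ∀ j,
    ‖a j‖ * ‖S.layerVec κ p (l j)‖ ≤ K * A j
  vel_le : ∀ l a, S.IsRootList ν κ p l → S.IsLift κ p l a →
    ‖a 2‖ * ‖velocityProj (S.layerVec κ p (l 2))‖ ≤ K * V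
  inc_le : ‖S.incVec p‖ ≤ K

theorem Setup.LayerBounds.mono {D : Fin 3 → Set ℂ} {r ρ A r' ρ' A' : Fin 3 → ℝ} {V V' K C : ℝ}
    (h : S.LayerBounds ν κ p D r ρ A V K) (hK : 0 < K) (hC : 1 ≤ C) (hr : ∀ j, r' j ≤ C * r j)
    (hρ : ∀ j, ρ j ≤ C * ρ' j) (hA : ∀ j, A j ≤ C * A' j) (hV : V ≤ C * V') :
    S.LayerBounds ν κ p D r' ρ' A' V' (K * C) where
  m_ne := h.m_ne
  Ω_ne := h.Ω_ne
  rootsIn := h.rootsIn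
  det_ne := h.det_ne
  re_ge l hl j := by
    refine le_trans ?_ (h.re_ge l hl j)
    have hC0 : 0 < C := by linarith
    rw [mul_inv, mul_assoc]
    refine mul_le_mul_of_nonneg_left ?_ (by positivity)
    rw [inv_mul_le_iff₀ hC0]
    exact hr j
  norm_le l hl j := (h.norm_le l hl j).trans (by
    rw [mul_assoc]; exact mul_le_mul_of_nonneg_left (hρ j) hK.le)
  amp_le l a hl ha j := (h.amp_le l a hl ha j).trans (by
    rw [mul_assoc]; exact mul_le_mul_of_nonneg_left (hA j) hK.le)
  vel_le l a hl ha := (h.vel_le l a hl ha).trans (by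
    rw [mul_assoc]; exact mul_le_mul_of_nonneg_left hV hK.le)
  inc_le := h.inc_le.trans (by nlinarith)

section Consequences

variable {D : Fin 3 → Set ℂ} {r ρ A : Fin 3 → ℝ} {V K ε B : ℝ} {I J : Set ℝ}

theorem Setup.layersDefined (hs : Real.sin S.γ ≠ 0) (hsp : S.SpecBound ε B I J) (hK : 0 < K)
    (hDc : ∀ j, IsClosed (D j)) (hDr : ∀ j, ∀ z ∈ D j, 0 ≤ z.re)
    (hD : Pairwise fun i j => Disjoint (D i) (D j)) (hA : ∀ j, 0 ≤ A j)
    (h : ∀ p, S.spec ε p ≠ 0 → S.LayerBounds ν κ p D r ρ A V K) : S.LayersDefined ν κ ε := by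
  refine ⟨?_, fun t z => Setup.integrable_incIntegrand hsp hK.le (fun p hp => (h p hp).inc_le) t z,
    fun l a hla j t z hz => ?_⟩
  · obtain ⟨l, hl, hroot⟩ := Setup.exists_measurable_rootList (S := S) (ν := ν) (κ := κ)
      (E := {p | S.spec ε p ≠ 0}) ((hsp.meas (measurableSet_singleton 0)).compl) hDc hDr hD
      (fun p hp => (h p hp).rootsIn)
    refine ⟨l, fun p => S.ampAt κ p (l p), (S.isLayerSystem_iff _ _ _ _ _).2
      ⟨hl, S.measurable_ampAt κ hl, fun p hp => ⟨hroot p hp, ?_⟩⟩⟩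
    have hp' := h p hp
    obtain ⟨l', hl'⟩ := hp'.rootsIn
    exact S.isLift_ampAt hs hl'.k_ne hp'.m_ne hp'.Ω_ne (hroot p hp) (hp'.det_ne _ (hroot p hp))
  · rw [S.isLayerSystem_iff] at hla
    obtain ⟨hl, ha, hla⟩ := hla
    exact Setup.integrable_layerIntegrand hsp hl ha
      (fun p hp => (h p hp).amp_le _ _ (hla p hp).1 (hla p hp).2 j)
      (mul_nonneg hK.le (hA j)) (fun p hp => ((hla p hp).1.re_pos j).le) t z hz

variable {l a : ℝ × ℝ → Fin 3 → ℂ}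

/-- A constant which absorbs those of all the packet bounds. -/
noncomputable def packetConst (B K : ℝ) : ℝ := K + B ^ 3 * K + 2 * √(B ^ 5) * (K * √K) + 8 * B ^ 2 * K

theorem Setup.sizeLE_of_layerBounds (hsp : S.SpecBound ε B I J) (hK : 0 < K) (hA : ∀ j, 0 ≤ A j)
    (hV : 0 ≤ V) (h : ∀ p, S.spec ε p ≠ 0 → S.LayerBounds ν κ p D r ρ A V K)
    (hla : S.IsLayerSystem ν κ ε l a) :
    (∀ j, SizeLE (S.layer κ ε l a j) ⊤ (packetConst B K * (ε ^ 2 * A j))) ∧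
    (∀ j, 0 < r j →
      SizeLE (S.layer κ ε l a j) 2 (packetConst B K * (ε * A j * (√(r j))⁻¹))) ∧
    (0 < r 2 → SizeLE (velocity (S.layer κ ε l a 2)) ⊤ (packetConst B K * (ε ^ 2 * V)) ∧
      SizeLE (velocity (S.layer κ ε l a 2)) 2 (packetConst B K * (ε * V * (√(r 2))⁻¹))) ∧
    SizeLE (S.incident ε) ⊤ (packetConst B K * ε ^ 2) ∧
    SizeLE (S.incident ε) 2 (packetConst B K) := by
  rw [S.isLayerSystem_iff] at hla
  obtain ⟨hl, ha, hla⟩ := hla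
  have hB := hsp.D_pos
  have hε := hsp.ε_pos
  have hAj : ∀ j p, S.spec ε p ≠ 0 → ‖a p j‖ * ‖S.layerVec κ p (l p j)‖ ≤ K * A j :=
    fun j p hp => (h p hp).amp_le _ _ (hla p hp).1 (hla p hp).2 j
  have hA0 : ∀ j, 0 ≤ K * A j := fun j => mul_nonneg hK.le (hA j)
  have hre : ∀ j p, S.spec ε p ≠ 0 → K⁻¹ * r j ≤ (l p j).re :=
    fun j p hp => (h p hp).re_ge _ (hla p hp).1 j
  have hre0 : ∀ j p, S.spec ε p ≠ 0 → 0 ≤ (l p j).re :=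
    fun j p hp => ((hla p hp).1.re_pos j).le
  have c1 : B ^ 3 * K ≤ packetConst B K := by
    have : 0 ≤ K + 2 * √(B ^ 5) * (K * √K) + 8 * B ^ 2 * K := by positivity
    unfold packetConst; linarith
  have c2 : 2 * √(B ^ 5) * (K * √K) ≤ packetConst B K := by
    have : 0 ≤ K + B ^ 3 * K + 8 * B ^ 2 * K := by positivity
    unfold packetConst; linarith
  have c3 : 8 * B ^ 2 * K ≤ packetConst B K := by
    have : 0 ≤ K + B ^ 3 * K + 2 * √(B ^ 5) * (K * √K) := by positivity
    unfold packetConst; linarith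
  have e1 : ∀ X, 0 ≤ X → B ^ 3 * (ε ^ 2 * (K * X)) ≤ packetConst B K * (ε ^ 2 * X) := fun X hX => by
    have := mul_le_mul_of_nonneg_right c1 (by positivity : 0 ≤ ε ^ 2 * X)
    linarith
  have e2 : ∀ X R, 0 ≤ X → 0 < R → 2 * √(B ^ 5) * (ε * (K * X) * (√(K⁻¹ * R))⁻¹) ≤
      packetConst B K * (ε * X * (√R)⁻¹) := fun X R hX hR => by
    have := mul_le_mul_of_nonneg_right c2 (by positivity : 0 ≤ ε * X * (√R)⁻¹)
    refine le_trans (le_of_eq ?_) this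
    rw [Real.sqrt_mul (by positivity), Real.sqrt_inv, mul_inv, inv_inv]
    ring
  refine ⟨fun j => ?_, fun j hr => ?_, fun hr => ?_, ?_, ?_⟩
  · exact (Setup.sizeLE_layer_top hsp hl ha (hAj j) (hA0 j) (hre0 j)).mono (e1 _ (hA j))
  · exact (Setup.sizeLE_layer_two hsp hl ha (hAj j) (hA0 j) (by positivity) (hre j)).mono
      (e2 _ _ (hA j) hr)
  · have := Setup.sizeLE_velocity (κ := κ) hsp hl ha (j := 2) (A := K * V) (r := K⁻¹ * r 2)
      (fun t z hz => Setup.integrable_layerIntegrand hsp hl ha (hAj 2) (hA0 2) (hre0 2) t z hz)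
      (fun p hp => (h p hp).vel_le _ _ (hla p hp).1 (hla p hp).2) (by positivity) (by positivity)
      (hre 2)
    exact ⟨this.1.mono (e1 _ hV), this.2.mono (e2 _ _ hV hr)⟩
  · refine (Setup.sizeLE_incident hsp hK.le (fun p hp => (h p hp).inc_le)).1.mono ?_
    simpa using e1 1 zero_le_one
  · exact (Setup.sizeLE_incident hsp hK.le (fun p hp => (h p hp).inc_le)).2.mono c3

theorem Setup.decayScale_of_layerBounds {j : Fin 3} {b : ℝ} (hK : 0 < K)
    (h : ∀ p, S.spec ε p ≠ 0 → S.LayerBounds ν κ p D r ρ A V K)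
    (hla : S.IsLayerSystem ν κ ε l a) (hr : r j = ε ^ (-b)) (hρ : ρ j = ε ^ (-b)) (hε : 0 < ε)
    {K' : ℝ} (hK' : K ≤ K') : S.DecayScale ε l j b K' := by
  rw [S.isLayerSystem_iff] at hla
  obtain ⟨hl, ha, hla⟩ := hla
  intro p hp
  have h1 := (h p hp).re_ge _ (hla p hp).1 j
  have h2 := (h p hp).norm_le _ (hla p hp).1 j
  rw [hr] at h1
  rw [hρ] at h2
  have := Real.rpow_nonneg hε.le (-b)
  refine ⟨le_trans ?_ h1, h2.trans ?_⟩ <;> gcongr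

end Consequences

section Amplitudes

/-- Bounds for the central wavenumbers and frequency. -/
structure Setup.Moderate (S : Setup) (p : ℝ × ℝ) (B : ℝ) : Prop where
  one_le : 1 ≤ B
  k_ne : p.1 ≠ 0
  m_ne : p.2 ≠ 0
  Ω_ne : S.omega p.1 p.2 ≠ 0
  k_le : |p.1| ≤ B
  m_inv_le : |p.2|⁻¹ ≤ B
  Ω_le : |Real.sin S.γ| / |S.omega p.1 p.2| ≤ B
  rhs_le : |p.1 * Real.cos S.γ - p.2 * Real.sin S.γ| / |Real.sin S.γ| ≤ B
  inc_le : ‖S.incVec p‖ ≤ B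

theorem norm_vec3_le (x y z : ℂ) : ‖(!₂[x, y, z] : State)‖ ≤ ‖x‖ + ‖y‖ + ‖z‖ := by
  rw [EuclideanSpace.norm_eq]
  refine Real.sqrt_le_iff.2 ⟨by positivity, ?_⟩
  simp only [Fin.sum_univ_three, Matrix.cons_val_zero, Matrix.cons_val_one, Matrix.cons_val]
  nlinarith [norm_nonneg x, norm_nonneg y, norm_nonneg z, mul_nonneg (norm_nonneg x) (norm_nonneg y),
    mul_nonneg (norm_nonneg x) (norm_nonneg z), mul_nonneg (norm_nonneg y) (norm_nonneg z)]

theorem norm_vec2_le (x y : ℂ) : ‖(!₂[x, y] : EuclideanSpace ℂ (Fin 2))‖ ≤ ‖x‖ + ‖y‖ := by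
  rw [EuclideanSpace.norm_eq]
  refine Real.sqrt_le_iff.2 ⟨by positivity, ?_⟩
  simp only [Fin.sum_univ_two, Matrix.cons_val_zero, Matrix.cons_val_one]
  nlinarith [mul_nonneg (norm_nonneg x) (norm_nonneg y)]

theorem Setup.norm_velocityProj_layerVec_le (κ : ℝ) {B : ℝ} {z : ℂ} (h : S.Moderate p B)
    (hz : 1 ≤ ‖z‖) : ‖velocityProj (S.layerVec κ p z)‖ ≤ 2 * B := by
  have h0 : (0 : ℝ) < ‖z‖ := by linarith
  rw [velocityProj_apply]
  refine (norm_vec2_le _ _).trans ?_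
  have : ‖Complex.I * p.1 / z‖ ≤ B := by
    rw [norm_div, norm_I_mul_ofReal, div_le_iff₀ h0]
    nlinarith [h.k_le, h.one_le]
  have h1 : ‖S.layerVec κ p z 0‖ + ‖S.layerVec κ p z 1‖ = 1 + ‖Complex.I * p.1 / z‖ := by
    simp [Setup.layerVec]
  rw [h1]
  linarith [h.one_le]

theorem Setup.norm_layerVec_le (hs : Real.sin S.γ ≠ 0) (κ : ℝ) {B : ℝ} {z : ℂ}
    (h : S.Moderate p B) (hz : 1 ≤ ‖z‖) :
    ‖S.layerVec κ p z‖ ≤ 2 * B * (1 + ‖S.buoy κ p z‖ / ‖z‖) := by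
  have h0 : (0 : ℝ) < ‖z‖ := by linarith
  have hΩ := abs_pos.2 h.Ω_ne
  have hsp := abs_pos.2 hs
  have e : S.layerVec κ p z = !₂[S.layerVec κ p z 0, S.layerVec κ p z 1, S.layerVec κ p z 2] := by
    ext j; fin_cases j <;> rfl
  rw [e]
  refine (norm_vec3_le _ _ _).trans ?_
  have h2 : ‖Complex.I * p.1 / z‖ ≤ B := by
    rw [norm_div, norm_I_mul_ofReal, div_le_iff₀ h0]
    nlinarith [h.k_le, h.one_le]
  have h1 : ‖S.layerVec κ p z 0‖ + ‖S.layerVec κ p z 1‖ = 1 + ‖Complex.I * p.1 / z‖ := by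
    simp [Setup.layerVec]
  have h3 : ‖S.layerVec κ p z 2‖ =
      |Real.sin S.γ| / |S.omega p.1 p.2| * (‖S.buoy κ p z‖ / ‖z‖) := by
    rw [Setup.buoy, norm_mul, norm_div, norm_I_mul_ofReal, norm_mul, Complex.norm_real,
      Real.norm_eq_abs]
    field_simp
  rw [h1, h3]
  have h4 := mul_le_mul_of_nonneg_right h.Ω_le (by positivity : 0 ≤ ‖S.buoy κ p z‖ / ‖z‖)
  have h5 : 0 ≤ B * (‖S.buoy κ p z‖ / ‖z‖) := mul_nonneg (by linarith [h.one_le]) (by positivity)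
  linarith [h.one_le]

/-- The bounds of `Separated.norm_amp_le` are multiplied by bounds for the eigenvectors: `6B` for
the slow modes, where `|h| ≤ 2|l|`, and for the fast mode `2B(1 + |h|/|l|)`, or just `2B` for its
velocity part. -/
theorem Setup.amp_bounds (hs : Real.sin S.γ ≠ 0) {κ B c δ : ℝ} (hB : S.Moderate p B)
    (h : Separated c δ (l 0) (l 1) (l 2) (S.buoy κ p (l 0)) (S.buoy κ p (l 1)) (S.buoy κ p (l 2)))
    (hc : 0 < c) (hc1 : c ≤ 1) (hδ : δ ≤ 1) (hcδ : 12 * δ ≤ c ^ 2) (hl2 : 1 ≤ ‖l 2‖)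
    (ha : S.IsLift κ p l a) :
    (∀ j ≠ 2, ‖a j‖ * ‖S.layerVec κ p (l j)‖ ≤ 252 * B ^ 2 / c ^ 3 * ‖l 0‖) ∧
    ‖a 2‖ * ‖velocityProj (S.layerVec κ p (l 2))‖ ≤
      40 * B ^ 2 / c ^ 2 * (‖l 0‖ * ‖l 1‖ / (‖l 1‖ + ‖S.buoy κ p (l 2)‖)) ∧
    ‖a 2‖ * ‖S.layerVec κ p (l 2)‖ ≤
      40 * B ^ 2 / c ^ 2 * (‖l 0‖ * ‖l 1‖ / (‖l 1‖ + ‖S.buoy κ p (l 2)‖)) *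
        (1 + ‖S.buoy κ p (l 2)‖ / ‖l 2‖) := by
  obtain ⟨e1, e2, e3⟩ := (S.isLift_iff hs κ hB.k_ne hB.m_ne hB.Ω_ne a).1 ha
  have hB0 : 0 < B := by linarith [hB.one_le]
  have hl0 := h.one_le
  have hl1 := hl0.trans h.le
  obtain ⟨b0, b1, b2⟩ := h.norm_amp_le (C := B) hc hc1 hδ hcδ (by simpa using hB.one_le)
    (by simpa [norm_div] using hB.m_inv_le)
    (by rw [norm_div, norm_mul, norm_neg, Complex.norm_I, one_mul, Complex.norm_real,
          Complex.norm_real, Real.norm_eq_abs, Real.norm_eq_abs]; exact hB.rhs_le) e1 e2 e3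
  have hx : ∀ z : ℂ, 1 ≤ ‖z‖ → ‖S.buoy κ p z‖ ≤ 2 * ‖z‖ → ‖S.layerVec κ p z‖ ≤ 6 * B := by
    intro z hz hb
    refine (S.norm_layerVec_le hs κ hB hz).trans ?_
    have : ‖S.buoy κ p z‖ / ‖z‖ ≤ 2 := by
      rw [div_le_iff₀ (by linarith)]; exact hb
    nlinarith
  obtain ⟨n0, n1⟩ := h.norms_le hδ
  refine ⟨?_, ?_, ?_⟩
  · have key : ∀ j, ‖a j‖ ≤ 42 * B / c ^ 3 * ‖l 0‖ → ‖S.layerVec κ p (l j)‖ ≤ 6 * B →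
        ‖a j‖ * ‖S.layerVec κ p (l j)‖ ≤ 252 * B ^ 2 / c ^ 3 * ‖l 0‖ := fun j h1 h2 => by
      refine (mul_le_mul h1 h2 (norm_nonneg _) (by positivity)).trans (le_of_eq ?_)
      ring
    intro j hj
    fin_cases j
    · exact key 0 b0 (hx _ hl0 n0)
    · exact key 1 b1 (hx _ hl1 n1)
    · exact absurd rfl hj
  · refine (mul_le_mul b2 (S.norm_velocityProj_layerVec_le κ hB hl2) (norm_nonneg _)
      (by positivity)).trans (le_of_eq ?_)
    ring
  · refine (mul_le_mul b2 (S.norm_layerVec_le hs κ hB hl2) (norm_nonneg _)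
      (by positivity)).trans (le_of_eq ?_)
    ring

end Amplitudes

end NearCritical

/-! ### Coefficients of the modes and their separation. -/

namespace NearCritical

variable {S : Setup} {ν κ : ℝ} {p : ℝ × ℝ} {l : Fin 3 → ℂ}

theorem Setup.IsRootList.ne_zero (h : S.IsRootList ν κ p l) (j : Fin 3) : l j ≠ 0 := fun h0 => by
  have := h.re_pos j
  rw [h0] at this
  exact lt_irrefl _ this

/-- The two slow modes are almost hydrostatic. -/
theorem Setup.buoy_near (hs : Real.sin S.γ ≠ 0) {δ : ℝ} {z : ℂ} (hΩ : S.omega p.1 p.2 ≠ 0)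
    (hκ : 0 < κ) (hδ : δ ≤ 1) (hg : 4 * |p.1 * Real.cos S.γ / Real.sin S.γ| ≤ δ * ‖z‖)
    (hk : |p.1| ≤ ‖z‖) (hz0 : z ≠ 0) (hz : 8 * κ * ‖z‖ ^ 2 ≤ δ * |S.omega p.1 p.2|) :
    ‖S.buoy κ p z - z‖ ≤ δ * ‖z‖ := by
  rw [S.buoy_eq hs κ p hz0]
  refine norm_buoy_sub_le hΩ hκ.le hδ hg ?_ hz
  rw [← sq_abs p.1]
  exact pow_le_pow_left₀ (abs_nonneg _) hk 2

/-- Separation of the modes, given a lower bound for the coefficient of the fast mode. -/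
theorem Setup.IsRootList.separated (h : S.IsRootList ν κ p l) (hs : Real.sin S.γ ≠ 0) {c δ : ℝ}
    (hΩ : S.omega p.1 p.2 ≠ 0) (hκ : 0 < κ) (hδ0 : 0 ≤ δ) (hδ : δ ≤ 1)
    (hg : 4 * |p.1 * Real.cos S.γ / Real.sin S.γ| ≤ δ * ‖l 0‖) (hk : |p.1| ≤ ‖l 0‖)
    (h1 : 1 ≤ ‖l 0‖) (hl : 8 * κ * ‖l 1‖ ^ 2 ≤ δ * |S.omega p.1 p.2|)
    (h12 : ‖l 1‖ ≤ δ * ‖l 2‖) (hsep : c * ‖l 1‖ ≤ ‖l 1 - l 0‖)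
    (hmain : c * (‖l 1‖ + ‖S.buoy κ p (l 2)‖) ≤ ‖l 0 + l 1 - S.buoy κ p (l 2)‖) :
    Separated c δ (l 0) (l 1) (l 2) (S.buoy κ p (l 0)) (S.buoy κ p (l 1)) (S.buoy κ p (l 2)) where
  one_le := h1
  le := h.order.1
  le_mul := h12
  sep := hsep
  near₂ := by
    refine Setup.buoy_near hs hΩ hκ hδ hg hk (h.ne_zero 0) (le_trans ?_ hl)
    have := pow_le_pow_left₀ (norm_nonneg _) h.order.1 2
    gcongr
  near₃ := Setup.buoy_near hs hΩ hκ hδ (hg.trans (mul_le_mul_of_nonneg_left h.order.1 hδ0))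
    (hk.trans h.order.1) (h.ne_zero 1) hl
  main := hmain

/-- An error of `1/200` leaves `re z ≥ (99/200)|Z|` and `|z| ≤ (201/200)|Z|`, more than the stated
ratio requires. -/
theorem norm_and_re_of_near {z Z : ℂ} {ρ : ℝ} (hZ : ‖Z‖ ≤ 2 * Z.re) (hρ : 200 * ρ ≤ 1)
    (h : ‖z - Z‖ ≤ ρ * ‖Z‖) : 199 * ‖Z‖ ≤ 200 * ‖z‖ ∧ 200 * ‖z‖ ≤ 201 * ‖Z‖ ∧
      2 * ‖z‖ ≤ 5 * z.re := by
  have h1 := norm_sub_norm_le Z z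
  have h2 := norm_sub_norm_le z Z
  rw [norm_sub_rev] at h1
  have h3 := (Complex.abs_re_le_norm (z - Z)).trans h
  rw [abs_le, Complex.sub_re] at h3
  have h4 := mul_le_mul_of_nonneg_right hρ (norm_nonneg Z)
  refine ⟨by linarith, by linarith, by linarith [h3.1]⟩

/-- The fast mode when viscosity is not dominant. -/
theorem Setup.buoy_fast_of_le (hs : Real.sin S.γ ≠ 0) {C ρ : ℝ} {z : ℂ}
    (hΩ : S.omega p.1 p.2 ≠ 0) (hν : 0 < ν) (hκ : 0 < κ) (hC : 0 ≤ C) (hνκ : ν ≤ C * κ)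
    (hρ : 200 * ρ * (1 + C) ≤ 1) (hρ0 : 0 < ρ)
    (hz : ‖z - fastRate ν κ (S.omega p.1 p.2)‖ ≤ ρ * ‖fastRate ν κ (S.omega p.1 p.2)‖)
    (hz0 : z ≠ 0) (hk : p.1 ^ 2 ≤ ρ * ‖fastRate ν κ (S.omega p.1 p.2)‖ ^ 2)
    (hg : 2 * |p.1 * Real.cos S.γ / Real.sin S.γ| ≤ ρ * ‖z‖) :
    ‖S.buoy κ p z‖ ≤ 2 * (ν / κ * ‖z‖) ∧ ν / κ * ‖z‖ ≤ 2 * ‖S.buoy κ p z‖ ∧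
      ‖S.buoy κ p z‖ ≤ 8 * (-(S.buoy κ p z)).re := by
  set Z := fastRate ν κ (S.omega p.1 p.2) with hZ
  have hρ' : 200 * ρ ≤ 1 := by nlinarith [mul_nonneg hρ0.le hC]
  obtain ⟨-, -, hre⟩ := norm_and_re_of_near (norm_isqrt_le_re _) hρ' hz
  have hb := norm_buoy_add_le (k := p.1) (g := p.1 * Real.cos S.γ / Real.sin S.γ) hΩ hν hκ hC hνκ
    (by rw [hZ, fastRate, isqrt_sq]) (by nlinarith [mul_nonneg hρ0.le hC]) hz hk hg
  rw [← S.buoy_eq hs κ p hz0] at hb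
  have hνκ0 : 0 < ν / κ := by positivity
  have hN : 0 ≤ ν / κ * ‖z‖ := by positivity
  -- The relative error `9(1 + C)ρ` is at most `9/200`. This is small enough for the coefficient to
  -- inherit a negative real part of its own order from `-(ν/κ) z`.
  have hb' : ‖S.buoy κ p z + (ν / κ : ℝ) * z‖ ≤ 1 / 16 * (ν / κ * ‖z‖) := by
    refine hb.trans (mul_le_mul_of_nonneg_right ?_ hN)
    nlinarith
  have hn : ‖((ν / κ : ℝ) : ℂ) * z‖ = ν / κ * ‖z‖ := by
    rw [norm_mul, Complex.norm_real, Real.norm_of_nonneg hνκ0.le]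
  have h1 := norm_le_norm_add_norm_sub' (S.buoy κ p z) (-((ν / κ : ℝ) * z : ℂ))
  have h2 := norm_le_norm_add_norm_sub (S.buoy κ p z) (-((ν / κ : ℝ) * z : ℂ))
  rw [norm_neg, sub_neg_eq_add, hn] at h1 h2
  have h3 := (Complex.abs_re_le_norm _).trans hb'
  rw [abs_le, Complex.add_re, Complex.re_ofReal_mul] at h3
  have h4 := mul_le_mul_of_nonneg_left hre hνκ0.le
  rw [Complex.neg_re]
  refine ⟨by linarith, by linarith, by linarith [h3.2]⟩

/-- No cancellation can occur: `x` and `y` lie in the closed right half plane and `h` well inside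
the left one, so real parts add up. -/
theorem main_of_re {c : ℝ} {x y h : ℂ} (hc : 0 < c) (hc8 : 8 * c ≤ 1) (hx : 0 ≤ x.re)
    (hy : c * ‖y‖ ≤ y.re) (hh : ‖h‖ ≤ 8 * (-h).re) : c * (‖y‖ + ‖h‖) ≤ ‖x + y - h‖ := by
  refine le_trans ?_ (Complex.re_le_norm _)
  rw [Complex.sub_re, Complex.add_re]
  rw [Complex.neg_re] at hh
  have := mul_le_mul_of_nonneg_left hh hc.le
  nlinarith [norm_nonneg h]

/-- The counterpart for dominant viscosity, where the direction of `h` is not controlled but its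
modulus exceeds the others. -/
theorem main_of_norm {c : ℝ} {x y h : ℂ} (hc : 0 < c) (hc4 : 4 * c ≤ 1) (hx : ‖x‖ ≤ ‖y‖)
    (hh : 4 * ‖y‖ ≤ ‖h‖) : c * (‖y‖ + ‖h‖) ≤ ‖x + y - h‖ := by
  have h1 := norm_sub_norm_le h (x + y)
  rw [norm_sub_rev] at h1
  have h2 := norm_add_le x y
  nlinarith [norm_nonneg y]

/-- The fast mode when viscosity is dominant. -/
theorem Setup.buoy_fast_of_ge (hs : Real.sin S.γ ≠ 0) {ρ : ℝ} {z : ℂ}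
    (hΩ : S.omega p.1 p.2 ≠ 0) (hk0 : p.1 ≠ 0) (hν : 0 < ν) (hκ : 0 < κ) (hνκ : 16 * κ ≤ ν)
    (hζ : 2 * |S.zeta p.1 p.2| ≤ Real.sin S.γ ^ 2) (hroot : S.IsLayerRoot ν κ p z)
    (hρ : 200 * ρ ≤ 1)
    (hz : ‖z - fastRate ν κ (S.omega p.1 p.2)‖ ≤ ρ * ‖fastRate ν κ (S.omega p.1 p.2)‖)
    (hk : 2 * |p.1| ≤ ‖z‖) (hg : 2 * |p.1 * Real.cos S.γ / Real.sin S.γ| ≤ ‖z‖) :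
    ‖S.buoy κ p z‖ ≤ 24 * (ν * ‖z‖ ^ 3) / |S.omega p.1 p.2| ∧
      ν * ‖z‖ ^ 3 / (32 * |S.omega p.1 p.2|) ≤ ‖S.buoy κ p z‖ ∧ ‖z‖ ≤ 8 * ‖S.buoy κ p z‖ := by
  set Ω := S.omega p.1 p.2 with hΩd
  have hΩ' := abs_pos.2 hΩ
  have hs' := abs_pos.2 hs
  have hz0 : z ≠ 0 := fun h0 => by
    have := hroot.1
    rw [h0] at this
    exact lt_irrefl _ this
  obtain ⟨hn, -, -⟩ := norm_and_re_of_near (Z := fastRate ν κ Ω) (norm_isqrt_le_re _) hρ hz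
  have hF := norm_fastRate_sq Ω hν hκ
  have hF' : 16 * |Ω| ≤ ν * ‖fastRate ν κ Ω‖ ^ 2 := by
    rw [hF]
    have : ν * (|Ω| * (ν + κ) / (ν * κ)) = |Ω| * ((ν + κ) / κ) := by field_simp
    rw [this, mul_comm]
    refine mul_le_mul_of_nonneg_left ?_ hΩ'.le
    rw [le_div_iff₀ hκ]
    linarith
  have hνz : 4 * |Ω| ≤ ν * ‖z‖ ^ 2 := by
    have : (199 / 200 * ‖fastRate ν κ Ω‖) ^ 2 ≤ ‖z‖ ^ 2 :=
      pow_le_pow_left₀ (by positivity) (by linarith) 2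
    have := mul_le_mul_of_nonneg_left this hν.le
    nlinarith
  -- Near criticality `ω²` and `sin² γ` agree up to a factor 2, which turns the constants `|ω|/sin²
  -- γ` into multiples of `1/|ω|`.
  have hΩs : Real.sin S.γ ^ 2 ≤ 2 * |Ω| ^ 2 ∧ |Ω| ^ 2 ≤ 2 * Real.sin S.γ ^ 2 := by
    have e : S.zeta p.1 p.2 = Ω ^ 2 - Real.sin S.γ ^ 2 := rfl
    rw [e] at hζ
    have h1 := abs_le.1 (le_refl |Ω ^ 2 - Real.sin S.γ ^ 2|)
    rw [sq_abs]
    constructor <;> linarith [h1.1, h1.2, sq_nonneg Ω]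
  have hs2 : 0 < Real.sin S.γ ^ 2 := by positivity
  obtain ⟨b1, b2⟩ := norm_buoy_bounds (k := p.1) (c := Real.cos S.γ) (κ := κ) hs hΩ hν
    (by have := hroot.2
        rw [S.det_layerMatrix, neg_eq_zero] at this
        exact this)
    (by have := pow_le_pow_left₀ (by positivity) hk 2
        rw [mul_pow, sq_abs] at this
        linarith [sq_nonneg p.1])
    (by rw [abs_div] at hg
        have := mul_le_mul_of_nonneg_left hg hs'.le
        refine le_trans (le_of_eq ?_) this
        field_simp) (norm_pos_iff.2 hz0) hνz
  rw [← S.buoy_eq hs κ p hz0] at b1 b2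
  have hN : 0 ≤ ν * ‖z‖ ^ 3 := by positivity
  have b1' : ν * ‖z‖ ^ 3 / (32 * |Ω|) ≤ ‖S.buoy κ p z‖ := by
    refine le_trans ?_ b1
    rw [div_mul_eq_mul_div, div_le_div_iff₀ (by positivity) (by positivity)]
    have := mul_le_mul_of_nonneg_left hΩs.1 hN
    nlinarith
  refine ⟨b2.trans ?_, b1', ?_⟩
  · rw [div_mul_eq_mul_div, div_le_div_iff₀ (by positivity) (by positivity)]
    have := mul_le_mul_of_nonneg_left hΩs.2 hN
    nlinarith
  · have h5 : 4 * |Ω| * ‖z‖ ≤ ν * ‖z‖ ^ 3 := by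
      have := mul_le_mul_of_nonneg_right hνz (norm_nonneg z)
      nlinarith
    have h6 : ‖z‖ / 8 ≤ ν * ‖z‖ ^ 3 / (32 * |Ω|) := by
      rw [div_le_div_iff₀ (by norm_num) (by positivity)]
      linarith
    linarith

/-- The families of dispersion relations along a family of wavenumbers. -/
abbrev Setup.Family (S : Setup) {ι : Type*} (𝓕 : Filter ι) (ν κ : ι → ℝ) (p : ι → ℝ × ℝ)
    (k₁ m₁ Ω₁ q₁ : ℝ) : Prop :=
  NearCriticalFamily 𝓕 ν κ (fun i => (p i).1) (fun i => (p i).2)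
    (fun i => S.omega (p i).1 (p i).2) (fun i => S.slope (p i))
    (fun i => S.zeta (p i).1 (p i).2) k₁ m₁ Ω₁ q₁

section Family

variable {ι : Type*} {𝓕 : Filter ι} {ν κ : ι → ℝ} {p : ι → ℝ × ℝ} {k₁ m₁ Ω₁ q₁ : ℝ}

theorem exists_abs_le_of_tendsto {f : ι → ℝ} {a : ℝ} (h : Tendsto f 𝓕 (𝓝 a)) :
    ∀ᶠ i in 𝓕, |f i| ≤ |a| + 1 :=
  (h.abs.eventually_lt_const (lt_add_one _)).mono fun _ hi => hi.le

theorem Setup.Family.eventually_moderate (h : S.Family 𝓕 ν κ p k₁ m₁ Ω₁ q₁) :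
    ∃ B, ∀ᶠ i in 𝓕, S.Moderate (p i) B := by
  have tk := h.k_lim
  have tm := h.m_lim
  have tΩ := h.Ω_lim
  have hm := h.m_ne
  have hΩ := h.Ω₀_ne
  have tr := (tk.mul_const (Real.cos S.γ)).sub (tm.mul_const (Real.sin S.γ))
  have e1 := exists_abs_le_of_tendsto tk
  have e2 := exists_abs_le_of_tendsto (tm.inv₀ hm)
  have e3 := exists_abs_le_of_tendsto (tΩ.inv₀ hΩ |>.const_mul |Real.sin S.γ|)
  have e4 := exists_abs_le_of_tendsto (tr.mul_const |Real.sin S.γ|⁻¹)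
  have e5 := exists_abs_le_of_tendsto (tk.div tm hm)
  have e6 := exists_abs_le_of_tendsto (tr.div (tm.mul tΩ) (mul_ne_zero hm hΩ))
  set b1 := |k₁| + 1
  set b2 := |m₁⁻¹| + 1
  set b3 := abs (|Real.sin S.γ| * Ω₁⁻¹) + 1
  set b4 := |(k₁ * Real.cos S.γ - m₁ * Real.sin S.γ) * |Real.sin S.γ|⁻¹| + 1
  set b5 := |k₁ / m₁| + 1
  set b6 := |(k₁ * Real.cos S.γ - m₁ * Real.sin S.γ) / (m₁ * Ω₁)| + 1
  have p1 : 0 ≤ b1 := by positivity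
  have p2 : 0 ≤ b2 := by positivity
  have p3 : 0 ≤ b3 := by positivity
  have p4 : 0 ≤ b4 := by positivity
  have p5 : 0 ≤ b5 := by positivity
  have p6 : 0 ≤ b6 := by positivity
  refine ⟨1 + b1 + b2 + b3 + b4 + b5 + b6, ?_⟩
  filter_upwards [e1, e2, e3, e4, e5, e6, tk.eventually_ne h.k_ne, tm.eventually_ne hm,
    tΩ.eventually_ne hΩ] with i f1 f2 f3 f4 f5 f6 g1 g2 g3
  refine ⟨by linarith, g1, g2, g3, by linarith, ?_, ?_, ?_, ?_⟩
  · rw [abs_inv] at f2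
    linarith
  · rw [abs_mul, abs_abs, abs_inv, ← div_eq_mul_inv] at f3
    linarith
  · rw [abs_mul, abs_inv, abs_abs, ← div_eq_mul_inv] at f4
    linarith
  · rw [Setup.incVec]
    refine (norm_vec3_le _ _ _).trans ?_
    rw [norm_one, norm_neg, Complex.norm_real, norm_div (Complex.I * _), norm_I_mul_ofReal,
      Complex.norm_real, Real.norm_eq_abs, Real.norm_eq_abs, ← abs_div]
    simp only [Pi.div_apply] at f5 f6
    linarith

end Family

end NearCritical

/-! ### Regions and location of the roots at criticality. -/

namespace NearCritical

variable {S : Setup} {ν κ : ℝ} {p : ℝ × ℝ} {η c R ρ K B : ℝ} {l l' : Fin 3 → ℂ}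

/-- Regions which separate the three layer roots at criticality. -/
def critRegion (K η : ℝ) : Fin 3 → Set ℂ :=
  ![{z | 0 ≤ z.re ∧ K⁻¹ / η ≤ z.im ∧ ‖z‖ ≤ K / η},
    {z | 0 ≤ z.re ∧ z.im ≤ -(K⁻¹ / η) ∧ ‖z‖ ≤ K / η},
    {z | 0 ≤ z.re ∧ 2 * (K / η) ≤ ‖z‖}]

theorem isClosed_critRegion (K η : ℝ) (j : Fin 3) : IsClosed (critRegion K η j) := by
  have h1 : IsClosed {z : ℂ | 0 ≤ z.re} := isClosed_le continuous_const Complex.continuous_re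
  fin_cases j
  · exact h1.inter ((isClosed_le continuous_const Complex.continuous_im).inter
      (isClosed_le continuous_norm continuous_const))
  · exact h1.inter ((isClosed_le Complex.continuous_im continuous_const).inter
      (isClosed_le continuous_norm continuous_const))
  · exact h1.inter (isClosed_le continuous_const continuous_norm)

theorem re_nonneg_of_mem_critRegion (j : Fin 3) : ∀ z ∈ critRegion K η j, 0 ≤ z.re := by
  intro z hz
  fin_cases j <;> exact hz.1

theorem pairwise_of_three {P : Fin 3 → Fin 3 → Prop} (hs : ∀ i j, P i j → P j i) (h1 : P 0 1)
    (h2 : P 0 2) (h3 : P 1 2) : Pairwise P := by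
  intro i j hij
  fin_cases i <;> fin_cases j <;> simp_all

theorem disjoint_critRegion (hK : 0 < K) (hη : 0 < η) :
    Pairwise fun i j => Disjoint (critRegion K η i) (critRegion K η j) := by
  have h1 : 0 < K⁻¹ / η := by positivity
  have h2 : 0 < K / η := by positivity
  refine pairwise_of_three (fun i j h => h.symm) ?_ ?_ ?_ <;>
    refine Set.disjoint_left.2 fun z hz hz' => ?_
  · linarith [hz.2.1, hz'.2.1]
  · linarith [hz.2.2, hz'.2]
  · linarith [hz.2.2, hz'.2]

/-- Location of the layer roots at criticality. -/
structure Setup.CriticalRoots (S : Setup) (ν κ : ℝ) (p : ℝ × ℝ) (η c R ρ : ℝ) (l : Fin 3 → ℂ) :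
    Prop where
  k_ne : p.1 ≠ 0
  roots : ∀ μ : ℂ, 0 ≤ μ.re → (S.dispAt ν κ p μ = 0 ↔ ∃ j, l j = μ)
  slow : ∀ j, j ≠ 2 → c / η ≤ (l j).re ∧ ‖l j‖ ≤ R / η
  im₀ : c / η ≤ (l 0).im
  im₁ : (l 1).im ≤ -(c / η)
  fast : ‖l 2 - fastRate ν κ (S.omega p.1 p.2)‖ ≤ ρ * ‖fastRate ν κ (S.omega p.1 p.2)‖
  gap : R / η ≤ ρ * ‖fastRate ν κ (S.omega p.1 p.2)‖

namespace Setup.CriticalRoots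

theorem lt_fast (h : S.CriticalRoots ν κ p η c R ρ l) (hη : 0 < η) (hR : 0 < R)
    (hρ : 200 * ρ ≤ 1) (hρ0 : 0 < ρ) (hK : 4 * ρ * K ≤ R) :
    0 < (l 2).re ∧ 2 * (K / η) ≤ ‖l 2‖ ∧ ∀ j, j ≠ 2 → ‖l j‖ < ‖l 2‖ := by
  obtain ⟨h1, -, h3⟩ := norm_and_re_of_near (norm_isqrt_le_re _) hρ h.fast
  have hgap := h.gap
  rw [fastRate] at hgap
  set N := ‖isqrt (-(S.omega p.1 p.2 * (ν + κ) / (ν * κ)))‖ with hN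
  have hRη : 0 < R / η := by positivity
  have hN0 : 0 < N := by
    by_contra! h0
    nlinarith
  have h4 : R / η ≤ N / 200 := by nlinarith
  refine ⟨by linarith, ?_, fun j hj => by linarith [(h.slow j hj).2]⟩
  have h5 : 4 * ρ * (K / η) ≤ ρ * N := by
    calc 4 * ρ * (K / η) = 4 * ρ * K / η := by ring
      _ ≤ R / η := by gcongr
      _ ≤ _ := hgap
  have h6 : 4 * (K / η) ≤ N := by
    refine le_of_mul_le_mul_left ?_ hρ0
    linarith
  linarith

theorem rootsIn (h : S.CriticalRoots ν κ p η c R ρ l) (hη : 0 < η) (hR : 0 < R) (hc : 0 < c)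
    (hρ : 200 * ρ ≤ 1) (hρ0 : 0 < ρ) (hK : 4 * ρ * K ≤ R) (hRK : R ≤ K) (hcK : c⁻¹ ≤ K) :
    S.RootsIn ν κ p (critRegion K η) l := by
  obtain ⟨h1, h2, h3⟩ := h.lt_fast hη hR hρ hρ0 hK
  have hcη : 0 < c / η := by positivity
  have hlow : K⁻¹ / η ≤ c / η := by
    gcongr
    exact inv_le_of_inv_le₀ hc hcK
  have hup : R / η ≤ K / η := by gcongr
  refine ⟨h.k_ne, h.roots, ?_, ?_, h3 0 (by decide), h3 1 (by decide)⟩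
  · intro j
    by_cases hj : j = 2
    · rw [hj]; exact h1
    · exact hcη.trans_le (h.slow j hj).1
  · intro j
    fin_cases j
    · have := h.slow 0 (by decide)
      exact ⟨hcη.le.trans this.1, hlow.trans h.im₀, this.2.trans hup⟩
    · have := h.slow 1 (by decide)
      exact ⟨hcη.le.trans this.1, h.im₁.trans (by linarith), this.2.trans hup⟩
    · exact ⟨h1.le, h2⟩

/-- The same location for the roots in order of modulus. -/
theorem of_isRootList (h : S.CriticalRoots ν κ p η c R ρ l') (hl : S.IsRootList ν κ p l)
    (hη : 0 < η) (hR : 0 < R) (hc : 0 < c) (hρ : 200 * ρ ≤ 1) (hρ0 : 0 < ρ) :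
    (∀ j, j ≠ 2 → c / η ≤ (l j).re ∧ ‖l j‖ ≤ R / η) ∧ l 2 = l' 2 ∧
      c / R * ‖l 1‖ ≤ ‖l 1 - l 0‖ := by
  have hcη : 0 < c / η := by positivity
  obtain ⟨h1, h2, h3⟩ := h.lt_fast (K := 0) hη hR hρ hρ0 (by simpa using hR.le)
  have hroots : ∀ μ : ℂ, S.IsLayerRoot ν κ p μ ↔ ∃ j, l' j = μ := fun μ => by
    rw [Setup.isLayerRoot_iff h.k_ne]
    constructor
    · rintro ⟨g1, g2⟩
      exact (h.roots μ g1.le).1 g2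
    · rintro ⟨j, rfl⟩
      have : 0 < (l' j).re := by
        by_cases hj : j = 2
        · rw [hj]; exact h1
        · exact hcη.trans_le (h.slow j hj).1
      exact ⟨this, (h.roots _ this.le).2 ⟨j, rfl⟩⟩
  obtain ⟨e2, e⟩ := hl.eq_or hroots (h3 0 (by decide)) (h3 1 (by decide))
  have s0 := h.slow 0 (by decide)
  have s1 := h.slow 1 (by decide)
  have him : 2 * (c / η) ≤ (l' 0).im - (l' 1).im := by linarith [h.im₀, h.im₁]
  have hsep : 2 * (c / η) ≤ ‖l' 1 - l' 0‖ := by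
    refine him.trans ?_
    rw [norm_sub_rev, ← Complex.sub_im]
    exact Complex.im_le_norm _
  have hup : ∀ z : ℂ, ‖z‖ ≤ R / η → c / R * ‖z‖ ≤ c / η := fun z hz => by
    refine (mul_le_mul_of_nonneg_left hz (by positivity)).trans (le_of_eq ?_)
    field_simp
  rcases e with ⟨e0, e1⟩ | ⟨e0, e1⟩
  · refine ⟨fun j hj => ?_, e2, ?_⟩
    · fin_cases j
      · exact e0 ▸ s0
      · exact e1 ▸ s1
      · exact absurd rfl hj
    · rw [e0, e1]
      linarith [hup _ s1.2]
  · refine ⟨fun j hj => ?_, e2, ?_⟩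
    · fin_cases j
      · exact e0 ▸ s1
      · exact e1 ▸ s0
      · exact absurd rfl hj
    · rw [e0, e1, norm_sub_rev]
      linarith [hup _ s0.2]

/-- Smallness conditions under which the modes separate. -/
structure Small (S : Setup) (ν κ : ℝ) (p : ℝ × ℝ) (η c R δ w₁ w₂ : ℝ) : Prop where
  η_pos : 0 < η
  ν_pos : 0 < ν
  κ_pos : 0 < κ
  one_le : 1 ≤ c / η
  k_le : |p.1| ≤ c / η
  g_le : 4 * |p.1 * Real.cos S.γ / Real.sin S.γ| ≤ δ * (c / η)
  κ_le : 8 * κ * (R / η) ^ 2 ≤ δ * |S.omega p.1 p.2|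
  w₁_pos : 0 < w₁
  w₁_le : w₁ ≤ √|S.omega p.1 p.2|
  w₂_le : √|S.omega p.1 p.2| ≤ w₂

theorem separated (h : S.CriticalRoots ν κ p η c R ρ l') {δ w₁ w₂ c' : ℝ}
    (hsm : Small S ν κ p η c R δ w₁ w₂) (hs : Real.sin S.γ ≠ 0)
    (hΩ : S.omega p.1 p.2 ≠ 0) (hl : S.IsRootList ν κ p l) (hR : 0 < R) (hc : 0 < c)
    (hρ : 200 * ρ ≤ 1) (hρ0 : 0 < ρ) (hδ1 : δ ≤ 1) (hρδ : 2 * ρ ≤ δ)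
    (hc' : c' ≤ c / R)
    (hmain : c' * (‖l 1‖ + ‖S.buoy κ p (l 2)‖) ≤ ‖l 0 + l 1 - S.buoy κ p (l 2)‖) :
    Separated c' δ (l 0) (l 1) (l 2) (S.buoy κ p (l 0)) (S.buoy κ p (l 1)) (S.buoy κ p (l 2)) := by
  obtain ⟨h1, h2, h3⟩ := h.of_isRootList hl hsm.η_pos hR hc hρ hρ0
  obtain ⟨f1, f2, f3⟩ := norm_and_re_of_near (norm_isqrt_le_re _) hρ h.fast
  have hgap := h.gap
  rw [fastRate] at hgap
  rw [← h2] at f1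
  have hδ0 : 0 ≤ δ := by linarith
  have l0 : c / η ≤ ‖l 0‖ := (h1 0 (by decide)).1.trans (Complex.re_le_norm _)
  have l1 := (h1 1 (by decide)).2
  have hκ := hsm.κ_pos
  refine hl.separated hs hΩ hsm.κ_pos hδ0 hδ1
    (hsm.g_le.trans (mul_le_mul_of_nonneg_left l0 hδ0)) (hsm.k_le.trans l0) (hsm.one_le.trans l0)
    (le_trans ?_ hsm.κ_le) ?_ (le_trans ?_ h3) hmain
  · gcongr
  · have := mul_le_mul_of_nonneg_left f1 hρ0.le
    have := mul_le_mul_of_nonneg_right hρδ (norm_nonneg (l 2))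
    have := mul_nonneg hρ0.le (norm_nonneg (l 2))
    linarith
  · gcongr

end Setup.CriticalRoots

/-- The order of quantifiers is the point: `c`, `R`, `w₁` and `w₂` are fixed before the tolerances
`ρ` and `δ`, which are later chosen in terms of them. -/
theorem Setup.Family.eventually_criticalRoots {ι : Type*} {𝓕 : Filter ι} {ν κ : ι → ℝ}
    {p : ι → ℝ × ℝ} {k₁ m₁ Ω₁ q₁ : ℝ} (h : S.Family 𝓕 ν κ p k₁ m₁ Ω₁ q₁) {η : ι → ℝ}
    (hη : ∀ᶠ i in 𝓕, 0 < η i) (hημ : ∀ᶠ i in 𝓕, η i ^ 3 = ν i + κ i) (hη0 : Tendsto η 𝓕 (𝓝 0))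
    {C : ℝ} (ha : ∀ᶠ i in 𝓕, |S.zeta (p i).1 (p i).2| ≤ C * η i) :
    ∃ c > 0, ∃ R > 0, ∃ w₁ > 0, ∃ w₂ > 0,
      (∀ ρ > 0, ∀ᶠ i in 𝓕, ∃ l, S.CriticalRoots (ν i) (κ i) (p i) (η i) c R ρ l) ∧
      ∀ δ > 0, ∀ᶠ i in 𝓕,
        Setup.CriticalRoots.Small S (ν i) (κ i) (p i) (η i) c R δ w₁ w₂ := by
  obtain ⟨c, hc, R, hR, H⟩ := h.exists_critical_roots hη hημ hη0 ha
  have hΩ₁ := abs_pos.2 h.Ω₀_ne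
  have hsq : Tendsto (fun i => √|S.omega (p i).1 (p i).2|) 𝓕 (𝓝 (√|Ω₁|)) := h.Ω_lim.abs.sqrt
  have hsq0 : 0 < √|Ω₁| := Real.sqrt_pos.2 hΩ₁
  refine ⟨c, hc, R, hR, √|Ω₁| / 2, by positivity, √|Ω₁| + 1, by positivity, fun ρ hρ => ?_,
    fun δ hδ => ?_⟩
  · filter_upwards [H ρ hρ, h.k_lim.eventually_ne h.k_ne] with i ⟨l, g1, g2, g3, g4, g5, g6⟩ hk
    exact ⟨l, hk, g1, g2, g3, g4, g5, g6⟩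
  · have hg : Tendsto (fun i => (p i).1 * Real.cos S.γ / Real.sin S.γ) 𝓕
        (𝓝 (k₁ * Real.cos S.γ / Real.sin S.γ)) := (h.k_lim.mul_const _).div_const _
    have small : ∀ x > 0, ∀ᶠ i in 𝓕, η i < x := fun x hx => hη0.eventually_lt_const hx
    set b1 := |k₁| + 1
    set b2 := |k₁ * Real.cos S.γ / Real.sin S.γ| + 1
    have p1 : 0 < b1 := by positivity
    have p2 : 0 < b2 := by positivity
    filter_upwards [hη, h.ν_pos, h.κ_pos, hημ, exists_abs_le_of_tendsto h.k_lim,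
      exists_abs_le_of_tendsto hg, small c hc, small (c / b1) (by positivity),
      small (δ * c / (4 * b2)) (by positivity),
      small (δ * |Ω₁| / (16 * R ^ 2)) (by positivity),
      hsq.eventually_const_lt (half_lt_self hsq0), hsq.eventually_lt_const (lt_add_one _),
      h.Ω_lim.abs.eventually_const_lt (half_lt_self hΩ₁)]
      with i i1 i2 i3 i4 i5 i6 s1 s2 s3 s4 w1 w2 hΩ
    refine ⟨i1, i2, i3, ?_, ?_, ?_, ?_, by positivity, w1.le, w2.le⟩
    · rw [one_le_div i1]; exact s1.le
    · refine i5.trans ?_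
      rw [le_div_iff₀ i1]
      rw [lt_div_iff₀ p1] at s2
      linarith
    · have : δ * (c / η i) = δ * c / η i := by ring
      rw [this, le_div_iff₀ i1]
      rw [lt_div_iff₀ (by positivity)] at s3
      nlinarith
    -- Diffusion is negligible on the slow scale because `κ η⁻² ≤ η`.
    · have hκ : κ i ≤ η i ^ 3 := by linarith
      rw [lt_div_iff₀ (by positivity)] at s4
      calc 8 * κ i * (R / η i) ^ 2 ≤ 8 * η i ^ 3 * (R / η i) ^ 2 := by gcongr
        _ = 8 * (η i * R ^ 2) := by field_simp
        _ ≤ δ * (|Ω₁| / 2) := by linarith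
        _ ≤ _ := by gcongr

end NearCritical

/-! ### Bounds for the layers at criticality. -/

namespace NearCritical

variable {S : Setup} {ν κ : ℝ} {p : ℝ × ℝ} {η c R ρ K B : ℝ} {l l' : Fin 3 → ℂ}

/-- The size of the fastest decay rate. -/
noncomputable def fastScale (ν κ : ℝ) : ℝ := √((ν + κ) / (ν * κ))

theorem fastScale_pos (hν : 0 < ν) (hκ : 0 < κ) : 0 < fastScale ν κ :=
  Real.sqrt_pos.2 (by positivity)

theorem fastScale_sq (hν : 0 < ν) (hκ : 0 < κ) : fastScale ν κ ^ 2 = (ν + κ) / (ν * κ) :=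
  Real.sq_sqrt (by positivity)

theorem norm_fastRate (Ω : ℝ) (hν : 0 < ν) (hκ : 0 < κ) :
    ‖fastRate ν κ Ω‖ = √|Ω| * fastScale ν κ := by
  rw [← Real.sqrt_sq (norm_nonneg (fastRate ν κ Ω)), norm_fastRate_sq Ω hν hκ, fastScale,
    ← Real.sqrt_mul (abs_nonneg _)]
  congr 1
  ring

/-- The pair of slow modes and the fast mode. -/
def slowFast (x y : ℝ) : Fin 3 → ℝ := ![x, x, y]

theorem slowFast_of_ne {x y : ℝ} {j : Fin 3} (hj : j ≠ 2) : slowFast x y j = x := by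
  fin_cases j
  · rfl
  · rfl
  · exact absurd rfl hj

@[simp] theorem slowFast_two (x y : ℝ) : slowFast x y 2 = y := rfl

namespace Setup.CriticalRoots

variable {δ w₁ w₂ c' X A V : ℝ}

theorem fast_bounds (h : S.CriticalRoots ν κ p η c R ρ l')
    (hsm : Small S ν κ p η c R δ w₁ w₂) (hl : S.IsRootList ν κ p l) (hR : 0 < R) (hc : 0 < c)
    (hρ : 200 * ρ ≤ 1) (hρ0 : 0 < ρ) :
    ‖l 2 - fastRate ν κ (S.omega p.1 p.2)‖ ≤ ρ * ‖fastRate ν κ (S.omega p.1 p.2)‖ ∧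
    199 * ‖fastRate ν κ (S.omega p.1 p.2)‖ ≤ 200 * ‖l 2‖ ∧
    w₁ / 4 * fastScale ν κ ≤ (l 2).re ∧ ‖l 2‖ ≤ 2 * w₂ * fastScale ν κ ∧
    w₁ / 2 * fastScale ν κ ≤ ‖l 2‖ := by
  obtain ⟨-, h2, -⟩ := h.of_isRootList hl hsm.η_pos hR hc hρ hρ0
  have hF := fastScale_pos hsm.ν_pos hsm.κ_pos
  have hfast := h.fast
  rw [← h2] at hfast
  obtain ⟨f1, f2, f3⟩ := norm_and_re_of_near (Z := fastRate ν κ (S.omega p.1 p.2))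
    (norm_isqrt_le_re _) hρ hfast
  have hn := norm_fastRate (S.omega p.1 p.2) hsm.ν_pos hsm.κ_pos
  have g1 := mul_le_mul_of_nonneg_right hsm.w₁_le hF.le
  have g2 := mul_le_mul_of_nonneg_right hsm.w₂_le hF.le
  rw [← hn] at g1 g2
  refine ⟨hfast, f1, by linarith, by linarith [norm_nonneg (l 2)],
    by linarith [norm_nonneg (l 2)]⟩

/-- The part common to both critical regimes. What depends on the ratio of viscosity to diffusion
enters through `hsep` and `hA`, that is, through the coefficient of the fast mode. -/
theorem layerBounds (h : S.CriticalRoots ν κ p η c R ρ l')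
    (hsm : Small S ν κ p η c R δ w₁ w₂) (hs : Real.sin S.γ ≠ 0) (hB : S.Moderate p B)
    (hR : 0 < R) (hc : 0 < c) (hρ : 200 * ρ ≤ 1) (hρ0 : 0 < ρ) (hδ1 : δ ≤ 1) (hc'0 : 0 < c')
    (hc'1 : c' ≤ 1) (hcδ : 12 * δ ≤ c' ^ 2)
    (hsep : ∀ l, S.IsRootList ν κ p l → Separated c' δ (l 0) (l 1) (l 2) (S.buoy κ p (l 0))
      (S.buoy κ p (l 1)) (S.buoy κ p (l 2)))
    (hA : ∀ l, S.IsRootList ν κ p l →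
      ‖l 0‖ * ‖l 1‖ / (‖l 1‖ + ‖S.buoy κ p (l 2)‖) ≤ X * V ∧
      ‖l 0‖ * ‖l 1‖ / (‖l 1‖ + ‖S.buoy κ p (l 2)‖) * (1 + ‖S.buoy κ p (l 2)‖ / ‖l 2‖) ≤ X * A)
    (hKρ : 4 * ρ * K ≤ R) (hK1 : R ≤ K) (hK2 : c⁻¹ ≤ K) (hK3 : 252 * B ^ 2 / c' ^ 3 * R ≤ K)
    (hK4 : 40 * B ^ 2 / c' ^ 2 * X ≤ K) (hK5 : B ≤ K) (hK6 : 4 / w₁ ≤ K) (hK7 : 2 * w₂ ≤ K)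
    (hA0 : 0 ≤ A) (hV0 : 0 ≤ V) :
    S.LayerBounds ν κ p (critRegion K η) (slowFast (1 / η) (fastScale ν κ))
      (slowFast (1 / η) (fastScale ν κ)) (slowFast (1 / η) A) V K := by
  have hη := hsm.η_pos
  have hK0 : 0 < K := hR.trans_le hK1
  have hF := fastScale_pos hsm.ν_pos hsm.κ_pos
  have hw := hsm.w₁_pos
  have hB0 : 0 < B := by linarith [hB.one_le]
  have amp : ∀ l a, S.IsRootList ν κ p l → S.IsLift κ p l a →
      (∀ j ≠ 2, ‖a j‖ * ‖S.layerVec κ p (l j)‖ ≤ K * (1 / η)) ∧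
      ‖a 2‖ * ‖velocityProj (S.layerVec κ p (l 2))‖ ≤ K * V ∧
      ‖a 2‖ * ‖S.layerVec κ p (l 2)‖ ≤ K * A := by
    intro l a hl ha
    have hS := hsep l hl
    have hl2 : 1 ≤ ‖l 2‖ := (hS.one_le.trans hS.le).trans hl.order.2.le
    obtain ⟨b1, b2, b3⟩ := S.amp_bounds hs hB hS hc'0 hc'1 hδ1 hcδ hl2 ha
    obtain ⟨q1, q2⟩ := hA l hl
    have hl0 := ((h.of_isRootList hl hη hR hc hρ hρ0).1 0 (by decide)).2
    refine ⟨fun j hj => (b1 j hj).trans ?_, b2.trans ?_, b3.trans ?_⟩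
    · calc 252 * B ^ 2 / c' ^ 3 * ‖l 0‖ ≤ 252 * B ^ 2 / c' ^ 3 * (R / η) := by gcongr
        _ = 252 * B ^ 2 / c' ^ 3 * R * (1 / η) := by ring
        _ ≤ _ := by gcongr
    · calc _ ≤ 40 * B ^ 2 / c' ^ 2 * (X * V) := mul_le_mul_of_nonneg_left q1 (by positivity)
        _ = 40 * B ^ 2 / c' ^ 2 * X * V := by ring
        _ ≤ _ := by gcongr
    · calc _ = 40 * B ^ 2 / c' ^ 2 * (‖l 0‖ * ‖l 1‖ / (‖l 1‖ + ‖S.buoy κ p (l 2)‖) *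
            (1 + ‖S.buoy κ p (l 2)‖ / ‖l 2‖)) := by ring
        _ ≤ 40 * B ^ 2 / c' ^ 2 * (X * A) := mul_le_mul_of_nonneg_left q2 (by positivity)
        _ = 40 * B ^ 2 / c' ^ 2 * X * A := by ring
        _ ≤ _ := by gcongr
  refine ⟨hB.m_ne, hB.Ω_ne, ⟨l', h.rootsIn hη hR hc hρ hρ0 hKρ hK1 hK2⟩, fun l hl => ?_,
    fun l hl j => ?_, fun l hl j => ?_, fun l a hl ha j => ?_,
    fun l a hl ha => (amp l a hl ha).2.1, hB.inc_le.trans hK5⟩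
  · have hS := hsep l hl
    have h1 := hS.le_norm_ampDet hc'0 hδ1 hcδ
    have h3 := hS.l₃_pos
    have : 0 < c' ^ 2 / 2 * (‖l 1‖ * (‖l 1‖ + ‖S.buoy κ p (l 2)‖)) := by positivity
    exact norm_pos_iff.1 (this.trans_le h1)
  · by_cases hj : j = 2
    · subst hj
      refine le_trans ?_ (h.fast_bounds hsm hl hR hc hρ hρ0).2.2.1
      rw [slowFast_two]
      have : K⁻¹ ≤ w₁ / 4 := by
        rw [← inv_div]
        gcongr
      gcongr
    · refine le_trans ?_ ((h.of_isRootList hl hη hR hc hρ hρ0).1 j hj).1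
      rw [slowFast_of_ne hj, ← div_eq_mul_one_div]
      gcongr
      exact inv_le_of_inv_le₀ hc hK2
  · by_cases hj : j = 2
    · subst hj
      refine ((h.fast_bounds hsm hl hR hc hρ hρ0).2.2.2.1).trans ?_
      rw [slowFast_two]
      gcongr
    · refine ((h.of_isRootList hl hη hR hc hρ hρ0).1 j hj).2.trans ?_
      rw [slowFast_of_ne hj, ← div_eq_mul_one_div]
      gcongr
  · by_cases hj : j = 2
    · subst hj
      exact (amp l a hl ha).2.2
    · rw [slowFast_of_ne hj]
      exact (amp l a hl ha).1 j hj

/-- The layers at criticality when viscosity is not dominant. -/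
theorem layerBounds_of_le (h : S.CriticalRoots ν κ p η c R ρ l')
    (hsm : Small S ν κ p η c R δ w₁ w₂) (hs : Real.sin S.γ ≠ 0) (hB : S.Moderate p B)
    {C : ℝ} (hC : 0 ≤ C) (hνκ : ν ≤ C * κ) (hR : 0 < R) (hc : 0 < c) (hcR : c ≤ R)
    (hρ : 200 * ρ * (1 + C) ≤ 1) (hρ0 : 0 < ρ) (hδ1 : δ ≤ 1) (hρδ : 2 * ρ ≤ δ) (hc'0 : 0 < c')
    (hc'8 : 8 * c' ≤ 1) (hc'R : c' ≤ c / R) (hcδ : 12 * δ ≤ c' ^ 2)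
    (hX : R ^ 2 * (1 + 2 * C) ≤ X * min c (w₁ / 4))
    (hKρ : 4 * ρ * K ≤ R) (hK1 : R ≤ K) (hK2 : c⁻¹ ≤ K) (hK3 : 252 * B ^ 2 / c' ^ 3 * R ≤ K)
    (hK4 : 40 * B ^ 2 / c' ^ 2 * X ≤ K) (hK5 : B ≤ K) (hK6 : 4 / w₁ ≤ K) (hK7 : 2 * w₂ ≤ K) :
    S.LayerBounds ν κ p (critRegion K η) (slowFast (1 / η) (fastScale ν κ))
      (slowFast (1 / η) (fastScale ν κ))
      (slowFast (1 / η) ((1 / η) ^ 2 / (1 / η + ν / κ * fastScale ν κ)))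
      ((1 / η) ^ 2 / (1 / η + ν / κ * fastScale ν κ)) K := by
  have hη := hsm.η_pos
  have hν := hsm.ν_pos
  have hκ := hsm.κ_pos
  have hF := fastScale_pos hν hκ
  have hw := hsm.w₁_pos
  have hm0 : 0 < min c (w₁ / 4) := lt_min hc (by positivity)
  have hX0 : 0 ≤ X := by
    have : 0 ≤ R ^ 2 * (1 + 2 * C) := by positivity
    by_contra! hn
    nlinarith [mul_neg_of_neg_of_pos hn hm0]
  have hρ' : 200 * ρ ≤ 1 := by nlinarith [mul_nonneg hρ0.le hC]
  have hρ1 : ρ ≤ 1 := by linarith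
  have hcη : 0 < c / η := by positivity
  have hRη : c / η ≤ R / η := by gcongr
  set Z := fastRate ν κ (S.omega p.1 p.2) with hZ
  have hgap : R / η ≤ ρ * ‖Z‖ := h.gap
  have hkZ : p.1 ^ 2 ≤ ρ * ‖Z‖ ^ 2 := by
    have h1 : |p.1| ≤ ρ * ‖Z‖ := hsm.k_le.trans (hRη.trans hgap)
    have h2 := pow_le_pow_left₀ (abs_nonneg _) h1 2
    rw [sq_abs, mul_pow] at h2
    refine h2.trans (mul_le_mul_of_nonneg_right ?_ (by positivity))
    nlinarith
  have hbuoy : ∀ l, S.IsRootList ν κ p l → ‖S.buoy κ p (l 2)‖ ≤ 2 * (ν / κ * ‖l 2‖) ∧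
      ν / κ * ‖l 2‖ ≤ 2 * ‖S.buoy κ p (l 2)‖ ∧
      ‖S.buoy κ p (l 2)‖ ≤ 8 * (-(S.buoy κ p (l 2))).re := by
    intro l hl
    obtain ⟨f0, f1, -⟩ := h.fast_bounds hsm hl hR hc hρ' hρ0
    refine Setup.buoy_fast_of_le hs hB.Ω_ne hν hκ hC hνκ hρ hρ0 f0 (hl.ne_zero 2) hkZ ?_
    have h1 : 4 * |p.1 * Real.cos S.γ / Real.sin S.γ| ≤ c / η :=
      hsm.g_le.trans (mul_le_of_le_one_left hcη.le hδ1)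
    have h2 := mul_le_mul_of_nonneg_left f1 hρ0.le
    linarith
  have hsep : ∀ l, S.IsRootList ν κ p l → Separated c' δ (l 0) (l 1) (l 2) (S.buoy κ p (l 0))
      (S.buoy κ p (l 1)) (S.buoy κ p (l 2)) := fun l hl => by
    refine h.separated hsm hs hB.Ω_ne hl hR hc hρ' hρ0 hδ1 hρδ hc'R ?_
    have h1 := (h.of_isRootList hl hη hR hc hρ' hρ0).1 1 (by decide)
    refine main_of_re hc'0 hc'8 (hl.re_pos 0).le (le_trans ?_ h1.1) (hbuoy l hl).2.2
    calc c' * ‖l 1‖ ≤ c / R * (R / η) := by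
          have := h1.2
          gcongr
      _ = c / η := by field_simp
  have hD0 : 0 < 1 / η + ν / κ * fastScale ν κ := by positivity
  -- The factor `1 + 2C` anticipates `1 + |h₅|/|l₅|`, so this one estimate bounds both the velocity
  -- and the full fast mode.
  have hA : ∀ l, S.IsRootList ν κ p l →
      ‖l 0‖ * ‖l 1‖ / (‖l 1‖ + ‖S.buoy κ p (l 2)‖) * (1 + 2 * C) ≤
        X * ((1 / η) ^ 2 / (1 / η + ν / κ * fastScale ν κ)) := by
    intro l hl
    obtain ⟨-, -, -, -, f5⟩ := h.fast_bounds hsm hl hR hc hρ' hρ0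
    have hslow := (h.of_isRootList hl hη hR hc hρ' hρ0).1
    have b := (hbuoy l hl).2.1
    have l1 : c / η ≤ ‖l 1‖ := (hslow 1 (by decide)).1.trans (Complex.re_le_norm _)
    have hden : min c (w₁ / 4) * (1 / η + ν / κ * fastScale ν κ) ≤
        ‖l 1‖ + ‖S.buoy κ p (l 2)‖ := by
      have e1 : min c (w₁ / 4) * (1 / η) ≤ c / η := by
        rw [← div_eq_mul_one_div]
        gcongr
        exact min_le_left _ _
      have e2 : min c (w₁ / 4) * (ν / κ * fastScale ν κ) ≤ w₁ / 4 * (ν / κ * fastScale ν κ) := by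
        gcongr
        exact min_le_right _ _
      have e3 : ν / κ * (w₁ / 2 * fastScale ν κ) ≤ ν / κ * ‖l 2‖ := by gcongr
      rw [mul_add]
      linarith
    have hnum : ‖l 0‖ * ‖l 1‖ ≤ R ^ 2 * (1 / η) ^ 2 := by
      calc ‖l 0‖ * ‖l 1‖ ≤ R / η * (R / η) :=
            mul_le_mul (hslow 0 (by decide)).2 (hslow 1 (by decide)).2 (norm_nonneg _)
              (by positivity)
        _ = _ := by ring
    calc ‖l 0‖ * ‖l 1‖ / (‖l 1‖ + ‖S.buoy κ p (l 2)‖) * (1 + 2 * C) ≤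
          R ^ 2 * (1 / η) ^ 2 / (min c (w₁ / 4) * (1 / η + ν / κ * fastScale ν κ)) *
            (1 + 2 * C) := by gcongr
      _ = R ^ 2 * (1 + 2 * C) / min c (w₁ / 4) *
          ((1 / η) ^ 2 / (1 / η + ν / κ * fastScale ν κ)) := by
        field_simp
      _ ≤ _ := by
        gcongr
        rwa [div_le_iff₀ hm0]
  refine h.layerBounds hsm hs hB hR hc hρ' hρ0 hδ1 hc'0 (by linarith) hcδ hsep
    (fun l hl => ⟨?_, ?_⟩) hKρ hK1 hK2 hK3 hK4 hK5 hK6 hK7 (by positivity) (by positivity)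
  · refine le_trans ?_ (hA l hl)
    exact le_mul_of_one_le_right (by positivity) (by linarith)
  · refine le_trans (mul_le_mul_of_nonneg_left ?_ (by positivity)) (hA l hl)
    have hl2 : 0 < ‖l 2‖ := norm_pos_iff.2 (hl.ne_zero 2)
    have : ‖S.buoy κ p (l 2)‖ / ‖l 2‖ ≤ 2 * C := by
      rw [div_le_iff₀ hl2]
      refine (hbuoy l hl).1.trans ?_
      rw [mul_assoc]
      have : ν / κ ≤ C := by rwa [div_le_iff₀ hκ]
      gcongr
    linarith

/-- The layers at criticality when viscosity is dominant. -/
theorem layerBounds_of_ge (h : S.CriticalRoots ν κ p η c R ρ l')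
    (hsm : Small S ν κ p η c R δ w₁ w₂) (hs : Real.sin S.γ ≠ 0) (hB : S.Moderate p B)
    (hνκ : 16 * κ ≤ ν) (hζ : 2 * |S.zeta p.1 p.2| ≤ Real.sin S.γ ^ 2)
    (hR : 0 < R) (hc : 0 < c) (hcR : c ≤ R)
    (hρ : 200 * ρ ≤ 1) (hρ0 : 0 < ρ) (hδ1 : 32 * δ ≤ 1) (hρδ : 2 * ρ ≤ δ) (hc'0 : 0 < c')
    (hc'4 : 4 * c' ≤ 1) (hc'R : c' ≤ c / R) (hcδ : 12 * δ ≤ c' ^ 2)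
    (hX : 2000 * R ^ 2 ≤ X * w₁)
    (hKρ : 4 * ρ * K ≤ R) (hK1 : R ≤ K) (hK2 : c⁻¹ ≤ K) (hK3 : 252 * B ^ 2 / c' ^ 3 * R ≤ K)
    (hK4 : 40 * B ^ 2 / c' ^ 2 * X ≤ K) (hK5 : B ≤ K) (hK6 : 4 / w₁ ≤ K) (hK7 : 2 * w₂ ≤ K) :
    S.LayerBounds ν κ p (critRegion K η) (slowFast (1 / η) (fastScale ν κ))
      (slowFast (1 / η) (fastScale ν κ))
      (slowFast (1 / η) ((1 / η) ^ 2 / fastScale ν κ))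
      ((1 / η) ^ 2 / (ν * fastScale ν κ ^ 3)) K := by
  have hη := hsm.η_pos
  have hν := hsm.ν_pos
  have hκ := hsm.κ_pos
  have hF := fastScale_pos hν hκ
  have hw := hsm.w₁_pos
  have hΩ := abs_pos.2 hB.Ω_ne
  have hX0 : 0 ≤ X := by
    by_contra! hn
    nlinarith [mul_neg_of_neg_of_pos hn hw]
  have hδ0 : 0 < δ := by linarith
  have hcη : 0 < c / η := by positivity
  have hRη : c / η ≤ R / η := by gcongr
  set Z := fastRate ν κ (S.omega p.1 p.2) with hZ
  have hZn : ‖Z‖ = √|S.omega p.1 p.2| * fastScale ν κ := norm_fastRate _ hν hκ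
  have hgap : R / η ≤ ρ * ‖Z‖ := h.gap
  have hcZ : 200 * (c / η) ≤ ‖Z‖ := by
    have := mul_le_mul_of_nonneg_right hρ (norm_nonneg Z)
    linarith
  have hbuoy : ∀ l, S.IsRootList ν κ p l →
      ‖S.buoy κ p (l 2)‖ ≤ 24 * (ν * ‖l 2‖ ^ 3) / |S.omega p.1 p.2| ∧
      ν * ‖l 2‖ ^ 3 / (32 * |S.omega p.1 p.2|) ≤ ‖S.buoy κ p (l 2)‖ ∧
      ‖l 2‖ ≤ 8 * ‖S.buoy κ p (l 2)‖ := by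
    intro l hl
    obtain ⟨f0, f1, -⟩ := h.fast_bounds hsm hl hR hc hρ hρ0
    refine Setup.buoy_fast_of_ge hs hB.Ω_ne hB.k_ne hν hκ hνκ hζ ((hl.roots _).2 ⟨2, rfl⟩) hρ f0
      ?_ ?_
    · linarith [hsm.k_le]
    · have h1 : δ * (c / η) ≤ c / η := mul_le_of_le_one_left hcη.le (by linarith)
      linarith [hsm.g_le]
  have hsep : ∀ l, S.IsRootList ν κ p l → Separated c' δ (l 0) (l 1) (l 2) (S.buoy κ p (l 0))
      (S.buoy κ p (l 1)) (S.buoy κ p (l 2)) := fun l hl => by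
    refine h.separated hsm hs hB.Ω_ne hl hR hc hρ hρ0 (by linarith) hρδ hc'R ?_
    obtain ⟨f0, f1, -⟩ := h.fast_bounds hsm hl hR hc hρ hρ0
    refine main_of_norm hc'0 hc'4 hl.order.1 ?_
    have h1 := ((h.of_isRootList hl hη hR hc hρ hρ0).1 1 (by decide)).2
    have h2 := mul_le_mul_of_nonneg_left f1 hρ0.le
    have h3 : ρ * ‖l 2‖ ≤ 1 / 64 * ‖l 2‖ :=
      mul_le_mul_of_nonneg_right (by linarith) (norm_nonneg _)
    linarith [(hbuoy l hl).2.2]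
  have hνF : 1 ≤ ν * fastScale ν κ ^ 2 := by
    rw [fastScale_sq hν hκ]
    have : ν * ((ν + κ) / (ν * κ)) = (ν + κ) / κ := by field_simp
    rw [this, one_le_div hκ]
    linarith
  -- The factor 60 anticipates `1 + |h₅|/|l₅| ≤ 60 ν F²`, with `F` the fast scale: the summand 1 is
  -- absorbed by `νF² ≥ 1`. Multiplying by `νF²` then turns the velocity bound into the bound for
  -- the full mode.
  have hA : ∀ l, S.IsRootList ν κ p l →
      60 * (‖l 0‖ * ‖l 1‖ / (‖l 1‖ + ‖S.buoy κ p (l 2)‖)) ≤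
        X * ((1 / η) ^ 2 / (ν * fastScale ν κ ^ 3)) := by
    intro l hl
    obtain ⟨-, f1, -⟩ := h.fast_bounds hsm hl hR hc hρ hρ0
    have hslow := (h.of_isRootList hl hη hR hc hρ hρ0).1
    have b := (hbuoy l hl).2.1
    have hw1 : ν * fastScale ν κ ^ 3 * w₁ / 33 ≤ ν * ‖l 2‖ ^ 3 / (32 * |S.omega p.1 p.2|) := by
      have g1 : (199 / 200 * ‖Z‖) ^ 3 ≤ ‖l 2‖ ^ 3 :=
        pow_le_pow_left₀ (by positivity) (by linarith) 3
      have g2 : ‖Z‖ ^ 3 = |S.omega p.1 p.2| * √|S.omega p.1 p.2| * fastScale ν κ ^ 3 := by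
        rw [hZn, mul_pow, pow_succ, Real.sq_sqrt hΩ.le]
      have g3 : |S.omega p.1 p.2| * w₁ * fastScale ν κ ^ 3 ≤ ‖Z‖ ^ 3 := by
        rw [g2]
        have := hsm.w₁_le
        gcongr
      rw [div_le_div_iff₀ (by norm_num) (by positivity)]
      rw [mul_pow] at g1
      have g4 : 32 * (|S.omega p.1 p.2| * w₁ * fastScale ν κ ^ 3) ≤ 33 * ‖l 2‖ ^ 3 := by
        have : (0 : ℝ) ≤ ‖Z‖ ^ 3 := by positivity
        norm_num at g1
        linarith
      have g5 := mul_le_mul_of_nonneg_left g4 hν.le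
      linarith
    have hden : ν * fastScale ν κ ^ 3 * w₁ / 33 ≤ ‖l 1‖ + ‖S.buoy κ p (l 2)‖ := by
      linarith [norm_nonneg (l 1)]
    have hnum : ‖l 0‖ * ‖l 1‖ ≤ R ^ 2 * (1 / η) ^ 2 := by
      calc ‖l 0‖ * ‖l 1‖ ≤ R / η * (R / η) :=
            mul_le_mul (hslow 0 (by decide)).2 (hslow 1 (by decide)).2 (norm_nonneg _)
              (by positivity)
        _ = _ := by ring
    calc 60 * (‖l 0‖ * ‖l 1‖ / (‖l 1‖ + ‖S.buoy κ p (l 2)‖)) ≤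
          60 * (R ^ 2 * (1 / η) ^ 2 / (ν * fastScale ν κ ^ 3 * w₁ / 33)) := by gcongr
      _ = 1980 * R ^ 2 / w₁ * ((1 / η) ^ 2 / (ν * fastScale ν κ ^ 3)) := by
        field_simp
        norm_num
      _ ≤ _ := by
        gcongr
        rw [div_le_iff₀ hw]
        linarith [sq_nonneg R]
  refine h.layerBounds hsm hs hB hR hc hρ hρ0 (by linarith) hc'0 (by linarith) hcδ hsep
    (fun l hl => ⟨?_, ?_⟩) hKρ hK1 hK2 hK3 hK4 hK5 hK6 hK7 (by positivity) (by positivity)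
  · refine le_trans ?_ (hA l hl)
    have : 0 ≤ ‖l 0‖ * ‖l 1‖ / (‖l 1‖ + ‖S.buoy κ p (l 2)‖) := by positivity
    linarith
  · have hl2 : 0 < ‖l 2‖ := norm_pos_iff.2 (hl.ne_zero 2)
    have hb : 1 + ‖S.buoy κ p (l 2)‖ / ‖l 2‖ ≤ 60 * (ν * fastScale ν κ ^ 2) := by
      have g1 : ‖S.buoy κ p (l 2)‖ / ‖l 2‖ ≤ 24 * (ν * ‖l 2‖ ^ 2) / |S.omega p.1 p.2| := by
        rw [div_le_iff₀ hl2]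
        refine (hbuoy l hl).1.trans (le_of_eq ?_)
        ring
      obtain ⟨f0, -⟩ := h.fast_bounds hsm hl hR hc hρ hρ0
      obtain ⟨-, f2, -⟩ := norm_and_re_of_near (Z := Z) (norm_isqrt_le_re _) hρ f0
      have g2 : ‖l 2‖ ^ 2 ≤ (201 / 200 * ‖Z‖) ^ 2 :=
        pow_le_pow_left₀ (norm_nonneg _) (by linarith) 2
      have g3 : ‖Z‖ ^ 2 = |S.omega p.1 p.2| * fastScale ν κ ^ 2 := by
        rw [hZn, mul_pow, Real.sq_sqrt hΩ.le]
      have g4 : 24 * (ν * ‖l 2‖ ^ 2) / |S.omega p.1 p.2| ≤ 59 * (ν * fastScale ν κ ^ 2) := by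
        rw [div_le_iff₀ hΩ]
        rw [mul_pow, g3] at g2
        have g5 := mul_le_mul_of_nonneg_left g2 hν.le
        have : 0 ≤ ν * (|S.omega p.1 p.2| * fastScale ν κ ^ 2) := by positivity
        norm_num at g5
        linarith
      linarith
    have hQ : 0 ≤ ‖l 0‖ * ‖l 1‖ / (‖l 1‖ + ‖S.buoy κ p (l 2)‖) := by positivity
    calc _ ≤ ‖l 0‖ * ‖l 1‖ / (‖l 1‖ + ‖S.buoy κ p (l 2)‖) * (60 * (ν * fastScale ν κ ^ 2)) :=
          mul_le_mul_of_nonneg_left hb hQ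
      _ = 60 * (‖l 0‖ * ‖l 1‖ / (‖l 1‖ + ‖S.buoy κ p (l 2)‖)) * (ν * fastScale ν κ ^ 2) := by ring
      _ ≤ X * ((1 / η) ^ 2 / (ν * fastScale ν κ ^ 3)) * (ν * fastScale ν κ ^ 2) :=
          mul_le_mul_of_nonneg_right (hA l hl) (by positivity)
      _ = _ := by field_simp

end Setup.CriticalRoots

end NearCritical

/-! ### Choice of the constants at criticality. -/

namespace NearCritical

namespace Setup.Family

variable {S : Setup} {ι : Type*} {𝓕 : Filter ι} {ν κ : ι → ℝ} {p : ι → ℝ × ℝ} {k₁ m₁ Ω₁ q₁ : ℝ}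

/-- Uniform bounds for the layers at criticality when viscosity is not dominant. -/
theorem layerBounds_of_le (h : S.Family 𝓕 ν κ p k₁ m₁ Ω₁ q₁) (hs : Real.sin S.γ ≠ 0) {η : ι → ℝ}
    (hη : ∀ᶠ i in 𝓕, 0 < η i) (hημ : ∀ᶠ i in 𝓕, η i ^ 3 = ν i + κ i) (hη0 : Tendsto η 𝓕 (𝓝 0))
    {C : ℝ} (ha : ∀ᶠ i in 𝓕, |S.zeta (p i).1 (p i).2| ≤ C * η i)
    {C' : ℝ} (hC' : 0 ≤ C') (hνκ : ∀ᶠ i in 𝓕, ν i ≤ C' * κ i) :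
    ∃ K₀, ∀ K ≥ K₀, ∀ᶠ i in 𝓕, S.LayerBounds (ν i) (κ i) (p i) (critRegion K (η i))
      (slowFast (1 / η i) (fastScale (ν i) (κ i))) (slowFast (1 / η i) (fastScale (ν i) (κ i)))
      (slowFast (1 / η i) ((1 / η i) ^ 2 / (1 / η i + ν i / κ i * fastScale (ν i) (κ i))))
      ((1 / η i) ^ 2 / (1 / η i + ν i / κ i * fastScale (ν i) (κ i))) K := by
  obtain ⟨c, hc, R₀, hR₀, w₁, hw₁, w₂, hw₂, H1, H2⟩ := h.eventually_criticalRoots hη hημ hη0 ha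
  obtain ⟨B, hB⟩ := h.eventually_moderate
  rcases eq_or_neBot 𝓕 with hbot | hne
  · exact ⟨0, fun K _ => by rw [hbot]; exact eventually_bot⟩
  have hB1 : 1 ≤ B := by obtain ⟨i, hi⟩ := hB.exists; exact hi.one_le
  have hcR : c ≤ R₀ := by
    obtain ⟨i, hi, ⟨l, hl⟩⟩ := (hη.and (H1 1 one_pos)).exists
    have := hl.slow 0 (by decide)
    have := this.1.trans ((Complex.re_le_norm _).trans this.2)
    rwa [div_le_div_iff_of_pos_right hi] at this
  -- The ratio `c/R₀` measures the separation of the slow roots, `1/8` is required by `main_of_re`,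
  -- and `δ = c'²/12` is the largest tolerance allowed by the determinant estimate.
  set c' := min (c / R₀) (1 / 8) with hc'
  have hc'0 : 0 < c' := lt_min (by positivity) (by norm_num)
  have hc'8 : c' ≤ 1 / 8 := min_le_right _ _
  set δ := c' ^ 2 / 12 with hδ
  have hδ0 : 0 < δ := by positivity
  have hm : 0 < min c (w₁ / 4) := lt_min hc (by positivity)
  set X := R₀ ^ 2 * (1 + 2 * C') / min c (w₁ / 4) with hX
  refine ⟨R₀ + c⁻¹ + 252 * B ^ 2 / c' ^ 3 * R₀ + 40 * B ^ 2 / c' ^ 2 * X + B + 4 / w₁ + 2 * w₂,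
    fun K hK => ?_⟩
  have t1 : 0 < c⁻¹ := by positivity
  have t2 : 0 ≤ 252 * B ^ 2 / c' ^ 3 * R₀ := by positivity
  have t3 : 0 ≤ 40 * B ^ 2 / c' ^ 2 * X := by positivity
  have t4 : 0 < 4 / w₁ := by positivity
  have hK0 : 0 < K := by linarith
  -- The tolerance is chosen after `K`: the fast root must lie beyond `2K/η`, outside the disc that
  -- contains the regions of the slow roots.
  set ρ := min (1 / (200 * (1 + C'))) (min (δ / 2) (R₀ / (4 * K))) with hρ
  have hρ0 : 0 < ρ := lt_min (by positivity) (lt_min (by positivity) (by positivity))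
  have hρ1 : 200 * ρ * (1 + C') ≤ 1 := by
    have : ρ ≤ 1 / (200 * (1 + C')) := min_le_left _ _
    rw [le_div_iff₀ (by positivity)] at this
    linarith
  have hρ2 : ρ ≤ δ / 2 := (min_le_right _ _).trans (min_le_left _ _)
  have hρ3 : 4 * ρ * K ≤ R₀ := by
    have : ρ ≤ R₀ / (4 * K) := (min_le_right _ _).trans (min_le_right _ _)
    rw [le_div_iff₀ (by positivity)] at this
    linarith
  filter_upwards [H1 ρ hρ0, H2 δ hδ0, hB, hνκ] with i ⟨l, hl⟩ hsm hBi hνκi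
  refine hl.layerBounds_of_le (c' := c') (X := X) hsm hs hBi hC' hνκi hR₀ hc hcR hρ1 hρ0
    (by nlinarith) (by linarith) hc'0 (by linarith) (min_le_left _ _) (by linarith) ?_ hρ3
    (by linarith) (by linarith) (by linarith) (by linarith) (by linarith) (by linarith)
    (by linarith)
  rw [hX, div_mul_cancel₀ _ hm.ne']

/-- Uniform bounds for the layers at criticality when viscosity is dominant. -/
theorem layerBounds_of_ge (h : S.Family 𝓕 ν κ p k₁ m₁ Ω₁ q₁) (hs : Real.sin S.γ ≠ 0) {η : ι → ℝ}
    (hη : ∀ᶠ i in 𝓕, 0 < η i) (hημ : ∀ᶠ i in 𝓕, η i ^ 3 = ν i + κ i) (hη0 : Tendsto η 𝓕 (𝓝 0))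
    {C : ℝ} (ha : ∀ᶠ i in 𝓕, |S.zeta (p i).1 (p i).2| ≤ C * η i)
    (hνκ : ∀ᶠ i in 𝓕, 16 * κ i ≤ ν i) :
    ∃ K₀, ∀ K ≥ K₀, ∀ᶠ i in 𝓕, S.LayerBounds (ν i) (κ i) (p i) (critRegion K (η i))
      (slowFast (1 / η i) (fastScale (ν i) (κ i))) (slowFast (1 / η i) (fastScale (ν i) (κ i)))
      (slowFast (1 / η i) ((1 / η i) ^ 2 / fastScale (ν i) (κ i)))
      ((1 / η i) ^ 2 / (ν i * fastScale (ν i) (κ i) ^ 3)) K := by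
  obtain ⟨c, hc, R₀, hR₀, w₁, hw₁, w₂, hw₂, H1, H2⟩ := h.eventually_criticalRoots hη hημ hη0 ha
  obtain ⟨B, hB⟩ := h.eventually_moderate
  rcases eq_or_neBot 𝓕 with hbot | hne
  · exact ⟨0, fun K _ => by rw [hbot]; exact eventually_bot⟩
  have hB1 : 1 ≤ B := by obtain ⟨i, hi⟩ := hB.exists; exact hi.one_le
  have hcR : c ≤ R₀ := by
    obtain ⟨i, hi, ⟨l, hl⟩⟩ := (hη.and (H1 1 one_pos)).exists
    have := hl.slow 0 (by decide)
    have := this.1.trans ((Complex.re_le_norm _).trans this.2)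
    rwa [div_le_div_iff_of_pos_right hi] at this
  set c' := min (c / R₀) (1 / 8) with hc'
  have hc'0 : 0 < c' := lt_min (by positivity) (by norm_num)
  have hc'8 : c' ≤ 1 / 8 := min_le_right _ _
  set δ := c' ^ 2 / 12 with hδ
  have hδ0 : 0 < δ := by positivity
  set X := 2000 * R₀ ^ 2 / w₁ with hX
  refine ⟨R₀ + c⁻¹ + 252 * B ^ 2 / c' ^ 3 * R₀ + 40 * B ^ 2 / c' ^ 2 * X + B + 4 / w₁ + 2 * w₂,
    fun K hK => ?_⟩
  have t1 : 0 < c⁻¹ := by positivity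
  have t2 : 0 ≤ 252 * B ^ 2 / c' ^ 3 * R₀ := by positivity
  have t3 : 0 ≤ 40 * B ^ 2 / c' ^ 2 * X := by positivity
  have t4 : 0 < 4 / w₁ := by positivity
  have hK0 : 0 < K := by linarith
  set ρ := min (1 / 200) (min (δ / 2) (R₀ / (4 * K))) with hρ
  have hρ0 : 0 < ρ := lt_min (by positivity) (lt_min (by positivity) (by positivity))
  have hρ1 : 200 * ρ ≤ 1 := by
    have : ρ ≤ 1 / 200 := min_le_left _ _
    linarith
  have hρ2 : ρ ≤ δ / 2 := (min_le_right _ _).trans (min_le_left _ _)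
  have hρ3 : 4 * ρ * K ≤ R₀ := by
    have : ρ ≤ R₀ / (4 * K) := (min_le_right _ _).trans (min_le_right _ _)
    rw [le_div_iff₀ (by positivity)] at this
    linarith
  have hζ : ∀ᶠ i in 𝓕, |S.zeta (p i).1 (p i).2| < Real.sin S.γ ^ 2 / 2 := by
    have := h.ζ_lim.abs
    rw [abs_zero] at this
    exact this.eventually_lt_const (by positivity)
  filter_upwards [H1 ρ hρ0, H2 δ hδ0, hB, hνκ, hζ] with i ⟨l, hl⟩ hsm hBi hνκi hζi
  refine hl.layerBounds_of_ge (c' := c') (X := X) hsm hs hBi hνκi (by linarith) hR₀ hc hcR hρ1 hρ0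
    (by nlinarith) (by linarith) hc'0 (by linarith) (min_le_left _ _) (by linarith) ?_ hρ3
    (by linarith) (by linarith) (by linarith) (by linarith) (by linarith) (by linarith)
    (by linarith)
  rw [hX, div_mul_cancel₀ _ hw₁.ne']

end Setup.Family

end NearCritical

/-! ### Location of the roots and bounds for the layers away from criticality. -/

namespace NearCritical

variable {S : Setup} {ν κ : ℝ} {p : ℝ × ℝ} {x y z e ρ K B C : ℝ} {l l' : Fin 3 → ℂ}

/-- Regions which separate three layer roots of different orders of magnitude. -/
def annuli (K x y z : ℝ) : Fin 3 → Set ℂ :=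
  ![{w | 0 ≤ w.re ∧ ‖w‖ ≤ K * x},
    {w | 0 ≤ w.re ∧ K⁻¹ * y ≤ ‖w‖ ∧ ‖w‖ ≤ K * y},
    {w | 0 ≤ w.re ∧ K⁻¹ * z ≤ ‖w‖}]

theorem isClosed_annuli (K x y z : ℝ) (j : Fin 3) : IsClosed (annuli K x y z j) := by
  have h1 : IsClosed {w : ℂ | 0 ≤ w.re} := isClosed_le continuous_const Complex.continuous_re
  fin_cases j
  · exact h1.inter (isClosed_le continuous_norm continuous_const)
  · exact h1.inter ((isClosed_le continuous_const continuous_norm).inter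
      (isClosed_le continuous_norm continuous_const))
  · exact h1.inter (isClosed_le continuous_const continuous_norm)

theorem re_nonneg_of_mem_annuli (j : Fin 3) : ∀ w ∈ annuli K x y z j, 0 ≤ w.re := by
  intro w hw
  fin_cases j <;> exact hw.1

theorem disjoint_annuli (hxy : K * x < K⁻¹ * y) (hxz : K * x < K⁻¹ * z) (hyz : K * y < K⁻¹ * z) :
    Pairwise fun i j => Disjoint (annuli K x y z i) (annuli K x y z j) := by
  refine pairwise_of_three (fun i j h => h.symm) ?_ ?_ ?_ <;>
    refine Set.disjoint_left.2 fun w hw hw' => ?_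
  · linarith [hw.2, hw'.2.1]
  · linarith [hw.2, hw'.2]
  · linarith [hw.2.2, hw'.2]

/-- Location of the layer roots away from criticality. -/
structure Setup.NoncriticalRoots (S : Setup) (ν κ : ℝ) (p : ℝ × ℝ) (x y z e ρ : ℝ)
    (l : Fin 3 → ℂ) : Prop where
  k_ne : p.1 ≠ 0
  roots : ∀ μ : ℂ, 0 ≤ μ.re → (S.dispAt ν κ p μ = 0 ↔ ∃ j, l j = μ)
  re₀ : 0 < (l 0).re
  le₀ : e * x ≤ ‖l 0‖
  ge₀ : ‖l 0‖ ≤ e⁻¹ * x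
  re₁ : 2 * ‖l 1‖ ≤ 5 * (l 1).re
  le₁ : e * y ≤ ‖l 1‖
  ge₁ : ‖l 1‖ ≤ e⁻¹ * y
  le₂ : e * z ≤ ‖l 2‖
  ge₂ : ‖l 2‖ ≤ e⁻¹ * z
  fast : ‖l 2 - fastRate ν κ (S.omega p.1 p.2)‖ ≤ ρ * ‖fastRate ν κ (S.omega p.1 p.2)‖
  gap₀ : ‖l 0‖ ≤ 2 * ρ * ‖l 1‖
  gap₁ : ‖l 1‖ ≤ 2 * ρ * ‖l 2‖

namespace Setup.NoncriticalRoots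

theorem basic (h : S.NoncriticalRoots ν κ p x y z e ρ l) (hρ : 2000 * ρ ≤ 1) (hρ0 : 0 < ρ) :
    (∀ j, 0 < (l j).re) ∧ ‖l 0‖ < ‖l 1‖ ∧ ‖l 1‖ < ‖l 2‖ ∧ 2 * ‖l 2‖ ≤ 5 * (l 2).re := by
  have h0 : 0 < ‖l 0‖ := h.re₀.trans_le (Complex.re_le_norm _)
  have hg0 : ‖l 0‖ ≤ 1 / 1000 * ‖l 1‖ :=
    h.gap₀.trans (mul_le_mul_of_nonneg_right (by linarith) (norm_nonneg _))
  have hg1 : ‖l 1‖ ≤ 1 / 1000 * ‖l 2‖ :=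
    h.gap₁.trans (mul_le_mul_of_nonneg_right (by linarith) (norm_nonneg _))
  obtain ⟨-, -, f3⟩ := norm_and_re_of_near (norm_isqrt_le_re _) (by linarith) h.fast
  refine ⟨fun j => ?_, by linarith, by linarith, f3⟩
  fin_cases j
  · exact h.re₀
  · show 0 < (l 1).re
    linarith [h.re₁]
  · show 0 < (l 2).re
    linarith

theorem rootsIn (h : S.NoncriticalRoots ν κ p x y z e ρ l) (hρ : 2000 * ρ ≤ 1) (hρ0 : 0 < ρ)
    (hx : 0 ≤ x) (hy : 0 ≤ y) (hz : 0 ≤ z) (he : 0 < e) (hK : e⁻¹ ≤ K) :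
    S.RootsIn ν κ p (annuli K x y z) l := by
  obtain ⟨h1, h2, h3, -⟩ := h.basic hρ hρ0
  have hKe : K⁻¹ ≤ e := inv_le_of_inv_le₀ he hK
  refine ⟨h.k_ne, h.roots, h1, ?_, h2.trans h3, h3⟩
  intro j
  fin_cases j
  · exact ⟨(h1 0).le, h.ge₀.trans (by gcongr)⟩
  · exact ⟨(h1 1).le, le_trans (by gcongr) h.le₁, h.ge₁.trans (by gcongr)⟩
  · exact ⟨(h1 2).le, le_trans (by gcongr) h.le₂⟩

/-- The three moduli differ strictly, so ordering by modulus leaves no freedom, unlike at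
criticality. -/
theorem eq_of_isRootList (h : S.NoncriticalRoots ν κ p x y z e ρ l') (hρ : 2000 * ρ ≤ 1)
    (hρ0 : 0 < ρ) (hl : S.IsRootList ν κ p l) : l = l' := by
  obtain ⟨h1, h2, h3, -⟩ := h.basic hρ hρ0
  have hroots : ∀ μ : ℂ, S.IsLayerRoot ν κ p μ ↔ ∃ j, l' j = μ := fun μ => by
    rw [Setup.isLayerRoot_iff h.k_ne]
    constructor
    · rintro ⟨g1, g2⟩
      exact (h.roots μ g1.le).1 g2
    · rintro ⟨j, rfl⟩
      exact ⟨h1 j, (h.roots _ (h1 j).le).2 ⟨j, rfl⟩⟩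
  obtain ⟨e2, e⟩ := hl.eq_or hroots (h2.trans h3) h3
  rcases e with ⟨e0, e1⟩ | ⟨e0, e1⟩
  · ext j
    fin_cases j
    exacts [e0, e1, e2]
  · have := hl.order.1
    rw [e0, e1] at this
    exact absurd h2 this.not_gt

/-- The layers away from criticality when viscosity is not dominant. -/
theorem layerBounds (h : S.NoncriticalRoots ν κ p x y z e ρ l') (hs : Real.sin S.γ ≠ 0)
    (hB : S.Moderate p B) (hν : 0 < ν) (hκ : 0 < κ) (hC : 1 ≤ C) (hνκ : ν ≤ C * κ)
    (hκν : κ ≤ C * ν) (hρ : 2000 * ρ * (1 + C) ≤ 1) (hρ0 : 0 < ρ) (hx : 0 < x) (hy : 0 < y)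
    (hz : 0 < z) (he : 0 < e) (h1 : 1 ≤ e * x) (hk : |p.1| ≤ e * x)
    (hg : 4000 * |p.1 * Real.cos S.γ / Real.sin S.γ| ≤ e * x)
    (hκy : 8000 * κ * (e⁻¹ * y) ^ 2 ≤ |S.omega p.1 p.2|)
    (hK1 : 3 * e⁻¹ ≤ K) (hK2 : 252 * B ^ 2 / (1 / 8) ^ 3 * e⁻¹ ≤ K)
    (hK3 : 40 * B ^ 2 / (1 / 8) ^ 2 * (2 * C * (1 + 2 * C) * e⁻¹ ^ 3) ≤ K) (hK4 : B ≤ K) :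
    S.LayerBounds ν κ p (annuli K x y z) ![0, y, z] ![x, y, z] ![x, x, x * y / z] (x * y / z)
      K := by
  have hρC : 0 ≤ ρ * C := by positivity
  have hρ' : 2000 * ρ ≤ 1 := by linarith
  obtain ⟨b1, b2, b3, b4⟩ := h.basic hρ' hρ0
  have he' : 0 < e⁻¹ := by positivity
  have hK0 : 0 < K := by linarith
  have hB0 : 0 < B := by linarith [hB.one_le]
  set Z := fastRate ν κ (S.omega p.1 p.2) with hZ
  obtain ⟨f1, f2, -⟩ := norm_and_re_of_near (Z := Z) (norm_isqrt_le_re _) (by linarith) h.fast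
  have hl0 := h.le₀
  have n0 : 0 < ‖l' 0‖ := by linarith
  have h0Z : ‖l' 0‖ ≤ ρ * ‖Z‖ / 4 ∧ ‖l' 0‖ ≤ ρ * ‖l' 2‖ / 4 := by
    have g1 : ‖l' 1‖ ≤ 1 / 1000 * ‖l' 2‖ :=
      h.gap₁.trans (mul_le_mul_of_nonneg_right (by linarith) (norm_nonneg _))
    have g2 := mul_le_mul_of_nonneg_left g1 hρ0.le
    have g3 := mul_le_mul_of_nonneg_left f2 hρ0.le
    have g4 := mul_nonneg hρ0.le (norm_nonneg (l' 2))
    have g5 := mul_nonneg hρ0.le (norm_nonneg Z)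
    have g6 := h.gap₀
    constructor <;> linarith
  have hkZ : p.1 ^ 2 ≤ ρ * ‖Z‖ ^ 2 := by
    have g1 : |p.1| ≤ ρ * ‖Z‖ := by
      linarith [h0Z.1, mul_nonneg hρ0.le (norm_nonneg Z)]
    have g2 := pow_le_pow_left₀ (abs_nonneg _) g1 2
    rw [sq_abs, mul_pow] at g2
    refine g2.trans (mul_le_mul_of_nonneg_right ?_ (by positivity))
    nlinarith
  have hrl : ∀ l, S.IsRootList ν κ p l → l = l' := fun l hl => h.eq_of_isRootList hρ' hρ0 hl
  have hl'0 : l' 2 ≠ 0 := fun h0 => by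
    have := b1 2
    rw [h0] at this
    exact lt_irrefl _ this
  obtain ⟨c1, c2, c3⟩ := Setup.buoy_fast_of_le hs hB.Ω_ne hν hκ (by linarith) hνκ
    (by linarith) hρ0 h.fast hl'0 hkZ
    (by linarith [h0Z.2, abs_nonneg (p.1 * Real.cos S.γ / Real.sin S.γ),
      mul_nonneg hρ0.le (norm_nonneg (l' 2))])
  -- Here `c = 1/8`, and `1/768 = c²/12` is the tolerance that the determinant estimate permits.
  have hsep : S.IsRootList ν κ p l' → Separated (1 / 8) (1 / 768) (l' 0) (l' 1) (l' 2)
      (S.buoy κ p (l' 0)) (S.buoy κ p (l' 1)) (S.buoy κ p (l' 2)) := fun hl => by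
    have g0 : ‖l' 0‖ ≤ 1 / 1000 * ‖l' 1‖ :=
      h.gap₀.trans (mul_le_mul_of_nonneg_right (by linarith) (norm_nonneg _))
    refine hl.separated hs hB.Ω_ne hκ (by norm_num) (by norm_num) (by linarith) (hk.trans hl0)
      (h1.trans hl0) ?_ ?_ ?_ ?_
    · have := pow_le_pow_left₀ (norm_nonneg _) h.ge₁ 2
      have := mul_le_mul_of_nonneg_left this hκ.le
      have : 0 ≤ κ * (e⁻¹ * y) ^ 2 := by positivity
      linarith
    · refine h.gap₁.trans (mul_le_mul_of_nonneg_right (by linarith) (norm_nonneg _))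
    · linarith [norm_sub_norm_le (l' 1) (l' 0)]
    · exact main_of_re (by norm_num) (by norm_num) (b1 0).le (by linarith [h.re₁]) c3
  have hA : ‖l' 0‖ * ‖l' 1‖ / (‖l' 1‖ + ‖S.buoy κ p (l' 2)‖) * (1 + 2 * C) ≤
      2 * C * (1 + 2 * C) * e⁻¹ ^ 3 * (x * y / z) := by
    -- The assumption `κ ≤ Cν` makes the coefficient of the fast mode at least `|l₅|/(2C)`, and it
    -- carries the denominator alone.
    have hden : e * z / (2 * C) ≤ ‖l' 1‖ + ‖S.buoy κ p (l' 2)‖ := by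
      have g1 : 1 / C ≤ ν / κ := by
        rw [div_le_div_iff₀ (by linarith) hκ]
        linarith
      have g2 : 1 / C * (e * z) ≤ ν / κ * ‖l' 2‖ := mul_le_mul g1 h.le₂ (by positivity)
        (by positivity)
      have g3 : e * z / (2 * C) = 1 / C * (e * z) / 2 := by ring
      rw [g3]
      linarith [norm_nonneg (l' 1)]
    have hnum : ‖l' 0‖ * ‖l' 1‖ ≤ e⁻¹ * x * (e⁻¹ * y) :=
      mul_le_mul h.ge₀ h.ge₁ (norm_nonneg _) (by positivity)
    calc _ ≤ e⁻¹ * x * (e⁻¹ * y) / (e * z / (2 * C)) * (1 + 2 * C) := by gcongr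
      _ = _ := by field_simp
  have amp : ∀ l a, S.IsRootList ν κ p l → S.IsLift κ p l a →
      (∀ j ≠ 2, ‖a j‖ * ‖S.layerVec κ p (l j)‖ ≤ K * x) ∧
      ‖a 2‖ * ‖velocityProj (S.layerVec κ p (l 2))‖ ≤ K * (x * y / z) ∧
      ‖a 2‖ * ‖S.layerVec κ p (l 2)‖ ≤ K * (x * y / z) := by
    intro l a hl ha
    obtain rfl := hrl l hl
    have hl2 : 1 ≤ ‖l 2‖ := by linarith
    have hl20 : 0 < ‖l 2‖ := by linarith
    obtain ⟨a1, a2, a3⟩ := S.amp_bounds hs hB (hsep hl) (by norm_num) (by norm_num) (by norm_num)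
      (by norm_num) hl2 ha
    have hratio : ‖S.buoy κ p (l 2)‖ / ‖l 2‖ ≤ 2 * C := by
      rw [div_le_iff₀ hl20]
      refine c1.trans ?_
      rw [mul_assoc]
      have : ν / κ ≤ C := by rwa [div_le_iff₀ hκ]
      gcongr
    have hQ : 0 ≤ ‖l 0‖ * ‖l 1‖ / (‖l 1‖ + ‖S.buoy κ p (l 2)‖) := by positivity
    have fin : 40 * B ^ 2 / (1 / 8) ^ 2 * (‖l 0‖ * ‖l 1‖ / (‖l 1‖ + ‖S.buoy κ p (l 2)‖) *
        (1 + 2 * C)) ≤ K * (x * y / z) := by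
      refine (mul_le_mul_of_nonneg_left hA (by positivity)).trans ?_
      rw [← mul_assoc]
      exact mul_le_mul_of_nonneg_right hK3 (by positivity)
    refine ⟨fun j hj => (a1 j hj).trans ?_, a2.trans (le_trans ?_ fin),
      a3.trans (le_trans ?_ fin)⟩
    · calc _ ≤ 252 * B ^ 2 / (1 / 8) ^ 3 * (e⁻¹ * x) :=
            mul_le_mul_of_nonneg_left h.ge₀ (by positivity)
        _ = 252 * B ^ 2 / (1 / 8) ^ 3 * e⁻¹ * x := by ring
        _ ≤ _ := by gcongr
    · refine mul_le_mul_of_nonneg_left ?_ (by positivity)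
      exact le_mul_of_one_le_right hQ (by linarith)
    · rw [mul_assoc]
      refine mul_le_mul_of_nonneg_left ?_ (by positivity)
      gcongr
  have hKe : K⁻¹ ≤ e / 3 := by
    rw [inv_le_comm₀ hK0 (by positivity), inv_div, div_eq_mul_inv]
    exact hK1
  refine ⟨hB.m_ne, hB.Ω_ne, ⟨l', h.rootsIn hρ' hρ0 hx.le hy.le hz.le he (by linarith)⟩,
    fun l hl => ?_, fun l hl j => ?_, fun l hl j => ?_, fun l a hl ha j => ?_,
    fun l a hl ha => (amp l a hl ha).2.1, hB.inc_le.trans hK4⟩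
  · obtain rfl := hrl l hl
    have hS := hsep hl
    have h1 := hS.le_norm_ampDet (by norm_num) (by norm_num) (by norm_num)
    have h3 := hS.l₃_pos
    have : 0 < (1 / 8 : ℝ) ^ 2 / 2 * (‖l 1‖ * (‖l 1‖ + ‖S.buoy κ p (l 2)‖)) := by positivity
    exact norm_pos_iff.1 (this.trans_le h1)
  · obtain rfl := hrl l hl
    fin_cases j
    · show K⁻¹ * 0 ≤ (l 0).re
      linarith [b1 0]
    · show K⁻¹ * y ≤ (l 1).re
      linarith [mul_le_mul_of_nonneg_right hKe hy.le, h.re₁, h.le₁]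
    · show K⁻¹ * z ≤ (l 2).re
      linarith [mul_le_mul_of_nonneg_right hKe hz.le, h.le₂]
  · obtain rfl := hrl l hl
    have hKe' : e⁻¹ ≤ K := by linarith
    fin_cases j
    · exact h.ge₀.trans (mul_le_mul_of_nonneg_right hKe' hx.le)
    · exact h.ge₁.trans (mul_le_mul_of_nonneg_right hKe' hy.le)
    · exact h.ge₂.trans (mul_le_mul_of_nonneg_right hKe' hz.le)
  · fin_cases j
    · exact (amp l a hl ha).1 0 (by decide)
    · exact (amp l a hl ha).1 1 (by decide)
    · exact (amp l a hl ha).2.2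

end Setup.NoncriticalRoots

/-- Uniform bounds for the layers away from criticality, when the decay rates are of sizes
`x`, `y` and `z`. -/
theorem Setup.Family.layerBounds_of_noncritical {ι : Type*} {𝓕 : Filter ι} {ν κ : ι → ℝ}
    {p : ι → ℝ × ℝ} {k₁ m₁ Ω₁ q₁ : ℝ} (h : S.Family 𝓕 ν κ p k₁ m₁ Ω₁ q₁) (hs : Real.sin S.γ ≠ 0)
    (hζ : ∀ᶠ i in 𝓕, S.zeta (p i).1 (p i).2 ≠ 0)
    (hμ : Tendsto (fun i => (ν i + κ i) / |S.zeta (p i).1 (p i).2| ^ 3) 𝓕 (𝓝 0))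
    {x y z : ι → ℝ} (hx : Tendsto x 𝓕 atTop) (hy : ∀ᶠ i in 𝓕, 0 < y i) (hz : ∀ᶠ i in 𝓕, 0 < z i)
    (hκy : Tendsto (fun i => κ i * y i ^ 2) 𝓕 (𝓝 0))
    {C e : ℝ} (hC : 1 ≤ C) (he : 0 < e) (hνκ : ∀ᶠ i in 𝓕, ν i ≤ C * κ i)
    (hκν : ∀ᶠ i in 𝓕, κ i ≤ C * ν i)
    (hx₁ : ∀ᶠ i in 𝓕, e * x i ≤ |S.slope (p i) / S.zeta (p i).1 (p i).2| ∧
      |S.slope (p i) / S.zeta (p i).1 (p i).2| ≤ e⁻¹ * x i)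
    (hy₁ : ∀ᶠ i in 𝓕,
      e * y i ≤ ‖midRate (ν i) (κ i) (S.omega (p i).1 (p i).2) (S.zeta (p i).1 (p i).2)‖ ∧
      ‖midRate (ν i) (κ i) (S.omega (p i).1 (p i).2) (S.zeta (p i).1 (p i).2)‖ ≤ e⁻¹ * y i)
    (hz₁ : ∀ᶠ i in 𝓕, e * z i ≤ ‖fastRate (ν i) (κ i) (S.omega (p i).1 (p i).2)‖ ∧
      ‖fastRate (ν i) (κ i) (S.omega (p i).1 (p i).2)‖ ≤ e⁻¹ * z i) :
    ∃ K₀, ∀ K ≥ K₀, ∀ᶠ i in 𝓕, S.LayerBounds (ν i) (κ i) (p i) (annuli K (x i) (y i) (z i))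
      ![0, y i, z i] ![x i, y i, z i] ![x i, x i, x i * y i / z i] (x i * y i / z i) K := by
  obtain ⟨B, hB⟩ := h.eventually_moderate
  set ρ := 1 / (4000 * (1 + C)) with hρ
  have hρ0 : 0 < ρ := by positivity
  have hρ1 : 2000 * (2 * ρ) * (1 + C) ≤ 1 := by rw [hρ]; field_simp; norm_num
  have hρ2 : 2000 * ρ ≤ 1 := by nlinarith [mul_nonneg hρ0.le (by linarith : 0 ≤ C)]
  have hΩ₁ := abs_pos.2 h.Ω₀_ne
  have hg : Tendsto (fun i => (p i).1 * Real.cos S.γ / Real.sin S.γ) 𝓕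
      (𝓝 (k₁ * Real.cos S.γ / Real.sin S.γ)) := (h.k_lim.mul_const _).div_const _
  -- The given bounds concern the leading orders of the rates. Halving `e`, and doubling `ρ` below,
  -- leaves room for the relative errors of the true roots.
  set e' := e / 2 with he'
  have he'0 : 0 < e' := by positivity
  have hei : e'⁻¹ = 2 * e⁻¹ := by rw [he', inv_div, div_eq_mul_inv]
  have hκy' : Tendsto (fun i => 8000 * κ i * (e'⁻¹ * y i) ^ 2) 𝓕 (𝓝 0) := by
    have := hκy.const_mul (8000 * e'⁻¹ ^ 2)
    rw [mul_zero] at this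
    refine this.congr fun i => ?_
    ring
  have hxe : Tendsto (fun i => e' * x i) 𝓕 atTop := hx.const_mul_atTop he'0
  refine ⟨3 * e'⁻¹ + 252 * B ^ 2 / (1 / 8) ^ 3 * e'⁻¹ +
    40 * B ^ 2 / (1 / 8) ^ 2 * (2 * C * (1 + 2 * C) * e'⁻¹ ^ 3) + B, fun K hK => ?_⟩
  have t1 : 0 ≤ 3 * e'⁻¹ := by positivity
  have t2 : 0 ≤ 252 * B ^ 2 / (1 / 8) ^ 3 * e'⁻¹ := by positivity
  have t3 : 0 ≤ 40 * B ^ 2 / (1 / 8) ^ 2 * (2 * C * (1 + 2 * C) * e'⁻¹ ^ 3) := by positivity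
  filter_upwards [h.exists_noncritical_roots hζ hμ hρ0, hB, h.ν_pos, h.κ_pos, hνκ, hκν, hy, hz,
    hx₁, hy₁, hz₁, exists_abs_le_of_tendsto h.k_lim, exists_abs_le_of_tendsto hg,
    hxe.eventually_ge_atTop 1, hxe.eventually_ge_atTop (|k₁| + 1),
    hxe.eventually_ge_atTop (4000 * (|k₁ * Real.cos S.γ / Real.sin S.γ| + 1)),
    hκy'.eventually_lt_const (half_pos hΩ₁), h.Ω_lim.abs.eventually_const_lt (half_lt_self hΩ₁)]
    with i ⟨l, r1, r2, r3, r4, r5, r6, r7⟩ hBi hνi hκi c1 c2 yi zi ⟨x1, x2⟩ ⟨y1, y2⟩ ⟨z1, z2⟩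
      hk hg g1 g2 g3 g4 g5
  set W := |S.slope (p i) / S.zeta (p i).1 (p i).2|
  set Y := midRate (ν i) (κ i) (S.omega (p i).1 (p i).2) (S.zeta (p i).1 (p i).2)
  set Z := fastRate (ν i) (κ i) (S.omega (p i).1 (p i).2)
  have xi : 0 < x i := by
    by_contra! hn
    nlinarith
  have hW : W / 2 ≤ ‖l 0‖ ∧ ‖l 0‖ ≤ 2 * W := by
    have e1 : ‖Complex.I * ((S.slope (p i) / S.zeta (p i).1 (p i).2 : ℝ) : ℂ)‖ = W :=
      norm_I_mul_ofReal _
    have e2 := norm_sub_norm_le (l 0) (Complex.I * ((S.slope (p i) / S.zeta (p i).1 (p i).2 : ℝ) : ℂ))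
    have e3 := norm_sub_norm_le (Complex.I * ((S.slope (p i) / S.zeta (p i).1 (p i).2 : ℝ) : ℂ)) (l 0)
    rw [norm_sub_rev] at e3
    rw [e1] at e2 e3
    have e4 : ρ * W ≤ 1 / 2 * W := mul_le_mul_of_nonneg_right (by linarith) (abs_nonneg _)
    have e5 : 0 ≤ W := abs_nonneg _
    constructor <;> linarith
  obtain ⟨Y1, Y2, Y3⟩ := norm_and_re_of_near (Z := Y) (norm_isqrt_le_re _) (by linarith) r4
  obtain ⟨Z1, Z2, -⟩ := norm_and_re_of_near (Z := Z) (norm_isqrt_le_re _) (by linarith) r5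
  have Yn := norm_nonneg Y
  have Zn := norm_nonneg Z
  have hroots : S.NoncriticalRoots (ν i) (κ i) (p i) (x i) (y i) (z i) e' (2 * ρ) l := by
    refine ⟨hBi.k_ne, r1, r2, ?_, ?_, Y3, ?_, ?_, ?_, ?_, r5.trans ?_, ?_, ?_⟩
    · rw [he']; linarith
    · rw [hei]; linarith
    · rw [he']; linarith
    · rw [hei]; linarith
    · rw [he']; linarith
    · rw [hei]; linarith
    · exact mul_le_mul_of_nonneg_right (by linarith) Zn
    · have := mul_le_mul_of_nonneg_left Y1 hρ0.le
      have := mul_nonneg hρ0.le (norm_nonneg (l 1))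
      linarith [hW.2]
    · have := mul_le_mul_of_nonneg_left Z1 hρ0.le
      have := mul_nonneg hρ0.le (norm_nonneg (l 2))
      linarith
  exact hroots.layerBounds hs hBi hνi hκi hC c1 c2 hρ1 (by positivity) xi yi zi he'0 g1
    (hk.trans g2) ((mul_le_mul_of_nonneg_left hg (by norm_num)).trans g3) (g4.le.trans g5.le)
    (by linarith [hBi.one_le]) (by linarith [hBi.one_le]) (by linarith [hBi.one_le]) (by linarith)

end NearCritical

/-! ### Uniform packet sizes and power laws in `ε`. -/

namespace NearCritical

open Asymptotics

/-- Sizes of the packets of a layer system whose decay rates are bounded by `r` and `ρ` and whose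
modes are bounded by `A`. -/
structure Setup.PacketSizes (S : Setup) (κ ε : ℝ) (l a : ℝ × ℝ → Fin 3 → ℂ) (r ρ A : Fin 3 → ℝ)
    (V T : ℝ) : Prop where
  ε_pos : 0 < ε
  ε_lt : ε < 1
  top : ∀ j, SizeLE (S.layer κ ε l a j) ⊤ (T * (ε ^ 2 * A j))
  two : ∀ j, 0 < r j → SizeLE (S.layer κ ε l a j) 2 (T * (ε * A j * (√(r j))⁻¹))
  velocity_top : 0 < r 2 → SizeLE (velocity (S.layer κ ε l a 2)) ⊤ (T * (ε ^ 2 * V))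
  velocity_two : 0 < r 2 → SizeLE (velocity (S.layer κ ε l a 2)) 2 (T * (ε * V * (√(r 2))⁻¹))
  incident_top : SizeLE (S.incident ε) ⊤ (T * ε ^ 2)
  incident_two : SizeLE (S.incident ε) 2 T
  decay : ∀ j b K, T ≤ K → r j = ε ^ (-b) → ρ j = ε ^ (-b) → S.DecayScale ε l j b K

variable {S : Setup}

theorem eventually_le_mul_of_isBigO {f g : ℝ → ℝ} {F : Filter ℝ} (h : f =O[F] g)
    (hg : ∀ᶠ ε in F, 0 ≤ g ε) : ∃ C₀, ∀ C ≥ C₀, ∀ᶠ ε in F, f ε ≤ C * g ε := by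
  obtain ⟨C₀, hC₀⟩ := h.bound
  refine ⟨C₀, fun C hC => ?_⟩
  filter_upwards [hC₀, hg] with ε h1 h2
  rw [Real.norm_eq_abs, Real.norm_of_nonneg h2] at h1
  exact (le_abs_self _).trans (h1.trans (mul_le_mul_of_nonneg_right hC h2))

theorem eventually_forall_le_mul_of_isBigO {f g : ℝ → Fin 3 → ℝ} {F : Filter ℝ}
    (h : ∀ j, (fun ε => f ε j) =O[F] fun ε => g ε j) (hg : ∀ᶠ ε in F, ∀ j, 0 ≤ g ε j) :
    ∃ C₀, ∀ C ≥ C₀, ∀ᶠ ε in F, ∀ j, f ε j ≤ C * g ε j := by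
  choose C₀ hC₀ using fun j => eventually_le_mul_of_isBigO (h j) (hg.mono fun ε hε => hε j)
  refine ⟨max (C₀ 0) (max (C₀ 1) (C₀ 2)), fun C hC => ?_⟩
  rw [eventually_all]
  intro j
  refine hC₀ j C (le_trans ?_ hC)
  fin_cases j <;> simp

/-- Packet sizes from uniform bounds at each wavenumber. -/
theorem Setup.exists_packetSizes (hs : Real.sin S.γ ≠ 0) (hχ : Continuous S.χ)
    (hχc : HasCompactSupport S.χ) {ν κ : ℝ → ℝ} {D : ℝ → ℝ → Fin 3 → Set ℂ}
    (hDc : ∀ K ε j, IsClosed (D K ε j)) (hDr : ∀ K ε j, ∀ z ∈ D K ε j, 0 ≤ z.re)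
    (hD : ∀ K > 0, ∀ᶠ ε in 𝓝[>] (0 : ℝ), Pairwise fun i j => Disjoint (D K ε i) (D K ε j))
    {r ρ A r' ρ' A' : ℝ → Fin 3 → ℝ} {V V' : ℝ → ℝ}
    (hr0 : ∀ᶠ ε in 𝓝[>] (0 : ℝ), ∀ j, 0 ≤ r ε j) (hρ0 : ∀ᶠ ε in 𝓝[>] (0 : ℝ), ∀ j, 0 ≤ ρ' ε j)
    (hA0 : ∀ᶠ ε in 𝓝[>] (0 : ℝ), ∀ j, 0 ≤ A' ε j) (hV0 : ∀ᶠ ε in 𝓝[>] (0 : ℝ), 0 ≤ V' ε)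
    (hr : ∀ j, (fun ε => r' ε j) =O[𝓝[>] 0] fun ε => r ε j)
    (hρ : ∀ j, (fun ε => ρ ε j) =O[𝓝[>] 0] fun ε => ρ' ε j)
    (hA : ∀ j, (fun ε => A ε j) =O[𝓝[>] 0] fun ε => A' ε j) (hV : V =O[𝓝[>] 0] V')
    (H : ∀ P ∈ ({(S.k₀, S.m₀), (-S.k₀, -S.m₀)} : Set (ℝ × ℝ)), ∀ M, NeBot (S.germ M P) →
      ∃ K₀, ∀ K ≥ K₀, ∀ᶠ i in S.germ M P, S.LayerBounds (ν i.1) (κ i.1) i.2 (D K i.1) (r i.1)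
        (ρ i.1) (A i.1) (V i.1) K) :
    ∃ T > 0, ∀ᶠ ε in 𝓝[>] (0 : ℝ), S.LayersDefined (ν ε) (κ ε) ε ∧
      ∀ l a, S.IsLayerSystem (ν ε) (κ ε) ε l a →
        S.PacketSizes (κ ε) ε l a (r' ε) (ρ' ε) (A' ε) (V' ε) T := by
  obtain ⟨M, -, -, hM⟩ := exists_bound_of_cutoff hχ hχc
  obtain ⟨B, hB⟩ := Setup.exists_specBound hχ hχc
  obtain ⟨K₀, hK₀⟩ := Setup.eventually_of_germ (S := S) hM (Q := fun K ε p =>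
    S.LayerBounds (ν ε) (κ ε) p (D K ε) (r ε) (ρ ε) (A ε) (V ε) K) fun P hP hne => H P hP M hne
  obtain ⟨C₁, h1⟩ := eventually_forall_le_mul_of_isBigO hr hr0
  obtain ⟨C₂, h2⟩ := eventually_forall_le_mul_of_isBigO hρ hρ0
  obtain ⟨C₃, h3⟩ := eventually_forall_le_mul_of_isBigO hA hA0
  obtain ⟨C₄, h4⟩ := eventually_le_mul_of_isBigO hV hV0
  set K := max K₀ 1 with hK
  set C := max 1 (max (max C₁ C₂) (max C₃ C₄)) with hC
  have hC1 : 1 ≤ C := le_max_left _ _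
  have hK1 : 1 ≤ K := le_max_right _ _
  have hK0 : 0 < K := by linarith
  have hKC : 0 < K * C := by positivity
  obtain ⟨_, _, hB1⟩ := hB 1 one_pos
  have hB0 := hB1.D_pos
  have hT : K * C ≤ packetConst B (K * C) := by
    have : 0 ≤ B ^ 3 * (K * C) + 2 * √(B ^ 5) * (K * C * √(K * C)) + 8 * B ^ 2 * (K * C) := by
      positivity
    unfold packetConst; linarith
  refine ⟨packetConst B (K * C), hKC.trans_le hT, ?_⟩
  have hlt : ∀ᶠ ε in 𝓝[>] (0 : ℝ), ε < 1 :=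
    (eventually_lt_nhds one_pos).filter_mono nhdsWithin_le_nhds
  filter_upwards [hK₀ K (le_max_left _ _), h1 C (by simp [hC]), h2 C (by simp [hC]),
    h3 C (by simp [hC]), h4 C (by simp [hC]), hA0, hV0, hD K hK0, self_mem_nhdsWithin, hlt]
    with ε g0 g1 g2 g3 g4 g5 g6 g7 hε hε1
  have hε : 0 < ε := hε
  obtain ⟨I, J, hsp⟩ := hB ε hε
  have hLB : ∀ p, S.spec ε p ≠ 0 →
      S.LayerBounds (ν ε) (κ ε) p (D K ε) (r' ε) (ρ' ε) (A' ε) (V' ε) (K * C) :=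
    fun p hp => (g0 p hp).mono hK0 hC1 g1 g2 g3 g4
  refine ⟨Setup.layersDefined hs hsp hKC (hDc K ε) (hDr K ε) g7 g5 hLB, fun l a hla => ?_⟩
  obtain ⟨s1, s2, s3, s4, s5⟩ := Setup.sizeLE_of_layerBounds hsp hKC g5 g6 hLB hla
  exact ⟨hε, hε1, s1, s2, fun h => (s3 h).1, fun h => (s3 h).2, s4, s5, fun j b K' hK' hrj hρj =>
    Setup.decayScale_of_layerBounds hKC hLB hla hrj hρj hε (hT.trans hK')⟩

theorem isTheta_rpow_of_eq {f : ℝ → ℝ} {f₀ a : ℝ} (hf₀ : f₀ ≠ 0)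
    (hf : ∀ ε > 0, f ε = f₀ * ε ^ a) : f =Θ[𝓝[>] (0 : ℝ)] fun ε => ε ^ a := by
  have : f =ᶠ[𝓝[>] (0 : ℝ)] fun ε => f₀ * ε ^ a := by
    filter_upwards [self_mem_nhdsWithin] with ε hε using hf ε hε
  exact this.trans_isTheta ((isTheta_const_mul_left hf₀).2 isTheta_rfl)

theorem isBigO_rpow_of_le {a b : ℝ} (hab : a ≤ b) :
    (fun ε : ℝ => ε ^ b) =O[𝓝[>] (0 : ℝ)] fun ε => ε ^ a := by
  refine IsBigO.of_bound 1 ?_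
  have hlt : ∀ᶠ ε in 𝓝[>] (0 : ℝ), ε < 1 :=
    (eventually_lt_nhds one_pos).filter_mono nhdsWithin_le_nhds
  filter_upwards [self_mem_nhdsWithin, hlt] with ε hε h1
  have hε : 0 < ε := hε
  rw [Real.norm_of_nonneg (by positivity), Real.norm_of_nonneg (by positivity), one_mul]
  exact Real.rpow_le_rpow_of_exponent_ge hε h1.le hab

theorem isTheta_add_of_isBigO {f g h : ℝ → ℝ} {F : Filter ℝ} (hf : f =Θ[F] h) (hg : g =O[F] h)
    (hf0 : ∀ᶠ ε in F, 0 ≤ f ε) (hg0 : ∀ᶠ ε in F, 0 ≤ g ε) : (fun ε => f ε + g ε) =Θ[F] h := by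
  refine ⟨hf.1.add hg, hf.2.trans (IsBigO.of_bound 1 ?_)⟩
  filter_upwards [hf0, hg0] with ε h1 h2
  rw [Real.norm_of_nonneg h1, Real.norm_of_nonneg (add_nonneg h1 h2)]
  linarith

theorem eventually_rpow_nonneg (a : ℝ) : 0 ≤ᶠ[𝓝[>] (0 : ℝ)] fun ε => ε ^ a := by
  filter_upwards [self_mem_nhdsWithin] with ε hε
  exact Real.rpow_nonneg (le_of_lt hε) a

theorem isTheta_rpow_congr {f : ℝ → ℝ} {g : ℝ → ℝ} {a : ℝ} (h : f =Θ[𝓝[>] (0 : ℝ)] g)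
    (hg : ∀ ε > 0, g ε = ε ^ a) : f =Θ[𝓝[>] (0 : ℝ)] fun ε => ε ^ a :=
  h.trans (EventuallyEq.isTheta (by
    filter_upwards [self_mem_nhdsWithin] with ε hε using hg ε hε))

theorem tendsto_rpow_zero {a : ℝ} (ha : 0 < a) :
    Tendsto (fun ε : ℝ => ε ^ a) (𝓝[>] 0) (𝓝 0) := by
  have := (Real.continuousAt_rpow_const 0 a (Or.inr ha.le)).tendsto
  rw [Real.zero_rpow ha.ne'] at this
  exact this.mono_left nhdsWithin_le_nhds

/-- Sizes of the viscosity and diffusivity. -/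
structure PowerLaw (ν κ : ℝ → ℝ) (a b : ℝ) : Prop where
  ν_pos : ∀ᶠ ε in 𝓝[>] (0 : ℝ), 0 < ν ε
  κ_pos : ∀ᶠ ε in 𝓝[>] (0 : ℝ), 0 < κ ε
  ν_theta : ν =Θ[𝓝[>] (0 : ℝ)] fun ε => ε ^ a
  κ_theta : κ =Θ[𝓝[>] (0 : ℝ)] fun ε => ε ^ b

theorem powerLaw_of_eq {ν κ : ℝ → ℝ} {a b ν₀ κ₀ : ℝ} (hν₀ : 0 < ν₀) (hκ₀ : 0 < κ₀)
    (hν : ∀ ε > 0, ν ε = ν₀ * ε ^ a) (hκ : ∀ ε > 0, κ ε = κ₀ * ε ^ b) : PowerLaw ν κ a b where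
  ν_pos := by
    filter_upwards [self_mem_nhdsWithin] with ε hε
    rw [hν ε hε]
    exact mul_pos hν₀ (Real.rpow_pos_of_pos hε a)
  κ_pos := by
    filter_upwards [self_mem_nhdsWithin] with ε hε
    rw [hκ ε hε]
    exact mul_pos hκ₀ (Real.rpow_pos_of_pos hε b)
  ν_theta := isTheta_rpow_of_eq hν₀.ne' hν
  κ_theta := isTheta_rpow_of_eq hκ₀.ne' hκ

namespace PowerLaw

variable {ν κ : ℝ → ℝ} {a b : ℝ}

theorem swap (h : PowerLaw ν κ a b) : PowerLaw κ ν b a := ⟨h.κ_pos, h.ν_pos, h.κ_theta, h.ν_theta⟩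

theorem add_theta (h : PowerLaw ν κ a b) (hab : b ≤ a) :
    (fun ε => ν ε + κ ε) =Θ[𝓝[>] (0 : ℝ)] fun ε => ε ^ b := by
  have := isTheta_add_of_isBigO h.κ_theta (h.ν_theta.1.trans (isBigO_rpow_of_le hab))
    (h.κ_pos.mono fun _ h => h.le) (h.ν_pos.mono fun _ h => h.le)
  refine IsTheta.trans (EventuallyEq.isTheta (Eventually.of_forall fun ε => ?_)) this
  exact add_comm _ _

/-- The quotient `(ν + κ)/(νκ)` is comparable with the reciprocal of the smaller coefficient, which
is `ν` as `b ≤ a`. -/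
theorem fastScale_theta (h : PowerLaw ν κ a b) (hab : b ≤ a) :
    (fun ε => fastScale (ν ε) (κ ε)) =Θ[𝓝[>] (0 : ℝ)] fun ε => ε ^ (-(a / 2)) := by
  have h1 : (fun ε => (ν ε + κ ε) / (ν ε * κ ε)) =Θ[𝓝[>] (0 : ℝ)] fun ε => ε ^ (-a) := by
    refine isTheta_rpow_congr ((h.add_theta hab).div (h.ν_theta.mul h.κ_theta)) fun ε hε => ?_
    rw [← Real.rpow_add hε, ← Real.rpow_sub hε]
    congr 1
    ring
  have h2 := h1.sqrt (by
    filter_upwards [h.ν_pos, h.κ_pos] with ε h1 h2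
    show (0 : ℝ) ≤ _
    positivity) (eventually_rpow_nonneg _)
  refine isTheta_rpow_congr h2 fun ε hε => ?_
  rw [Real.sqrt_eq_rpow, ← Real.rpow_mul (le_of_lt hε)]
  congr 1
  ring

theorem fastScale_comm (ν κ : ℝ) : fastScale ν κ = fastScale κ ν := by
  rw [fastScale, fastScale, add_comm, mul_comm]

theorem tendsto (h : PowerLaw ν κ a b) (ha : 0 < a) : Tendsto ν (𝓝[>] 0) (𝓝 0) :=
  h.ν_theta.1.trans_tendsto (tendsto_rpow_zero ha)

end PowerLaw

/-- The slow length scale at criticality. -/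
noncomputable def critScale (ν κ : ℝ) : ℝ := (ν + κ) ^ (1 / 3 : ℝ)

theorem PowerLaw.critScale_facts {ν κ : ℝ → ℝ} {a b : ℝ} (h : PowerLaw ν κ a b) :
    (∀ᶠ ε in 𝓝[>] (0 : ℝ), 0 < critScale (ν ε) (κ ε)) ∧
    ∀ᶠ ε in 𝓝[>] (0 : ℝ), critScale (ν ε) (κ ε) ^ 3 = ν ε + κ ε := by
  constructor
  · filter_upwards [h.ν_pos, h.κ_pos] with ε h1 h2
    exact Real.rpow_pos_of_pos (add_pos h1 h2) _
  · filter_upwards [h.ν_pos, h.κ_pos] with ε h1 h2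
    rw [critScale, ← Real.rpow_natCast, ← Real.rpow_mul (add_pos h1 h2).le]
    norm_num

theorem PowerLaw.critScale_theta {ν κ : ℝ → ℝ} {a b : ℝ} (h : PowerLaw ν κ a b) (hab : b ≤ a) :
    (fun ε => critScale (ν ε) (κ ε)) =Θ[𝓝[>] (0 : ℝ)] fun ε => ε ^ (b / 3) := by
  refine isTheta_rpow_congr ((h.add_theta hab).rpow (r := 1 / 3) ?_ (eventually_rpow_nonneg _))
    fun ε hε => ?_
  · filter_upwards [h.ν_pos, h.κ_pos] with ε h1 h2
    exact (add_pos h1 h2).le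
  · rw [← Real.rpow_mul (le_of_lt hε)]
    congr 1
    ring

end NearCritical

/-! ### Packet sizes at criticality. -/

namespace NearCritical

open Asymptotics

variable {S : Setup} {ν κ : ℝ → ℝ} {a b : ℝ}

theorem isBigO_min {f g h : ℝ → ℝ} {F : Filter ℝ} (hg : f =O[F] g) (hh : f =O[F] h)
    (hg0 : ∀ᶠ ε in F, 0 ≤ g ε) (hh0 : ∀ᶠ ε in F, 0 ≤ h ε) :
    f =O[F] fun ε => min (g ε) (h ε) := by
  obtain ⟨C₁, h1⟩ := hg.bound
  obtain ⟨C₂, h2⟩ := hh.bound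
  refine IsBigO.of_bound (max C₁ C₂) ?_
  filter_upwards [h1, h2, hg0, hh0] with ε g1 g2 g3 g4
  rw [Real.norm_of_nonneg g3] at g1
  rw [Real.norm_of_nonneg g4] at g2
  rw [Real.norm_of_nonneg (le_min g3 g4)]
  rcases min_cases (g ε) (h ε) with ⟨e, -⟩ | ⟨e, -⟩ <;> rw [e]
  · exact g1.trans (mul_le_mul_of_nonneg_right (le_max_left _ _) g3)
  · exact g2.trans (mul_le_mul_of_nonneg_right (le_max_right _ _) g4)

theorem isBigO_slowFast {x y x' y' : ℝ → ℝ} {F : Filter ℝ} (hx : x =O[F] x') (hy : y =O[F] y')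
    (j : Fin 3) : (fun ε => slowFast (x ε) (y ε) j) =O[F] fun ε => slowFast (x' ε) (y' ε) j := by
  fin_cases j
  exacts [hx, hx, hy]

theorem slowFast_nonneg {x y : ℝ} (hx : 0 ≤ x) (hy : 0 ≤ y) (j : Fin 3) : 0 ≤ slowFast x y j := by
  fin_cases j
  exacts [hx, hx, hy]

/-- The support of the packet lies close to criticality. -/
def Setup.ZetaLE (S : Setup) : Prop :=
  ∃ C : ℝ, ∀ᶠ ε in 𝓝[>] (0 : ℝ), ∀ p : ℝ × ℝ, S.spec ε p ≠ 0 → |S.zeta p.1 p.2| ≤ C * ε ^ 2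

theorem Setup.ne_zero_of_center (hk : S.k₀ ≠ 0) (hm : S.m₀ ≠ 0) {P : ℝ × ℝ}
    (hP : P ∈ ({(S.k₀, S.m₀), (-S.k₀, -S.m₀)} : Set (ℝ × ℝ))) : P.1 ≠ 0 ∧ P.2 ≠ 0 := by
  rcases hP with rfl | rfl
  · exact ⟨hk, hm⟩
  · exact ⟨neg_ne_zero.2 hk, neg_ne_zero.2 hm⟩

theorem Setup.ZetaLE.family (hζ : S.ZetaLE) (hs : Real.sin S.γ ≠ 0) (h : PowerLaw ν κ a b)
    (ha : 0 < a) (hb : 0 < b) {P : ℝ × ℝ} (hP : P.1 ≠ 0 ∧ P.2 ≠ 0) {M : ℝ}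
    [NeBot (S.germ M P)] :
    S.Family (S.germ M P) (fun i => ν i.1) (fun i => κ i.1) Prod.snd P.1 P.2 (S.omega P.1 P.2)
      (S.slope P) := by
  obtain ⟨C, hC⟩ := hζ
  exact Setup.nearCriticalFamily hs hP.1 hP.2 hC (h.tendsto ha) (h.swap.tendsto hb) h.ν_pos h.κ_pos

theorem eventually_rpow_nonneg' (a : ℝ) : ∀ᶠ ε in 𝓝[>] (0 : ℝ), 0 ≤ ε ^ a :=
  eventually_rpow_nonneg a

theorem sq_isBigO_rpow {c : ℝ} (hc : c ≤ 2) :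
    (fun ε : ℝ => ε ^ 2) =O[𝓝[>] (0 : ℝ)] fun ε => ε ^ c := by
  refine IsBigO.trans (IsBigO.of_bound 1 (Eventually.of_forall fun ε => ?_)) (isBigO_rpow_of_le hc)
  rw [one_mul, Real.rpow_ofNat]

/-- In the applications `η ~ ε^c`, where `3c` is the smaller of the two exponents of `ν` and `κ`.
That this exponent is at most 6 is what lets `ζ = O(ε²)` imply `ζ = O(η)`. -/
theorem Setup.ZetaLE.le_mul (hζ : S.ZetaLE) {η : ℝ → ℝ} {c : ℝ} (hc : c ≤ 2)
    (hη : η =Θ[𝓝[>] (0 : ℝ)] fun ε => ε ^ c) (hη0 : ∀ᶠ ε in 𝓝[>] (0 : ℝ), 0 < η ε) :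
    ∃ C, ∀ M P, ∀ᶠ i in S.germ M P, |S.zeta i.2.1 i.2.2| ≤ C * η i.1 := by
  obtain ⟨C, hC⟩ := hζ
  obtain ⟨C', hC'⟩ := eventually_le_mul_of_isBigO ((sq_isBigO_rpow hc).trans hη.2)
    (hη0.mono fun _ h => h.le)
  refine ⟨max C 0 * C', fun M P => Setup.eventually_germ.2 ?_⟩
  filter_upwards [hC, hC' C' le_rfl] with ε h1 h2 p hp _
  calc |S.zeta p.1 p.2| ≤ C * ε ^ 2 := h1 p hp
    _ ≤ max C 0 * ε ^ 2 := mul_le_mul_of_nonneg_right (le_max_left _ _) (sq_nonneg _)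
    _ ≤ max C 0 * (C' * η ε) := mul_le_mul_of_nonneg_left h2 (le_max_right _ _)
    _ = _ := by ring

theorem PowerLaw.inv_critScale_theta (h : PowerLaw ν κ a b) (hab : b ≤ a) :
    (fun ε => 1 / critScale (ν ε) (κ ε)) =Θ[𝓝[>] (0 : ℝ)] fun ε => ε ^ (-(b / 3)) := by
  refine isTheta_rpow_congr ((isTheta_refl (fun _ : ℝ => (1 : ℝ)) _).div (h.critScale_theta hab))
    fun ε hε => ?_
  rw [Real.rpow_neg (le_of_lt hε), one_div]

/-- Packet sizes at criticality when viscosity is not dominant. -/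
theorem Setup.packetSizes_of_le (hs : Real.sin S.γ ≠ 0) (hk : S.k₀ ≠ 0) (hm : S.m₀ ≠ 0)
    (hχ : Continuous S.χ) (hχc : HasCompactSupport S.χ) (hζ : S.ZetaLE) (h : PowerLaw ν κ a b)
    (hab : b ≤ a) (hb : 0 < b) (hb6 : b ≤ 6) :
    ∃ T > 0, ∀ᶠ ε in 𝓝[>] (0 : ℝ), S.LayersDefined (ν ε) (κ ε) ε ∧
      ∀ l a', S.IsLayerSystem (ν ε) (κ ε) ε l a' →
        S.PacketSizes (κ ε) ε l a' (slowFast (ε ^ (-(b / 3))) (ε ^ (-(a / 2))))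
          (slowFast (ε ^ (-(b / 3))) (ε ^ (-(a / 2))))
          (slowFast (ε ^ (-(b / 3))) (min (ε ^ (-(b / 3))) (ε ^ (b / 3 - a / 2))))
          (min (ε ^ (-(b / 3))) (ε ^ (b / 3 - a / 2))) T := by
  have hη := h.critScale_facts
  have hηΘ := h.critScale_theta hab
  have hηi := h.inv_critScale_theta hab
  have hF := h.fastScale_theta hab
  have hη0 : Tendsto (fun ε => critScale (ν ε) (κ ε)) (𝓝[>] 0) (𝓝 0) :=
    hηΘ.1.trans_tendsto (tendsto_rpow_zero (by positivity))
  obtain ⟨C, hC⟩ := hζ.le_mul (by linarith) hηΘ hη.1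
  obtain ⟨C', hC'⟩ := eventually_le_mul_of_isBigO
    ((h.ν_theta.1.trans (isBigO_rpow_of_le hab)).trans h.κ_theta.2)
    (h.κ_pos.mono fun _ h => h.le)
  have p1 : ∀ᶠ ε in 𝓝[>] (0 : ℝ), 0 ≤ 1 / critScale (ν ε) (κ ε) :=
    hη.1.mono fun ε h => by positivity
  have p2 : ∀ᶠ ε in 𝓝[>] (0 : ℝ), 0 ≤ fastScale (ν ε) (κ ε) :=
    Eventually.of_forall fun ε => Real.sqrt_nonneg _
  have p3 : ∀ᶠ ε in 𝓝[>] (0 : ℝ), 0 ≤ min (ε ^ (-(b / 3))) (ε ^ (b / 3 - a / 2)) := by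
    filter_upwards [eventually_rpow_nonneg' (-(b / 3)), eventually_rpow_nonneg' (b / 3 - a / 2)]
      with ε h1 h2 using le_min h1 h2
  -- Dropping either summand of the denominator gives one of the two powers. They cross at `a =
  -- 4b/3`: this is the threshold `9/2` for `a = 6` and the threshold `8` for `b = 6`.
  have hA2 : (fun ε => (1 / critScale (ν ε) (κ ε)) ^ 2 /
      (1 / critScale (ν ε) (κ ε) + ν ε / κ ε * fastScale (ν ε) (κ ε))) =O[𝓝[>] (0 : ℝ)]
      fun ε => min (ε ^ (-(b / 3))) (ε ^ (b / 3 - a / 2)) := by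
    refine isBigO_min ?_ ?_ (eventually_rpow_nonneg' _) (eventually_rpow_nonneg' _)
    · refine IsBigO.trans (IsBigO.of_bound 1 ?_) hηi.1
      filter_upwards [hη.1, h.ν_pos, h.κ_pos, p2] with ε h1 h2 h3 h4
      have h5 : 0 < 1 / critScale (ν ε) (κ ε) := by positivity
      rw [Real.norm_of_nonneg (by positivity), Real.norm_of_nonneg h5.le, one_mul,
        div_le_iff₀ (by positivity), sq]
      gcongr
      have : 0 ≤ ν ε / κ ε * fastScale (ν ε) (κ ε) := by positivity
      linarith
    · have e : (fun ε => (1 / critScale (ν ε) (κ ε)) ^ 2 /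
          (ν ε / κ ε * fastScale (ν ε) (κ ε))) =Θ[𝓝[>] (0 : ℝ)] fun ε => ε ^ (b / 3 - a / 2) := by
        refine isTheta_rpow_congr ((hηi.pow 2).div ((h.ν_theta.div h.κ_theta).mul hF))
          fun ε hε => ?_
        rw [← Real.rpow_natCast, ← Real.rpow_mul (le_of_lt hε), ← Real.rpow_sub hε,
          ← Real.rpow_add hε, ← Real.rpow_sub hε]
        congr 1
        push_cast
        ring
      refine IsBigO.trans (IsBigO.of_bound 1 ?_) e.1
      filter_upwards [hη.1, h.ν_pos, h.κ_pos] with ε h1 h2 h3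
      have h4 := fastScale_pos h2 h3
      have h5 : 0 < 1 / critScale (ν ε) (κ ε) := by positivity
      rw [Real.norm_of_nonneg (by positivity), Real.norm_of_nonneg (by positivity), one_mul]
      gcongr
      linarith
  refine Setup.exists_packetSizes (S := S) hs hχ hχc
    (D := fun K ε => critRegion K (critScale (ν ε) (κ ε)))
    (r := fun ε => slowFast (1 / critScale (ν ε) (κ ε)) (fastScale (ν ε) (κ ε)))
    (ρ := fun ε => slowFast (1 / critScale (ν ε) (κ ε)) (fastScale (ν ε) (κ ε)))
    (A := fun ε => slowFast (1 / critScale (ν ε) (κ ε)) ((1 / critScale (ν ε) (κ ε)) ^ 2 /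
      (1 / critScale (ν ε) (κ ε) + ν ε / κ ε * fastScale (ν ε) (κ ε))))
    (V := fun ε => (1 / critScale (ν ε) (κ ε)) ^ 2 /
      (1 / critScale (ν ε) (κ ε) + ν ε / κ ε * fastScale (ν ε) (κ ε)))
    (fun K ε j => isClosed_critRegion _ _ j)
    (fun K ε j => re_nonneg_of_mem_critRegion j)
    (fun K hK => hη.1.mono fun ε h => disjoint_critRegion hK h) ?_ ?_ ?_ p3
    (isBigO_slowFast hηi.2 hF.2) (isBigO_slowFast hηi.1 hF.1)
    (isBigO_slowFast hηi.1 hA2) hA2 fun P hP M hne => ?_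
  · filter_upwards [p1, p2] with ε h1 h2 using slowFast_nonneg h1 h2
  · filter_upwards [eventually_rpow_nonneg' (-(b / 3)), eventually_rpow_nonneg' (-(a / 2))]
      with ε h1 h2 using slowFast_nonneg h1 h2
  · filter_upwards [eventually_rpow_nonneg' (-(b / 3)), p3] with ε h1 h2 using slowFast_nonneg h1 h2
  · have t := S.tendsto_germ_fst M P
    have fam := hζ.family hs h (hb.trans_le hab) hb (S.ne_zero_of_center hk hm hP) (M := M)
    refine fam.layerBounds_of_le hs (t.eventually hη.1) (t.eventually hη.2) (hη0.comp t)
      (hC M P) (C' := max C' 0) (le_max_right _ _) ?_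
    exact t.eventually (hC' _ (le_max_left _ _))

/-- Packet sizes at criticality when viscosity is dominant. -/
theorem Setup.packetSizes_of_lt (hs : Real.sin S.γ ≠ 0) (hk : S.k₀ ≠ 0) (hm : S.m₀ ≠ 0)
    (hχ : Continuous S.χ) (hχc : HasCompactSupport S.χ) (hζ : S.ZetaLE) (h : PowerLaw ν κ a b)
    (hab : a < b) (ha : 0 < a) (ha6 : a ≤ 6) :
    ∃ T > 0, ∀ᶠ ε in 𝓝[>] (0 : ℝ), S.LayersDefined (ν ε) (κ ε) ε ∧
      ∀ l a', S.IsLayerSystem (ν ε) (κ ε) ε l a' →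
        S.PacketSizes (κ ε) ε l a' (slowFast (ε ^ (-(a / 3))) (ε ^ (-(b / 2))))
          (slowFast (ε ^ (-(a / 3))) (ε ^ (-(b / 2))))
          (slowFast (ε ^ (-(a / 3))) (ε ^ (b / 2 - 2 * a / 3)))
          (ε ^ (3 * b / 2 - 5 * a / 3)) T := by
  have hη := h.critScale_facts
  have hcomm : ∀ ε, critScale (κ ε) (ν ε) = critScale (ν ε) (κ ε) := fun ε => by
    rw [critScale, critScale, add_comm]
  have hηΘ := h.swap.critScale_theta hab.le
  have hηi := h.swap.inv_critScale_theta hab.le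
  have hF := h.swap.fastScale_theta hab.le
  simp only [hcomm] at hηΘ hηi
  simp only [PowerLaw.fastScale_comm (κ _)] at hF
  have hη0 : Tendsto (fun ε => critScale (ν ε) (κ ε)) (𝓝[>] 0) (𝓝 0) :=
    hηΘ.1.trans_tendsto (tendsto_rpow_zero (by positivity))
  obtain ⟨C, hC⟩ := hζ.le_mul (by linarith) hηΘ hη.1
  have hratio : ∀ᶠ ε in 𝓝[>] (0 : ℝ), 16 * κ ε ≤ ν ε := by
    have e : (fun ε => κ ε / ν ε) =Θ[𝓝[>] (0 : ℝ)] fun ε => ε ^ (b - a) :=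
      isTheta_rpow_congr (h.κ_theta.div h.ν_theta) fun ε hε => (Real.rpow_sub hε _ _).symm
    have := e.1.trans_tendsto (tendsto_rpow_zero (sub_pos.2 hab))
    filter_upwards [this.eventually_lt_const (by norm_num : (0 : ℝ) < 1 / 16), h.ν_pos]
      with ε h1 h2
    rw [div_lt_iff₀ h2] at h1
    linarith
  have p1 : ∀ᶠ ε in 𝓝[>] (0 : ℝ), 0 ≤ 1 / critScale (ν ε) (κ ε) :=
    hη.1.mono fun ε h => by positivity
  have p2 : ∀ᶠ ε in 𝓝[>] (0 : ℝ), 0 ≤ fastScale (ν ε) (κ ε) :=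
    Eventually.of_forall fun ε => Real.sqrt_nonneg _
  have hA2 : (fun ε => (1 / critScale (ν ε) (κ ε)) ^ 2 / fastScale (ν ε) (κ ε)) =Θ[𝓝[>] (0 : ℝ)]
      fun ε => ε ^ (b / 2 - 2 * a / 3) := by
    refine isTheta_rpow_congr ((hηi.pow 2).div hF) fun ε hε => ?_
    rw [← Real.rpow_natCast, ← Real.rpow_mul (le_of_lt hε), ← Real.rpow_sub hε]
    congr 1
    push_cast
    ring
  -- The velocity bound differs from the bound for the full mode by `1/(νF²)`, with `F` the fast
  -- scale. This is of order `ε^(b - a)`, which is small, so buoyancy dominates in this mode.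
  have hV2 : (fun ε => (1 / critScale (ν ε) (κ ε)) ^ 2 / (ν ε * fastScale (ν ε) (κ ε) ^ 3))
      =Θ[𝓝[>] (0 : ℝ)] fun ε => ε ^ (3 * b / 2 - 5 * a / 3) := by
    refine isTheta_rpow_congr ((hηi.pow 2).div (h.ν_theta.mul (hF.pow 3))) fun ε hε => ?_
    rw [← Real.rpow_natCast, ← Real.rpow_natCast, ← Real.rpow_mul (le_of_lt hε),
      ← Real.rpow_mul (le_of_lt hε), ← Real.rpow_add hε, ← Real.rpow_sub hε]
    congr 1
    push_cast
    ring
  refine Setup.exists_packetSizes (S := S) hs hχ hχc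
    (D := fun K ε => critRegion K (critScale (ν ε) (κ ε)))
    (r := fun ε => slowFast (1 / critScale (ν ε) (κ ε)) (fastScale (ν ε) (κ ε)))
    (ρ := fun ε => slowFast (1 / critScale (ν ε) (κ ε)) (fastScale (ν ε) (κ ε)))
    (A := fun ε => slowFast (1 / critScale (ν ε) (κ ε)) ((1 / critScale (ν ε) (κ ε)) ^ 2 /
      fastScale (ν ε) (κ ε)))
    (V := fun ε => (1 / critScale (ν ε) (κ ε)) ^ 2 / (ν ε * fastScale (ν ε) (κ ε) ^ 3))
    (fun K ε j => isClosed_critRegion _ _ j)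
    (fun K ε j => re_nonneg_of_mem_critRegion j)
    (fun K hK => hη.1.mono fun ε h => disjoint_critRegion hK h) ?_ ?_ ?_
    (eventually_rpow_nonneg' _)
    (isBigO_slowFast hηi.2 hF.2) (isBigO_slowFast hηi.1 hF.1)
    (isBigO_slowFast hηi.1 hA2.1) hV2.1 fun P hP M hne => ?_
  · filter_upwards [p1, p2] with ε h1 h2 using slowFast_nonneg h1 h2
  · filter_upwards [eventually_rpow_nonneg' (-(a / 3)), eventually_rpow_nonneg' (-(b / 2))]
      with ε h1 h2 using slowFast_nonneg h1 h2
  · filter_upwards [eventually_rpow_nonneg' (-(a / 3)),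
      eventually_rpow_nonneg' (b / 2 - 2 * a / 3)] with ε h1 h2 using slowFast_nonneg h1 h2
  · have t := S.tendsto_germ_fst M P
    have fam := hζ.family hs h ha (ha.trans hab) (S.ne_zero_of_center hk hm hP) (M := M)
    exact fam.layerBounds_of_ge hs (t.eventually hη.1) (t.eventually hη.2) (hη0.comp t)
      (hC M P) (t.eventually hratio)

end NearCritical

/-! ### Packet sizes away from criticality. -/

namespace NearCritical

open Asymptotics

theorem exists_two_sided_of_isTheta {ι : Type*} {F : Filter ι} {f g : ι → ℝ} (h : f =Θ[F] g)
    (hf : ∀ᶠ i in F, 0 ≤ f i) (hg : ∀ᶠ i in F, 0 ≤ g i) :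
    ∃ e₀ > 0, ∀ e, 0 < e → e ≤ e₀ → ∀ᶠ i in F, e * g i ≤ f i ∧ f i ≤ e⁻¹ * g i := by
  obtain ⟨C₁, p1, h1⟩ := h.1.exists_pos
  obtain ⟨C₂, p2, h2⟩ := h.2.exists_pos
  refine ⟨min C₁⁻¹ C₂⁻¹, lt_min (inv_pos.2 p1) (inv_pos.2 p2), fun e he hle => ?_⟩
  filter_upwards [h1.bound, h2.bound, hf, hg] with i g1 g2 g3 g4
  rw [Real.norm_of_nonneg g3, Real.norm_of_nonneg g4] at g1 g2
  constructor
  · calc e * g i ≤ C₂⁻¹ * (C₂ * f i) :=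
        mul_le_mul (hle.trans (min_le_right _ _)) g2 g4 (inv_pos.2 p2).le
      _ = f i := by field_simp
  · refine g1.trans (mul_le_mul_of_nonneg_right ?_ g4)
    exact (le_inv_comm₀ he p1).1 (hle.trans (min_le_left _ _))

theorem isTheta_one_of_tendsto {ι : Type*} {F : Filter ι} {f : ι → ℝ} {c : ℝ} (hc : c ≠ 0)
    (h : Tendsto f F (𝓝 c)) : f =Θ[F] fun _ => (1 : ℝ) :=
  ((isEquivalent_const_iff_tendsto hc).2 h).isTheta.trans (isTheta_const_const hc one_ne_zero)

theorem isTheta_congr_right {ι : Type*} {F : Filter ι} {f g g' : ι → ℝ} (h : f =Θ[F] g)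
    (hg : g =ᶠ[F] g') : f =Θ[F] g' := h.trans hg.isTheta

variable {S : Setup} {ν κ : ℝ → ℝ} {a b : ℝ}

theorem tendsto_rpow_neg_atTop {a : ℝ} (ha : 0 < a) :
    Tendsto (fun ε : ℝ => ε ^ (-a)) (𝓝[>] 0) atTop := by
  have h := (tendsto_rpow_atTop ha).comp tendsto_inv_nhdsGT_zero
  refine h.congr' ?_
  filter_upwards [self_mem_nhdsWithin] with ε hε
  rw [Function.comp_apply, Real.inv_rpow (le_of_lt hε), Real.rpow_neg (le_of_lt hε)]

theorem eventually_rpow_lt_rpow {a b : ℝ} (hab : b < a) {K : ℝ} (hK : 0 < K) :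
    ∀ᶠ ε in 𝓝[>] (0 : ℝ), K * ε ^ a < K⁻¹ * ε ^ b := by
  have h := tendsto_rpow_zero (sub_pos.2 hab)
  filter_upwards [h.eventually_lt_const (by positivity : 0 < K⁻¹ * K⁻¹), self_mem_nhdsWithin]
    with ε h1 hε
  have h2 : ε ^ a = ε ^ (a - b) * ε ^ b := by rw [← Real.rpow_add hε]; ring_nf
  have h3 : 0 < ε ^ b := Real.rpow_pos_of_pos hε b
  calc K * ε ^ a = K * ε ^ (a - b) * ε ^ b := by rw [h2, mul_assoc]
    _ < K * (K⁻¹ * K⁻¹) * ε ^ b := by gcongr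
    _ = _ := by field_simp

/-- Packet sizes away from criticality. -/
theorem Setup.packetSizes_of_noncritical (hs : Real.sin S.γ ≠ 0) (hk : S.k₀ ≠ 0) (hm : S.m₀ ≠ 0)
    (hχ : Continuous S.χ) (hχc : HasCompactSupport S.χ) (hζ : S.ZetaLE)
    (hζ' : ∃ c > 0, ∀ᶠ ε in 𝓝[>] (0 : ℝ), ∀ p : ℝ × ℝ, S.spec ε p ≠ 0 →
      c * ε ^ 2 ≤ |S.zeta p.1 p.2|) (h : PowerLaw ν κ b b) (hb : 6 < b) :
    ∃ T > 0, ∀ᶠ ε in 𝓝[>] (0 : ℝ), S.LayersDefined (ν ε) (κ ε) ε ∧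
      ∀ l a', S.IsLayerSystem (ν ε) (κ ε) ε l a' →
        S.PacketSizes (κ ε) ε l a' ![0, ε ^ (-(b / 2 - 1)), ε ^ (-(b / 2))]
          ![ε ^ (-2 : ℝ), ε ^ (-(b / 2 - 1)), ε ^ (-(b / 2))]
          ![ε ^ (-2 : ℝ), ε ^ (-2 : ℝ), ε ^ (-1 : ℝ)] (ε ^ (-1 : ℝ)) T := by
  have hpos : ∀ a : ℝ, ∀ᶠ ε in 𝓝[>] (0 : ℝ), 0 < ε ^ a := fun a => by
    filter_upwards [self_mem_nhdsWithin] with ε hε using Real.rpow_pos_of_pos hε a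
  have hprod : (fun ε : ℝ => ε ^ (-2 : ℝ) * ε ^ (-(b / 2 - 1)) / ε ^ (-(b / 2)))
      =Θ[𝓝[>] (0 : ℝ)] fun ε => ε ^ (-1 : ℝ) := by
    refine isTheta_rpow_congr (isTheta_refl _ _) fun ε hε => ?_
    rw [← Real.rpow_add hε, ← Real.rpow_sub hε]
    congr 1
    ring
  refine Setup.exists_packetSizes (S := S) hs hχ hχc
    (D := fun K ε => annuli K (ε ^ (-2 : ℝ)) (ε ^ (-(b / 2 - 1))) (ε ^ (-(b / 2))))
    -- Only positivity of the real part is retained for the degenerate root, hence the rate 0. Its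
    -- packet has a sup bound, and `PacketSizes.two` says nothing about it.
    (r := fun ε => ![0, ε ^ (-(b / 2 - 1)), ε ^ (-(b / 2))])
    (ρ := fun ε => ![ε ^ (-2 : ℝ), ε ^ (-(b / 2 - 1)), ε ^ (-(b / 2))])
    (A := fun ε => ![ε ^ (-2 : ℝ), ε ^ (-2 : ℝ),
      ε ^ (-2 : ℝ) * ε ^ (-(b / 2 - 1)) / ε ^ (-(b / 2))])
    (V := fun ε => ε ^ (-2 : ℝ) * ε ^ (-(b / 2 - 1)) / ε ^ (-(b / 2)))
    (fun K ε j => isClosed_annuli _ _ _ _ j)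
    (fun K ε j => re_nonneg_of_mem_annuli j)
    (fun K hK => ?_) ?_ ?_ ?_ (eventually_rpow_nonneg' _)
    (fun j => isBigO_refl _ _) (fun j => isBigO_refl _ _) (fun j => ?_) hprod.1
    fun P hP M hne => ?_
  · filter_upwards [eventually_rpow_lt_rpow (a := -2) (b := -(b / 2 - 1)) (by linarith) hK,
      eventually_rpow_lt_rpow (a := -2) (b := -(b / 2)) (by linarith) hK,
      eventually_rpow_lt_rpow (a := -(b / 2 - 1)) (b := -(b / 2)) (by linarith) hK]
      with ε h1 h2 h3 using disjoint_annuli h1 h2 h3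
  · filter_upwards [hpos (-(b / 2 - 1)), hpos (-(b / 2))] with ε h1 h2 j
    fin_cases j
    exacts [le_rfl, h1.le, h2.le]
  · filter_upwards [hpos (-2), hpos (-(b / 2 - 1)), hpos (-(b / 2))] with ε h0 h1 h2 j
    fin_cases j
    exacts [h0.le, h1.le, h2.le]
  · filter_upwards [hpos (-2), hpos (-1)] with ε h0 h1 j
    fin_cases j
    exacts [h0.le, h0.le, h1.le]
  · fin_cases j
    exacts [isBigO_refl _ _, isBigO_refl _ _, hprod.1]
  have t := S.tendsto_germ_fst M P
  have fam := hζ.family hs h (by linarith) (by linarith) (S.ne_zero_of_center hk hm hP) (M := M)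
  have hΩ0 := fam.Ω₀_ne
  have hε : ∀ᶠ i in S.germ M P, 0 < i.1 := t.eventually self_mem_nhdsWithin
  have hpos' : ∀ a : ℝ, ∀ᶠ i in S.germ M P, 0 < i.1 ^ a := fun a => t.eventually (hpos a)
  have pull : ∀ {f : ℝ → ℝ} {a : ℝ}, f =Θ[𝓝[>] (0 : ℝ)] (fun ε => ε ^ a) →
      (fun i : ℝ × ℝ × ℝ => f i.1) =Θ[S.germ M P] fun i => i.1 ^ a :=
    fun hf => ⟨hf.1.comp_tendsto t, hf.2.comp_tendsto t⟩
  have hz : (fun i : ℝ × ℝ × ℝ => |S.zeta i.2.1 i.2.2|) =Θ[S.germ M P]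
      fun i => i.1 ^ (2 : ℝ) := by
    obtain ⟨C, hC⟩ := hζ
    obtain ⟨c, hc, hcζ⟩ := hζ'
    constructor
    · refine IsBigO.of_bound C (Setup.eventually_germ.2 ?_)
      filter_upwards [hC] with ε h1 p hp _
      rw [Real.norm_of_nonneg (abs_nonneg _), Real.rpow_ofNat, Real.norm_of_nonneg (sq_nonneg _)]
      exact h1 p hp
    · refine IsBigO.of_bound c⁻¹ (Setup.eventually_germ.2 ?_)
      filter_upwards [hcζ] with ε h1 p hp _
      rw [Real.norm_of_nonneg (abs_nonneg _), Real.rpow_ofNat, Real.norm_of_nonneg (sq_nonneg _),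
        le_inv_mul_iff₀ hc]
      exact h1 p hp
  have hζ0 : ∀ᶠ i in S.germ M P, S.zeta i.2.1 i.2.2 ≠ 0 := by
    obtain ⟨c, hc, hcζ⟩ := hζ'
    refine Setup.eventually_germ.2 ?_
    filter_upwards [hcζ, self_mem_nhdsWithin] with ε h1 h2 p hp _
    have : 0 < c * ε ^ 2 := mul_pos hc (pow_pos h2 2)
    exact abs_pos.1 (this.trans_le (h1 p hp))
  have hsum := pull (h.add_theta le_rfl)
  have hΩ := isTheta_one_of_tendsto (abs_ne_zero.2 hΩ0) fam.Ω_lim.abs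
  have hx : (fun i : ℝ × ℝ × ℝ => |S.slope i.2 / S.zeta i.2.1 i.2.2|) =Θ[S.germ M P]
      fun i => i.1 ^ (-2 : ℝ) := by
    simp only [abs_div]
    refine isTheta_congr_right
      ((isTheta_one_of_tendsto (abs_ne_zero.2 fam.q₀_ne) fam.q_lim.abs).div hz) ?_
    filter_upwards [hε] with i hi
    rw [Real.rpow_neg hi.le, one_div]
  have hy : (fun i : ℝ × ℝ × ℝ => ‖midRate (ν i.1) (κ i.1) (S.omega i.2.1 i.2.2)
      (S.zeta i.2.1 i.2.2)‖) =Θ[S.germ M P] fun i => i.1 ^ (-(b / 2 - 1)) := by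
    have e := (hz.div (hΩ.mul hsum)).sqrt (by
      filter_upwards [t.eventually h.ν_pos, t.eventually h.κ_pos] with i h1 h2
      show (0 : ℝ) ≤ _
      positivity) (by
      filter_upwards [hε] with i hi
      show (0 : ℝ) ≤ _
      positivity)
    refine isTheta_congr_right ((EventuallyEq.isTheta ?_).trans e) ?_
    · filter_upwards [t.eventually h.ν_pos, t.eventually h.κ_pos] with i h1 h2
      rw [← norm_midRate_sq _ _ h1 h2, Real.sqrt_sq (norm_nonneg _)]
    · filter_upwards [hε] with i hi
      rw [one_mul, ← Real.rpow_sub hi, Real.sqrt_eq_rpow, ← Real.rpow_mul hi.le]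
      congr 1
      ring
  have hf : (fun i : ℝ × ℝ × ℝ => ‖fastRate (ν i.1) (κ i.1) (S.omega i.2.1 i.2.2)‖)
      =Θ[S.germ M P] fun i => i.1 ^ (-(b / 2)) := by
    have hΩs := isTheta_one_of_tendsto (Real.sqrt_ne_zero'.2 (abs_pos.2 hΩ0)) fam.Ω_lim.abs.sqrt
    refine isTheta_congr_right ((EventuallyEq.isTheta ?_).trans
      (hΩs.mul (pull (h.fastScale_theta le_rfl)))) (Eventually.of_forall fun i => one_mul _)
    filter_upwards [t.eventually h.ν_pos, t.eventually h.κ_pos] with i h1 h2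
    exact norm_fastRate _ h1 h2
  obtain ⟨e₁, p1, H1⟩ := exists_two_sided_of_isTheta hx (Eventually.of_forall fun _ => abs_nonneg _)
    ((hpos' _).mono fun _ h => h.le)
  obtain ⟨e₂, p2, H2⟩ := exists_two_sided_of_isTheta hy
    (Eventually.of_forall fun _ => norm_nonneg _) ((hpos' _).mono fun _ h => h.le)
  obtain ⟨e₃, p3, H3⟩ := exists_two_sided_of_isTheta hf
    (Eventually.of_forall fun _ => norm_nonneg _) ((hpos' _).mono fun _ h => h.le)
  obtain ⟨C₁, hC₁⟩ := eventually_le_mul_of_isBigO (h.ν_theta.trans h.κ_theta.symm).1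
    (h.κ_pos.mono fun _ h => h.le)
  obtain ⟨C₂, hC₂⟩ := eventually_le_mul_of_isBigO (h.κ_theta.trans h.ν_theta.symm).1
    (h.ν_pos.mono fun _ h => h.le)
  have he : 0 < min e₁ (min e₂ e₃) := lt_min p1 (lt_min p2 p3)
  refine fam.layerBounds_of_noncritical hs hζ0 ?_ ((tendsto_rpow_neg_atTop two_pos).comp t)
    (hpos' _) (hpos' _) ?_ (C := max 1 (max C₁ C₂)) (le_max_left _ _) he
    (t.eventually (hC₁ _ (by simp))) (t.eventually (hC₂ _ (by simp)))
    (H1 _ he (min_le_left _ _)) (H2 _ he ((min_le_right _ _).trans (min_le_left _ _)))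
    (H3 _ he ((min_le_right _ _).trans (min_le_right _ _)))
  -- The noncritical regime requires `ν + κ ≪ |ζ|³`, that is `ε^(b - 6) → 0`; this is where `b > 6`
  -- is used.
  · have e := isTheta_congr_right (hsum.div (hz.pow 3)) (g' := fun i => i.1 ^ (b - 6)) (by
      filter_upwards [hε] with i hi
      rw [← Real.rpow_natCast, ← Real.rpow_mul hi.le, ← Real.rpow_sub hi]
      congr 1
      push_cast
      ring)
    exact e.1.trans_tendsto ((tendsto_rpow_zero (by linarith)).comp t)
  · have e := isTheta_rpow_congr (h.κ_theta.mul
      ((isTheta_refl (fun ε : ℝ => ε ^ (-(b / 2 - 1))) (𝓝[>] 0)).pow 2)) (a := 2) fun ε hε => by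
      rw [← Real.rpow_natCast, ← Real.rpow_mul (le_of_lt hε), ← Real.rpow_add hε]
      congr 1
      push_cast
      ring
    exact (e.1.trans_tendsto (tendsto_rpow_zero two_pos)).comp t

end NearCritical

/-! ### Reading off the exponents in the five cases. -/

namespace NearCritical

variable {S : Setup}

/-- The factor 4 accounts for the incident packet and the three layers in the approximate solution.
-/
theorem Setup.uniformly_of_packetSizes {ν κ : ℝ → ℝ} {r ρ A : ℝ → Fin 3 → ℝ} {V : ℝ → ℝ}
    {Q : ℝ → ℝ → (ℝ × ℝ → Fin 3 → ℂ) → (ℝ × ℝ → Fin 3 → ℂ) → Prop}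
    (H : ∃ T > 0, ∀ᶠ ε in 𝓝[>] (0 : ℝ), S.LayersDefined (ν ε) (κ ε) ε ∧
      ∀ l a, S.IsLayerSystem (ν ε) (κ ε) ε l a →
        S.PacketSizes (κ ε) ε l a (r ε) (ρ ε) (A ε) (V ε) T)
    (hQ : ∀ T > 0, ∀ ε l a, S.PacketSizes (κ ε) ε l a (r ε) (ρ ε) (A ε) (V ε) T →
      Q (4 * T) ε l a) : S.Uniformly ν κ Q := by
  obtain ⟨T, hT, h⟩ := H
  refine ⟨4 * T, by positivity, h.mono fun ε hε => ⟨hε.1, fun l a hla => ?_⟩⟩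
  exact hQ T hT ε l a (hε.2 l a hla)

namespace Setup.PacketSizes

variable {κ ε V T : ℝ} {l a : ℝ × ℝ → Fin 3 → ℂ} {r ρ A : Fin 3 → ℝ}

theorem top_bound (h : S.PacketSizes κ ε l a r ρ A V T) (hT : 0 < T) {v x y : ℝ}
    (hv : v ≤ ε ^ x) (hy : y ≤ 2 + x) : T * (ε ^ 2 * v) ≤ T * ε ^ y := by
  have hε := h.ε_pos
  have e : ε ^ (2 + x) = ε ^ 2 * ε ^ x := by rw [Real.rpow_add hε, Real.rpow_ofNat]
  refine mul_le_mul_of_nonneg_left ?_ hT.le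
  calc ε ^ 2 * v ≤ ε ^ 2 * ε ^ x := mul_le_mul_of_nonneg_left hv (sq_nonneg _)
    _ = ε ^ (2 + x) := e.symm
    _ ≤ ε ^ y := Real.rpow_le_rpow_of_exponent_ge hε h.ε_lt.le hy

theorem two_bound (h : S.PacketSizes κ ε l a r ρ A V T) (hT : 0 < T) {v b x y : ℝ}
    (hv : v ≤ ε ^ x) (hy : y ≤ 1 + x + b / 2) :
    T * (ε * v * (√(ε ^ (-b)))⁻¹) ≤ T * ε ^ y := by
  have hε := h.ε_pos
  have e : ε ^ (1 + x + b / 2) = ε * ε ^ x * (√(ε ^ (-b)))⁻¹ := by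
    rw [Real.rpow_add hε, Real.rpow_add hε, Real.rpow_one, Real.sqrt_eq_rpow,
      ← Real.rpow_mul hε.le, ← Real.rpow_neg hε.le]
    ring_nf
  refine mul_le_mul_of_nonneg_left ?_ hT.le
  calc ε * v * (√(ε ^ (-b)))⁻¹ ≤ ε * ε ^ x * (√(ε ^ (-b)))⁻¹ := by gcongr
    _ = ε ^ (1 + x + b / 2) := e.symm
    _ ≤ ε ^ y := Real.rpow_le_rpow_of_exponent_ge hε h.ε_lt.le hy

theorem le_four_mul (h : S.PacketSizes κ ε l a r ρ A V T) (hT : 0 < T) (y : ℝ) :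
    T * ε ^ y ≤ 4 * T * ε ^ y :=
  mul_le_mul_of_nonneg_right (by linarith) (Real.rpow_nonneg h.ε_pos.le y)

theorem layer_top (h : S.PacketSizes κ ε l a r ρ A V T) (hT : 0 < T) {j : Fin 3} {x y : ℝ}
    (hA : A j ≤ ε ^ x) (hy : y ≤ 2 + x) : SizeLE (S.layer κ ε l a j) ⊤ (T * ε ^ y) :=
  (h.top j).mono (h.top_bound hT hA hy)

theorem layer_two (h : S.PacketSizes κ ε l a r ρ A V T) (hT : 0 < T) {j : Fin 3} {b x y : ℝ}
    (hr : r j = ε ^ (-b)) (hA : A j ≤ ε ^ x) (hy : y ≤ 1 + x + b / 2) :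
    SizeLE (S.layer κ ε l a j) 2 (T * ε ^ y) := by
  have := h.two j (by rw [hr]; exact Real.rpow_pos_of_pos h.ε_pos _)
  rw [hr] at this
  exact this.mono (h.two_bound hT hA hy)

theorem velocity_top_rpow (h : S.PacketSizes κ ε l a r ρ A V T) (hT : 0 < T) {b x y : ℝ}
    (hr : r 2 = ε ^ (-b)) (hV : V ≤ ε ^ x) (hy : y ≤ 2 + x) :
    SizeLE (velocity (S.layer κ ε l a 2)) ⊤ (T * ε ^ y) :=
  (h.velocity_top (by rw [hr]; exact Real.rpow_pos_of_pos h.ε_pos _)).mono (h.top_bound hT hV hy)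

theorem velocity_two_rpow (h : S.PacketSizes κ ε l a r ρ A V T) (hT : 0 < T) {b x y : ℝ}
    (hr : r 2 = ε ^ (-b)) (hV : V ≤ ε ^ x) (hy : y ≤ 1 + x + b / 2) :
    SizeLE (velocity (S.layer κ ε l a 2)) 2 (T * ε ^ y) := by
  have := h.velocity_two (by rw [hr]; exact Real.rpow_pos_of_pos h.ε_pos _)
  rw [hr] at this
  exact this.mono (h.two_bound hT hV hy)

theorem incident_top_rpow (h : S.PacketSizes κ ε l a r ρ A V T) (hT : 0 < T) {y : ℝ}
    (hy : y ≤ 2) : SizeLE (S.incident ε) ⊤ (T * ε ^ y) := by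
  refine h.incident_top.mono (mul_le_mul_of_nonneg_left ?_ hT.le)
  rw [← Real.rpow_ofNat]
  exact Real.rpow_le_rpow_of_exponent_ge h.ε_pos h.ε_lt.le hy

theorem approx_top (h : S.PacketSizes κ ε l a r ρ A V T) (hT : 0 < T) {y : ℝ} (hy : y ≤ 2)
    (hj : ∀ j, SizeLE (S.layer κ ε l a j) ⊤ (T * ε ^ y)) :
    SizeLE (S.approx κ ε l a Finset.univ) ⊤ (4 * T * ε ^ y) := by
  have hε := Real.rpow_nonneg h.ε_pos.le y
  have h0 : 0 ≤ T * ε ^ y := by positivity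
  exact (Setup.sizeLE_approx_univ le_top h0 h0 (h.incident_top_rpow hT hy) hj).mono (by linarith)

theorem approx_two (h : S.PacketSizes κ ε l a r ρ A V T) (hT : 0 < T)
    (hj : ∀ j, SizeLE (S.layer κ ε l a j) 2 (T * ε ^ (0 : ℝ))) :
    SizeLE (S.approx κ ε l a Finset.univ) 2 (4 * T) := by
  simp only [Real.rpow_zero, mul_one] at hj
  exact (Setup.sizeLE_approx_univ one_le_two hT.le hT.le h.incident_two hj).mono (by linarith)

end Setup.PacketSizes

theorem SizeLE.of_rpow_zero {E : Type*} [NormedAddCommGroup E] {F : ℝ → ℝ × ℝ → E} {q : ℝ≥0∞}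
    {K ε : ℝ} (h : SizeLE F q (K * ε ^ (0 : ℝ))) : SizeLE F q K := by
  rwa [Real.rpow_zero, mul_one] at h

theorem forall_of_slow_of_fast {P : Fin 3 → Prop} (hs : ∀ j, j ≠ 2 → P j) (hf : P 2) (j : Fin 3) :
    P j := by
  by_cases h : j = 2
  · exact h ▸ hf
  · exact hs j h

end NearCritical

theorem proposition4p2 (S : NearCritical.Setup)
    (hsin : Real.sin S.γ ≠ 0) (hcos : Real.cos S.γ ≠ 0) (hk : S.k₀ ≠ 0) (hm : S.m₀ ≠ 0)
    (hχ : ContDiff ℝ ∞ S.χ) (hχc : HasCompactSupport S.χ)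
    (hζ : ∃ C : ℝ, ∀ᶠ ε in 𝓝[>] (0 : ℝ), ∀ p : ℝ × ℝ, S.spec ε p ≠ 0 →
      |S.zeta p.1 p.2| ≤ C * ε ^ 2)
    (ν₀ κ₀ β : ℝ) (hν₀ : 0 < ν₀) (hκ₀ : 0 < κ₀) (hβ : 0 < β) :
    -- Case 1
    (β < 6 → S.Uniformly (fun ε => ν₀ * ε ^ 6) (fun ε => κ₀ * ε ^ β) fun K ε l a =>
      NearCritical.SizeLE (S.approx (κ₀ * ε ^ β) ε l a Finset.univ) ∞ (K * ε ^ (2 - β / 3)) ∧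
      NearCritical.SizeLE (S.approx (κ₀ * ε ^ β) ε l a Finset.univ) 2 K ∧
      (∀ j : Fin 3, j ≠ 2 → S.DecayScale ε l j (β / 3) K ∧
        NearCritical.SizeLE (S.layer (κ₀ * ε ^ β) ε l a j) ∞ (K * ε ^ (2 - β / 3)) ∧
        NearCritical.SizeLE (S.layer (κ₀ * ε ^ β) ε l a j) 2 (K * ε ^ (1 - β / 6))) ∧
      S.DecayScale ε l 2 3 K ∧
      (β ≤ 9 / 2 →
        NearCritical.SizeLE (S.layer (κ₀ * ε ^ β) ε l a 2) ∞ (K * ε ^ (2 - β / 3)) ∧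
        NearCritical.SizeLE (S.layer (κ₀ * ε ^ β) ε l a 2) 2 (K * ε ^ (5 / 2 - β / 3))) ∧
      (9 / 2 ≤ β →
        NearCritical.SizeLE (S.layer (κ₀ * ε ^ β) ε l a 2) ∞ (K * ε ^ (β / 3 - 1)) ∧
        NearCritical.SizeLE (S.layer (κ₀ * ε ^ β) ε l a 2) 2 (K * ε ^ (β / 3 - 1 / 2)))) ∧
    -- Case 2
    (6 < β → S.Uniformly (fun ε => ν₀ * ε ^ 6) (fun ε => κ₀ * ε ^ β) fun K ε l a =>
      NearCritical.SizeLE (S.approx (κ₀ * ε ^ β) ε l a Finset.univ) ∞ K ∧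
      NearCritical.SizeLE (S.approx (κ₀ * ε ^ β) ε l a Finset.univ) 2 K ∧
      (∀ j : Fin 3, j ≠ 2 → S.DecayScale ε l j 2 K ∧
        NearCritical.SizeLE (S.layer (κ₀ * ε ^ β) ε l a j) ∞ K ∧
        NearCritical.SizeLE (S.layer (κ₀ * ε ^ β) ε l a j) 2 K) ∧
      S.DecayScale ε l 2 (β / 2) K ∧
      NearCritical.SizeLE (S.layer (κ₀ * ε ^ β) ε l a 2) ∞ (K * ε ^ (β / 2 - 2)) ∧
      NearCritical.SizeLE (S.layer (κ₀ * ε ^ β) ε l a 2) 2 (K * ε ^ (3 * β / 4 - 3))) ∧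
    -- Case 3
    (β < 6 → S.Uniformly (fun ε => ν₀ * ε ^ β) (fun ε => κ₀ * ε ^ 6) fun K ε l a =>
      NearCritical.SizeLE (S.approx (κ₀ * ε ^ 6) ε l a Finset.univ) ∞ (K * ε ^ (2 - β / 3)) ∧
      NearCritical.SizeLE (S.approx (κ₀ * ε ^ 6) ε l a Finset.univ) 2 K ∧
      (∀ j : Fin 3, j ≠ 2 → S.DecayScale ε l j (β / 3) K ∧
        NearCritical.SizeLE (S.layer (κ₀ * ε ^ 6) ε l a j) ∞ (K * ε ^ (2 - β / 3)) ∧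
        NearCritical.SizeLE (S.layer (κ₀ * ε ^ 6) ε l a j) 2 (K * ε ^ (1 - β / 6))) ∧
      S.DecayScale ε l 2 3 K ∧
      NearCritical.SizeLE (NearCritical.velocity (S.layer (κ₀ * ε ^ 6) ε l a 2)) ∞
        (K * ε ^ (11 - 5 * β / 3)) ∧
      NearCritical.SizeLE (NearCritical.velocity (S.layer (κ₀ * ε ^ 6) ε l a 2)) 2
        (K * ε ^ (23 / 2 - 5 * β / 3)) ∧
      NearCritical.SizeLE (S.layer (κ₀ * ε ^ 6) ε l a 2) ∞ (K * ε ^ (5 - 2 * β / 3)) ∧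
      NearCritical.SizeLE (S.layer (κ₀ * ε ^ 6) ε l a 2) 2 (K * ε ^ (11 / 2 - 2 * β / 3))) ∧
    -- Case 4
    (6 < β → S.Uniformly (fun ε => ν₀ * ε ^ β) (fun ε => κ₀ * ε ^ 6) fun K ε l a =>
      NearCritical.SizeLE (S.approx (κ₀ * ε ^ 6) ε l a Finset.univ) ∞ K ∧
      NearCritical.SizeLE (S.approx (κ₀ * ε ^ 6) ε l a Finset.univ) 2 K ∧
      (∀ j : Fin 3, j ≠ 2 → S.DecayScale ε l j 2 K ∧
        NearCritical.SizeLE (S.layer (κ₀ * ε ^ 6) ε l a j) ∞ K ∧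
        NearCritical.SizeLE (S.layer (κ₀ * ε ^ 6) ε l a j) 2 K) ∧
      S.DecayScale ε l 2 (β / 2) K ∧
      (β ≤ 8 →
        NearCritical.SizeLE (S.layer (κ₀ * ε ^ 6) ε l a 2) ∞ (K * ε ^ (4 - β / 2)) ∧
        NearCritical.SizeLE (S.layer (κ₀ * ε ^ 6) ε l a 2) 2 (K * ε ^ (3 - β / 4))) ∧
      (8 ≤ β →
        NearCritical.SizeLE (S.layer (κ₀ * ε ^ 6) ε l a 2) ∞ K ∧
        NearCritical.SizeLE (S.layer (κ₀ * ε ^ 6) ε l a 2) 2 (K * ε ^ (β / 4 - 1)))) ∧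
    -- Case 5: the degenerate slowly decaying layer is bounded, and is discarded for the `L²` bound
    (6 < β →
      (∃ c > 0, ∀ᶠ ε in 𝓝[>] (0 : ℝ), ∀ p : ℝ × ℝ, S.spec ε p ≠ 0 →
        c * ε ^ 2 ≤ |S.zeta p.1 p.2|) →
      S.Uniformly (fun ε => ν₀ * ε ^ β) (fun ε => κ₀ * ε ^ β) fun K ε l a =>
      NearCritical.SizeLE (S.approx (κ₀ * ε ^ β) ε l a Finset.univ) ∞ K ∧
      NearCritical.SizeLE (S.approx (κ₀ * ε ^ β) ε l a {1, 2}) ∞ K ∧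
      NearCritical.SizeLE (S.approx (κ₀ * ε ^ β) ε l a {1, 2}) 2 K ∧
      S.DecayScale ε l 1 (β / 2 - 1) K ∧
      NearCritical.SizeLE (S.layer (κ₀ * ε ^ β) ε l a 1) ∞ K ∧
      NearCritical.SizeLE (S.layer (κ₀ * ε ^ β) ε l a 1) 2 (K * ε ^ ((β - 6) / 4)) ∧
      S.DecayScale ε l 2 (β / 2) K ∧
      NearCritical.SizeLE (S.layer (κ₀ * ε ^ β) ε l a 2) ∞ (K * ε) ∧
      NearCritical.SizeLE (S.layer (κ₀ * ε ^ β) ε l a 2) 2 (K * ε ^ (β / 4))) := by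
  have hχ' := hχ.continuous
  -- The statement writes `ε ^ 6` with a natural exponent, the power laws with a real one.
  have nat : ∀ (c ε : ℝ), c * ε ^ 6 = c * ε ^ (6 : ℝ) := fun c ε => by
    rw [← Real.rpow_natCast]; norm_num
  refine ⟨fun h6 => ?_, fun h6 => ?_, fun h6 => ?_, fun h6 => ?_, fun h6 hζ' => ?_⟩
  · have law : NearCritical.PowerLaw (fun ε => ν₀ * ε ^ 6) (fun ε => κ₀ * ε ^ β) 6 β :=
      NearCritical.powerLaw_of_eq hν₀ hκ₀ (fun ε _ => nat _ _) fun _ _ => rfl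
    refine NearCritical.Setup.uniformly_of_packetSizes
      (S.packetSizes_of_le hsin hk hm hχ' hχc hζ law h6.le hβ h6.le) fun T hT ε l a h => ?_
    -- Both bounds hold for every `β` in this case; the threshold `9/2` only tells which is sharper.
    have hA1 := min_le_left (ε ^ (-(β / 3))) (ε ^ (β / 3 - 6 / 2))
    have hA2 := min_le_right (ε ^ (-(β / 3))) (ε ^ (β / 3 - 6 / 2))
    have s1 : ∀ j : Fin 3, j ≠ 2 → ∀ y, y ≤ 2 + -(β / 3) →
        NearCritical.SizeLE (S.layer (κ₀ * ε ^ β) ε l a j) ∞ (T * ε ^ y) := fun j hj y hy =>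
      h.layer_top hT (NearCritical.slowFast_of_ne hj).le hy
    have s2 : ∀ j : Fin 3, j ≠ 2 → ∀ y, y ≤ 1 - β / 6 →
        NearCritical.SizeLE (S.layer (κ₀ * ε ^ β) ε l a j) 2 (T * ε ^ y) := fun j hj y hy =>
      h.layer_two hT (NearCritical.slowFast_of_ne hj) (NearCritical.slowFast_of_ne hj).le
        (by linarith)
    have f2 : ∀ y, y ≤ 5 / 2 - β / 3 →
        NearCritical.SizeLE (S.layer (κ₀ * ε ^ β) ε l a 2) 2 (T * ε ^ y) := fun y hy =>
      h.layer_two hT (j := 2) (b := 6 / 2) rfl hA1 (by linarith)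
    have f1 : NearCritical.SizeLE (S.layer (κ₀ * ε ^ β) ε l a 2) ∞ (T * ε ^ (2 - β / 3)) :=
      h.layer_top hT (j := 2) hA1 (by linarith)
    refine ⟨h.approx_top hT (by linarith) (NearCritical.forall_of_slow_of_fast
      (fun j hj => s1 j hj _ (by linarith)) f1),
      h.approx_two hT (NearCritical.forall_of_slow_of_fast (fun j hj => s2 j hj _ (by linarith))
        (f2 _ (by linarith))), fun j hj => ⟨?_, ?_, ?_⟩, ?_, fun _ => ⟨?_, ?_⟩, fun _ => ⟨?_, ?_⟩⟩
    · exact h.decay j _ _ (by linarith) (NearCritical.slowFast_of_ne hj)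
        (NearCritical.slowFast_of_ne hj)
    · exact (s1 j hj _ (by linarith)).mono (h.le_four_mul hT _)
    · exact (s2 j hj _ le_rfl).mono (h.le_four_mul hT _)
    · have e : ε ^ (-(6 / 2 : ℝ)) = ε ^ (-3 : ℝ) := by norm_num
      exact h.decay 2 _ _ (by linarith) e e
    · exact f1.mono (h.le_four_mul hT _)
    · exact (f2 _ le_rfl).mono (h.le_four_mul hT _)
    · exact (h.layer_top hT (j := 2) hA2 (by linarith)).mono (h.le_four_mul hT _)
    · exact (h.layer_two hT (j := 2) (b := 6 / 2) rfl hA2 (by linarith)).mono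
        (h.le_four_mul hT _)
  · have law : NearCritical.PowerLaw (fun ε => ν₀ * ε ^ 6) (fun ε => κ₀ * ε ^ β) 6 β :=
      NearCritical.powerLaw_of_eq hν₀ hκ₀ (fun ε _ => nat _ _) fun _ _ => rfl
    refine NearCritical.Setup.uniformly_of_packetSizes
      (S.packetSizes_of_lt hsin hk hm hχ' hχc hζ law h6 (by norm_num) le_rfl)
      fun T hT ε l a h => ?_
    have e2 : ε ^ (-(6 / 3 : ℝ)) = ε ^ (-2 : ℝ) := by norm_num
    have s1 : ∀ j : Fin 3, j ≠ 2 →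
        NearCritical.SizeLE (S.layer (κ₀ * ε ^ β) ε l a j) ∞ (T * ε ^ (0 : ℝ)) := fun j hj =>
      h.layer_top hT (NearCritical.slowFast_of_ne hj).le (by norm_num)
    have s2 : ∀ j : Fin 3, j ≠ 2 →
        NearCritical.SizeLE (S.layer (κ₀ * ε ^ β) ε l a j) 2 (T * ε ^ (0 : ℝ)) := fun j hj =>
      h.layer_two hT (NearCritical.slowFast_of_ne hj) (NearCritical.slowFast_of_ne hj).le
        (by norm_num)
    have f1 : ∀ y, y ≤ β / 2 - 2 →
        NearCritical.SizeLE (S.layer (κ₀ * ε ^ β) ε l a 2) ∞ (T * ε ^ y) := fun y hy =>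
      h.layer_top hT (j := 2) (x := β / 2 - 2 * 6 / 3) le_rfl (by linarith)
    have f2 : ∀ y, y ≤ 3 * β / 4 - 3 →
        NearCritical.SizeLE (S.layer (κ₀ * ε ^ β) ε l a 2) 2 (T * ε ^ y) := fun y hy =>
      h.layer_two hT (j := 2) (b := β / 2) (x := β / 2 - 2 * 6 / 3) rfl le_rfl (by linarith)
    refine ⟨(h.approx_top hT (by norm_num) (NearCritical.forall_of_slow_of_fast
      s1 (f1 _ (by linarith)))).of_rpow_zero,
      h.approx_two hT (NearCritical.forall_of_slow_of_fast s2 (f2 _ (by linarith))),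
      fun j hj => ⟨?_, ?_, ?_⟩, ?_, ?_, ?_⟩
    · exact h.decay j _ _ (by linarith) ((NearCritical.slowFast_of_ne hj).trans e2)
        ((NearCritical.slowFast_of_ne hj).trans e2)
    · exact ((s1 j hj).mono (h.le_four_mul hT _)).of_rpow_zero
    · exact ((s2 j hj).mono (h.le_four_mul hT _)).of_rpow_zero
    · exact h.decay 2 _ _ (by linarith) rfl rfl
    · exact (f1 _ le_rfl).mono (h.le_four_mul hT _)
    · exact (f2 _ le_rfl).mono (h.le_four_mul hT _)
  · have law : NearCritical.PowerLaw (fun ε => ν₀ * ε ^ β) (fun ε => κ₀ * ε ^ 6) β 6 :=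
      NearCritical.powerLaw_of_eq hν₀ hκ₀ (fun _ _ => rfl) fun ε _ => nat _ _
    refine NearCritical.Setup.uniformly_of_packetSizes
      (S.packetSizes_of_lt hsin hk hm hχ' hχc hζ law h6 hβ h6.le) fun T hT ε l a h => ?_
    have s1 : ∀ j : Fin 3, j ≠ 2 → ∀ y, y ≤ 2 + -(β / 3) →
        NearCritical.SizeLE (S.layer (κ₀ * ε ^ 6) ε l a j) ∞ (T * ε ^ y) := fun j hj y hy =>
      h.layer_top hT (NearCritical.slowFast_of_ne hj).le hy
    have s2 : ∀ j : Fin 3, j ≠ 2 → ∀ y, y ≤ 1 - β / 6 →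
        NearCritical.SizeLE (S.layer (κ₀ * ε ^ 6) ε l a j) 2 (T * ε ^ y) := fun j hj y hy =>
      h.layer_two hT (NearCritical.slowFast_of_ne hj) (NearCritical.slowFast_of_ne hj).le
        (by linarith)
    have f1 : ∀ y, y ≤ 5 - 2 * β / 3 →
        NearCritical.SizeLE (S.layer (κ₀ * ε ^ 6) ε l a 2) ∞ (T * ε ^ y) := fun y hy =>
      h.layer_top hT (j := 2) (x := 6 / 2 - 2 * β / 3) le_rfl (by linarith)
    have f2 : ∀ y, y ≤ 11 / 2 - 2 * β / 3 →
        NearCritical.SizeLE (S.layer (κ₀ * ε ^ 6) ε l a 2) 2 (T * ε ^ y) := fun y hy =>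
      h.layer_two hT (j := 2) (b := 6 / 2) (x := 6 / 2 - 2 * β / 3) rfl le_rfl (by linarith)
    refine ⟨h.approx_top hT (by linarith) (NearCritical.forall_of_slow_of_fast
      (fun j hj => s1 j hj _ (by linarith)) (f1 _ (by linarith))),
      h.approx_two hT (NearCritical.forall_of_slow_of_fast (fun j hj => s2 j hj _ (by linarith))
        (f2 _ (by linarith))), fun j hj => ⟨?_, ?_, ?_⟩, ?_, ?_, ?_, ?_, ?_⟩
    · exact h.decay j _ _ (by linarith) (NearCritical.slowFast_of_ne hj)
        (NearCritical.slowFast_of_ne hj)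
    · exact (s1 j hj _ (by linarith)).mono (h.le_four_mul hT _)
    · exact (s2 j hj _ le_rfl).mono (h.le_four_mul hT _)
    · have e : ε ^ (-(6 / 2 : ℝ)) = ε ^ (-3 : ℝ) := by norm_num
      exact h.decay 2 _ _ (by linarith) e e
    · exact (h.velocity_top_rpow hT (b := 6 / 2) (x := 3 * 6 / 2 - 5 * β / 3) rfl le_rfl
        (by linarith)).mono (h.le_four_mul hT _)
    · exact (h.velocity_two_rpow hT (b := 6 / 2) (x := 3 * 6 / 2 - 5 * β / 3) rfl le_rfl
        (by linarith)).mono (h.le_four_mul hT _)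
    · exact (f1 _ le_rfl).mono (h.le_four_mul hT _)
    · exact (f2 _ le_rfl).mono (h.le_four_mul hT _)
  · have law : NearCritical.PowerLaw (fun ε => ν₀ * ε ^ β) (fun ε => κ₀ * ε ^ 6) β 6 :=
      NearCritical.powerLaw_of_eq hν₀ hκ₀ (fun _ _ => rfl) fun ε _ => nat _ _
    refine NearCritical.Setup.uniformly_of_packetSizes
      (S.packetSizes_of_le hsin hk hm hχ' hχc hζ law h6.le (by norm_num) le_rfl)
      fun T hT ε l a h => ?_
    -- Again both bounds hold throughout, and `β = 8` is where they coincide.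
    have hA1 := min_le_left (ε ^ (-(6 / 3 : ℝ))) (ε ^ (6 / 3 - β / 2))
    have hA2 := min_le_right (ε ^ (-(6 / 3 : ℝ))) (ε ^ (6 / 3 - β / 2))
    have e2 : ε ^ (-(6 / 3 : ℝ)) = ε ^ (-2 : ℝ) := by norm_num
    have s1 : ∀ j : Fin 3, j ≠ 2 →
        NearCritical.SizeLE (S.layer (κ₀ * ε ^ 6) ε l a j) ∞ (T * ε ^ (0 : ℝ)) := fun j hj =>
      h.layer_top hT (NearCritical.slowFast_of_ne hj).le (by norm_num)
    have s2 : ∀ j : Fin 3, j ≠ 2 →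
        NearCritical.SizeLE (S.layer (κ₀ * ε ^ 6) ε l a j) 2 (T * ε ^ (0 : ℝ)) := fun j hj =>
      h.layer_two hT (NearCritical.slowFast_of_ne hj) (NearCritical.slowFast_of_ne hj).le
        (by norm_num)
    have f1 : NearCritical.SizeLE (S.layer (κ₀ * ε ^ 6) ε l a 2) ∞ (T * ε ^ (0 : ℝ)) :=
      h.layer_top hT (j := 2) hA1 (by norm_num)
    have f2 : ∀ y, y ≤ β / 4 - 1 →
        NearCritical.SizeLE (S.layer (κ₀ * ε ^ 6) ε l a 2) 2 (T * ε ^ y) := fun y hy =>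
      h.layer_two hT (j := 2) (b := β / 2) rfl hA1 (by linarith)
    refine ⟨(h.approx_top hT (by norm_num) (NearCritical.forall_of_slow_of_fast
      s1 f1)).of_rpow_zero,
      h.approx_two hT (NearCritical.forall_of_slow_of_fast s2 (f2 _ (by linarith))),
      fun j hj => ⟨?_, ?_, ?_⟩, ?_, fun _ => ⟨?_, ?_⟩, fun _ => ⟨?_, ?_⟩⟩
    · exact h.decay j _ _ (by linarith) ((NearCritical.slowFast_of_ne hj).trans e2)
        ((NearCritical.slowFast_of_ne hj).trans e2)
    · exact ((s1 j hj).mono (h.le_four_mul hT _)).of_rpow_zero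
    · exact ((s2 j hj).mono (h.le_four_mul hT _)).of_rpow_zero
    · exact h.decay 2 _ _ (by linarith) rfl rfl
    · exact (h.layer_top hT (j := 2) hA2 (by linarith)).mono (h.le_four_mul hT _)
    · exact (h.layer_two hT (j := 2) (b := β / 2) rfl hA2 (by linarith)).mono
        (h.le_four_mul hT _)
    · exact (f1.mono (h.le_four_mul hT _)).of_rpow_zero
    · exact (f2 _ le_rfl).mono (h.le_four_mul hT _)
  · have law : NearCritical.PowerLaw (fun ε => ν₀ * ε ^ β) (fun ε => κ₀ * ε ^ β) β β :=
      NearCritical.powerLaw_of_eq hν₀ hκ₀ (fun _ _ => rfl) fun _ _ => rfl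
    refine NearCritical.Setup.uniformly_of_packetSizes
      (S.packetSizes_of_noncritical hsin hk hm hχ' hχc hζ hζ' law h6) fun T hT ε l a h => ?_
    -- The degenerate packet has amplitude `ε⁻²`, which the factor `ε²` just compensates: it is
    -- bounded and may be kept in the sup norm, but has no entry in the `L²` estimates.
    have s0 : NearCritical.SizeLE (S.layer (κ₀ * ε ^ β) ε l a 0) ∞ (T * ε ^ (0 : ℝ)) :=
      h.layer_top hT (x := -2) le_rfl (by norm_num)
    have s1 : NearCritical.SizeLE (S.layer (κ₀ * ε ^ β) ε l a 1) ∞ (T * ε ^ (0 : ℝ)) :=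
      h.layer_top hT (x := -2) le_rfl (by norm_num)
    have s2 : ∀ y : ℝ, y ≤ 1 →
        NearCritical.SizeLE (S.layer (κ₀ * ε ^ β) ε l a 2) ∞ (T * ε ^ y) := fun y hy =>
      h.layer_top hT (x := -1) le_rfl (by linarith)
    have t1 : ∀ y, y ≤ (β - 6) / 4 →
        NearCritical.SizeLE (S.layer (κ₀ * ε ^ β) ε l a 1) 2 (T * ε ^ y) := fun y hy =>
      h.layer_two hT (b := β / 2 - 1) (x := -2) rfl le_rfl (by linarith)
    have t2 : ∀ y, y ≤ β / 4 →
        NearCritical.SizeLE (S.layer (κ₀ * ε ^ β) ε l a 2) 2 (T * ε ^ y) := fun y hy =>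
      h.layer_two hT (b := β / 2) (x := -1) rfl le_rfl (by linarith)
    refine ⟨(h.approx_top hT (by norm_num) fun j => ?_).of_rpow_zero, ?_, ?_, ?_, ?_, ?_, ?_, ?_, ?_⟩
    · fin_cases j
      exacts [s0, s1, s2 _ (by norm_num)]
    · exact (NearCritical.Setup.sizeLE_approx_pair le_top hT.le hT.le
        (h.incident_top_rpow hT (by norm_num)).of_rpow_zero s1.of_rpow_zero
        (s2 _ (by norm_num)).of_rpow_zero).mono (by linarith)
    · exact (NearCritical.Setup.sizeLE_approx_pair one_le_two hT.le hT.le h.incident_two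
        (t1 _ (by linarith)).of_rpow_zero (t2 _ (by linarith)).of_rpow_zero).mono (by linarith)
    · exact h.decay 1 _ _ (by linarith) rfl rfl
    · exact (s1.mono (h.le_four_mul hT _)).of_rpow_zero
    · exact (t1 _ le_rfl).mono (h.le_four_mul hT _)
    · exact h.decay 2 _ _ (by linarith) rfl rfl
    · have := (s2 1 le_rfl).mono (h.le_four_mul hT _)
      rwa [Real.rpow_one] at this
    · exact (t2 _ le_rfl).mono (h.le_four_mul hT _)
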